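/- Let $M$ be a compact connected 3-manifold with (possibly disconnected) boundary $\partial M=\Sigma_1\sqcup\dots\sqcup\Sigma_k$, where each $\Sigma_i=\mathbb H^2/\Gamma_i$ is a closed hyperbolic surface, and suppose that $\pi_1(M)$ admits a convex co-compact (discrete and faithful) representation into $\mathrm{PSL}_2\mathbb C$ (for example, $M$ hyperbolizable, with the holonomy of a convex co-compact hyperbolic metric on its interior). Let $\chi(M)=R(\pi_1(M))/\!/\mathrm{PSL}_2\mathbb C$ be the $\mathrm{PSL}_2\mathbb C$-character variety, with the Zariski topology, and let $\chi_0(M)$ be an irreducible component of $\chi(M)$ that contains the character of a convex co-compact representation. Let $\lambda$ be a maximal geodesic lamination on $\partial M$ that contains a pants decomposition $P$ (a maximal collection of disjoint simple closed geodesics), and assume that every pair of pants of $\partial M\setminus P$ is incompressible in $M$, i.e. its fundamental group injects into $\pi_1(M)$ (equivalently, by the loop theorem, no curve of $P$ is null-homotopic in $M$). A (generalized) pleated surface with pleating locus $\lambda$ for $\rho:\pi_1(M)\to\mathrm{PSL}_2\mathbb C$ on $\Sigma_i$ consists of a map $\xi$, from the ideal endpoints in $\partial\mathbb H^2$ of the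 lifted leaves $\tilde\lambda$ to $\mathbb{CP}^1=\partial\mathbb H^3$, and a map $\tilde f$, from the complement in $\mathbb H^2$ of the lifts of the closed leaves to $\mathbb H^3$, both equivariant with respect to $\rho|_{\pi_1(\Sigma_i)}$, with $\tilde f$ continuous, such that: 1. for every closed leaf $\gamma$, $\rho(\gamma)\ne 1$, and $\xi$ takes distinct values at the two ends of each lift of $\gamma$ (so $\rho(\gamma)$ is loxodromic or elliptic, and these values are the ends of its axis); 2. $\tilde f$ maps each lift of a non-closed leaf, with ends $a,b$, homeomorphically onto the geodesic of $\mathbb H^3$ from $\xi(a)$ to $\xi(b)$, where $\xi(a)\neq\xi(b)$; 3. $\tilde f$ maps each complementary ideal triangle of $\tilde\lambda$, together with its sides, bijectively onto the ideal triangle spanned by the images under $\xi$ of its vertices. Then the set $$\mathcal P(M,\lambda)=\{\chi\in\chi_0(M)\;:\;\text{every }\rho\text{ with character }\chi\text{ has a pleated surface with pleating locus }\lambda\text{ on each }\Sigma_i\}$$ is a Zariski-open and Zariski-dense subset of $\chi_0(M)$. -/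

import Mathlib

open scoped ComplexOrder MatrixGroups UpperHalfPlane LinearAlgebra.Projectivization Manifold Matrix

noncomputable section

/-! ## `PSL₂(ℂ)`, hyperbolic 3-space and convex co-compact representations -/

/-- The group `PSL₂(ℂ) = SL₂(ℂ) / {±1}`. -/
abbrev PSL2C : Type := Matrix.ProjectiveSpecialLinearGroup (Fin 2) ℂ

/-- The sphere at infinity `∂ℍ³ = ℂP¹`, with Mathlib's action of `PSL₂(ℂ)`. -/
abbrev BdH3 : Type := ℙ ℂ (Fin 2 → ℂ)

/-- The circle at infinity `∂ℍ² = ℝP¹`, with Mathlib's action of `SL₂(ℝ)`. -/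
abbrev BdH2 : Type := ℙ ℝ (Fin 2 → ℝ)

/-- Hyperbolic 3-space, in the model of positive definite Hermitian `2 × 2` matrices of
determinant one; an element `A` of `SL₂(ℂ)` acts by `X ↦ A X Aᴴ`. -/
abbrev H3 : Type := {X : Matrix (Fin 2) (Fin 2) ℂ // X.PosDef ∧ X.det = 1}

theorem H3.conj_mem (A : SL(2, ℂ)) (X : H3) :
    ((A : Matrix (Fin 2) (Fin 2) ℂ) * X.1 * (A : Matrix (Fin 2) (Fin 2) ℂ)ᴴ).PosDef ∧
      ((A : Matrix (Fin 2) (Fin 2) ℂ) * X.1 * (A : Matrix (Fin 2) (Fin 2) ℂ)ᴴ).det = 1 := by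
  refine ⟨X.2.1.mul_mul_conjTranspose_same ?_, ?_⟩
  · apply Matrix.vecMul_injective_of_isUnit
    rw [Matrix.isUnit_iff_isUnit_det]
    simp
  · simp [Matrix.det_mul, Matrix.det_conjTranspose, X.2.2]

instance H3.slAction : MulAction SL(2, ℂ) H3 where
  smul A X := ⟨_, H3.conj_mem A X⟩
  one_smul X := Subtype.ext (by
    change ((1 : SL(2, ℂ)) : Matrix (Fin 2) (Fin 2) ℂ) * X.1 *
      ((1 : SL(2, ℂ)) : Matrix (Fin 2) (Fin 2) ℂ)ᴴ = X.1
    simp)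
  mul_smul A B X := Subtype.ext (by
    change ((A * B : SL(2, ℂ)) : Matrix (Fin 2) (Fin 2) ℂ) * X.1 *
        ((A * B : SL(2, ℂ)) : Matrix (Fin 2) (Fin 2) ℂ)ᴴ =
      (A : Matrix (Fin 2) (Fin 2) ℂ) * ((B : Matrix (Fin 2) (Fin 2) ℂ) * X.1 *
        (B : Matrix (Fin 2) (Fin 2) ℂ)ᴴ) * (A : Matrix (Fin 2) (Fin 2) ℂ)ᴴ
    simp [Matrix.mul_assoc])

theorem H3.smul_val (A : SL(2, ℂ)) (X : H3) :
    (A • X).1 = (A : Matrix (Fin 2) (Fin 2) ℂ) * X.1 * (A : Matrix (Fin 2) (Fin 2) ℂ)ᴴ := rfl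

theorem center_sl_two {A : SL(2, ℂ)} (hA : A ∈ Subgroup.center SL(2, ℂ)) :
    ∃ r : ℂ, r ^ 2 = 1 ∧ (A : Matrix (Fin 2) (Fin 2) ℂ) = Matrix.scalar (Fin 2) r := by
  obtain ⟨r, hr, h⟩ := Matrix.SpecialLinearGroup.mem_center_iff.mp hA
  exact ⟨r, by simpa using hr, h.symm⟩

/-- The action of `PSL₂(ℂ)` on hyperbolic 3-space, as a homomorphism to permutations. -/
def H3.permHom : PSL2C →* Equiv.Perm H3 :=
  QuotientGroup.lift (Subgroup.center SL(2, ℂ)) (MulAction.toPermHom SL(2, ℂ) H3) (by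
    intro A hA
    obtain ⟨r, hr, h⟩ := center_sl_two hA
    have hn : ‖r‖ = 1 := by
      have h2 : ‖r‖ ^ 2 = 1 := by rw [← norm_pow, hr, norm_one]
      exact (pow_eq_one_iff_of_nonneg (norm_nonneg r) two_ne_zero).mp h2
    have hs : r * star r = 1 := by
      have h3 := Complex.mul_conj r
      rw [Complex.normSq_eq_norm_sq, hn] at h3
      simpa using h3
    ext1 X
    apply Subtype.ext
    change (A • X).1 = X.1
    rw [H3.smul_val, h]
    have h4 : (Matrix.scalar (Fin 2) r)ᴴ = Matrix.scalar (Fin 2) (star r) := by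
      simp [Matrix.scalar_apply, Matrix.diagonal_conjTranspose]
    rw [h4]
    ext i j
    simp only [Matrix.scalar_apply, Matrix.mul_diagonal, Matrix.diagonal_mul]
    calc r * X.1 i j * star r = (r * star r) * X.1 i j := by ring
      _ = X.1 i j := by rw [hs, one_mul])

instance H3.pslAction : MulAction PSL2C H3 := MulAction.compHom H3 H3.permHom

/-- The point `diag(eˢ, e⁻ˢ)` at arc length parameter `2 s` on the geodesic of `ℍ³` that runs
from `[0 : 1]` (as `s → -∞`) to `[1 : 0]` (as `s → ∞`). -/
def H3.axis (s : ℝ) : H3 :=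
  ⟨Matrix.diagonal ![(Real.exp s : ℂ), (Real.exp (-s) : ℂ)], by
    constructor
    · rw [Matrix.posDef_diagonal_iff]
      intro i
      fin_cases i
      · exact Complex.zero_lt_real.mpr (Real.exp_pos s)
      · exact Complex.zero_lt_real.mpr (Real.exp_pos (-s))
    · rw [Matrix.det_diagonal]
      simp [← Complex.exp_add]⟩

/-- The end `[0 : 1]` of the standard geodesic of `ℍ³`. -/
def BdH3.zero : BdH3 := Projectivization.mk ℂ ![0, 1] (by simp)

/-- The end `[1 : 0]` of the standard geodesic of `ℍ³`. -/
def BdH3.infty : BdH3 := Projectivization.mk ℂ ![1, 0] (by simp)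

/-- The closed ideal triangle of `ℍ³` with ideal vertices `p, q, r` (vertices included only at
infinity). A point `[v]` of `ℂP¹` is the ray of rank-one Hermitian matrices `t v vᴴ`, and the
convex hull of ideal points is the cone over these rays, intersected with `ℍ³`. -/
def H3.idealTriangle (p q r : BdH3) : Set H3 :=
  {X | ∃ s t u : ℝ, 0 ≤ s ∧ 0 ≤ t ∧ 0 ≤ u ∧
    X.1 = (s : ℂ) • Matrix.vecMulVec p.rep (star p.rep) +
      (t : ℂ) • Matrix.vecMulVec q.rep (star q.rep) +
      (u : ℂ) • Matrix.vecMulVec r.rep (star r.rep)}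

/-- Geodesic convexity: with any two points, `C` contains the geodesic arc between them. -/
def H3.IsGeodesicallyConvex (C : Set H3) : Prop :=
  ∀ (A : PSL2C) (r s t : ℝ), r ≤ s → s ≤ t →
    A • H3.axis r ∈ C → A • H3.axis t ∈ C → A • H3.axis s ∈ C

/-- Convex co-compact (discrete and faithful) representations: `ρ` is injective, `ρ(G)` acts
properly discontinuously on `ℍ³`, and `ρ(G)` acts co-compactly on some non-empty closed convex
invariant subset of `ℍ³`. -/
structure IsConvexCocompact {G : Type*} [Group G] (ρ : G →* PSL2C) : Prop where
  faithful : Function.Injective ρ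
  discrete : ∀ K : Set H3, IsCompact K →
    {g : G | (((fun X : H3 => ρ g • X) '' K) ∩ K).Nonempty}.Finite
  cocompact : ∃ C : Set H3, C.Nonempty ∧ IsClosed C ∧ H3.IsGeodesicallyConvex C ∧
    (∀ g : G, ∀ X ∈ C, ρ g • X ∈ C) ∧
    ∃ K ⊆ C, IsCompact K ∧ ∀ X ∈ C, ∃ g : G, ρ g • X ∈ K

/-! ## Representation variety and character variety -/

/-- The adjoint representation `A ↦ (X ↦ A X A⁻¹)` of `SL₂(ℂ)` on `2 × 2` matrices
(`𝔤𝔩₂ = 𝔰𝔩₂ ⊕ ℂ`, with trivial action on the second summand). -/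
def adSL : SL(2, ℂ) →* Module.End ℂ (Matrix (Fin 2) (Fin 2) ℂ) where
  toFun A := LinearMap.mulLeft ℂ (A : Matrix (Fin 2) (Fin 2) ℂ) ∘ₗ
    LinearMap.mulRight ℂ ((A⁻¹ : SL(2, ℂ)) : Matrix (Fin 2) (Fin 2) ℂ)
  map_one' := by ext1 X; simp
  map_mul' A B := by
    refine LinearMap.ext fun X => ?_
    simp [Matrix.mul_assoc]

/-- The adjoint representation of `PSL₂(ℂ)`. -/
def adPSL : PSL2C →* Module.End ℂ (Matrix (Fin 2) (Fin 2) ℂ) :=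
  QuotientGroup.lift (Subgroup.center SL(2, ℂ)) adSL (by
    intro A hA
    refine LinearMap.ext fun X => ?_
    obtain ⟨r, hr, h⟩ := center_sl_two hA
    change (A : Matrix (Fin 2) (Fin 2) ℂ) *
      (X * ((A⁻¹ : SL(2, ℂ)) : Matrix (Fin 2) (Fin 2) ℂ)) = X
    have hc : (A : Matrix (Fin 2) (Fin 2) ℂ) * X = X * (A : Matrix (Fin 2) (Fin 2) ℂ) := by
      rw [h]
      exact (Matrix.scalar_commute r (fun r' => Commute.all r r') X).eq
    rw [← Matrix.mul_assoc, hc, Matrix.mul_assoc, ← Matrix.SpecialLinearGroup.coe_mul,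
      mul_inv_cancel, Matrix.SpecialLinearGroup.coe_one, Matrix.mul_one])

/-- The representation variety `R(G)`, as a set. -/
abbrev RepVar (G : Type*) [Group G] : Type _ := G →* PSL2C

/-- The ring `A[R(G)]` of regular functions on `R(G)`, where `PSL₂(ℂ)` is an affine algebraic set
through its adjoint representation: the algebra of functions generated by the matrix entries of
`Ad ρ(g)`, `g ∈ G`. -/
def regularFunctions (G : Type*) [Group G] : Subalgebra ℂ (RepVar G → ℂ) :=
  Algebra.adjoin ℂ {f | ∃ (g : G) (i j k l : Fin 2),
    f = fun ρ => adPSL (ρ g) (Matrix.single k l 1) i j}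

/-- The representation `g ↦ A ρ(g) A⁻¹`. -/
def conjRep {G : Type*} [Group G] (A : PSL2C) (ρ : RepVar G) : RepVar G :=
  (MulAut.conj A).toMonoidHom.comp ρ

/-- The ring `A^{PSL₂(ℂ)}[R(G)]` of conjugation invariant regular functions on `R(G)`. -/
def invariantFunctions (G : Type*) [Group G] : Subalgebra ℂ (RepVar G → ℂ) where
  carrier := {f | f ∈ regularFunctions G ∧ ∀ A ρ, f (conjRep A ρ) = f ρ}
  mul_mem' := fun ha hb => ⟨mul_mem ha.1 hb.1, fun A ρ => by simp [ha.2, hb.2]⟩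
  add_mem' := fun ha hb => ⟨add_mem ha.1 hb.1, fun A ρ => by simp [ha.2, hb.2]⟩
  algebraMap_mem' := fun r => ⟨Subalgebra.algebraMap_mem _ r, fun _ _ => rfl⟩

/-- Two representations have the same character when no invariant regular function separates
them. -/
def characterSetoid (G : Type*) [Group G] : Setoid (RepVar G) where
  r ρ ρ' := ∀ f ∈ invariantFunctions G, f ρ = f ρ'
  iseqv := ⟨fun _ _ _ => rfl, fun h f hf => (h f hf).symm,
    fun h h' f hf => (h f hf).trans (h' f hf)⟩

/-- The character variety `χ(G)`, the algebro-geometric quotient `R(G) / PSL₂(ℂ)`: its ring of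
regular functions is `invariantFunctions G`, and its points are the values of the surjection
`χ : R(G) → χ(G)`. -/
def CharVar (G : Type*) [Group G] : Type _ := Quotient (characterSetoid G)

/-- The character `χ_ρ` of a representation `ρ`. -/
def character {G : Type*} [Group G] (ρ : RepVar G) : CharVar G :=
  Quotient.mk (characterSetoid G) ρ

/-- The Zariski topology of `χ(G)`: a basis is given by the non-vanishing sets of the regular
functions on `χ(G)`. -/
instance CharVar.zariski (G : Type*) [Group G] : TopologicalSpace (CharVar G) :=
  TopologicalSpace.generateFrom
    {U | ∃ f ∈ invariantFunctions G, U = {c | ∃ ρ, character ρ = c ∧ f ρ ≠ 0}}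

/-! ## Geodesic laminations on closed hyperbolic surfaces

A geodesic lamination on `ℍ / Γ` is handled through its preimage in `ℍ`, a `Γ`-invariant set of
geodesics. -/

/-- The point `eˢ i` of the imaginary axis of the upper half plane; it tends to `[0 : 1]` as
`s → -∞` and to `[1 : 0]` as `s → ∞`. -/
def H2.axis (s : ℝ) : ℍ := ⟨Complex.I * (Real.exp s : ℂ), by
  simpa [Complex.exp_ofReal_re] using Real.exp_pos s⟩

/-- The end `[0 : 1]` of the imaginary axis. -/
def BdH2.zero : BdH2 := Projectivization.mk ℝ ![0, 1] (by simp)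

/-- The end `[1 : 0]` of the imaginary axis. -/
def BdH2.infty : BdH2 := Projectivization.mk ℝ ![1, 0] (by simp)

/-- `L` is the complete geodesic of `ℍ` with ideal endpoints `a` and `b`. -/
def HasEndpoints (L : Set ℍ) (a b : BdH2) : Prop :=
  ∃ A : SL(2, ℝ), L = Set.range (fun s => A • H2.axis s) ∧
    a = A • BdH2.zero ∧ b = A • BdH2.infty

/-- The translate `g L` of a set `L`. -/
def translateSet (g : SL(2, ℝ)) (L : Set ℍ) : Set ℍ := (fun z => g • z) '' L

/-- `g` acts on `ℍ` as a non-trivial isometry. -/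
def ActsNontrivially (g : SL(2, ℝ)) : Prop := ∃ z : ℍ, g • z ≠ z

/-- `L` is a complete geodesic which projects to a closed geodesic of `ℍ / Γ`. -/
def IsClosedGeodesic (Γ : Subgroup SL(2, ℝ)) (L : Set ℍ) : Prop :=
  (∃ a b, HasEndpoints L a b) ∧ ∃ g ∈ Γ, ActsNontrivially g ∧ translateSet g L = L

/-- `Λ` is the set of all lifts to `ℍ` of the leaves of a geodesic lamination on `ℍ / Γ`, that is,
of a closed subset that is a disjoint union of simple complete geodesics. -/
structure IsGeodesicLamination (Γ : Subgroup SL(2, ℝ)) (Λ : Set (Set ℍ)) : Prop where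
  geodesic : ∀ L ∈ Λ, ∃ a b, HasEndpoints L a b
  disjoint : Λ.PairwiseDisjoint id
  invariant : ∀ g ∈ Γ, ∀ L ∈ Λ, translateSet g L ∈ Λ
  isClosed : IsClosed (⋃₀ Λ)

/-- `P` is the set of all lifts to `ℍ` of a collection of disjoint simple closed geodesics of
`ℍ / Γ`. A pants decomposition is a maximal such collection. -/
structure IsMulticurve (Γ : Subgroup SL(2, ℝ)) (P : Set (Set ℍ)) : Prop where
  closed : ∀ L ∈ P, IsClosedGeodesic Γ L
  disjoint : P.PairwiseDisjoint id
  invariant : ∀ g ∈ Γ, ∀ L ∈ P, translateSet g L ∈ P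

/-- The union of the lifts of the closed leaves of a lamination. -/
def closedLeaves (Γ : Subgroup SL(2, ℝ)) (Λ : Set (Set ℍ)) : Set ℍ :=
  ⋃₀ {L ∈ Λ | IsClosedGeodesic Γ L}

/-- `T` is a plaque of `Λ` (a connected component of the complement of the leaves), and it is the
ideal triangle with ideal vertices `a, b, c`: its frontier consists of three leaves that join
these vertices. -/
def IsTriangularPlaque (Λ : Set (Set ℍ)) (T : Set ℍ) (a b c : BdH2) : Prop :=
  (∃ z ∈ (⋃₀ Λ)ᶜ, T = connectedComponentIn (⋃₀ Λ)ᶜ z) ∧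
  ∃ L₁ ∈ Λ, ∃ L₂ ∈ Λ, ∃ L₃ ∈ Λ,
    HasEndpoints L₁ a b ∧ HasEndpoints L₂ b c ∧ HasEndpoints L₃ c a ∧
    frontier T = L₁ ∪ L₂ ∪ L₃

/-- A (generalized) pleated surface with pleating locus `Λ` for a representation
`σ : Γ → PSL₂(ℂ)` of the group of the surface `ℍ / Γ`.

The image `σ(γ)` of every closed leaf `γ` is non-trivial and has two distinct fixed points at
infinity, i.e. it has an axis (it may be loxodromic or elliptic); `vertex` sends the ends of the
lifts of `γ` to the ends of these axes, equivariantly. The map `toFun` is defined and continuous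
off the lifts of the closed leaves, is equivariant, sends every other leaf to the geodesic of `ℍ³`
that joins the images of its ends (homeomorphically, preserving the direction), and sends every
plaque, together with its sides, bijectively to the ideal triangle spanned by the images of its
ideal vertices. -/
structure PleatedSurface (Γ : Subgroup SL(2, ℝ)) (Λ : Set (Set ℍ)) (σ : Γ →* PSL2C) where
  vertex : BdH2 → BdH3
  toFun : ℍ → H3
  vertex_smul : ∀ L ∈ Λ, ∀ a b, HasEndpoints L a b →
    ∀ g : Γ, vertex ((g : SL(2, ℝ)) • a) = σ g • vertex a
  closed_nontrivial : ∀ L ∈ Λ, IsClosedGeodesic Γ L →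
    ∃ g : Γ, translateSet (g : SL(2, ℝ)) L = L ∧ σ g ≠ 1
  closed_axis : ∀ L ∈ Λ, IsClosedGeodesic Γ L → ∀ a b, HasEndpoints L a b → vertex a ≠ vertex b
  toFun_smul : ∀ z ∉ closedLeaves Γ Λ, ∀ g : Γ, toFun ((g : SL(2, ℝ)) • z) = σ g • toFun z
  continuousOn_toFun : ContinuousOn toFun (closedLeaves Γ Λ)ᶜ
  leaf_geodesic : ∀ A : SL(2, ℝ), Set.range (fun s => A • H2.axis s) ∈ Λ →
    ¬ IsClosedGeodesic Γ (Set.range (fun s => A • H2.axis s)) →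
    ∃ (B : PSL2C) (θ : ℝ ≃o ℝ), (∀ s, toFun (A • H2.axis s) = B • H3.axis (θ s)) ∧
      B • BdH3.zero = vertex (A • BdH2.zero) ∧ B • BdH3.infty = vertex (A • BdH2.infty)
  plaque_triangle : ∀ T a b c, IsTriangularPlaque Λ T a b c →
    Set.BijOn toFun (closure T) (H3.idealTriangle (vertex a) (vertex b) (vertex c))

/-! ## The 3-manifold, its boundary and the peripheral homomorphisms -/

/-- A hyperbolic structure on the boundary of a 3-manifold `M`: the boundary is the disjoint union
of compact connected surfaces `Σ₁, …, Σₖ`, and `Σᵢ` is identified with `ℍ / Γᵢ` for a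
group `Γᵢ = deck i` of isometries, through a covering map `proj i : ℍ → Σᵢ ⊆ M`
(`Γᵢ` may or may not contain `-1`, which acts trivially). -/
structure HyperbolicBoundary (M : Type*) [TopologicalSpace M]
    [ChartedSpace (EuclideanHalfSpace 3) M] (k : ℕ) where
  deck : Fin k → Subgroup SL(2, ℝ)
  proj : Fin k → C(ℍ, M)
  isCovering : ∀ i, IsCoveringMap (Set.rangeFactorization (proj i))
  proj_eq_iff : ∀ i z w, proj i z = proj i w ↔ ∃ g ∈ deck i, g • z = w
  isCompact : ∀ i, IsCompact (Set.range (proj i))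
  disjoint : Pairwise fun i j => Disjoint (Set.range (proj i)) (Set.range (proj j))
  iUnion_eq : ⋃ i, Set.range (proj i) = (𝓡∂ 3).boundary M

section Peripheral

variable {M : Type*} [TopologicalSpace M] (p : C(ℍ, M)) (Γ : Subgroup SL(2, ℝ))
  (hp : ∀ g ∈ Γ, ∀ z, p (g • z) = p z)

/-- The loop in the surface, based at the image of `i`, that is the projection of a path in `ℍ`
from `g • i` to `i`; as `ℍ` is simply connected its homotopy class depends on `g` only. -/
def deckLoop (g : Γ) : Path (p UpperHalfPlane.I) (p UpperHalfPlane.I) :=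
  ((PathConnectedSpace.somePath ((g : SL(2, ℝ)) • UpperHalfPlane.I) UpperHalfPlane.I).map
    p.continuous).cast (hp g g.2 _).symm rfl

theorem deckLoop_mul (g h : Γ) :
    (deckLoop p Γ hp (g * h)).Homotopic ((deckLoop p Γ hp h).trans (deckLoop p Γ hp g)) := by
  let z : ℍ := UpperHalfPlane.I
  let P : ∀ w : ℍ, Path w z := fun w => PathConnectedSpace.somePath w z
  have hcont : Continuous fun w : ℍ => (g : SL(2, ℝ)) • w := by fun_prop
  let Q : Path (((g * h : Γ) : SL(2, ℝ)) • z) ((g : SL(2, ℝ)) • z) :=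
    ((P ((h : SL(2, ℝ)) • z)).map hcont).cast (by simp [mul_smul]) rfl
  have key : (P (((g * h : Γ) : SL(2, ℝ)) • z)).Homotopic (Q.trans (P ((g : SL(2, ℝ)) • z))) :=
    SimplyConnectedSpace.paths_homotopic _ _
  have key2 := key.map p
  have e1 : deckLoop p Γ hp (g * h) =
      ((P (((g * h : Γ) : SL(2, ℝ)) • z)).map p.continuous).cast
        (hp _ (g * h).2 _).symm rfl := rfl
  have e2 : (deckLoop p Γ hp h).trans (deckLoop p Γ hp g) =
      ((Q.trans (P ((g : SL(2, ℝ)) • z))).map p.continuous).cast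
        (hp _ (g * h).2 _).symm rfl := by
    ext t
    simp only [deckLoop, Path.trans_apply, Path.cast_coe, Path.map_coe, Function.comp_apply, Q]
    split_ifs
    · exact (hp g g.2 _).symm
    · rfl
  rw [e1, e2]
  exact key2

/-- The homotopy class of a deck loop, transported to the base point `x₀` along `δ`. -/
def peripheralClass (x₀ : M) (δ : Path x₀ (p UpperHalfPlane.I)) (g : Γ) : FundamentalGroup M x₀ :=
  FundamentalGroup.fromPath (Path.Homotopic.Quotient.mk
    ((δ.trans (deckLoop p Γ hp g)).trans δ.symm))

theorem peripheralClass_mul (x₀ : M) (δ : Path x₀ (p UpperHalfPlane.I)) (g h : Γ) :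
    peripheralClass p Γ hp x₀ δ (g * h) =
      peripheralClass p Γ hp x₀ δ g * peripheralClass p Γ hp x₀ δ h := by
  have h1 := Path.Homotopic.Quotient.eq.mpr (deckLoop_mul p Γ hp g h)
  rw [FundamentalGroup.mul_def]
  simp only [peripheralClass, Path.Homotopic.Quotient.mk_trans, Path.Homotopic.Quotient.mk_symm]
    at h1 ⊢
  change _ = Path.Homotopic.Quotient.trans _ _
  rw [h1]
  set d := Path.Homotopic.Quotient.mk δ
  set a := Path.Homotopic.Quotient.mk (deckLoop p Γ hp g)
  set b := Path.Homotopic.Quotient.mk (deckLoop p Γ hp h)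
  calc ((d.trans (b.trans a)).trans d.symm)
      = (d.trans b).trans (a.trans d.symm) := by
        simp only [Path.Homotopic.Quotient.trans_assoc]
    _ = (d.trans b).trans ((d.symm.trans d).trans (a.trans d.symm)) := by
        rw [Path.Homotopic.Quotient.symm_trans, Path.Homotopic.Quotient.refl_trans]
    _ = _ := by simp only [Path.Homotopic.Quotient.trans_assoc]

/-- The homomorphism `Γ ≅ π₁(ℍ / Γ) → π₁(M, x₀)` induced by the inclusion of the boundary surface
`ℍ / Γ` and the path `δ` from the base point to it. -/
def peripheralHom (x₀ : M) (δ : Path x₀ (p UpperHalfPlane.I)) : Γ →* FundamentalGroup M x₀ :=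
  MonoidHom.mk' (peripheralClass p Γ hp x₀ δ) (peripheralClass_mul p Γ hp x₀ δ)

end Peripheral

section Pleated

variable {M : Type*} [TopologicalSpace M] [ChartedSpace (EuclideanHalfSpace 3) M] {k : ℕ}

theorem HyperbolicBoundary.proj_smul (S : HyperbolicBoundary M k) (i : Fin k) :
    ∀ g ∈ S.deck i, ∀ z, S.proj i (g • z) = S.proj i z :=
  fun g hg z => ((S.proj_eq_iff i z (g • z)).mpr ⟨g, hg, rfl⟩).symm

/-- The homomorphism `π₁(Σᵢ) → π₁(M, x₀)` determined by a path `δ` from `x₀` to `Σᵢ`, on the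
deck group `Γᵢ` of `Σᵢ = ℍ / Γᵢ`. -/
def HyperbolicBoundary.incl (S : HyperbolicBoundary M k) (x₀ : M) (i : Fin k)
    (δ : Path x₀ (S.proj i UpperHalfPlane.I)) : S.deck i →* FundamentalGroup M x₀ :=
  peripheralHom (S.proj i) (S.deck i) (S.proj_smul i) x₀ δ

/-- The pairs of pants in `ℍ / Γ` cut off by the pants decomposition `P` are incompressible with
respect to `φ : Γ → G`, that is, `φ` is injective on their fundamental groups: it kills no
non-trivial element of `Γ` whose closed geodesic (not necessarily simple) lies in `P` or is
disjoint from `P`. -/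
def IsIncompressiblePants (Γ : Subgroup SL(2, ℝ)) (P : Set (Set ℍ)) {G : Type*} [Group G]
    (φ : Γ →* G) : Prop :=
  ∀ g : Γ, ActsNontrivially (g : SL(2, ℝ)) →
    (∃ L a b, HasEndpoints L a b ∧ translateSet (g : SL(2, ℝ)) L = L ∧
      ∀ L' ∈ P, L = L' ∨ Disjoint L L') → φ g ≠ 1

/-- The characters of `π₁(M)` whose restriction to `∂M` admits a pleated surface with pleating
locus `Λ = (Λᵢ)`: for every representation with the given character, and every boundary component,
the restricted representation admits a pleated surface. (An irreducible representation is
determined up to conjugation by its character.) -/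
def pleatedCharacters (S : HyperbolicBoundary M k) (x₀ : M)
    (δ : ∀ i, Path x₀ (S.proj i UpperHalfPlane.I)) (Λ : Fin k → Set (Set ℍ)) :
    Set (CharVar (FundamentalGroup M x₀)) :=
  {c | ∀ ρ : RepVar (FundamentalGroup M x₀), character ρ = c →
    ∀ i, Nonempty (PleatedSurface (S.deck i) (Λ i) (ρ.comp (S.incl x₀ i (δ i))))}

end Pleated

end

noncomputable section

open BdH2 Projectivization Metric H3
open UpperHalfPlane hiding mk
open Real hiding mk
open Complex (div_re normSq_apply div_im continuous_ofReal normSq_eq_norm_sq sub_re sub_im lt_def ofReal_mul star_def conj_ofReal ofReal_one ofReal_re mul_conj ofReal_exp ofReal_pow add_re ofReal_div ofReal_ne_zero ofReal_eq_zero normSq)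

local notation "SL2R" => SL(2, ℝ)
local notation "Rel" => BdH2 → BdH2 → Prop

variable {Γ Δ : Subgroup SL2R} {F P : Rel} {a b c e p q x y : BdH2}
  {g k : SL2R} {z w o : ℍ}

/-! ### Determinants of pairs of vectors and the form attached to a point of the upper half plane -/

section Vectors

variable {K : Type*} [Field K]

/-- The determinant of a pair of vectors of `K²`. -/
def vdet (u v : Fin 2 → K) : K := u 0 * v 1 - u 1 * v 0

lemma vdet_swap (u v : Fin 2 → K) : vdet u v = -vdet v u := by simp only [vdet]; ring

lemma vdet_smul_left (t : K) (u v : Fin 2 → K) : vdet (t • u) v = t * vdet u v := by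
  simp only [vdet, Pi.smul_apply, smul_eq_mul]; ring

lemma vdet_smul_right (t : K) (u v : Fin 2 → K) : vdet u (t • v) = t * vdet u v := by
  simp only [vdet, Pi.smul_apply, smul_eq_mul]; ring

lemma vdet_self (u : Fin 2 → K) : vdet u u = 0 := by simp only [vdet]; ring

lemma sl_smul_0 (g : SL(2, K)) (v : Fin 2 → K) : (g • v) 0 = g 0 0 * v 0 + g 0 1 * v 1 := by
  simp [Matrix.SpecialLinearGroup.smul_def, Matrix.mulVec, dotProduct]

lemma sl_smul_1 (g : SL(2, K)) (v : Fin 2 → K) : (g • v) 1 = g 1 0 * v 0 + g 1 1 * v 1 := by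
  simp [Matrix.SpecialLinearGroup.smul_def, Matrix.mulVec, dotProduct]

lemma sl_det (g : SL(2, K)) : g 0 0 * g 1 1 - g 0 1 * g 1 0 = 1 := by
  have := g.det_coe; rwa [Matrix.det_fin_two] at this

lemma vdet_sl_smul (g : SL(2, K)) (u v : Fin 2 → K) : vdet (g • u) (g • v) = vdet u v := by
  simp only [vdet, sl_smul_0, sl_smul_1]; linear_combination (u 0 * v 1 - u 1 * v 0) * sl_det g

/-- Two points of a projective line are equal when their representatives are dependent. -/
lemma mk_eq_iff {u v : Fin 2 → K} (hu : u ≠ 0) (hv : v ≠ 0) :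
    mk K u hu = mk K v hv ↔ vdet u v = 0 := by
  rw [mk_eq_mk_iff']
  constructor
  · rintro ⟨t, rfl⟩
    rw [vdet_smul_left, vdet_self, mul_zero]
  · intro h
    simp only [vdet] at h
    by_cases h0 : v 0 = 0
    · have h1 : v 1 ≠ 0 := fun h1 => hv (by ext i; fin_cases i <;> simp [h0, h1])
      refine ⟨u 1 / v 1, ?_⟩
      have hu0 : u 0 = 0 := by
        rw [h0, mul_zero, sub_zero] at h
        exact (mul_eq_zero.mp h).resolve_right h1
      ext i; fin_cases i
      · simp [h0, hu0]
      · simp [h1]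
    · refine ⟨u 0 / v 0, ?_⟩
      ext i; fin_cases i
      · simp [h0]
      · simp; field_simp; linear_combination h

lemma eq_iff_vdet (x y : ℙ K (Fin 2 → K)) : x = y ↔ vdet x.rep y.rep = 0 := by
  conv_lhs => rw [← x.mk_rep, ← y.mk_rep]
  exact mk_eq_iff _ _

lemma exists_rep_mk (v : Fin 2 → K) (hv : v ≠ 0) :
    ∃ t : K, t ≠ 0 ∧ (mk K v hv).rep = t • v := by
  obtain ⟨a, ha⟩ := exists_smul_eq_mk_rep K v hv; exact ⟨a, a.ne_zero, ha.symm⟩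

lemma exists_rep_smul (g : SL(2, K)) (x : ℙ K (Fin 2 → K)) :
    ∃ t : K, t ≠ 0 ∧ (g • x).rep = t • (g • x.rep) := by
  have h : g • x = mk K (g • x.rep) ((smul_ne_zero_iff_ne g).mpr x.rep_nonzero) := by
    conv_lhs => rw [← x.mk_rep]
    rfl
  rw [h]; exact exists_rep_mk _ _

lemma vdet_ne {x y : ℙ K (Fin 2 → K)} (h : x ≠ y) : vdet x.rep y.rep ≠ 0 :=
  fun h' => h ((eq_iff_vdet x y).mpr h')

end Vectors

/-- The scalar product on `ℝ²` attached to a point of the upper half plane; it has determinant one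
and is equivariant under `SL₂(ℝ)`. -/
def hform (z : ℍ) (v w : Fin 2 → ℝ) : ℝ :=
  (v 0 * w 0 - z.re * (v 0 * w 1 + v 1 * w 0) + (z.re ^ 2 + z.im ^ 2) * (v 1 * w 1)) / z.im

lemma hform_comm (z : ℍ) (v w : Fin 2 → ℝ) : hform z v w = hform z w v := by simp only [hform]; ring

lemma hform_smul_left (z : ℍ) (t : ℝ) (v w : Fin 2 → ℝ) : hform z (t • v) w = t * hform z v w := by
  simp only [hform, Pi.smul_apply, smul_eq_mul]; ring

lemma hform_smul_right (z : ℍ) (t : ℝ) (v w : Fin 2 → ℝ) : hform z v (t • w) = t * hform z v w := by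
  simp only [hform, Pi.smul_apply, smul_eq_mul]; ring

lemma re_sl_smul_I (g : SL2R) :
    (g • I).re = (g 0 0 * g 1 0 + g 0 1 * g 1 1) / (g 1 0 ^ 2 + g 1 1 ^ 2) := by
  rw [specialLinearGroup_apply]; simp [mk_re, div_re, normSq_apply]; field_simp; ring

lemma im_sl_smul_I (g : SL2R) : (g • I).im = 1 / (g 1 0 ^ 2 + g 1 1 ^ 2) := by
  rw [specialLinearGroup_apply]; simp [mk_im, div_im, normSq_apply]; have := sl_det g
  have e : g 0 0 * g 1 1 / (g 1 0 * g 1 0 + g 1 1 * g 1 1) -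
      g 0 1 * g 1 0 / (g 1 0 * g 1 0 + g 1 1 * g 1 1) = 1 / (g 1 0 * g 1 0 + g 1 1 * g 1 1) := by
    rw [div_sub_div_same, this]
  rw [inv_eq_one_div, pow_two, pow_two, ← e]; ring

lemma sl_row_sq_pos (g : SL2R) : 0 < g 1 0 ^ 2 + g 1 1 ^ 2 := by
  by_contra h; have h0 : g 1 0 = 0 := by nlinarith [sq_nonneg (g 1 0), sq_nonneg (g 1 1)]
  have h1 : g 1 1 = 0 := by nlinarith [sq_nonneg (g 1 0), sq_nonneg (g 1 1)]
  have := sl_det g; rw [h0, h1] at this; norm_num at this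

lemma hform_sl_smul_I (g : SL2R) (v w : Fin 2 → ℝ) :
    hform (g • I) (g • v) (g • w) = v 0 * w 0 + v 1 * w 1 := by
  have h := sl_row_sq_pos g
  simp only [hform, re_sl_smul_I, im_sl_smul_I, sl_smul_0, sl_smul_1]; field_simp
  have hd : g 0 0 * g 1 1 = 1 + g 0 1 * g 1 0 := by linear_combination sl_det g
  have e : (g 0 0 * g 1 0 + g 0 1 * g 1 1) ^ 2 + 1 =
      (g 0 0 ^ 2 + g 0 1 ^ 2) * (g 1 0 ^ 2 + g 1 1 ^ 2) := by
    linear_combination (-1 - (g 0 0 * g 1 1 - g 0 1 * g 1 0)) * sl_det g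
  rw [e]; have e2 := sl_det g; field_simp
  linear_combination (v 0 * w 0 + v 1 * w 1) * (g 0 0 * g 1 1 - g 0 1 * g 1 0 + 1) * e2

lemma hform_sl_smul (g : SL2R) (z : ℍ) (v w : Fin 2 → ℝ) :
    hform (g • z) (g • v) (g • w) = hform z v w := by
  obtain ⟨m, rfl⟩ : ∃ m : SL2R, m • I = z := ⟨z.toSL2R, z.toSL2R_smul_I⟩
  have h1 := hform_sl_smul_I (g * m) (m⁻¹ • v) (m⁻¹ • w)
  have h2 := hform_sl_smul_I m (m⁻¹ • v) (m⁻¹ • w); simp only [mul_smul, smul_inv_smul] at h1 h2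
  rw [h1, h2]

lemma hform_self_pos (z : ℍ) {v : Fin 2 → ℝ} (hv : v ≠ 0) : 0 < hform z v v := by
  have hz := z.im_pos; refine div_pos ?_ hz
  have e : v 0 * v 0 - z.re * (v 0 * v 1 + v 1 * v 0) + (z.re ^ 2 + z.im ^ 2) * (v 1 * v 1) =
    (v 0 - z.re * v 1) ^ 2 + (z.im * v 1) ^ 2 := by ring
  rw [e]; by_cases h1 : v 1 = 0
  · have h0 : v 0 ≠ 0 := fun h0 => hv (by ext i; fin_cases i <;> simp [h0, h1])
    rw [h1]; simp only [mul_zero, sub_zero]; positivity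
  · positivity

lemma hform_gram (z : ℍ) (v w : Fin 2 → ℝ) :
    hform z v v * hform z w w - hform z v w ^ 2 = vdet v w ^ 2 := by
  have hz := z.im_ne_zero; simp only [hform, vdet]; field_simp; ring

/-- The form of a point of `ℍ`, expanded in a basis. -/
lemma hform_expand_two (z : ℍ) (c e v w : Fin 2 → ℝ) :
    vdet c e ^ 2 * hform z v w = vdet v c * vdet w c * hform z e e -
      (vdet v c * vdet w e + vdet v e * vdet w c) * hform z c e +
      vdet v e * vdet w e * hform z c c := by
  have hz := z.im_ne_zero; simp only [hform, vdet]; field_simp; ring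

/-- The form of a point of `ℍ`, as a combination of the forms of three ideal points. -/
lemma hform_expand_three (z : ℍ) {a b c : Fin 2 → ℝ} (hab : vdet a b ≠ 0) (hbc : vdet b c ≠ 0)
    (hca : vdet c a ≠ 0) (v w : Fin 2 → ℝ) :
    hform z v w = -hform z b c / (vdet a b * vdet c a) * (vdet v a * vdet w a) +
      -hform z c a / (vdet b c * vdet a b) * (vdet v b * vdet w b) +
      -hform z a b / (vdet c a * vdet b c) * (vdet v c * vdet w c) := by
  have hz := z.im_ne_zero; field_simp; simp only [hform, vdet]; field_simp; ring

lemma hform_ext {z' : ℍ} (h : ∀ v w, hform z v w = hform z' v w) : z = z' := by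
  have h1 := h ![1, 0] ![1, 0]; have h2 := h ![1, 0] ![0, 1]; have hz := z.im_ne_zero
  have hz' := z'.im_ne_zero; simp [hform] at h1 h2; rw [h1] at h2
  have h3 : z.re = z'.re := by field_simp at h2; linarith
  exact ext_re_im h3 h1

lemma continuous_hform (v w : Fin 2 → ℝ) : Continuous fun z : ℍ => hform z v w := by
  have h1 := UpperHalfPlane.continuous_re; have h2 := UpperHalfPlane.continuous_im; unfold hform
  exact Continuous.div (by fun_prop) (by fun_prop) (fun z => z.im_ne_zero)

lemma continuous_hform_prod :
    Continuous fun q : ℍ × (Fin 2 → ℝ) × (Fin 2 → ℝ) => hform q.1 q.2.1 q.2.2 := by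
  have h1 := UpperHalfPlane.continuous_re; have h2 := UpperHalfPlane.continuous_im; unfold hform
  exact Continuous.div (by fun_prop) (by fun_prop) (fun q => q.1.im_ne_zero)

/-- The point of `ℍ` whose form is proportional to the positive definite form with matrix
`(A, B; B, C)`. -/
def conePt (A B C : ℝ) : ℍ := ofComplex (⟨-B / A, √(A * C - B ^ 2) / A⟩ : ℂ)

lemma conePt_coe {A B C : ℝ} (hA : 0 < A) (h : 0 < A * C - B ^ 2) :
    ((conePt A B C : ℍ) : ℂ) = ⟨-B / A, √(A * C - B ^ 2) / A⟩ := by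
  have : 0 < (⟨-B / A, √(A * C - B ^ 2) / A⟩ : ℂ).im := div_pos (sqrt_pos.mpr h) hA
  rw [conePt, ofComplex_apply_of_im_pos this]

lemma hform_conePt {A B C : ℝ} (hA : 0 < A) (h : 0 < A * C - B ^ 2) (v w : Fin 2 → ℝ) :
    hform (conePt A B C) v w = (A * (v 0 * w 0) + B * (v 0 * w 1 + v 1 * w 0) +
      C * (v 1 * w 1)) / √(A * C - B ^ 2) := by
  have hr : (conePt A B C).re = -B / A := by rw [← coe_re, conePt_coe hA h]
  have hi : (conePt A B C).im = √(A * C - B ^ 2) / A := by rw [← coe_im, conePt_coe hA h]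
  have hs := sqrt_pos.mpr h; have hs2 := sq_sqrt h.le
  rw [hform, hr, hi, div_pow √(A * C - B ^ 2), hs2]; field_simp; ring

lemma continuousOn_conePt : ContinuousOn (fun q : ℝ × ℝ × ℝ => conePt q.1 q.2.1 q.2.2)
      {q | 0 < q.1 ∧ 0 < q.1 * q.2.2 - q.2.1 ^ 2} := by
  rw [isOpenEmbedding_coe.isEmbedding.continuousOn_iff]
  have : ContinuousOn (fun q : ℝ × ℝ × ℝ =>
      ((-q.2.1 / q.1 : ℝ) : ℂ) + ((√(q.1 * q.2.2 - q.2.1 ^ 2) / q.1 : ℝ) : ℂ) * Complex.I)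
      {q | 0 < q.1 ∧ 0 < q.1 * q.2.2 - q.2.1 ^ 2} := by
    refine ContinuousOn.add ?_ (ContinuousOn.mul ?_ continuousOn_const)
    · refine continuous_ofReal.comp_continuousOn (ContinuousOn.div (by fun_prop) (by fun_prop) ?_)
      exact fun q hq => hq.1.ne'
    · refine continuous_ofReal.comp_continuousOn (ContinuousOn.div ?_ (by fun_prop) ?_)
      exacts [(continuous_sqrt.comp (by fun_prop)).continuousOn, fun q hq => hq.1.ne']
  refine this.congr fun q hq => ?_; simp only [Function.comp]; rw [conePt_coe hq.1 hq.2]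
  exact Complex.mk_eq_add_mul_I _ _

/-! ### Ideal points, linking and geodesics -/

/-- The pairs `{a, b}` and `{c, e}` of points of `ℝP¹` separate each other. -/
def Link (a b c e : BdH2) : Prop :=
  vdet a.rep c.rep * vdet b.rep c.rep * (vdet a.rep e.rep * vdet b.rep e.rep) < 0

lemma link_mk_iff {a b c e : Fin 2 → ℝ} (ha : a ≠ 0) (hb : b ≠ 0) (hc : c ≠ 0) (he : e ≠ 0) :
    Link (mk ℝ a ha) (mk ℝ b hb) (mk ℝ c hc)
      (mk ℝ e he) ↔
      vdet a c * vdet b c * (vdet a e * vdet b e) < 0 := by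
  obtain ⟨s, hs, e1⟩ := exists_rep_mk a ha
  obtain ⟨t, ht, e2⟩ := exists_rep_mk b hb
  obtain ⟨u, hu, e3⟩ := exists_rep_mk c hc
  obtain ⟨v, hv, e4⟩ := exists_rep_mk e he
  rw [Link, e1, e2, e3, e4]
  simp only [vdet_smul_left, vdet_smul_right]
  have : s * (u * vdet a c) * (t * (u * vdet b c)) * (s * (v * vdet a e) * (t * (v * vdet b e))) =
    (s * t * u * v) ^ 2 * (vdet a c * vdet b c * (vdet a e * vdet b e)) := by ring
  have hp : 0 < (s * t * u * v) ^ 2 := by positivity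
  constructor
  · intro h
    by_contra h'
    push Not at h'
    nlinarith [mul_nonneg hp.le h']
  · intro h
    nlinarith [mul_neg_of_pos_of_neg hp h]

lemma Link.symm_left (h : Link a b c e) : Link b a c e := by unfold Link at *; linarith

lemma Link.symm_right (h : Link a b c e) : Link a b e c := by unfold Link at *; linarith

lemma Link.swap (h : Link a b c e) : Link c e a b := by
  unfold Link at *
  rw [vdet_swap c.rep a.rep, vdet_swap e.rep a.rep, vdet_swap c.rep b.rep, vdet_swap e.rep b.rep]
  linarith

lemma link_smul (g : SL2R) (a b c e : BdH2) :
    Link (g • a) (g • b) (g • c) (g • e) ↔ Link a b c e := by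
  have key : ∀ x : BdH2, g • x = mk ℝ (g • x.rep)
      ((smul_ne_zero_iff_ne g).mpr x.rep_nonzero) := fun x => by
    conv_lhs => rw [← x.mk_rep]
    rfl
  rw [key a, key b, key c, key e, link_mk_iff]; simp only [vdet_sl_smul]
  rfl

lemma Link.ne_left (h : Link a b c e) : a ≠ b := by
  rintro rfl; unfold Link at h
  nlinarith [mul_nonneg (mul_self_nonneg (vdet a.rep c.rep)) (mul_self_nonneg (vdet a.rep e.rep))]

lemma Link.ne13 (h : Link a b c e) : a ≠ c := by
  rintro rfl; unfold Link at h; rw [vdet_self] at h; simp at h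

lemma Link.ne14 (h : Link a b c e) : a ≠ e := h.symm_right.ne13
lemma Link.ne23 (h : Link a b c e) : b ≠ c := h.symm_left.ne13
lemma Link.ne24 (h : Link a b c e) : b ≠ e := h.symm_left.ne14
lemma Link.ne_right (h : Link a b c e) : c ≠ e := h.swap.ne_left

/-- The real point `[t : 1]` of `ℝP¹`. -/
def BdH2.ofReal (t : ℝ) : BdH2 :=
  mk ℝ ![t, 1] (fun h => one_ne_zero (congrFun h 1))

lemma BdH2.zero_eq : zero = ofReal 0 := rfl

lemma BdH2.ofReal_inj {s t : ℝ} : ofReal s = ofReal t ↔ s = t := by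
  rw [ofReal, ofReal, mk_eq_iff]; simp [vdet, sub_eq_zero]

lemma BdH2.ofReal_ne_infty (t : ℝ) : ofReal t ≠ infty := by
  rw [Ne, ofReal, infty, mk_eq_iff]; simp [vdet]

lemma BdH2.zero_ne_infty : zero ≠ infty := ofReal_ne_infty 0

lemma BdH2.eq_infty_or (x : BdH2) : x = infty ∨ ∃ t, x = ofReal t := by
  by_cases h : x.rep 1 = 0
  · left; rw [← x.mk_rep, infty, mk_eq_iff]; simp [vdet, h]
  · right; refine ⟨x.rep 0 / x.rep 1, ?_⟩
    conv_lhs => rw [← x.mk_rep]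
    rw [ofReal, mk_eq_iff]; simp [vdet]; field_simp; ring

lemma BdH2.exists_ofReal (h : x ≠ infty) : ∃ t, x = ofReal t := x.eq_infty_or.resolve_left h

lemma link_infty (x y z : ℝ) :
    Link infty (ofReal x) (ofReal y) (ofReal z) ↔ (x - y) * (x - z) < 0 := by
  rw [infty, ofReal, ofReal, ofReal, link_mk_iff]; simp [vdet]

lemma link_ofReal (a b c e : ℝ) :
    Link (ofReal a) (ofReal b) (ofReal c) (ofReal e) ↔
      (a - c) * (b - c) * ((a - e) * (b - e)) < 0 := by
  rw [ofReal, ofReal, ofReal, ofReal, link_mk_iff]; simp [vdet]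

lemma sl_smul_ofReal {t : ℝ} (h : g 1 0 * t + g 1 1 ≠ 0) :
    g • ofReal t = ofReal ((g 0 0 * t + g 0 1) / (g 1 0 * t + g 1 1)) := by
  rw [ofReal, Projectivization.smul_mk, ofReal, mk_eq_iff]
  simp only [vdet, sl_smul_0, sl_smul_1]; simp; rw [mul_div_cancel₀ _ h, sub_self]

lemma sl_smul_infty (h : g 1 0 ≠ 0) : g • infty = ofReal (g 0 0 / g 1 0) := by
  rw [infty, Projectivization.smul_mk, ofReal, mk_eq_iff]
  simp only [vdet, sl_smul_0, sl_smul_1]; simp; field_simp; ring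

lemma sl_smul_infty_iff : g • infty = infty ↔ g 1 0 = 0 := by
  rw [infty, Projectivization.smul_mk, mk_eq_iff]
  simp only [vdet, sl_smul_0, sl_smul_1]; simp

lemma sl_smul_zero_iff : g • zero = zero ↔ g 0 1 = 0 := by
  rw [zero, Projectivization.smul_mk, mk_eq_iff]
  simp only [vdet, sl_smul_0, sl_smul_1]; simp

lemma sl_smul_ofReal_eq_infty {t : ℝ} (h : g 1 0 * t + g 1 1 = 0) : g • ofReal t = infty := by
  rw [ofReal, Projectivization.smul_mk, infty, mk_eq_iff]
  simp only [vdet, sl_smul_0, sl_smul_1]; simp; linear_combination (-1 : ℝ) * h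

/-- The element of `SL₂(ℝ)` with the given entries. -/
def slMk (a b c d : ℝ) (h : a * d - b * c = 1) : SL2R :=
  ⟨!![a, b; c, d], by rw [Matrix.det_fin_two_of]; exact h⟩

@[simp] theorem slMk_zero_zero (a b c d : ℝ) (h) : slMk a b c d h 0 0 = a := rfl
@[simp] theorem slMk_zero_one (a b c d : ℝ) (h) : slMk a b c d h 0 1 = b := rfl
@[simp] theorem slMk_one_zero (a b c d : ℝ) (h) : slMk a b c d h 1 0 = c := rfl
@[simp] theorem slMk_one_one (a b c d : ℝ) (h) : slMk a b c d h 1 1 = d := rfl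

/-- `SL₂(ℝ)` acts doubly transitively on `ℝP¹`. -/
lemma exists_sl_frame (h : a ≠ b) :
    ∃ A : SL2R, A • zero = a ∧ A • infty = b := by
  have hd : vdet b.rep a.rep ≠ 0 := fun h' => h ((eq_iff_vdet b a).mpr h').symm
  refine ⟨slMk (b.rep 0) (a.rep 0 / vdet b.rep a.rep) (b.rep 1) (a.rep 1 / vdet b.rep a.rep) ?_,
    ?_, ?_⟩
  · rw [mul_div_assoc', div_mul_eq_mul_div, div_sub_div_same, div_eq_one_iff_eq hd]
    simp only [vdet]; ring
  · conv_rhs => rw [← a.mk_rep]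
    rw [zero, Projectivization.smul_mk, mk_eq_iff]
    simp only [vdet, sl_smul_0, sl_smul_1]
    simp
    ring
  · conv_rhs => rw [← b.mk_rep]
    rw [infty, Projectivization.smul_mk, mk_eq_iff]
    simp only [vdet, sl_smul_0, sl_smul_1]
    simp
    ring

/-- The geodesic of `ℍ` with ideal endpoints `a` and `b`. -/
def geod (a b : BdH2) : Set ℍ := {z | hform z a.rep b.rep = 0}

lemma geod_comm (a b : BdH2) : geod a b = geod b a := by
  ext z; simp only [geod, Set.mem_ofPred_eq, hform_comm]

lemma mem_geod_mk {a b : Fin 2 → ℝ} (ha : a ≠ 0) (hb : b ≠ 0) (z : ℍ) :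
    z ∈ geod (mk ℝ a ha) (mk ℝ b hb) ↔ hform z a b = 0 := by
  obtain ⟨s, hs, e1⟩ := exists_rep_mk a ha; obtain ⟨t, ht, e2⟩ := exists_rep_mk b hb
  simp [geod, e1, e2, hform_smul_left, hform_smul_right, hs, ht]

lemma smul_mem_geod (g : SL2R) (a b : BdH2) (z : ℍ) :
    g • z ∈ geod (g • a) (g • b) ↔ z ∈ geod a b := by
  obtain ⟨s, hs, e1⟩ := exists_rep_smul g a; obtain ⟨t, ht, e2⟩ := exists_rep_smul g b
  simp [geod, e1, e2, hform_smul_left, hform_smul_right, hs, ht, hform_sl_smul]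

lemma translateSet_geod (g : SL2R) (a b : BdH2) :
    translateSet g (geod a b) = geod (g • a) (g • b) := by
  ext z
  constructor
  · rintro ⟨w, hw, rfl⟩
    exact (smul_mem_geod g a b w).mpr hw
  · intro hz
    refine ⟨g⁻¹ • z, ?_, smul_inv_smul g z⟩
    rw [← smul_mem_geod g, smul_inv_smul]
    exact hz

lemma mem_geod_zero_infty (z : ℍ) : z ∈ geod zero infty ↔ z.re = 0 := by
  rw [zero, infty, mem_geod_mk]; simp [hform, z.im_ne_zero]

lemma H2.axis_re (s : ℝ) : (H2.axis s).re = 0 := by rw [H2.axis, mk_re]; simp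

lemma H2.axis_im (s : ℝ) : (H2.axis s).im = exp s := by
  rw [H2.axis, mk_im]; simp [Complex.exp_ofReal_re]

lemma range_axis : Set.range H2.axis = geod zero infty := by
  ext z
  rw [mem_geod_zero_infty]
  constructor
  · rintro ⟨s, rfl⟩; exact H2.axis_re s
  · intro h
    refine ⟨log z.im, ext_re_im ?_ ?_⟩
    · rw [H2.axis_re, h]
    · rw [H2.axis_im, Real.exp_log z.im_pos]

lemma range_smul_axis (A : SL2R) :
    Set.range (fun s => A • H2.axis s) = geod (A • zero) (A • infty) := by
  rw [← translateSet_geod, ← range_axis, translateSet, ← Set.range_comp]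
  rfl

lemma hasEndpoints_iff {L : Set ℍ} :
    HasEndpoints L a b ↔ a ≠ b ∧ L = geod a b := by
  constructor
  · rintro ⟨A, rfl, rfl, rfl⟩
    exact ⟨fun h => zero_ne_infty (smul_left_cancel A h), range_smul_axis A⟩
  · rintro ⟨h, rfl⟩
    obtain ⟨A, rfl, rfl⟩ := exists_sl_frame h
    exact ⟨A, (range_smul_axis A).symm, rfl, rfl⟩

/-- The form of a point of a geodesic, in terms of the ends. -/
lemma hform_of_mem_geod (hab : a ≠ b) (hz : z ∈ geod a b) :
    ∃ s t : ℝ, 0 < s ∧ 0 < t ∧ ∀ v w, hform z v w =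
      s * (vdet v a.rep * vdet w a.rep) + t * (vdet v b.rep * vdet w b.rep) := by
  have hd : vdet a.rep b.rep ≠ 0 := fun h' => hab ((eq_iff_vdet a b).mpr h')
  have hd2 : 0 < vdet a.rep b.rep ^ 2 := by positivity
  refine ⟨hform z b.rep b.rep / vdet a.rep b.rep ^ 2, hform z a.rep a.rep / vdet a.rep b.rep ^ 2,
    div_pos (hform_self_pos z b.rep_nonzero) hd2, div_pos (hform_self_pos z a.rep_nonzero) hd2,
    fun v w => ?_⟩
  have h := hform_expand_two z a.rep b.rep v w; have hz' : hform z a.rep b.rep = 0 := hz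
  rw [hz'] at h; field_simp; linear_combination h

lemma geod_nonempty (hab : a ≠ b) : (geod a b).Nonempty := by
  obtain ⟨A, rfl, rfl⟩ := exists_sl_frame hab
  exact ⟨A • I, by
    rw [smul_mem_geod, mem_geod_zero_infty]; exact UpperHalfPlane.I_re⟩

/-- Two geodesics with a common point cross, or are equal. -/
lemma link_or_eq_of_mem_geod (hce : c ≠ e) (h1 : z ∈ geod a b) (h2 : z ∈ geod c e) :
    Link a b c e ∨ (a = c ∧ b = e) ∨ (a = e ∧ b = c) := by
  obtain ⟨s, t, hs, ht, h⟩ := hform_of_mem_geod hce h2; have h0 : hform z a.rep b.rep = 0 := h1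
  rw [h] at h0; by_cases hac : vdet a.rep c.rep * vdet b.rep c.rep = 0
  · right; rw [hac, mul_zero, zero_add] at h0; have hae := (mul_eq_zero.mp h0).resolve_left ht.ne'
    rcases mul_eq_zero.mp hac with h3 | h3 <;> rcases mul_eq_zero.mp hae with h4 | h4
    exacts [absurd (((eq_iff_vdet a c).mpr h3).symm.trans ((eq_iff_vdet a e).mpr h4)) hce,
      Or.inl ⟨(eq_iff_vdet a c).mpr h3, (eq_iff_vdet b e).mpr h4⟩,
      Or.inr ⟨(eq_iff_vdet a e).mpr h4, (eq_iff_vdet b c).mpr h3⟩,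
      absurd (((eq_iff_vdet b c).mpr h3).symm.trans ((eq_iff_vdet b e).mpr h4)) hce]
  · left; unfold Link; set p := vdet a.rep c.rep * vdet b.rep c.rep
    set q := vdet a.rep e.rep * vdet b.rep e.rep; have hp : 0 < p ^ 2 := by positivity
    have : q = -(s / t) * p := by field_simp; linarith
    rw [this]; have : 0 < s / t := div_pos hs ht; nlinarith

/-- Geodesics with linked ends cross. -/
lemma exists_mem_geod_of_link (h : Link a b c e) :
    ∃ z, z ∈ geod a b ∧ z ∈ geod c e := by
  obtain ⟨A, rfl, rfl⟩ := exists_sl_frame h.ne_left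
  obtain ⟨c', rfl⟩ : ∃ c', A • c' = c := ⟨A⁻¹ • c, smul_inv_smul A c⟩
  obtain ⟨e', rfl⟩ : ∃ e', A • e' = e := ⟨A⁻¹ • e, smul_inv_smul A e⟩
  rw [link_smul] at h
  obtain ⟨x, rfl⟩ := exists_ofReal h.ne23.symm
  obtain ⟨y, rfl⟩ := exists_ofReal h.ne24.symm
  replace h := h.symm_left
  rw [zero_eq, link_infty] at h
  have hxy : 0 < -(x * y) := by nlinarith
  refine ⟨A • conePt 1 0 (-(x * y)), ?_, ?_⟩
  · rw [smul_mem_geod, zero, infty, mem_geod_mk,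
      hform_conePt one_pos (by nlinarith)]
    simp
  · rw [smul_mem_geod, ofReal, ofReal, mem_geod_mk,
      hform_conePt one_pos (by nlinarith)]
    simp

lemma geod_inj (hab : a ≠ b) (hce : c ≠ e) (h : geod a b = geod c e) :
    (a = c ∧ b = e) ∨ (a = e ∧ b = c) := by
  obtain ⟨z, hz⟩ := geod_nonempty hab; rcases link_or_eq_of_mem_geod hce hz (h ▸ hz) with hl | h'
  · exfalso; obtain ⟨A, rfl, rfl⟩ := exists_sl_frame hab
    have h1 : ∀ s : ℝ, A • H2.axis s ∈ geod c e := fun s => by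
      rw [← h, ← range_smul_axis]; exact ⟨s, rfl⟩
    obtain ⟨c', rfl⟩ : ∃ c', A • c' = c := ⟨A⁻¹ • c, smul_inv_smul A c⟩
    obtain ⟨e', rfl⟩ : ∃ e', A • e' = e := ⟨A⁻¹ • e, smul_inv_smul A e⟩; rw [link_smul] at hl
    obtain ⟨x, rfl⟩ := exists_ofReal hl.ne23.symm; obtain ⟨y, rfl⟩ := exists_ofReal hl.ne24.symm
    have key : ∀ s : ℝ, x * y + exp s ^ 2 = 0 := fun s => by
      have := h1 s; rw [smul_mem_geod, ofReal, ofReal, mem_geod_mk] at this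
      have hp := (exp_pos s).ne'; simpa [hform, H2.axis_re, H2.axis_im, hp] using this
    have h3 := key 0; have h4 := key (log 2); rw [Real.exp_zero] at h3
    rw [Real.exp_log two_pos] at h4; linarith
  · exact h'

/-! ### Matrix entries, traces and norms in `SL₂` -/

section Entries

variable {K : Type*} [Field K]

lemma sl_mul (g h : SL(2, K)) (i j : Fin 2) :
    (g * h) i j = g i 0 * h 0 j + g i 1 * h 1 j := by
  rw [Matrix.SpecialLinearGroup.coe_mul, Matrix.mul_apply, Fin.sum_univ_two]

lemma sl_inv_00 (g : SL(2, K)) : g⁻¹ 0 0 = g 1 1 := by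
  simp [Matrix.SpecialLinearGroup.coe_inv, Matrix.adjugate_fin_two]
lemma sl_inv_01 (g : SL(2, K)) : g⁻¹ 0 1 = -g 0 1 := by
  simp [Matrix.SpecialLinearGroup.coe_inv, Matrix.adjugate_fin_two]
lemma sl_inv_10 (g : SL(2, K)) : g⁻¹ 1 0 = -g 1 0 := by
  simp [Matrix.SpecialLinearGroup.coe_inv, Matrix.adjugate_fin_two]
lemma sl_inv_11 (g : SL(2, K)) : g⁻¹ 1 1 = g 0 0 := by
  simp [Matrix.SpecialLinearGroup.coe_inv, Matrix.adjugate_fin_two]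

lemma sl_neg_apply (g : SL(2, K)) (i j : Fin 2) : (-g) i j = -g i j := by
  rw [Matrix.SpecialLinearGroup.coe_neg]; rfl

lemma sl_one_zero_zero : (1 : SL(2, K)) 0 0 = 1 := by simp
lemma sl_one_zero_one : (1 : SL(2, K)) 0 1 = 0 := by simp
lemma sl_one_one_zero : (1 : SL(2, K)) 1 0 = 0 := by simp

lemma sl_ext {g h : SL(2, K)} (h00 : g 0 0 = h 0 0) (h01 : g 0 1 = h 0 1)
    (h10 : g 1 0 = h 1 0) (h11 : g 1 1 = h 1 1) : g = h := by
  ext i j; fin_cases i <;> fin_cases j <;> assumption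

lemma neg_sl_smul_proj (g : SL(2, K)) (x : ℙ K (Fin 2 → K)) : (-g) • x = g • x := by
  obtain ⟨s, hs, e1⟩ := exists_rep_smul g x; obtain ⟨t, ht, e2⟩ := exists_rep_smul (-g) x
  rw [eq_iff_vdet, e1, e2, vdet_smul_left, vdet_smul_right]
  simp only [vdet, sl_smul_0, sl_smul_1, sl_neg_apply]; ring

/-- The trace of an element of `SL₂`. -/
def sltr (g : SL(2, K)) : K := g 0 0 + g 1 1

lemma sltr_neg (g : SL(2, K)) : sltr (-g) = -sltr g := by simp only [sltr, sl_neg_apply]; ring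

lemma sltr_mul_comm (g h : SL(2, K)) : sltr (g * h) = sltr (h * g) := by
  simp only [sltr, sl_mul]; ring

lemma sltr_conj (m g : SL(2, K)) : sltr (m * g * m⁻¹) = sltr g := by
  rw [sltr_mul_comm, inv_mul_cancel_left]

end Entries

/-- The square of the Hilbert-Schmidt norm. -/
def frob (g : SL2R) : ℝ := g 0 0 ^ 2 + g 0 1 ^ 2 + g 1 0 ^ 2 + g 1 1 ^ 2

lemma frob_nonneg (g : SL2R) : 0 ≤ frob g := by unfold frob; positivity

lemma frob_inv (g : SL2R) : frob g⁻¹ = frob g := by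
  simp only [frob, sl_inv_00, sl_inv_01, sl_inv_10, sl_inv_11]; ring

lemma frob_mul_le (g h : SL2R) : frob (g * h) ≤ frob g * frob h := by
  have e : frob g * frob h - frob (g * h) =
      (g 0 0 * h 1 0 - g 0 1 * h 0 0) ^ 2 + (g 0 0 * h 1 1 - g 0 1 * h 0 1) ^ 2 +
      (g 1 0 * h 1 0 - g 1 1 * h 0 0) ^ 2 + (g 1 0 * h 1 1 - g 1 1 * h 0 1) ^ 2 := by
    simp only [frob, sl_mul]; ring
  have : 0 ≤ frob g * frob h - frob (g * h) := by rw [e]; positivity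
  linarith

lemma frob_conj_le (m g : SL2R) : frob (m * g * m⁻¹) ≤ frob m ^ 2 * frob g := by
  have h1 := frob_mul_le (m * g) m⁻¹; have h2 := frob_mul_le m g; rw [frob_inv] at h1
  nlinarith [frob_nonneg m, mul_le_mul_of_nonneg_right h2 (frob_nonneg m)]

/-- The diagonal element of `SL₂(ℝ)` with upper left entry `l`. -/
def slDiag (l : ℝ) (h : l ≠ 0) : SL2R := slMk l 0 0 l⁻¹ (by field_simp; ring)

lemma slDiag_zero_zero (l : ℝ) (h) : slDiag l h 0 0 = l := rfl
lemma slDiag_zero_one (l : ℝ) (h) : slDiag l h 0 1 = 0 := rfl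
lemma slDiag_one_zero (l : ℝ) (h) : slDiag l h 1 0 = 0 := rfl
lemma slDiag_one_one (l : ℝ) (h) : slDiag l h 1 1 = l⁻¹ := rfl

lemma slDiag_apply (l : ℝ) (h) : slDiag l h 0 0 = l ∧ slDiag l h 0 1 = 0 ∧ slDiag l h 1 0 = 0 ∧
    slDiag l h 1 1 = l⁻¹ := ⟨rfl, rfl, rfl, rfl⟩

lemma slDiag_mul (l m : ℝ) (hl hm) :
    slDiag l hl * slDiag m hm = slDiag (l * m) (mul_ne_zero hl hm) := by
  refine sl_ext ?_ ?_ ?_ ?_ <;> simp [sl_mul, slDiag_apply, mul_comm]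

lemma slDiag_inv (l : ℝ) (hl) : (slDiag l hl)⁻¹ = slDiag l⁻¹ (inv_ne_zero hl) := by
  refine sl_ext ?_ ?_ ?_ ?_ <;>
    simp [sl_inv_00, sl_inv_01, sl_inv_10, sl_inv_11, slDiag_apply]

lemma slDiag_zpow (l : ℝ) (hl) (n : ℤ) : slDiag l hl ^ n = slDiag (l ^ n) (zpow_ne_zero n hl) := by
  have hnat : ∀ n : ℕ, slDiag l hl ^ n = slDiag (l ^ n) (pow_ne_zero n hl) := by
    intro n
    induction n with
    | zero => refine sl_ext ?_ ?_ ?_ ?_ <;> simp [slDiag_apply]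
    | succ n ih => rw [pow_succ, ih, slDiag_mul]; congr 1
  cases n with
  | ofNat n => simpa using hnat n
  | negSucc n =>
    rw [zpow_negSucc, hnat, slDiag_inv]; congr 1

lemma slDiag_smul_ofReal (l : ℝ) (hl) (t : ℝ) :
    slDiag l hl • ofReal t = ofReal (l ^ 2 * t) := by
  rw [sl_smul_ofReal (by simp [slDiag_apply, hl])]; rw [BdH2.ofReal_inj]; simp [slDiag_apply]; ring

lemma slDiag_smul_infty (l : ℝ) (hl) : slDiag l hl • infty = infty := sl_smul_infty_iff.mpr rfl

lemma slDiag_smul_zero (l : ℝ) (hl) : slDiag l hl • zero = zero :=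
  sl_smul_zero_iff.mpr rfl

lemma eq_slDiag (h0 : g • zero = zero)
    (h1 : g • infty = infty) : ∃ l, ∃ hl : l ≠ 0, g = slDiag l hl := by
  rw [sl_smul_zero_iff] at h0; rw [sl_smul_infty_iff] at h1; have hd := sl_det g
  rw [h0, zero_mul, sub_zero] at hd
  exact ⟨_, left_ne_zero_of_mul_eq_one hd, sl_ext rfl h0 h1 (eq_inv_of_mul_eq_one_right hd)⟩

lemma eq_conj_slDiag (hab : a ≠ b) (ha : g • a = a)
    (hb : g • b = b) : ∃ (M : SL2R) (l : ℝ) (hl : l ≠ 0), M • zero = a ∧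
      M • infty = b ∧ g = M * slDiag l hl * M⁻¹ := by
  obtain ⟨M, rfl, rfl⟩ := exists_sl_frame hab
  obtain ⟨l, hl, e⟩ := eq_slDiag (g := M⁻¹ * g * M) (by rw [mul_smul, mul_smul, ha, inv_smul_smul])
    (by rw [mul_smul, mul_smul, hb, inv_smul_smul])
  exact ⟨M, l, hl, rfl, rfl, by rw [← e]; group⟩

lemma slDiag_one : slDiag 1 one_ne_zero = 1 := by refine sl_ext ?_ ?_ ?_ ?_ <;> simp [slDiag_apply]

lemma slDiag_neg (l : ℝ) (hl) : -slDiag l hl = slDiag (-l) (neg_ne_zero.mpr hl) := by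
  refine sl_ext ?_ ?_ ?_ ?_ <;> simp only [sl_neg_apply] <;> simp [slDiag_apply, inv_neg]

lemma slDiag_ne {l : ℝ} (hl : l ≠ 0) (hl1 : 1 < l) : slDiag l hl ≠ 1 ∧ slDiag l hl ≠ -1 := by
  constructor <;> intro h <;> have := congrArg (fun x : SL2R => x 0 0) h <;>
    simp only [slDiag_zero_zero, sl_neg_apply, sl_one_zero_zero] at this <;> linarith

/-- A diagonal element with trace greater than `2` can be replaced by its inverse and its
negative, so that its upper left entry is greater than `1`. -/
lemma exists_slDiag_mem {H : Subgroup SL2R} (hneg : ∀ g ∈ H, -g ∈ H)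
    (hk : k ∈ H) (hk0 : k • zero = zero) (hk1 : k • infty = infty)
    (htr : 2 < |sltr k|) :
    ∃ l : ℝ, ∃ hl : l ≠ 0, 1 < l ∧ slDiag l hl ∈ H ∧ |sltr k| = l + l⁻¹ := by
  obtain ⟨l, hl, rfl⟩ := eq_slDiag hk0 hk1; clear hk0 hk1
  wlog h : 0 < l generalizing l
  · have := this (-l) (neg_ne_zero.mpr hl) (slDiag_neg l hl ▸ hneg _ hk)
      (by rwa [← slDiag_neg, sltr_neg, abs_neg])
      (neg_pos.mpr (lt_of_le_of_ne (not_lt.mp h) hl))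
    rwa [← slDiag_neg, sltr_neg, abs_neg] at this
  have e : |sltr (slDiag l hl)| = l + l⁻¹ := abs_of_pos (add_pos h (inv_pos.mpr h)); rw [e] at htr ⊢
  rcases lt_trichotomy l 1 with h1 | rfl | h1
  · exact ⟨l⁻¹, inv_ne_zero hl, (one_lt_inv₀ h).mpr h1, slDiag_inv l hl ▸ inv_mem hk,
      by rw [inv_inv, add_comm]⟩
  · norm_num at htr
  · exact ⟨l, hl, h1, hk, rfl⟩

/-- A hyperbolic element of `SL₂(ℝ)` has two fixed points at infinity. -/
lemma exists_fixed_of_two_lt (h : 2 < |sltr g|) :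
    ∃ a b : BdH2, a ≠ b ∧ g • a = a ∧ g • b = b := by
  have hd := sl_det g
  have ht : 4 < sltr g ^ 2 := by
    rw [← sq_abs]; nlinarith [abs_nonneg (sltr g)]
  by_cases hc : g 1 0 = 0
  · rw [hc, mul_zero, sub_zero] at hd
    have hne : g 1 1 - g 0 0 ≠ 0 := by
      intro h'
      have : g 1 1 = g 0 0 := by linarith
      simp only [sltr, this] at ht
      rw [this] at hd
      nlinarith
    have h11 : g 1 1 ≠ 0 := right_ne_zero_of_mul_eq_one hd
    refine ⟨ofReal (g 0 1 / (g 1 1 - g 0 0)), infty, ofReal_ne_infty _, ?_,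
      sl_smul_infty_iff.mpr hc⟩
    rw [sl_smul_ofReal (by rw [hc]; simpa using h11), BdH2.ofReal_inj, hc]
    field_simp
    ring
  · set Δ := √(sltr g ^ 2 - 4)
    have hΔ : 0 < Δ := sqrt_pos.mpr (by linarith)
    have hΔ2 : Δ ^ 2 = sltr g ^ 2 - 4 := sq_sqrt (by linarith)
    have fixed : ∀ t : ℝ, g 1 0 * t ^ 2 + (g 1 1 - g 0 0) * t - g 0 1 = 0 →
        g • ofReal t = ofReal t := by
      intro t ht'
      have hne : g 1 0 * t + g 1 1 ≠ 0 := by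
        intro h0
        have h1 : g 0 0 * t + g 0 1 = 0 := by linear_combination t * h0 - ht'
        have : (g 0 0 * g 1 1 - g 0 1 * g 1 0) = 0 := by
          linear_combination g 0 0 * h0 - g 1 0 * h1
        linarith
      rw [sl_smul_ofReal hne, BdH2.ofReal_inj, div_eq_iff hne]
      linear_combination (-1 : ℝ) * ht'
    refine ⟨ofReal ((g 0 0 - g 1 1 + Δ) / (2 * g 1 0)),
      ofReal ((g 0 0 - g 1 1 - Δ) / (2 * g 1 0)), ?_, fixed _ ?_, fixed _ ?_⟩
    · rw [Ne, BdH2.ofReal_inj, div_left_inj' (mul_ne_zero two_ne_zero hc)]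
      intro h'; linarith
    · field_simp
      simp only [sltr] at hΔ2
      linear_combination hΔ2 + 4 * hd
    · field_simp
      simp only [sltr] at hΔ2
      linear_combination hΔ2 + 4 * hd

lemma sl_conj_ne {M e : SL2R} (he : Commute e M) (h : g ≠ e) : M * g * M⁻¹ ≠ e := by
  intro h'; apply h; have : g = M⁻¹ * (M * g * M⁻¹) * M := by group
  rw [this, h', mul_assoc, he.eq]; group

lemma sl_conj_ne_one (M : SL2R) (h : g ≠ 1) : M * g * M⁻¹ ≠ 1 :=
  sl_conj_ne (Commute.one_left M) h

lemma sl_conj_ne_neg_one (M : SL2R) (h : g ≠ -1) : M * g * M⁻¹ ≠ -1 :=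
  sl_conj_ne (by simp [Commute, SemiconjBy]) h

/-! ### Surface groups -/

/-- The properties of the deck group of a closed hyperbolic surface that are used below:
it contains no elliptic elements, and it is discrete and co-compact in `SL₂(ℝ)`. It is
normalised to contain `-1`, which acts trivially. -/
structure IsSurfaceGroup (Γ : Subgroup SL2R) : Prop where
  neg_one_mem : -1 ∈ Γ
  two_le_trace : ∀ g ∈ Γ, 2 ≤ |sltr g|
  discrete : ∀ R : ℝ, {g | g ∈ Γ ∧ frob g ≤ R}.Finite
  cocompact : ∃ R : ℝ, ∀ m : SL2R, ∃ g ∈ Γ, frob (g * m) ≤ R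

/-- The subgroup `M⁻¹ Γ M`. -/
def conjSub (M : SL2R) (Γ : Subgroup SL2R) : Subgroup SL2R :=
  Γ.comap (MulAut.conj M).toMonoidHom

lemma mem_conjSub {M : SL2R} : g ∈ conjSub M Γ ↔ M * g * M⁻¹ ∈ Γ := Iff.rfl

lemma conj_mem_conjSub {M : SL2R} : M⁻¹ * g * M ∈ conjSub M Γ ↔ g ∈ Γ := by
  rw [mem_conjSub]; congr! 1
  group

lemma IsSurfaceGroup.conj (h : IsSurfaceGroup Γ) (M : SL2R) : IsSurfaceGroup (conjSub M Γ) where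
  neg_one_mem := by rw [mem_conjSub]; simpa using h.neg_one_mem
  two_le_trace g hg := by
    have := h.two_le_trace _ (mem_conjSub.mp hg); rwa [sltr_conj] at this
  discrete R := by
    refine ((h.discrete (frob M ^ 2 * R)).preimage
      (f := fun g => M * g * M⁻¹) (fun a _ b _ hab => by simpa using hab)).subset ?_
    rintro g ⟨hg, hR⟩
    exact ⟨hg, (frob_conj_le M g).trans (mul_le_mul_of_nonneg_left hR (sq_nonneg _))⟩
  cocompact := by
    obtain ⟨R, hR⟩ := h.cocompact; refine ⟨frob M * R, fun m => ?_⟩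
    obtain ⟨g, hg, hgR⟩ := hR (M * m); refine ⟨M⁻¹ * g * M, conj_mem_conjSub.mpr hg, ?_⟩
    rw [mul_assoc, mul_assoc M⁻¹]; refine (frob_mul_le _ _).trans ?_; rw [frob_inv]
    exact mul_le_mul_of_nonneg_left hgR (frob_nonneg _)

lemma Set.Finite.exists_pos_le {S : Set ℝ} (hS : S.Finite) : ∃ δ > 0, ∀ x ∈ S, 0 < x → δ ≤ x := by
  by_cases h : (S ∩ Set.Ioi 0).Nonempty
  · obtain ⟨m, hm, hmin⟩ := Set.exists_min_image _ id (hS.inter_of_left _) h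
    exact ⟨m, hm.2, fun x hx h0 => hmin x ⟨hx, h0⟩⟩
  · exact ⟨1, one_pos, fun x hx h0 => absurd ⟨x, hx, h0⟩ h⟩

namespace IsSurfaceGroup

variable {Γ : Subgroup SL2R} (hΓ : IsSurfaceGroup Γ)
include hΓ

lemma neg_mem (hg : g ∈ Γ) : -g ∈ Γ := by
  have := mul_mem hΓ.neg_one_mem hg; rwa [neg_mul, one_mul] at this

lemma exists_frob_le : ∃ R : ℝ, 0 ≤ R ∧ ∀ m : SL2R, ∃ g ∈ Γ, frob (g * m) ≤ R :=
  let ⟨R, hR⟩ := hΓ.cocompact; let ⟨_, _, hg⟩ := hR 1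
  ⟨R, (frob_nonneg _).trans hg, hR⟩

lemma unipotent_eq {t : ℝ} (h : slMk 1 t 0 1 (by ring) ∈ Γ) : t = 0 := by
  by_contra ht; obtain ⟨R, hR0, hR⟩ := hΓ.exists_frob_le
  obtain ⟨δ, hδ, hmin⟩ := ((hΓ.discrete (R ^ 2 * (2 + t ^ 2))).image
    fun k : SL2R => |k 0 1 - k 1 0|).exists_pos_le
  obtain ⟨n, hn⟩ := exists_nat_gt (|t| * R / δ + 1)
  have hn1 : (1 : ℝ) < n := lt_of_le_of_lt (le_add_of_nonneg_left (by positivity)) hn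
  have hn0 : (n : ℝ) ≠ 0 := by linarith
  obtain ⟨g, hg, hgR⟩ := hR (slDiag n hn0)
  -- conjugation by `g` moves the unipotent element close to the identity
  have hk : g * slMk 1 t 0 1 (by ring) * g⁻¹ = (g * slDiag n hn0) * slMk 1 (t / n ^ 2) 0 1 (by ring) *
      (g * slDiag n hn0)⁻¹ := by
    have : slDiag n hn0 * slMk 1 (t / n ^ 2) 0 1 (by ring) * (slDiag n hn0)⁻¹ =
        slMk 1 t 0 1 (by ring) := by
      rw [mul_inv_eq_iff_eq_mul]; refine sl_ext ?_ ?_ ?_ ?_ <;> simp [sl_mul, slDiag_apply]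
      field_simp
    rw [← this]; simp only [mul_inv_rev, mul_assoc]
  have hmem := hk ▸ mul_mem (mul_mem hg h) (inv_mem hg)
  generalize g * slDiag n hn0 = X at *
  have hsq : (t / n ^ 2) ^ 2 ≤ t ^ 2 := by
    rw [div_pow]; exact div_le_self (sq_nonneg t) (one_le_pow₀ (one_le_pow₀ hn1.le))
  have hfr : frob (X * slMk 1 (t / n ^ 2) 0 1 (by ring) * X⁻¹) ≤ R ^ 2 * (2 + t ^ 2) := by
    refine (frob_conj_le _ _).trans
      (mul_le_mul (pow_le_pow_left₀ (frob_nonneg _) hgR 2) ?_ (frob_nonneg _) (sq_nonneg _))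
    simp only [frob, slMk_zero_zero, slMk_zero_one, slMk_one_zero, slMk_one_one]; linarith
  have e : (X * slMk 1 (t / n ^ 2) 0 1 (by ring) * X⁻¹) 0 1 -
      (X * slMk 1 (t / n ^ 2) 0 1 (by ring) * X⁻¹) 1 0 = t / n ^ 2 * (X 0 0 ^ 2 + X 1 0 ^ 2) := by
    simp only [sl_mul, sl_inv_01, sl_inv_11, sl_inv_00, sl_inv_10,
      slMk_zero_zero, slMk_zero_one, slMk_one_zero, slMk_one_one]
    ring
  have hX : 0 < X 0 0 ^ 2 + X 1 0 ^ 2 := by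
    refine pos_of_mul_pos_left (b := X 0 1 ^ 2 + X 1 1 ^ 2) ?_ (by positivity)
    have : (X 0 0 ^ 2 + X 1 0 ^ 2) * (X 0 1 ^ 2 + X 1 1 ^ 2) =
        1 + (X 0 0 * X 0 1 + X 1 0 * X 1 1) ^ 2 := by
      linear_combination (X 0 0 * X 1 1 - X 0 1 * X 1 0 + 1) * sl_det X
    rw [this]; positivity
  have hle := hmin _ ⟨_, ⟨hmem, hfr⟩, congrArg abs e⟩ (by positivity)
  rw [abs_mul, abs_div, abs_of_pos hX, abs_of_nonneg (sq_nonneg (n : ℝ)), div_mul_eq_mul_div,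
    le_div_iff₀ (by positivity)] at hle
  have hXR : X 0 0 ^ 2 + X 1 0 ^ 2 ≤ R := by
    unfold frob at hgR; nlinarith [sq_nonneg (X 0 1), sq_nonneg (X 1 1)]
  have h4 : |t| * R < δ * n := by
    have : |t| * R / δ < n := by linarith
    rw [div_lt_iff₀ hδ] at this; linarith
  nlinarith [mul_le_mul_of_nonneg_left hXR (abs_nonneg t), mul_pos hδ (sub_pos.mpr hn1)]

lemma two_lt_trace (hg : g ∈ Γ) (h1 : g ≠ 1) (h2 : g ≠ -1) : 2 < |sltr g| := by
  refine lt_of_le_of_ne (hΓ.two_le_trace g hg) fun h => ?_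
  wlog ht : sltr g = 2 generalizing g
  · refine this (hΓ.neg_mem hg) (fun h' => h2 (by rw [← h', neg_neg])) (fun h' => h1 (neg_injective h'))
      (by rwa [sltr_neg, abs_neg]) ?_
    rw [sltr_neg]
    rcases abs_cases (sltr g) with h' | h' <;> [exact absurd (h'.1.symm.trans h.symm) ht; linarith]
  have hd := sl_det g
  -- a parabolic element has a fixed point, which is moved to infinity
  obtain ⟨M, hM⟩ : ∃ M : SL2R, (M⁻¹ * g * M) 1 0 = 0 := by
    by_cases hc : g 1 0 = 0
    · exact ⟨1, by simpa using hc⟩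
    · refine ⟨slMk ((g 0 0 - g 1 1) / (2 * g 1 0)) (-1) 1 0 (by ring), ?_⟩
      simp only [sl_mul, sl_inv_10, sl_inv_11, slMk_zero_zero, slMk_one_zero]
      simp only [sltr] at ht; field_simp; linear_combination (-(g 0 0 + g 1 1) - 2) * ht + 4 * hd
  have hmem := (conj_mem_conjSub (M := M)).mpr hg
  have htr : sltr (M⁻¹ * g * M) = 2 := by
    have := sltr_conj M⁻¹ g; rw [inv_inv] at this; rw [this, ht]
  set k := M⁻¹ * g * M with hk; have hd' := sl_det k; simp only [sltr] at htr
  rw [hM, mul_zero, sub_zero] at hd'; have e0 : k 0 0 = 1 := by nlinarith [sq_nonneg (k 0 0 - 1)]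
  have e1 : k 1 1 = 1 := by linarith
  have ek : k = slMk 1 (k 0 1) 0 1 (by ring) := sl_ext e0 rfl hM e1
  have h0 := (hΓ.conj M).unipotent_eq (t := k 0 1) (ek ▸ hmem)
  have : k = 1 := sl_ext (by simpa using e0) (by simpa using h0) (by simpa using hM)
    (by simpa using e1)
  apply h1; rw [hk] at this; have h3 : g = M * (M⁻¹ * g * M) * M⁻¹ := by group
  rw [h3, this]; group

lemma exists_fixed (hg : g ∈ Γ) (h1 : g ≠ 1) (h2 : g ≠ -1) :
    ∃ a b : BdH2, a ≠ b ∧ g • a = a ∧ g • b = b :=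
  exists_fixed_of_two_lt (hΓ.two_lt_trace hg h1 h2)

/-- A function attains its minimum on a set of matrices if every element of the set can be replaced
by an element of a surface group with the same value, and with entries bounded by the value. -/
lemma exists_min {S : Set SL2R} (f : SL2R → ℝ) (hne : S.Nonempty)
    (hf : ∀ B, ∃ R, ∀ g ∈ S, f g ≤ B → ∃ g' ∈ Γ, f g' = f g ∧ frob g' ≤ R) :
    ∃ g ∈ S, ∀ g' ∈ S, f g ≤ f g' := by
  obtain ⟨g0, h0⟩ := hne; obtain ⟨R, hR⟩ := hf (f g0)
  have hfin : (f '' {g | g ∈ S ∧ f g ≤ f g0}).Finite :=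
    ((hΓ.discrete R).image f).subset fun _ ⟨g, hg, e⟩ => let ⟨g', h1, h2, h3⟩ := hR g hg.1 hg.2
      ⟨g', ⟨h1, h3⟩, h2.trans e⟩
  obtain ⟨_, ⟨g, hg, rfl⟩, hmin⟩ := Set.exists_min_image _ id hfin ⟨_, g0, ⟨h0, le_rfl⟩, rfl⟩
  exact ⟨g, hg.1, fun g' hg' => (le_total (f g') (f g0)).elim
    (fun h => hmin _ ⟨g', ⟨hg', h⟩, rfl⟩) hg.2.trans⟩

/-- Every set of non-trivial elements of a surface group has an element of minimal translation
length. -/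
lemma exists_min_trace {S : Set SL2R} (hS : ∀ g ∈ S, g ∈ Γ ∧ g ≠ 1 ∧ g ≠ -1)
    (hne : S.Nonempty) : ∃ g ∈ S, ∀ g' ∈ S, |sltr g| ≤ |sltr g'| := by
  obtain ⟨R, hR0, hR⟩ := hΓ.exists_frob_le
  refine hΓ.exists_min (fun g => |sltr g|) hne fun B => ⟨R ^ 2 * B ^ 2, fun g hg hB => ?_⟩
  obtain ⟨hgΓ, h1, h2⟩ := hS g hg; obtain ⟨a, b, hab, ha, hb⟩ := hΓ.exists_fixed hgΓ h1 h2
  obtain ⟨M, l, hl, rfl, rfl, rfl⟩ := eq_conj_slDiag hab ha hb; obtain ⟨h, hh, hhR⟩ := hR M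
  refine ⟨h * (M * slDiag l hl * M⁻¹) * h⁻¹, mul_mem (mul_mem hh hgΓ) (inv_mem hh),
    by simp only [sltr_conj], ?_⟩
  have e : h * (M * slDiag l hl * M⁻¹) * h⁻¹ = (h * M) * slDiag l hl * (h * M)⁻¹ := by group
  rw [sltr_conj] at hB; rw [e]
  refine (frob_conj_le _ _).trans
    (mul_le_mul (pow_le_pow_left₀ (frob_nonneg _) hhR 2) ?_ (frob_nonneg _) (sq_nonneg _))
  have := pow_le_pow_left₀ (abs_nonneg _) hB 2; rw [sq_abs] at this
  simp only [frob, sltr, slDiag_apply] at this ⊢; nlinarith [mul_inv_cancel₀ hl]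

/-- Elements of a surface group with a common fixed point have the same axis: otherwise their
commutator is parabolic. -/
lemma fixes_of_fixes (hg : g ∈ Γ) (hk : k ∈ Γ) (h1 : g ≠ 1) (h2 : g ≠ -1)
    (hab : a ≠ b) (ha : g • a = a) (hb : g • b = b) (hka : k • a = a) : k • b = b := by
  obtain ⟨M, l, hl, rfl, rfl, rfl⟩ := eq_conj_slDiag hab ha hb; have hΓ' := hΓ.conj M
  have hD := mem_conjSub.mpr hg; have hk' := (conj_mem_conjSub (M := M)).mpr hk
  rw [← inv_smul_eq_iff, smul_smul, smul_smul, sl_smul_zero_iff] at hka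
  rw [← inv_smul_eq_iff, smul_smul, smul_smul, sl_smul_infty_iff]
  generalize M⁻¹ * k * M = k at *; by_contra hq; have hdet := sl_det k
  rw [hka, zero_mul, sub_zero] at hdet
  have hc := mul_mem (mul_mem (mul_mem hk' hD) (inv_mem hk')) (inv_mem hD)
  have htr : sltr (k * slDiag l hl * k⁻¹ * (slDiag l hl)⁻¹) = 2 := by
    simp only [sltr, sl_mul, slDiag_apply, sl_inv_00, sl_inv_01,
      sl_inv_10, sl_inv_11, hka]
    linear_combination (2 * (l * l⁻¹)) * hdet + 2 * mul_inv_cancel₀ hl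
  have h10 : (k * slDiag l hl * k⁻¹ * (slDiag l hl)⁻¹) 1 0 = 0 := by
    by_contra hne
    have := hΓ'.two_lt_trace hc (fun h => hne (by rw [h, sl_one_one_zero]))
      (fun h => hne (by rw [h, sl_neg_apply, sl_one_one_zero, neg_zero]))
    norm_num [htr] at this
  simp only [sl_mul, slDiag_apply, sl_inv_00, sl_inv_01, sl_inv_10,
    sl_inv_11] at h10
  have hll : l * l = 1 := by
    have h11 := right_ne_zero_of_mul (hdet ▸ one_ne_zero); field_simp at h10
    have : k 1 0 * k 1 1 * (l * l - 1) = 0 := by linear_combination h10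
    exact sub_eq_zero.mp ((mul_eq_zero.mp this).resolve_left (mul_ne_zero hq h11))
  rcases mul_self_eq_one_iff.mp hll with rfl | rfl
  · exact h1 (by rw [slDiag_one]; group)
  · exact h2 (by rw [← slDiag_neg 1 one_ne_zero, slDiag_one]; simp)

/-- The ends of a closed geodesic are not exchanged. -/
lemma not_swap (hk : k ∈ Γ) (hab : a ≠ b) (h1 : k • a = b) (h2 : k • b = a) : False := by
  obtain ⟨M, rfl, rfl⟩ := exists_sl_frame hab; have hk' := (conj_mem_conjSub (M := M)).mpr hk
  have h3 : (M⁻¹ * k * M) • zero = infty := by rw [mul_smul, mul_smul, h1, inv_smul_smul]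
  have h4 : (M⁻¹ * k * M) • infty = zero := by rw [mul_smul, mul_smul, h2, inv_smul_smul]
  have ht := (hΓ.conj M).two_le_trace _ hk'
  generalize M⁻¹ * k * M = k at *
  have e1 : k 1 1 = 0 := by
    rw [zero, Projectivization.smul_mk, infty, mk_eq_iff] at h3
    simpa [vdet, sl_smul_0, sl_smul_1] using h3
  have e0 : k 0 0 = 0 := by
    rw [zero, infty, Projectivization.smul_mk, mk_eq_iff] at h4
    simpa [vdet, sl_smul_0, sl_smul_1] using h4
  simp [sltr, e0, e1] at ht; linarith

end IsSurfaceGroup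

/-! ### Stabilizers of closed geodesics -/

lemma eq_one_or_of_three (hab : a ≠ b) (hac : a ≠ c)
    (hbc : b ≠ c) (ha : g • a = a) (hb : g • b = b) (hc : g • c = c) : g = 1 ∨ g = -1 := by
  obtain ⟨M, l, hl, rfl, rfl, rfl⟩ := eq_conj_slDiag hab ha hb
  obtain ⟨t, ht⟩ := exists_ofReal (x := M⁻¹ • c) fun h => hbc (inv_smul_eq_iff.mp h).symm
  obtain rfl := inv_smul_eq_iff.mp ht; have h0 : t ≠ 0 := by rintro rfl; exact hac rfl
  rw [mul_smul, mul_smul, inv_smul_smul, slDiag_smul_ofReal, smul_left_cancel_iff,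
    BdH2.ofReal_inj] at hc
  rcases mul_self_eq_one_iff.mp (mul_right_cancel₀ h0 (by rw [← sq, hc, one_mul])) with rfl | rfl
  · left; rw [slDiag_one]; group
  · right; rw [← slDiag_neg 1 one_ne_zero, slDiag_one]; simp

lemma sl_smul_infty_zero (h0 : k 1 0 ≠ 0) (h1 : k 1 1 ≠ 0) :
    k • infty = ofReal (k 0 0 / k 1 0) ∧ k • zero = ofReal (k 0 1 / k 1 1) := by
  refine ⟨sl_smul_infty h0, ?_⟩; rw [zero_eq, sl_smul_ofReal (by simpa using h1)]; simp

lemma link_smul_zero_infty (k : SL2R) : Link zero infty (k • zero) (k • infty) ↔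
      k 0 0 * k 0 1 * k 1 0 * k 1 1 < 0 := by
  rw [zero, infty, Projectivization.smul_mk, Projectivization.smul_mk, link_mk_iff]
  simp only [vdet, sl_smul_0, sl_smul_1]; simp; ring_nf

namespace IsSurfaceGroup

variable {Γ : Subgroup SL2R} (hΓ : IsSurfaceGroup Γ)
include hΓ

/-- The stabilizer of a closed geodesic is cyclic up to sign. -/
lemma exists_generator_zero_infty (hg : g ∈ Γ) (h1 : g ≠ 1) (h2 : g ≠ -1)
    (h0 : g • zero = zero) (hi : g • infty = infty) :
    ∃ l : ℝ, ∃ hl : l ≠ 0, 1 < l ∧ slDiag l hl ∈ Γ ∧ ∀ k ∈ Γ, k • infty = infty →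
      ∃ n : ℤ, k = slDiag l hl ^ n ∨ k = -slDiag l hl ^ n := by
  have hfix : ∀ k ∈ Γ, k • infty = infty → k • zero = zero := fun k hk hki =>
    hΓ.fixes_of_fixes hg hk h1 h2 zero_ne_infty.symm hi h0 hki
  obtain ⟨m, ⟨hmΓ, hm1, hm2, hmi⟩, hmin⟩ := hΓ.exists_min_trace
    (S := {k | k ∈ Γ ∧ k ≠ 1 ∧ k ≠ -1 ∧ k • infty = infty})
    (fun k hk => ⟨hk.1, hk.2.1, hk.2.2.1⟩) ⟨g, hg, h1, h2, hi⟩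
  obtain ⟨l, hl, hl1, hlΓ, hltr⟩ := exists_slDiag_mem (fun _ => hΓ.neg_mem) hmΓ (hfix m hmΓ hmi) hmi
    (hΓ.two_lt_trace hmΓ hm1 hm2)
  refine ⟨l, hl, hl1, hlΓ, fun k hk hki => ?_⟩; obtain ⟨x, hx, rfl⟩ := eq_slDiag (hfix k hk hki) hki
  clear hki
  wlog hpos : 0 < x generalizing x
  · obtain ⟨n, hn⟩ := this (-x) (neg_ne_zero.mpr hx) (slDiag_neg x hx ▸ hΓ.neg_mem hk)
      (neg_pos.mpr (lt_of_le_of_ne (not_lt.mp hpos) hx))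
    rw [← slDiag_neg x hx] at hn
    exact ⟨n, hn.symm.imp neg_injective.eq_iff.mp neg_eq_iff_eq_neg.mp⟩
  obtain ⟨n, hn1, hn2⟩ := exists_mem_Ico_zpow hpos hl1
  have hln : 0 < l ^ n := zpow_pos (one_pos.trans hl1) n; rw [← one_le_div hln] at hn1
  rw [zpow_add_one₀ hl, mul_comm, ← div_lt_iff₀ hln] at hn2
  obtain ⟨r, er⟩ : ∃ r, x / l ^ n = r := ⟨_, rfl⟩; rw [er] at hn1 hn2
  have hr0 : 0 < r := one_pos.trans_le hn1
  have hmul : slDiag l hl ^ n * slDiag r hr0.ne' = slDiag x hx := by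
    rw [slDiag_zpow, slDiag_mul]; congr 1; rw [← er]; field_simp
  have hr := (mul_mem_cancel_left (zpow_mem hlΓ n)).mp (hmul ▸ hk); refine ⟨n, Or.inl ?_⟩
  rcases hn1.eq_or_lt with rfl | h
  · rw [← hmul, slDiag_one, mul_one]
  · have := hmin _ ⟨hr, (slDiag_ne _ h).1, (slDiag_ne _ h).2, slDiag_smul_infty _ _⟩
    rw [hltr, show sltr (slDiag r _) = r + r⁻¹ from rfl, abs_of_pos (by positivity)] at this
    have h4 : l + l⁻¹ - (r + r⁻¹) = (l - r) * (r * l - 1) / (r * l) := by field_simp; ring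
    have h5 : 0 < (l - r) * (r * l - 1) / (r * l) :=
      div_pos (mul_pos (by linarith) (by nlinarith)) (by positivity)
    linarith

lemma exists_generator (hg : g ∈ Γ) (h1 : g ≠ 1) (h2 : g ≠ -1)
    (hab : a ≠ b) (ha : g • a = a) (hb : g • b = b) :
    ∃ M : SL2R, ∃ l : ℝ, ∃ hl : l ≠ 0, M • zero = a ∧ M • infty = b ∧ 1 < l ∧
      M * slDiag l hl * M⁻¹ ∈ Γ ∧ ∀ k ∈ Γ, k • b = b →
      ∃ n : ℤ, k = (M * slDiag l hl * M⁻¹) ^ n ∨ k = -(M * slDiag l hl * M⁻¹) ^ n := by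
  obtain ⟨M, rfl, rfl⟩ := exists_sl_frame hab
  obtain ⟨l, hl, hl1, hlΓ, hgen⟩ := (hΓ.conj M).exists_generator_zero_infty (g := M⁻¹ * g * M)
    (conj_mem_conjSub.mpr hg) (by simpa using sl_conj_ne_one M⁻¹ h1)
    (by simpa using sl_conj_ne_neg_one M⁻¹ h2) (by rw [mul_smul, mul_smul, ha, inv_smul_smul])
    (by rw [mul_smul, mul_smul, hb, inv_smul_smul])
  refine ⟨M, l, hl, rfl, rfl, hl1, mem_conjSub.mp hlΓ, fun k hk hkb => ?_⟩
  obtain ⟨n, hn⟩ := hgen _ (conj_mem_conjSub.mpr hk) (by rw [mul_smul, mul_smul, hkb, inv_smul_smul])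
  have hk' : k = M * (M⁻¹ * k * M) * M⁻¹ := by group
  refine ⟨n, ?_⟩; rw [conj_zpow]; rcases hn with h | h
  · left; rw [hk', h]
  · right; rw [hk', h]; simp

/-- A closed geodesic is not mapped to a geodesic that starts where the first one ends. -/
lemma smul_ne_of_fixed (hg : g ∈ Γ) (h1 : g ≠ 1) (h2 : g ≠ -1) (hk : k ∈ Γ)
    (hab : a ≠ b) (ha : g • a = a) (hb : g • b = b) : k • a ≠ b := by
  intro h3; have hne : k • a ≠ k • b := fun h => hab (smul_left_cancel k h)
  have h4 := hΓ.fixes_of_fixes (mul_mem (mul_mem hk hg) (inv_mem hk)) hg (sl_conj_ne_one k h1)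
    (sl_conj_ne_neg_one k h2) hne (by rw [mul_smul, mul_smul, inv_smul_smul, ha])
    (by rw [mul_smul, mul_smul, inv_smul_smul, hb]) (by rw [h3, hb])
  by_cases h5 : k • b = a
  exacts [hΓ.not_swap hk hab h3 h5,
    (eq_one_or_of_three hab (Ne.symm h5) (h3 ▸ hne) ha hb h4).elim h1 h2]

/-- The translates of a closed geodesic have no common ends. -/
lemma fixes_of_common_end (hg : g ∈ Γ) (h1 : g ≠ 1) (h2 : g ≠ -1) (hk : k ∈ Γ)
    (hab : a ≠ b) (ha : g • a = a) (hb : g • b = b)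
    (h : k • a = a ∨ k • a = b ∨ k • b = a ∨ k • b = b) : k • a = a ∧ k • b = b := by
  rcases h with h | h | h | h
  exacts [⟨h, hΓ.fixes_of_fixes hg hk h1 h2 hab ha hb h⟩,
    absurd h (hΓ.smul_ne_of_fixed hg h1 h2 hk hab ha hb),
    absurd h (hΓ.smul_ne_of_fixed hg h1 h2 hk hab.symm hb ha),
    ⟨hΓ.fixes_of_fixes hg hk h1 h2 hab.symm hb ha h, h⟩]

lemma entries_ne_zero (hg : g ∈ Γ) (h1 : g ≠ 1) (h2 : g ≠ -1)
    (h0 : g • zero = zero) (hi : g • infty = infty) (hk : k ∈ Γ)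
    (hki : k • infty ≠ infty) : k 1 0 ≠ 0 ∧ k 1 1 ≠ 0 ∧ k 0 0 ≠ 0 ∧ k 0 1 ≠ 0 := by
  have key := mt (hΓ.fixes_of_common_end hg h1 h2 hk zero_ne_infty h0 hi) fun h => hki h.2
  push Not at key; have c0 : k 1 0 ≠ 0 := fun h' => hki (sl_smul_infty_iff.mpr h')
  refine ⟨c0, fun h => key.2.1 ?_, fun h => key.2.2.1 ?_, fun h => key.1 (sl_smul_zero_iff.mpr h)⟩
  · exact sl_smul_ofReal_eq_infty (by rw [h]; ring)
  · rw [sl_smul_infty c0, h, zero_div]; rfl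

/-- A group element moves the point `σ + s² i`, for small `s`, close to `i`; its inverse then moves
`i` to the side of `(0, ∞)` given by `σ`. -/
lemma exists_side_pos {σ : ℝ} (hσ : σ ^ 2 = 1) :
    ∃ k ∈ Γ, 0 < σ * (k 0 0 * k 1 0 + k 0 1 * k 1 1) := by
  obtain ⟨R, hR0, hR⟩ := hΓ.exists_frob_le
  obtain ⟨s, hs, hs1⟩ : ∃ s : ℝ, 0 < s ∧ R * s ^ 2 ≤ 1 :=
    ⟨(R + 1)⁻¹, by positivity, by field_simp; nlinarith⟩
  obtain ⟨h, hh, hr⟩ := hR (slMk s (σ / s) 0 (1 / s) (by field_simp; ring))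
  refine ⟨h⁻¹, inv_mem hh, ?_⟩; have hr' := (mul_le_mul_of_nonneg_right hr (sq_nonneg s)).trans hs1
  simp only [frob, sl_mul, slMk_zero_zero, slMk_zero_one, slMk_one_zero, slMk_one_one] at hr'
  simp only [sl_inv_00, sl_inv_01, sl_inv_10, sl_inv_11]
  have hd := sl_det h
  generalize h 0 0 = a at *
  generalize h 0 1 = b at *
  generalize h 1 0 = c at *
  generalize h 1 1 = d at *
  have e : ((a * s + b * 0) ^ 2 + (a * (σ / s) + b * (1 / s)) ^ 2 + (c * s + d * 0) ^ 2 +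
      (c * (σ / s) + d * (1 / s)) ^ 2) * s ^ 2 = s ^ 4 * (a ^ 2 + c ^ 2) + (a ^ 2 + c ^ 2) +
      (b ^ 2 + d ^ 2) - 2 * (σ * (d * -c + -b * a)) := by
    field_simp; linear_combination (a ^ 2 + c ^ 2) * hσ
  have : 0 ≤ s ^ 4 * (a ^ 2 + c ^ 2) := by positivity
  by_contra!
  nlinarith only [e, hr', this, hd, sq_nonneg (a - d), sq_nonneg (b + c), ‹0 ≤ s ^ 4 * _›]

/-- Each side of a simple closed geodesic contains a translate of the geodesic; here the geodesic
is `(0, ∞)`, and the side is given by the sign `σ`. -/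
lemma exists_translate_of_side (hg : g ∈ Γ) (h1 : g ≠ 1) (h2 : g ≠ -1)
    (h0 : g • zero = zero) (hi : g • infty = infty)
    (hs : ∀ k ∈ Γ, ¬Link zero infty (k • zero) (k • infty))
    {σ : ℝ} (hσ : σ ^ 2 = 1) :
    ∃ k ∈ Γ, ∃ p q : ℝ, 0 < σ * p ∧ 0 < σ * q ∧ k • zero = ofReal p ∧
      k • infty = ofReal q := by
  obtain ⟨k, hk, hcl⟩ := hΓ.exists_side_pos hσ
  obtain ⟨n10, n11, n00, n01⟩ := hΓ.entries_ne_zero hg h1 h2 h0 hi hk fun h => by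
    have h3 := hΓ.fixes_of_fixes hg hk h1 h2 zero_ne_infty.symm hi h0 h; rw [sl_smul_zero_iff] at h3
    rw [sl_smul_infty_iff] at h; simp [h, h3] at hcl
  obtain ⟨e1, e0⟩ := sl_smul_infty_zero n10 n11
  have hl := mt (link_smul_zero_infty k).mpr (hs k hk)
  have hp : 0 < (k 0 0 * k 1 0) * (k 0 1 * k 1 1) := lt_of_le_of_ne (by linarith) (by positivity)
  have key : ∀ u v : ℝ, 0 < u * v → 0 < σ * (u + v) → 0 < σ * u := fun u v h h' => by
    by_contra! hu; nlinarith [mul_nonneg (neg_nonneg.mpr hu) (show 0 ≤ σ * v by linarith)]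
  have frac : ∀ x y : ℝ, y ≠ 0 → 0 < σ * (x * y) → 0 < σ * (x / y) := fun x y hy h => by
    rw [show σ * (x / y) = σ * (x * y) / y ^ 2 by field_simp]; positivity
  exact ⟨k, hk, _, _, frac _ _ n11 (key _ _ (mul_comm (k 0 0 * k 1 0) _ ▸ hp) (by linarith)),
    frac _ _ n10 (key _ _ hp hcl), e0, e1⟩

end IsSurfaceGroup

/-! ### Complementary regions of families of disjoint geodesics -/

/-- The side of the geodesic `(a, b)` on which `z` lies: positive if it is the side of `c`. -/
def side (z : ℍ) (a b c : BdH2) : ℝ := hform z a.rep b.rep * (vdet a.rep c.rep * vdet b.rep c.rep)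

lemma side_comm (z : ℍ) (a b c : BdH2) : side z a b c = side z b a c := by
  rw [side, side, hform_comm z a.rep, mul_comm (vdet a.rep c.rep)]

lemma exists_side_smul (g : SL2R) (z : ℍ) (a b c : BdH2) :
    ∃ t : ℝ, 0 < t ∧ side (g • z) (g • a) (g • b) (g • c) = t * side z a b c := by
  obtain ⟨s, hs, ea⟩ := exists_rep_smul g a; obtain ⟨t, ht, eb⟩ := exists_rep_smul g b
  obtain ⟨u, hu, ec⟩ := exists_rep_smul g c; refine ⟨(s * t * u) ^ 2, by positivity, ?_⟩
  simp only [side, ea, eb, ec, hform_smul_left, hform_smul_right, vdet_smul_left, vdet_smul_right,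
    hform_sl_smul, vdet_sl_smul]
  ring

lemma side_smul_nonneg (g : SL2R) (z : ℍ) (a b c : BdH2) :
    0 ≤ side (g • z) (g • a) (g • b) (g • c) ↔ 0 ≤ side z a b c := by
  obtain ⟨t, ht, e⟩ := exists_side_smul g z a b c; rw [e, mul_nonneg_iff_of_pos_left ht]

lemma side_smul_pos (g : SL2R) (z : ℍ) (a b c : BdH2) :
    0 < side (g • z) (g • a) (g • b) (g • c) ↔ 0 < side z a b c := by
  obtain ⟨t, ht, e⟩ := exists_side_smul g z a b c; rw [e, mul_pos_iff_of_pos_left ht]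

lemma side_eq_zero_iff (hac : a ≠ c) (hbc : b ≠ c) : side z a b c = 0 ↔ z ∈ geod a b := by
  simp [side, geod, vdet_ne hac, vdet_ne hbc]

/-- The union of a family of geodesics, given by their pairs of ends. -/
def leaves (F : Rel) : Set ℍ := {z | ∃ a b, F a b ∧ z ∈ geod a b}

/-- A symmetric family of pairs of ends of pairwise disjoint geodesics with closed union. -/
structure IsGeodFamily (F : Rel) : Prop where
  ne : ∀ {a b}, F a b → a ≠ b
  symm : ∀ {a b}, F a b → F b a
  unlinked : ∀ {a b c e}, F a b → F c e → ¬Link a b c e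
  isClosed : IsClosed (leaves F)

/-- The points of `ℍ` on the same side of each geodesic of the family as `o`. -/
def plaque (F : Rel) (o : ℍ) : Set ℍ :=
  {z | ∀ a b, F a b → 0 < hform o a.rep b.rep * hform z a.rep b.rep}

/-- The points at infinity that no geodesic of the family separates from `o`. -/
def pEnds (F : Rel) (o : ℍ) : Set BdH2 :=
  {c | ∀ a b, F a b → 0 ≤ side o a b c}

lemma mul_pos_trans {x y z : ℝ} (h : 0 < x * y) (h' : 0 < y * z) : 0 < x * z :=
  pos_of_mul_pos_right (a := y ^ 2) (by linarith [mul_pos h h']) (sq_nonneg y)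

section Plaque

variable {F : Rel} {o : ℍ}

lemma hform_ne_zero (h : o ∉ leaves F) (hab : F a b) :
    hform o a.rep b.rep ≠ 0 := fun h' => h ⟨a, b, hab, h'⟩

lemma mem_plaque_self (h : o ∉ leaves F) : o ∈ plaque F o := fun _ _ hab =>
  mul_self_pos.mpr (hform_ne_zero h hab)

lemma notMem_of_mem_plaque (hz : z ∈ plaque F o) : z ∉ leaves F :=
  fun ⟨a, b, hab, h⟩ => (hz a b hab).ne' (mul_eq_zero_of_right _ h)

lemma mem_plaque_comm : z ∈ plaque F o ↔ o ∈ plaque F z := by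
  simp only [plaque, Set.mem_ofPred_eq, mul_comm]

lemma plaque_eq_of_mem (hz : z ∈ plaque F o) : plaque F z = plaque F o :=
  Set.ext fun _ => ⟨fun hw a b hab => mul_pos_trans (hz a b hab) (hw a b hab),
    fun hw a b hab => mul_pos_trans (mem_plaque_comm.mp hz a b hab) (hw a b hab)⟩

lemma pEnds_eq_of_mem (hz : z ∈ plaque F o) : pEnds F z = pEnds F o := by
  have key : ∀ {z w : ℍ}, z ∈ plaque F w → pEnds F z ⊆ pEnds F w := by
    intro z w hz c hc a b hab; have h1 := hz a b hab; have h2 := hc a b hab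
    unfold side at *
    refine nonneg_of_mul_nonneg_right (b := _) (a := hform z a.rep b.rep ^ 2) ?_
      (by have := right_ne_zero_of_mul h1.ne'; positivity)
    linarith [mul_nonneg h1.le h2]
  exact Set.Subset.antisymm (key hz) (key (mem_plaque_comm.mp hz))

/-- The sum of the form of `z` and of `τ` times the form with the coefficients `A, B, C`,
normalised. -/
def pencil (z : ℍ) (A B C τ : ℝ) : ℍ :=
  conePt (hform z ![1, 0] ![1, 0] + τ * A) (hform z ![1, 0] ![0, 1] + τ * B)
    (hform z ![0, 1] ![0, 1] + τ * C)

section Pencil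

variable (z : ℍ) {A B C τ : ℝ} (hQ : ∀ x y, 0 ≤ A * x ^ 2 + 2 * B * (x * y) + C * y ^ 2)
  (hdet : B ^ 2 ≤ A * C)
include hQ hdet

lemma pencil_aux (hτ : 0 ≤ τ) : 0 < hform z ![1, 0] ![1, 0] + τ * A ∧
    0 < (hform z ![1, 0] ![1, 0] + τ * A) * (hform z ![0, 1] ![0, 1] + τ * C) -
      (hform z ![1, 0] ![0, 1] + τ * B) ^ 2 := by
  have hz := z.im_pos; have hA := hQ 1 0; have hA' := hQ 0 1
  have e : (hform z ![1, 0] ![1, 0] + τ * A) * (hform z ![0, 1] ![0, 1] + τ * C) -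
      (hform z ![1, 0] ![0, 1] + τ * B) ^ 2 = 1 + τ * ((A * z.re ^ 2 + 2 * B * (z.re * 1) + C * 1 ^ 2) +
        A * z.im ^ 2) / z.im + τ ^ 2 * (A * C - B ^ 2) := by
    simp [hform]; field_simp; ring
  have h1 := hQ z.re 1
  simp only [one_pow, mul_one, ne_eq, OfNat.ofNat_ne_zero, not_false_eq_true, zero_pow, mul_zero,
    add_zero] at hA
  rw [e]; have h2 := sub_nonneg.mpr hdet; refine ⟨?_, by positivity⟩; simp [hform]; positivity

lemma hform_pencil (hτ : 0 ≤ τ) : ∃ s : ℝ, 0 < s ∧ ∀ v w, hform (pencil z A B C τ) v w =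
    s * (hform z v w + τ * (A * (v 0 * w 0) + B * (v 0 * w 1 + v 1 * w 0) + C * (v 1 * w 1))) := by
  obtain ⟨h1, h2⟩ := pencil_aux z hQ hdet hτ
  refine ⟨_, inv_pos.mpr (sqrt_pos.mpr h2), fun v w => ?_⟩
  rw [pencil, hform_conePt h1 h2, div_eq_inv_mul]; congr 1; simp [hform]; ring

lemma continuousOn_pencil : ContinuousOn (pencil z A B C) (Set.Ici 0) :=
  continuousOn_conePt.comp (f := fun τ : ℝ => (hform z ![1, 0] ![1, 0] + τ * A,
    hform z ![1, 0] ![0, 1] + τ * B, hform z ![0, 1] ![0, 1] + τ * C)) (s := Set.Ici 0)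
    (by fun_prop) fun _ hτ => pencil_aux z hQ hdet hτ

end Pencil

lemma hform_eq_of_proportional {s : ℝ} (hs : 0 < s)
    (h : ∀ u v, hform z u v = s * hform w u v) : z = w := by
  have h1 := hform_gram z ![1, 0] ![0, 1]; have h2 := hform_gram w ![1, 0] ![0, 1]
  rw [show vdet (![1, 0] : Fin 2 → ℝ) ![0, 1] = 1 by simp [vdet]] at h1 h2; simp only [h] at h1
  have : s = 1 := (pow_eq_one_iff_of_nonneg hs.le two_ne_zero).mp
    (by linear_combination h1 - s ^ 2 * h2)
  exact hform_ext fun v w => by rw [h, this, one_mul]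

lemma pencil_zero (z : ℍ) (A B C : ℝ) : pencil z A B C 0 = z := by
  obtain ⟨s, hs, h⟩ := hform_pencil (τ := 0) z (A := 0) (B := 0) (C := 0) (by simp) (by simp) le_rfl
  refine hform_eq_of_proportional hs fun u v => ?_; simpa [pencil] using h u v

/-- The ray from `o` to the point `[c]` at infinity: its points have the form of `o` plus `τ`
times the square of the form `v ↦ det (v, c)`, up to a factor. -/
def rayPt (o : ℍ) (c : Fin 2 → ℝ) : ℝ → ℍ := pencil o (c 1 ^ 2) (-(c 0 * c 1)) (c 0 ^ 2)

lemma hform_rayPt (o : ℍ) (c : Fin 2 → ℝ) {τ : ℝ} (hτ : 0 ≤ τ) :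
    ∃ s : ℝ, 0 < s ∧ ∀ v w, hform (rayPt o c τ) v w =
      s * (hform o v w + τ * (vdet v c * vdet w c)) := by
  obtain ⟨s, hs, h⟩ := hform_pencil o (A := c 1 ^ 2) (B := -(c 0 * c 1)) (C := c 0 ^ 2)
    (fun x y => by nlinarith only [sq_nonneg (c 1 * x - c 0 * y)]) (by nlinarith) hτ
  exact ⟨s, hs, fun v w => by rw [rayPt, h]; simp only [vdet]; ring⟩

lemma continuousOn_rayPt (o : ℍ) (c : Fin 2 → ℝ) : ContinuousOn (rayPt o c) (Set.Ici 0) :=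
  continuousOn_pencil o (fun x y => by nlinarith only [sq_nonneg (c 1 * x - c 0 * y)])
    (by nlinarith)

/-- A point at infinity outside of the closure of a plaque is separated from it by a geodesic in
the frontier of the plaque: the first one that a ray from `o` to the point meets. -/
lemma exists_separating_leaf (hF : IsGeodFamily F) (h0 : o ∉ leaves F)
    (hc : c ∉ pEnds F o) :
    ∃ a ∈ pEnds F o, ∃ b ∈ pEnds F o, F a b ∧ side o a b c < 0 := by
  set S : Set ℝ := {τ | τ ∈ Set.Ici 0 ∧ rayPt o c.rep τ ∈ leaves F} with hS
  have hScl : IsClosed S :=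
    (continuousOn_rayPt o c.rep).preimage_isClosed_of_isClosed isClosed_Ici hF.isClosed
  have hbdd : BddBelow S := ⟨0, fun τ hτ => hτ.1⟩
  have cross : ∀ e f, F e f → side o e f c < 0 →
      -hform o e.rep f.rep / (vdet e.rep c.rep * vdet f.rep c.rep) ∈ S := by
    intro e f hef hlt; unfold side at hlt; have hd := right_ne_zero_of_mul hlt.ne
    have hτ : 0 ≤ -hform o e.rep f.rep / (vdet e.rep c.rep * vdet f.rep c.rep) := by
      generalize vdet e.rep c.rep * vdet f.rep c.rep = d at *
      rw [show -hform o e.rep f.rep / d = -(hform o e.rep f.rep * d) / d ^ 2 by field_simp]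
      exact div_nonneg (by linarith) (sq_nonneg d)
    obtain ⟨s, hs, h1⟩ := hform_rayPt o c.rep hτ; refine ⟨hτ, e, f, hef, (h1 _ _).trans ?_⟩
    rw [div_mul_cancel₀ _ hd]; ring
  have hex : ∀ {x}, x ∉ pEnds F o → ∃ e f, F e f ∧ side o e f x < 0 := fun h => by
    simpa [pEnds] using h
  obtain ⟨e, f, hef, hlt⟩ := hex hc
  obtain ⟨hτ0, a, b, hab, hz⟩ := hScl.csInf_mem ⟨_, cross e f hef hlt⟩ hbdd
  have hmin : ∀ τ ∈ S, sInf S ≤ τ := fun τ hτ => csInf_le hbdd hτ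
  generalize sInf S = t at *
  replace hτ0 : 0 ≤ t := hτ0
  obtain ⟨s, hs, h1⟩ := hform_rayPt o c.rep hτ0
  have hsep : side o a b c < 0 := by
    have h2 := (mul_eq_zero.mp ((h1 _ _).symm.trans hz)).resolve_left hs.ne'
    have := mul_self_pos.mpr (hform_ne_zero h0 hab); unfold side; by_contra! h'
    linarith [mul_nonneg hτ0 h', congrArg (hform o a.rep b.rep * ·) h2]
  have key : ∀ x y : BdH2, F x y → rayPt o c.rep t ∈ geod x y → x ∈ pEnds F o := by
    intro x y hxy hzxy; by_contra hx; obtain ⟨e, f, hef, hlt⟩ := hex hx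
    obtain ⟨s', t', hs', ht', h2⟩ := hform_of_mem_geod (hF.ne hxy) hzxy
    have hun := not_lt.mp (hF.unlinked hef hxy); have h3 := (h1 _ _).symm.trans (h2 e.rep f.rep)
    have hP := hform_ne_zero h0 hef; have hcr := fun h => hmin _ (cross e f hef h)
    unfold side at *
    generalize hform o e.rep f.rep = P at *
    generalize vdet e.rep x.rep * vdet f.rep x.rep = u at *
    generalize vdet e.rep y.rep * vdet f.rep y.rep = v at *
    generalize vdet e.rep c.rep * vdet f.rep c.rep = d at *
    have hPv : P * v ≤ 0 := by
      by_contra! h'; nlinarith [mul_neg_of_neg_of_pos hlt h', mul_nonneg (sq_nonneg P) hun]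
    have hneg : P * (P + t * d) < 0 := by
      by_contra! h'
      nlinarith [mul_nonneg hs.le h', mul_pos hs' (neg_pos.mpr hlt), mul_nonneg ht'.le
        (neg_nonneg.mpr hPv), congrArg (P * ·) h3]
    -- the other geodesic is met strictly earlier
    have hPd : P * d < 0 := by
      by_contra! h'; nlinarith [mul_nonneg hτ0 h', mul_self_nonneg P]
    have h4 : -P / d * (P * d) = -(P * P) := by
      have := right_ne_zero_of_mul hPd.ne; field_simp
    nlinarith [mul_le_mul_of_nonpos_right (hcr hPd) hPd.le]
  exact ⟨a, key a b hab hz, b, key b a (hF.symm hab) (by rwa [geod_comm]), hab, hsep⟩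

end Plaque

section Plaque

variable {F : Rel} {o : ℍ}

lemma exists_ne_ne_bdH2 (a b : BdH2) : ∃ c : BdH2, c ≠ a ∧ c ≠ b := by
  have := Infinite.of_injective ofReal fun _ _ => BdH2.ofReal_inj.mp
  obtain ⟨c, hc⟩ := (Set.toFinite {a, b}).infinite_compl.nonempty; exact ⟨c, by simpa using hc⟩

lemma link_or_link_or_link (hab : a ≠ b) (hac : a ≠ c) (hae : a ≠ e)
    (hbc : b ≠ c) (hbe : b ≠ e) (hce : c ≠ e) : Link a b c e ∨ Link a c b e ∨ Link a e b c := by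
  have h1 := vdet_ne hab; have h2 := vdet_ne hac; have h3 := vdet_ne hae
  have h4 := vdet_ne hbc; have h5 := vdet_ne hbe; have h6 := vdet_ne hce
  have hpl : vdet a.rep b.rep * vdet c.rep e.rep - vdet a.rep c.rep * vdet b.rep e.rep +
      vdet a.rep e.rep * vdet b.rep c.rep = 0 := by simp only [vdet]; ring
  by_contra! h; unfold Link at h
  rw [vdet_swap c.rep b.rep, vdet_swap e.rep b.rep, vdet_swap e.rep c.rep] at h
  generalize vdet a.rep b.rep = ab at *
  generalize vdet a.rep c.rep = ac at *
  generalize vdet a.rep e.rep = ae at *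
  generalize vdet b.rep c.rep = bc at *
  generalize vdet b.rep e.rep = be at *
  generalize vdet c.rep e.rep = ce at *
  have i1 : 0 < (ac * be) * (ae * bc) := lt_of_le_of_ne (by linarith [h.1]) (by positivity)
  have i2 : 0 < (ab * ce) ^ 2 := by positivity
  nlinarith only [i1, i2, hpl, mul_pos i2 i1, mul_nonneg (neg_nonneg.mpr (show (ab * ce) * (ae * bc) ≤ 0
    by linarith [h.2.1])) (show 0 ≤ (ab * ce) * (ac * be) by linarith [h.2.2])]

lemma exists_three_pEnds (hF : IsGeodFamily F) (h0 : o ∉ leaves F) :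
    ∃ a ∈ pEnds F o, ∃ b ∈ pEnds F o, ∃ c ∈ pEnds F o, a ≠ b ∧ a ≠ c ∧ b ≠ c := by
  by_cases hall : ∀ c, c ∈ pEnds F o
  · refine ⟨_, hall (ofReal 0), _, hall (ofReal 1), _, hall (ofReal 2), ?_, ?_, ?_⟩ <;>
      rw [Ne, BdH2.ofReal_inj] <;> norm_num
  push Not at hall
  obtain ⟨c, hc⟩ := hall
  obtain ⟨a, ha, b, hb, hab, -⟩ := exists_separating_leaf hF h0 hc
  have hne := hF.ne hab
  -- a point on the same side of the leaf as `o`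
  obtain ⟨e, he⟩ : ∃ e : BdH2, 0 < side o a b e := by
    have hp := hform_ne_zero h0 hab
    have hd := vdet_ne hne
    have hv : a.rep - hform o a.rep b.rep • b.rep ≠ 0 := fun h => hd (by
      rw [sub_eq_zero.mp h]; simp [vdet]; ring)
    obtain ⟨t, ht, et⟩ := exists_rep_mk _ hv
    refine ⟨mk ℝ _ hv, ?_⟩
    rw [side, et, vdet_smul_right, vdet_smul_right]
    generalize hform o a.rep b.rep = p at *
    rw [show p * (t * vdet a.rep (a.rep - p • b.rep) * (t * vdet b.rep (a.rep - p • b.rep))) =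
      (p * t * vdet a.rep b.rep) ^ 2 by simp [vdet]; ring]
    positivity
  have hea : a ≠ e := by rintro rfl; simp [side, vdet_self] at he
  have heb : b ≠ e := by rintro rfl; simp [side, vdet_self] at he
  by_cases hE : e ∈ pEnds F o
  · exact ⟨a, ha, b, hb, e, hE, hne, hea, heb⟩
  obtain ⟨a', ha', b', hb', hab', hlt⟩ := exists_separating_leaf hF h0 hE
  by_cases h1 : a' = a ∨ a' = b
  · by_cases h2 : b' = a ∨ b' = b
    · have := side_comm o a b e
      have := hF.ne hab'
      grind
    · exact ⟨a, ha, b, hb, b', hb', hne, by grind, by grind⟩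
  · exact ⟨a, ha, b, hb, a', ha', hne, by grind, by grind⟩

lemma not_link_of_pEnds (h0 : o ∉ leaves F) (hp : p ∈ pEnds F o)
    (hq : q ∈ pEnds F o) (hab : F a b) : ¬Link a b p q := by
  intro h; have h1 := hp a b hab; have h2 := hq a b hab; have h3 := hform_ne_zero h0 hab
  unfold Link at h; unfold side at h1 h2; nlinarith [mul_nonneg h1 h2, pow_two_pos_of_ne_zero h3]

lemma geod_subset_plaque (hF : IsGeodFamily F) (h0 : o ∉ leaves F)
    (hp : p ∈ pEnds F o) (hq : q ∈ pEnds F o) (hpq : p ≠ q) (hn : ¬F p q) :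
    geod p q ⊆ plaque F o := by
  intro z hz a b hab; obtain ⟨s, t, hs, ht, h⟩ := hform_of_mem_geod hpq hz; have h1 := hp a b hab
  have h2 := hq a b hab; have h3 := hform_ne_zero h0 hab; rw [h]; unfold side at h1 h2
  generalize hform o a.rep b.rep = P at *; have h4 := mul_nonneg hs.le h1
  have h5 := mul_nonneg ht.le h2; refine lt_of_le_of_ne (by linarith) fun h0 => hn ?_
  have h6 : s * (P * (vdet a.rep p.rep * vdet b.rep p.rep)) = 0 := by linarith
  have h7 : t * (P * (vdet a.rep q.rep * vdet b.rep q.rep)) = 0 := by linarith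
  simp only [mul_eq_zero, hs.ne', ht.ne', h3, false_or, ← eq_iff_vdet] at h6 h7
  have := hF.symm hab; grind

/-- Two plaques on the same side of a common frontier leaf are equal. -/
lemma mem_plaque_of_adjacent (hF : IsGeodFamily F) {z1 : ℍ} (h0 : o ∉ leaves F)
    (h1 : z1 ∉ leaves F) (hab : F a b) (ha0 : a ∈ pEnds F o)
    (hb0 : b ∈ pEnds F o) (ha1 : a ∈ pEnds F z1) (hb1 : b ∈ pEnds F z1)
    (hs : 0 < hform o a.rep b.rep * hform z1 a.rep b.rep) : z1 ∈ plaque F o := by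
  intro e f hef; have h2 := hform_ne_zero h0 hef
  have h3 := hform_ne_zero h1 hef; by_contra hneg
  have hlt : hform o e.rep f.rep * hform z1 e.rep f.rep < 0 :=
    lt_of_le_of_ne (not_lt.mp hneg) (mul_ne_zero h2 h3)
  have key : ∀ c : BdH2, c ∈ pEnds F o → c ∈ pEnds F z1 → e = c ∨ f = c := by
    intro c hc0 hc1; have h4 := mul_nonneg (hc0 e f hef) (hc1 e f hef)
    rw [eq_iff_vdet, eq_iff_vdet, ← mul_eq_zero]; by_contra hu; unfold side at h4
    nlinarith [pow_two_pos_of_ne_zero hu]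
  have h6 := key a ha0 ha1; have h7 := key b hb0 hb1; have hne := hF.ne hab
  have := hform_comm o a.rep b.rep; have := hform_comm z1 a.rep b.rep; grind

variable {Γ : Subgroup SL2R}

lemma smul_mem_plaque (hinv : ∀ g ∈ Γ, ∀ a b, F a b → F (g • a) (g • b))
    (hg : g ∈ Γ) (h : z ∈ plaque F w) : g • z ∈ plaque F (g • w) := by
  intro a b hab; have h1 := h _ _ (hinv g⁻¹ (inv_mem hg) a b hab)
  obtain ⟨s, hs, es⟩ := exists_rep_smul g⁻¹ a; obtain ⟨t, ht, et⟩ := exists_rep_smul g⁻¹ b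
  have e : ∀ z : ℍ, hform z (g⁻¹ • a).rep (g⁻¹ • b).rep = s * t * hform (g • z) a.rep b.rep := by
    intro z
    rw [es, et, hform_smul_left, hform_smul_right, ← hform_sl_smul g, smul_inv_smul, smul_inv_smul]
    ring
  rw [e, e] at h1; exact pos_of_mul_pos_right (a := (s * t) ^ 2) (by linarith) (sq_nonneg _)

lemma smul_mem_pEnds (hinv : ∀ g ∈ Γ, ∀ a b, F a b → F (g • a) (g • b))
    (hg : g ∈ Γ) (h : c ∈ pEnds F w) : g • c ∈ pEnds F (g • w) := by
  intro a b hab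
  simpa using (side_smul_nonneg g _ _ _ _).mpr (h _ _ (hinv g⁻¹ (inv_mem hg) a b hab))

/-- The stabilizer of a plaque. -/
def plaqueStab (hinv : ∀ g ∈ Γ, ∀ a b, F a b → F (g • a) (g • b)) (h0 : o ∉ leaves F) :
    Subgroup SL2R where
  carrier := {g | g ∈ Γ ∧ g • o ∈ plaque F o}
  one_mem' := ⟨one_mem Γ, by rw [one_smul]; exact mem_plaque_self h0⟩
  mul_mem' := fun ⟨hg, hg'⟩ ⟨hh, hh'⟩ => ⟨mul_mem hg hh, by
    rw [mul_smul, ← plaque_eq_of_mem hg']; exact smul_mem_plaque hinv hg hh'⟩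
  inv_mem' := fun ⟨hg, hg'⟩ => ⟨inv_mem hg, mem_plaque_comm.mp (by
    simpa using smul_mem_plaque hinv (inv_mem hg) hg')⟩

lemma mem_plaqueStab (hinv : ∀ g ∈ Γ, ∀ a b, F a b → F (g • a) (g • b)) (h0 : o ∉ leaves F) :
    g ∈ plaqueStab hinv h0 ↔ g ∈ Γ ∧ g • o ∈ plaque F o := Iff.rfl

lemma smul_mem_pEnds_of_stab (hinv : ∀ g ∈ Γ, ∀ a b, F a b → F (g • a) (g • b))
    (h0 : o ∉ leaves F) (hg : g ∈ plaqueStab hinv h0)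
    (hc : c ∈ pEnds F o) : g • c ∈ pEnds F o := by
  have := smul_mem_pEnds hinv hg.1 hc; rwa [pEnds_eq_of_mem hg.2] at this

/-- A group element is in the stabilizer of a plaque if it maps a geodesic in the plaque to a
geodesic that crosses it. -/
lemma mem_plaqueStab_of_link (hF : IsGeodFamily F)
    (hinv : ∀ g ∈ Γ, ∀ a b, F a b → F (g • a) (g • b)) (h0 : o ∉ leaves F)
    (hp : p ∈ pEnds F o) (hq : q ∈ pEnds F o) (hn : ¬F p q)
    (hg : g ∈ Γ) (hl : Link p q (g • p) (g • q)) : g ∈ plaqueStab hinv h0 := by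
  refine ⟨hg, ?_⟩; have hsub := geod_subset_plaque hF h0 hp hq hl.ne_left hn
  obtain ⟨w, hw1, hw2⟩ := exists_mem_geod_of_link hl; rw [← translateSet_geod] at hw2
  obtain ⟨v, hv, rfl⟩ := hw2; rw [← plaque_eq_of_mem (hsub hw1)]
  exact mem_plaque_comm.mp (smul_mem_plaque hinv hg (hsub hv))

end Plaque

/-! ### Trace estimates for crossing translates of an axis -/

lemma trace_estimate {l m A D : ℝ} (hl1 : 1 < l) (hll : l * m = 1) (hA : 0 < A) (hD : 0 < D)
    (hprod : A * D < 1) (hle1 : A ≤ D) (hle2 : D ≤ l ^ 2 * A) :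
    |A + D| < l + m ∧ |l * A + m * D| < l + m ∧
      |(l * A + m * D) * (A + D) - (l + m)| < l + m := by
  have hm0 : 0 < m := by nlinarith
  have hm1 : m ^ 2 < 1 := by nlinarith
  have h1 := mul_pos (sub_pos.mpr hprod) (show 0 < l + m by linarith)
  have h2 := mul_pos h1 (show 0 < l + m by linarith)
  have i1 := mul_nonneg (sub_nonneg.mpr hle2) (show 0 ≤ D - m ^ 2 * A by nlinarith)
  have i2 := mul_nonneg (sub_nonneg.mpr hle1) (show 0 ≤ l ^ 2 * A - m ^ 2 * D by nlinarith)
  have i3 := mul_nonneg (mul_nonneg hm0.le (sub_nonneg.mpr hle1)) (sub_nonneg.mpr hle2)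
  have e1 : (l + m) ^ 2 - (A + D) ^ 2 = (1 - A * D) * (l + m) * (l + m) +
      (l ^ 2 * A - D) * (D - m ^ 2 * A) := by
    linear_combination (A ^ 2 * (l * m + 1) + 2 * A * D) * hll
  have e3 : 2 * (l + m) - (l * A + m * D) * (A + D) = 2 * ((1 - A * D) * (l + m)) +
      m * (D - A) * (l ^ 2 * A - D) := by linear_combination (l * A ^ 2 - l * A * D) * hll
  refine ⟨abs_lt_of_sq_lt_sq (by linarith) (by linarith), abs_lt_of_sq_lt_sq (by linarith)
    (by linarith), abs_lt.mpr ⟨?_, by linarith⟩⟩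
  have : 0 < (l * A + m * D) * (A + D) := by positivity
  linarith

/-- If `k` moves the axis of `h = diag (l, 1 / l)` to a geodesic that crosses it, then for a
suitable `p` the translation lengths of `k' = hᵖ k`, of `h k'` and of `h k'²` are smaller than that
of `h`; these are the curves obtained from the axis by surgery at a self-intersection. -/
lemma exists_smaller_trace {l : ℝ} (hl : l ≠ 0) (hl1 : 1 < l)
    (hk : k 0 0 * k 0 1 * k 1 0 * k 1 1 < 0) :
    ∃ (p : ℤ) (k' : SL2R), (k' = slDiag l hl ^ p * k ∨ k' = -(slDiag l hl ^ p * k)) ∧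
      0 < k' 0 0 ∧ 0 < k' 1 1 ∧ k' 0 0 * k' 1 1 < 1 ∧
      |sltr k'| < l + l⁻¹ ∧ |sltr (slDiag l hl * k')| < l + l⁻¹ ∧
      |sltr (slDiag l hl * k' ^ 2)| < l + l⁻¹ ∧ k' 0 0 ≤ k' 1 1 ∧ k' 1 1 ≤ l ^ 2 * k' 0 0 := by
  wlog hA : 0 < k 0 0 generalizing k
  · obtain ⟨p, k', hk', h⟩ := this (k := -k) (by simpa [sl_neg_apply] using hk) (by
      rw [sl_neg_apply]
      exact neg_pos.mpr (lt_of_le_of_ne (not_lt.mp hA) (by rintro h; simp [h] at hk)))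
    exact ⟨p, k', by simpa [or_comm] using hk', h⟩
  have hl0 : 0 < l := by linarith
  have hd := sl_det k; have hAD : 0 < k 0 0 * k 1 1 := by nlinarith
  have hD : 0 < k 1 1 := pos_of_mul_pos_right hAD hA.le
  obtain ⟨p, hp1, hp2⟩ := exists_mem_Ico_zpow (div_pos hD hA) (one_lt_pow₀ hl1 two_ne_zero)
  have hlp : 0 < l ^ p := zpow_pos hl0 p
  have hl2p : (l ^ 2) ^ p = l ^ p * l ^ p := by rw [sq, mul_zpow]
  rw [hl2p, le_div_iff₀ hA] at hp1; rw [zpow_add_one₀ (by positivity), hl2p, div_lt_iff₀ hA] at hp2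
  obtain ⟨k', hk'⟩ : ∃ k', k' = slDiag l hl ^ p * k := ⟨_, rfl⟩
  have hA' : k' 0 0 = l ^ p * k 0 0 := by simp [hk', slDiag_zpow, sl_mul, slDiag_apply]
  have hD' : k' 1 1 = (l ^ p)⁻¹ * k 1 1 := by simp [hk', slDiag_zpow, sl_mul, slDiag_apply]
  have hA'0 : 0 < k' 0 0 := by rw [hA']; positivity
  have hD'0 : 0 < k' 1 1 := by rw [hD']; positivity
  have hprod : k' 0 0 * k' 1 1 < 1 := by
    rw [hA', hD', show l ^ p * k 0 0 * ((l ^ p)⁻¹ * k 1 1) = k 0 0 * k 1 1 by field_simp]; nlinarith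
  have hle1 : k' 0 0 ≤ k' 1 1 := by rw [hA', hD', inv_mul_eq_div, le_div_iff₀ hlp]; linarith
  have hle2 : k' 1 1 ≤ l ^ 2 * k' 0 0 := by rw [hA', hD', inv_mul_eq_div, div_le_iff₀ hlp]; linarith
  refine ⟨p, k', Or.inl hk', hA'0, hD'0, hprod, ?_⟩
  have htr1 : sltr (slDiag l hl * k') = l * k' 0 0 + l⁻¹ * k' 1 1 := by
    simp [sltr, sl_mul, slDiag_apply]
  have htr2 : sltr (slDiag l hl * k' ^ 2) =
      (l * k' 0 0 + l⁻¹ * k' 1 1) * (k' 0 0 + k' 1 1) - (l + l⁻¹) := by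
    simp only [sltr, pow_two, sl_mul, slDiag_apply]
    linear_combination (-(l + l⁻¹)) * sl_det k'
  rw [htr1, htr2, sltr]
  have h3 := trace_estimate hl1 (mul_inv_cancel₀ hl) hA'0 hD'0 hprod hle1 hle2
  exact ⟨h3.1, h3.2.1, h3.2.2, hle1, hle2⟩

lemma off_diag_ne_zero_of_lt_one (h : k 0 0 * k 1 1 < 1) : k 0 1 ≠ 0 ∧ k 1 0 ≠ 0 := by
  have hd := sl_det k; constructor <;> intro h' <;> rw [h'] at hd <;> nlinarith

/-! ### Maximal laminations that contain a pants decomposition -/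

/-- The lifts `F` of the leaves of a maximal geodesic lamination of a closed hyperbolic surface,
and the lifts `P` of the curves of a pants decomposition that it contains, as relations between
the ends of the geodesics. -/
structure PantsLam (Γ : Subgroup SL2R) (F P : Rel) : Prop
    extends IsGeodFamily F where
  surf : IsSurfaceGroup Γ
  smul : ∀ g ∈ Γ, ∀ a b, F a b → F (g • a) (g • b)
  maximal : ∀ p q, p ≠ q → (∀ a b, F a b → ¬Link a b p q) →
    (∀ g ∈ Γ, ¬Link p q (g • p) (g • q)) → F p q
  P_sub : ∀ {a b}, P a b → F a b
  P_symm : ∀ {a b}, P a b → P b a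
  P_smul : ∀ g ∈ Γ, ∀ a b, P a b → P (g • a) (g • b)
  P_closed : ∀ {a b}, P a b → ∃ g ∈ Γ, g ≠ 1 ∧ g ≠ -1 ∧ g • a = a ∧ g • b = b
  P_maximal : ∀ p q, ∀ g ∈ Γ, g ≠ 1 → g ≠ -1 → p ≠ q → g • p = p → g • q = q →
    (∀ a b, P a b → ¬Link a b p q) → (∀ k ∈ Γ, ¬Link p q (k • p) (k • q)) → P p q

lemma leaves_conj (M : SL2R) (F : Rel) (z : ℍ) :
    z ∈ leaves (fun a b => F (M • a) (M • b)) ↔ M • z ∈ leaves F := by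
  constructor
  · rintro ⟨a, b, h, hz⟩
    exact ⟨_, _, h, (smul_mem_geod M a b z).mpr hz⟩
  · rintro ⟨a, b, h, hz⟩
    refine ⟨M⁻¹ • a, M⁻¹ • b, by simpa using h, ?_⟩
    rw [← smul_mem_geod M, smul_inv_smul, smul_inv_smul]
    exact hz

lemma PantsLam.conj
    (h : PantsLam Γ F P) (M : SL2R) :
    PantsLam (conjSub M Γ) (fun a b => F (M • a) (M • b)) (fun a b => P (M • a) (M • b)) where
  ne hab := fun h' => h.ne hab (by rw [h'])
  symm hab := h.symm hab
  unlinked hab hce := by rw [← link_smul M]; exact h.unlinked hab hce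
  isClosed := by
    have : leaves (fun a b => F (M • a) (M • b)) = (fun z : ℍ => M • z) ⁻¹' leaves F := by
      ext z; exact leaves_conj M F z
    rw [this]
    exact h.isClosed.preimage (continuous_const_smul M)
  surf := h.surf.conj M
  smul g hg a b hab := by
    have := h.smul _ (mem_conjSub.mp hg) _ _ hab
    simpa [mul_smul] using this
  maximal p q hpq h1 h2 := by
    refine h.maximal _ _ (fun h' => hpq (smul_left_cancel M h')) (fun a b hab => ?_) (fun g hg => ?_)
    · have := h1 (M⁻¹ • a) (M⁻¹ • b) (by rwa [smul_inv_smul, smul_inv_smul])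
      rwa [← link_smul M, smul_inv_smul, smul_inv_smul] at this
    · have := h2 (M⁻¹ * g * M) (conj_mem_conjSub.mpr hg)
      rw [← link_smul M] at this
      simpa [mul_smul] using this
  P_sub hab := h.P_sub hab
  P_symm hab := h.P_symm hab
  P_smul g hg a b hab := by
    have := h.P_smul _ (mem_conjSub.mp hg) _ _ hab
    simpa [mul_smul] using this
  P_closed hab := by
    obtain ⟨g, hg, h1, h2, ha, hb⟩ := h.P_closed hab
    refine ⟨M⁻¹ * g * M, conj_mem_conjSub.mpr hg, ?_, ?_, ?_, ?_⟩
    · have := sl_conj_ne_one M⁻¹ h1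
      rwa [inv_inv] at this
    · have := sl_conj_ne_neg_one M⁻¹ h2
      rwa [inv_inv] at this
    · rw [mul_smul, mul_smul, ha, inv_smul_smul]
    · rw [mul_smul, mul_smul, hb, inv_smul_smul]
  P_maximal p q g hg h1 h2 hpq hp hq h3 h4 := by
    refine h.P_maximal _ _ _ (mem_conjSub.mp hg) (sl_conj_ne_one M h1) (sl_conj_ne_neg_one M h2)
      (fun h' => hpq (smul_left_cancel M h')) ?_ ?_ (fun a b hab => ?_) (fun k hk => ?_)
    · rw [mul_smul, mul_smul, inv_smul_smul, hp]
    · rw [mul_smul, mul_smul, inv_smul_smul, hq]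
    · have := h3 (M⁻¹ • a) (M⁻¹ • b) (by rwa [smul_inv_smul, smul_inv_smul])
      rwa [← link_smul M, smul_inv_smul, smul_inv_smul] at this
    · have := h4 (M⁻¹ * k * M) (conj_mem_conjSub.mpr hk)
      rw [← link_smul M] at this
      simpa [mul_smul] using this

lemma plaque_conj (M : SL2R) (F : Rel) (z w : ℍ) :
    z ∈ plaque (fun a b => F (M • a) (M • b)) w ↔ M • z ∈ plaque F (M • w) := by
  have key : ∀ (M : SL2R) (F : Rel) (z w : ℍ),
      z ∈ plaque (fun a b => F (M • a) (M • b)) w → M • z ∈ plaque F (M • w) := by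
    intro M F z w h a b hab; have h1 := h (M⁻¹ • a) (M⁻¹ • b) (by simpa using hab)
    obtain ⟨s, hs, es⟩ := exists_rep_smul M⁻¹ a; obtain ⟨t, ht, et⟩ := exists_rep_smul M⁻¹ b
    have e : ∀ z : ℍ, hform z (M⁻¹ • a).rep (M⁻¹ • b).rep = s * t * hform (M • z) a.rep b.rep := by
      intro z
      rw [es, et, hform_smul_left, hform_smul_right, ← hform_sl_smul M, smul_inv_smul, smul_inv_smul]
      ring
    rw [e, e] at h1; have : 0 < (s * t) ^ 2 := by positivity
    by_contra h2; nlinarith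
  refine ⟨key M F z w, fun h => ?_⟩
  have := key M⁻¹ (fun a b => F (M • a) (M • b)) (M • z) (M • w) (by simpa using h)
  simpa using this

/-! ### The complementary regions of a maximal lamination are ideal triangles -/

/-- An uncrossing inequality. With `χ = (cosh d - 1) / 2` for the distance `d` between two
geodesics, the geodesics `(0, ∞)`, `(u₃, v₃)`, `(u₂, v₂)`, `(u₄, v₄)` cannot be such that the second
pair of opposite ones is not farther apart than the first, while the neighbours are not closer. -/
lemma false_of_uncrossing {s a b c d u₂ v2 u₃ v3 u₄ v4 : ℝ} (hs : 0 < s) (hc : 0 < c) (hd : 0 < d)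
    (ha : s ≤ a) (hb : s ≤ b) (e2 : s * (v2 - u₂) = u₂) (e3 : c * (v3 - u₃) = u₃)
    (e4 : b * (v4 - u₄) = u₄) (e₂₃ : a * ((v2 - u₂) * (v3 - u₃)) = (u₂ - v3) * (v2 - u₃))
    (e₃₄ : s * ((v3 - u₃) * (v4 - u₄)) = (u₄ - v3) * (v4 - u₃))
    (e₂₄ : d * ((v2 - u₂) * (v4 - u₄)) = (u₂ - v4) * (v2 - u₄)) (h3 : 0 < u₂ * u₃)
    (h4 : 0 < u₂ * u₄) (hl : (u₂ - u₃) * (u₂ - u₄) < 0) : False := by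
  wlog hp : 0 < u₂ generalizing u₂ v2 u₃ v3 u₄ v4
  · exact @this (-u₂) (-v2) (-u₃) (-v3) (-u₄) (-v4) (by linarith) (by linarith) (by linarith)
      (by linarith) (by linarith) (by linarith) (by linarith) (by linarith) (by linarith)
      (neg_pos.mpr (lt_of_le_of_ne (not_lt.mp hp) (by rintro rfl; simp at h3)))
  have p₃ := pos_of_mul_pos_right h3 hp.le
  have p₄ := pos_of_mul_pos_right h4 hp.le
  have b0 := hs.trans_le hb
  obtain ⟨x, rfl⟩ : ∃ x, v3 = u₃ + x := ⟨v3 - u₃, by ring⟩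
  obtain ⟨y, rfl⟩ : ∃ y, v2 = u₂ + y := ⟨v2 - u₂, by ring⟩
  obtain ⟨z, rfl⟩ : ∃ z, v4 = u₄ + z := ⟨v4 - u₄, by ring⟩
  simp only [add_sub_cancel_left] at *
  have hx : 0 < x := pos_of_mul_pos_right (e3 ▸ p₃) hc.le
  have hy : 0 < y := pos_of_mul_pos_right (e2 ▸ hp) hs.le
  have hz : 0 < z := pos_of_mul_pos_right (e4 ▸ p₄) b0.le
  have d₂₃ := mul_pos (hs.trans_le ha) (mul_pos hy hx)
  have d₂₄ := mul_pos hd (mul_pos hy hz)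
  rw [e₂₃] at d₂₃
  rw [e₂₄] at d₂₄
  have hle : s * (y * x) ≤ (u₂ - (u₃ + x)) * (u₂ + y - u₃) :=
    e₂₃ ▸ mul_le_mul_of_nonneg_right ha (mul_pos hy hx).le
  have hsz : s * z ≤ u₄ := e4 ▸ mul_le_mul_of_nonneg_right hb hz.le
  rcases mul_neg_iff.mp hl with ⟨h1, h2⟩ | ⟨h1, h2⟩
  · have q : 0 < u₂ - (u₃ + x) := pos_of_mul_pos_left d₂₃ (by linarith)
    have r : u₂ + y < u₄ := by
      by_contra! h
      nlinarith only [d₂₄, h, h2, hz, mul_pos hz hy]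
    nlinarith only [mul_le_mul_of_nonneg_right hsz hx.le, e2, e₃₄, hle, q, r, hx, hy, hz, h1, mul_pos q hx, mul_pos q hy, mul_pos q q]
  · have q : u₂ + y < u₃ := by
      by_contra! h
      nlinarith only [d₂₃, h, h1, hx, mul_pos hx hy]
    have r : u₄ + z < u₂ := by
      by_contra! h
      nlinarith only [d₂₄, mul_nonneg (sub_nonneg.mpr h) (add_pos h2 hy).le]
    have : z < y := lt_of_mul_lt_mul_left (by linarith) hs.le
    nlinarith only [this, e₃₄, hle, q, r, hx, hy, hz, hs, mul_pos hs hx]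

lemma neg_sl_smul_uhp (g : SL2R) (z : ℍ) : (-g) • z = g • z := by
  have e : ∀ v : Fin 2 → ℝ, (-g) • v = (-1 : ℝ) • (g • v) := by
    intro v; ext i; fin_cases i
    · simp only [Fin.zero_eta, Pi.smul_apply, sl_smul_0, sl_neg_apply, smul_eq_mul]; ring
    · simp only [Fin.mk_one, Pi.smul_apply, sl_smul_1, sl_neg_apply, smul_eq_mul]; ring
  refine hform_ext fun v w => ?_; have h1 := hform_sl_smul (-g) z (g⁻¹ • v) (g⁻¹ • w)
  have h2 := hform_sl_smul g z (g⁻¹ • v) (g⁻¹ • w)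
  rw [e, e, hform_smul_left, hform_smul_right] at h1; rw [smul_inv_smul, smul_inv_smul] at h1 h2
  linarith

lemma link_ofReal_infty (u v x : ℝ) :
    Link (ofReal u) (ofReal v) infty (ofReal x) ↔ (u - x) * (v - x) < 0 := by
  rw [infty, ofReal, ofReal, ofReal, link_mk_iff]; simp [vdet]

lemma inv_mul_entries {i j : SL2R} (hi0 : i 1 0 ≠ 0) (hi1 : i 1 1 ≠ 0) (hj0 : j 1 0 ≠ 0)
    (hj1 : j 1 1 ≠ 0) :
    -((i⁻¹ * j) 0 0 * (i⁻¹ * j) 1 1) *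
      ((j 0 1 / j 1 1 - j 0 0 / j 1 0) * (i 0 1 / i 1 1 - i 0 0 / i 1 0)) =
    (j 0 0 / j 1 0 - i 0 1 / i 1 1) * (j 0 1 / j 1 1 - i 0 0 / i 1 0) := by
  have e : ∀ k : SL2R, k 1 0 ≠ 0 → k 1 1 ≠ 0 →
      k 0 1 / k 1 1 - k 0 0 / k 1 0 = -1 / (k 1 0 * k 1 1) := fun k h h' => by
    field_simp; linear_combination -sl_det k
  rw [e j hj0 hj1, e i hi0 hi1]
  simp only [sl_mul, sl_inv_00, sl_inv_01, sl_inv_10, sl_inv_11]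
  field_simp; ring

lemma link_of_separating (hab : F a b)
    (hc : side o a b c < 0) (he : e ∈ pEnds F o) (hea : e ≠ a) (heb : e ≠ b) :
    Link a b c e := by
  have h := he a b hab
  have hne := mul_ne_zero (vdet_ne hea.symm) (vdet_ne heb.symm); unfold Link
  unfold side at *
  generalize vdet a.rep c.rep * vdet b.rep c.rep = u at *
  generalize vdet a.rep e.rep * vdet b.rep e.rep = v at *
  generalize hform o a.rep b.rep = s at *; have hs : s ≠ 0 := by rintro rfl; simp at hc
  by_contra! hn
  nlinarith only [mul_pos (lt_of_le_of_ne h (mul_ne_zero hs hne).symm) (neg_pos.mpr hc),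
    mul_nonneg (sq_nonneg s) hn]

/-- The fixed points of a hyperbolic element of the stabilizer of a plaque are ends of the
plaque: otherwise the leaf that cuts such a point off the plaque would be invariant. -/
lemma mem_pEnds_of_fixed (hF : IsGeodFamily F)
    (hinv : ∀ g ∈ Γ, ∀ a b, F a b → F (g • a) (g • b)) (h0 : o ∉ leaves F)
    (hg : g ∈ plaqueStab hinv h0) (htr : 2 < |sltr g|) (ha : g • a = a) :
    a ∈ pEnds F o := by
  by_contra hn; obtain ⟨p, hp, q, hq, hpq, hlt⟩ := exists_separating_leaf hF h0 hn
  obtain ⟨M, rfl, rfl⟩ := exists_sl_frame fun h : p = a => hn (h ▸ hp)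
  obtain ⟨r, hr⟩ := exists_ofReal (x := M⁻¹ • q) fun h => hn (inv_smul_eq_iff.mp h ▸ hq)
  obtain rfl := inv_smul_eq_iff.mp hr; have hr0 : r ≠ 0 := by rintro rfl; exact hF.ne hpq rfl
  have key : ∀ k ∈ plaqueStab hinv h0, k • M • infty = M • infty → (M⁻¹ * k * M) 0 0 ^ 2 ≤ 1 := by
    intro k hk hkM; obtain ⟨e, he⟩ : ∃ e, e = M⁻¹ * k * M := ⟨_, rfl⟩; rw [← he]
    have h10 : e 1 0 = 0 := sl_smul_infty_iff.mp (by
      rw [he, mul_smul, mul_smul, hkM, inv_smul_smul])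
    have hdet := sl_det e; rw [h10, mul_zero, sub_zero] at hdet
    have between : ∀ t : ℝ, M • ofReal t ∈ pEnds F o →
        (e 0 0 ^ 2 * t + e 0 0 * e 0 1) * (e 0 0 ^ 2 * t + e 0 0 * e 0 1 - r) ≤ 0 := by
      intro t ht; have hkE := smul_mem_pEnds_of_stab hinv h0 hk ht
      have ek : k • M • ofReal t = M • ofReal (e 0 0 ^ 2 * t + e 0 0 * e 0 1) := by
        have h11 : e 1 1 ≠ 0 := right_ne_zero_of_mul (hdet ▸ one_ne_zero)
        have := sl_smul_ofReal (g := e) (t := t) (by simpa [h10] using h11)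
        rw [← inv_smul_eq_iff, smul_smul, smul_smul, ← he, this, h10, BdH2.ofReal_inj,
          zero_mul, zero_add, div_eq_iff h11]
        linear_combination (-e 0 0 * t - e 0 1) * hdet
      rw [ek] at hkE
      generalize e 0 0 ^ 2 * t + e 0 0 * e 0 1 = x at *; by_contra! hx
      have hl := link_of_separating hpq hlt hkE
        (fun h => by rw [smul_left_cancel_iff, zero_eq, BdH2.ofReal_inj] at h; simp [h] at hx)
        (fun h => by rw [smul_left_cancel_iff, BdH2.ofReal_inj] at h; simp [h] at hx)
      rw [link_smul, zero_eq, link_ofReal_infty] at hl; linarith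
    have h1 := between 0 hp; have h2 := between r hq
    have h3 : (e 0 0 ^ 2) ^ 2 * r ^ 2 ≤ 1 * r ^ 2 := by
      nlinarith only [h1, h2, sq_nonneg (e 0 0 ^ 2 * r + 2 * (e 0 0 * e 0 1) - r)]
    exact (sq_le_one_iff₀ (sq_nonneg _)).mp (le_of_mul_le_mul_right h3 (by positivity))
  have h1 := key g hg ha; have h2 := key g⁻¹ (inv_mem hg) (inv_smul_eq_iff.mpr ha.symm)
  rw [show M⁻¹ * g⁻¹ * M = (M⁻¹ * g * M)⁻¹ by group, sl_inv_00] at h2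
  rw [← show sltr (M⁻¹ * g * M) = sltr g by simpa using sltr_conj M⁻¹ g] at htr
  have h3 : (M⁻¹ * g * M) 1 0 = 0 := sl_smul_infty_iff.mp (by
    rw [mul_smul, mul_smul, ha, inv_smul_smul])
  have h4 := sl_det (M⁻¹ * g * M); rw [h3, mul_zero, sub_zero] at h4
  exact htr.not_ge (abs_le_of_sq_le_sq (by unfold sltr; nlinarith only [h1, h2, h4]) zero_le_two)

namespace PantsLam

variable {Γ : Subgroup SL2R} {F P : Rel} (h : PantsLam Γ F P)
  {o : ℍ}
include h

lemma neg_mem_stab (h0 : o ∉ leaves F) (hg : g ∈ plaqueStab h.smul h0) :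
    -g ∈ plaqueStab h.smul h0 :=
  ⟨h.surf.neg_mem hg.1, by rw [neg_sl_smul_uhp]; exact hg.2⟩

/-- An element of the stabilizer of a plaque with the side `(0, ∞)` maps this side to a side that
the plaque faces. -/
lemma diag_pos (h0 : o ∉ leaves F) (h0i : F zero infty)
    (hEi : infty ∈ pEnds F o) {j : SL2R} (hj : j ∈ plaqueStab h.smul h0)
    (n10 : j 1 0 ≠ 0) (n11 : j 1 1 ≠ 0) (n00 : j 0 0 ≠ 0) : 0 < -(j 0 0 * j 1 1) := by
  by_contra! hn
  have hpos : 0 < j 0 0 * j 1 1 := lt_of_le_of_ne (by linarith) (mul_ne_zero n00 n11).symm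
  obtain ⟨e1, e2⟩ := sl_smul_infty_zero n10 n11
  have hs : j 0 0 + j 1 1 ≠ 0 := fun h' => by
    rw [eq_neg_of_add_eq_zero_right h'] at hpos; nlinarith [sq_nonneg (j 0 0)]
  have h1 := smul_mem_pEnds_of_stab h.smul h0 hj (smul_mem_pEnds_of_stab h.smul h0 hj hEi)
  have h2 := h.smul j hj.1 _ _ h0i
  have hq : j 1 0 * (j 0 0 / j 1 0) + j 1 1 ≠ 0 := by rwa [mul_div_cancel₀ _ n10]
  rw [e1, sl_smul_ofReal hq, mul_div_cancel₀ _ n10] at h1; rw [e1, e2] at h2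
  refine not_link_of_pEnds h0 h1 hEi h2 (Link.symm_right ?_); rw [link_ofReal_infty]
  have hd := sl_det j
  have e3 : j 0 1 / j 1 1 - (j 0 0 * (j 0 0 / j 1 0) + j 0 1) / (j 0 0 + j 1 1) =
      -(j 0 0 / (j 1 0 * j 1 1 * (j 0 0 + j 1 1))) := by
    field_simp; linear_combination -j 0 0 * hd
  have e4 : j 0 0 / j 1 0 - (j 0 0 * (j 0 0 / j 1 0) + j 0 1) / (j 0 0 + j 1 1) =
      1 / (j 1 0 * (j 0 0 + j 1 1)) := by
    field_simp; linear_combination hd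
  rw [e3, e4]; have : 0 < j 0 0 * j 1 1 / (j 1 0 * j 1 1 * (j 0 0 + j 1 1)) ^ 2 := by positivity
  calc _ = -(j 0 0 * j 1 1 / (j 1 0 * j 1 1 * (j 0 0 + j 1 1)) ^ 2) := by field_simp
    _ < 0 := by linarith

/-- A leaf that ends at an end of the axis of an element of the stabilizer of a plaque has translates
that separate the plaque. -/
lemma not_leaf_of_diag (h0 : o ∉ leaves F) {l : ℝ} {hl : l ≠ 0} (hl1 : 1 < l)
    (hd : slDiag l hl ∈ plaqueStab h.smul h0) {t : ℝ} (ht : t ≠ 0)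
    (htE : ofReal t ∈ pEnds F o) : ¬F infty (ofReal t) := by
  intro hF; have h1 := smul_mem_pEnds_of_stab h.smul h0 hd htE
  have h2 := smul_mem_pEnds_of_stab h.smul h0 hd h1; have h3 := h.smul _ hd.1 _ _ hF
  rw [slDiag_smul_ofReal] at h1 h3; rw [slDiag_smul_ofReal, slDiag_smul_ofReal] at h2
  rw [slDiag_smul_infty] at h3; refine not_link_of_pEnds h0 htE h2 h3 ?_
  rw [link_infty]; have h4 : 1 < l ^ 2 := one_lt_pow₀ hl1 two_ne_zero
  have e : (l ^ 2 * t - t) * (l ^ 2 * t - l ^ 2 * (l ^ 2 * t)) = -(l ^ 2 * (t * (l ^ 2 - 1)) ^ 2) := by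
    ring
  rw [e]; have : t * (l ^ 2 - 1) ≠ 0 := mul_ne_zero ht (by linarith)
  have : 0 < l ^ 2 * (t * (l ^ 2 - 1)) ^ 2 := by positivity
  linarith

/-- The axis of an element of the stabilizer of a plaque, here `(0, ∞)`, is not the axis of
smallest translation length: either it projects to a curve with a self-intersection, and surgery
gives a shorter one, or there are a further end of the plaque and by maximality a translate of the
geodesic from it to `∞` that crosses it, which leads to a translate of the axis closer to it than
any other. -/
lemma false_of_diag_mem_stab (h0 : o ∉ leaves F) {l : ℝ} {hl : l ≠ 0} (hl1 : 1 < l)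
    (hd : slDiag l hl ∈ plaqueStab h.smul h0)
    (hmin : ∀ k ∈ plaqueStab h.smul h0, k ≠ 1 → k ≠ -1 → l + l⁻¹ ≤ |sltr k|) : False := by
  have hF := h.toIsGeodFamily
  obtain ⟨n1, n2⟩ := slDiag_ne hl hl1
  have htr := h.surf.two_lt_trace hd.1 n1 n2
  have hE0 := mem_pEnds_of_fixed hF h.smul h0 hd htr (slDiag_smul_zero l hl)
  have hEi := mem_pEnds_of_fixed hF h.smul h0 hd htr (slDiag_smul_infty l hl)
  -- by minimality, the axis projects to a simple closed geodesic
  have hF0 : F zero infty := by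
    by_contra hn
    refine hn (h.maximal _ _ zero_ne_infty
      (fun a b hab => not_link_of_pEnds h0 hE0 hEi hab) fun g hg hlk => ?_)
    have hgs := mem_plaqueStab_of_link hF h.smul h0 hE0 hEi hn hg hlk
    obtain ⟨p, k', hk', hA, hD, hAD, htr, -, -⟩ :=
      exists_smaller_trace hl hl1 ((link_smul_zero_infty g).mp hlk)
    have hk's : k' ∈ plaqueStab h.smul h0 := by
      have h1 := mul_mem (zpow_mem hd p) hgs
      rcases hk' with rfl | rfl
      exacts [h1, h.neg_mem_stab h0 h1]
    have hoff := off_diag_ne_zero_of_lt_one hAD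
    have := hmin k' hk's (by rintro rfl; simp [sl_one_zero_one] at hoff)
      (by rintro rfl; simp [sl_neg_apply, sl_one_zero_one] at hoff)
    linarith
  -- by maximality, it suffices to find another end that gives no crossing
  suffices hex : ∃ t : ℝ, t ≠ 0 ∧ ofReal t ∈ pEnds F o ∧ ∀ g ∈ plaqueStab h.smul h0,
      ¬Link infty (ofReal t) (g • infty) (g • ofReal t) by
    obtain ⟨t, ht, htE, htl⟩ := hex
    refine h.not_leaf_of_diag h0 hl1 hd ht htE ?_
    by_contra hn
    exact hn (h.maximal _ _ (ofReal_ne_infty t).symm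
      (fun a b hab => not_link_of_pEnds h0 hEi htE hab) fun g hg hlk =>
        htl g (mem_plaqueStab_of_link hF h.smul h0 hEi htE hn hg hlk) hlk)
  by_cases hfix : ∀ k ∈ plaqueStab h.smul h0, k • infty = infty
  · obtain ⟨a, ha, b, hb, c, hc, hab, hac, hbc⟩ := exists_three_pEnds hF h0
    obtain ⟨e, he, he0, hei⟩ : ∃ e ∈ pEnds F o, e ≠ zero ∧ e ≠ infty := by
      by_contra! hcon
      have := fun e he => or_iff_not_imp_left.mpr (hcon e he)
      rcases this a ha with ha | ha <;> rcases this b hb with hb | hb <;>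
        rcases this c hc with hc | hc <;> simp_all
    obtain ⟨t, rfl⟩ := exists_ofReal hei
    exact ⟨t, fun h => he0 (by rw [h]; rfl), he, fun g hg hlk => hlk.ne13 (hfix g hg).symm⟩
  push Not at hfix
  -- twice the number is the hyperbolic cosine of the distance of the axis to its translate, minus 1
  let χ : SL2R → ℝ := fun k => -(k 0 0 * k 1 1)
  have hent : ∀ {k : SL2R}, k ∈ plaqueStab h.smul h0 → k • infty ≠ infty →
      k 1 0 ≠ 0 ∧ k 1 1 ≠ 0 ∧ k 0 0 ≠ 0 ∧ k 0 1 ≠ 0 := fun hk hki =>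
    h.surf.entries_ne_zero hd.1 n1 n2 (slDiag_smul_zero l hl) (slDiag_smul_infty l hl) hk.1 hki
  have pos : ∀ {k : SL2R}, k ∈ plaqueStab h.smul h0 → k • infty ≠ infty → 0 < χ k :=
    fun hk hki => h.diag_pos h0 hF0 hEi hk (hent hk hki).1 (hent hk hki).2.1 (hent hk hki).2.2.1
  obtain ⟨k, ⟨hk, hki⟩, hkmin⟩ := h.surf.exists_min (S := {k | k ∈ plaqueStab h.smul h0 ∧
      k • infty ≠ infty}) χ hfix fun B => by
    refine ⟨(1 + l ^ 4) * (2 * B + 1), fun k ⟨hk, hki⟩ hB => ?_⟩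
    obtain ⟨n10, n11, n00, n01⟩ := hent hk hki
    have norm : ∀ x y : ℝ, x ≠ 0 → y ≠ 0 → ∃ n : ℤ, ((l ^ n) ^ 2 * x) ^ 2 +
        (((l ^ n) ^ 2)⁻¹ * y) ^ 2 ≤ (1 + l ^ 4) * |x * y| := by
      intro x y hx hy
      have hx0 := abs_pos.mpr hx
      have hy0 := abs_pos.mpr hy
      obtain ⟨n, hn1, hn2⟩ := exists_mem_Ico_zpow (div_pos hy0 hx0) (one_lt_pow₀ hl1 four_ne_zero)
      have e : (l ^ 4) ^ n = (l ^ n) ^ 4 := by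
        rw [← zpow_natCast, ← zpow_natCast, ← zpow_mul, ← zpow_mul, mul_comm]
      have hp : 0 < l ^ n := zpow_pos (one_pos.trans hl1) _
      rw [le_div_iff₀ hx0, e] at hn1
      rw [div_lt_iff₀ hx0, zpow_add_one₀ (by positivity), e] at hn2
      refine ⟨n, ?_⟩
      generalize l ^ n = p at *
      have h1 := mul_le_mul_of_nonneg_right hn1 hx0.le
      have h2 : ((p ^ 2)⁻¹ * y) ^ 2 ≤ l ^ 4 * |x * y| := by
        rw [show ((p ^ 2)⁻¹ * y) ^ 2 = |y| * |y| / p ^ 4 by rw [abs_mul_abs_self]; field_simp,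
          div_le_iff₀ (by positivity), abs_mul]
        linarith [mul_le_mul_of_nonneg_right hn2.le hy0.le]
      rw [abs_mul] at h2 ⊢
      rw [mul_pow, ← sq_abs x]
      linarith
    obtain ⟨s, hs⟩ := norm _ _ n00 n11
    obtain ⟨t, ht⟩ := norm _ _ n01 n10
    have hχ := pos hk hki
    have p1 : l ^ s ≠ 0 := zpow_ne_zero _ hl
    have p2 : l ^ t ≠ 0 := zpow_ne_zero _ hl
    refine ⟨_, mul_mem (mul_mem (zpow_mem hd.1 (s + t)) hk.1) (zpow_mem hd.1 (s - t)), ?_, ?_⟩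
    · simp only [χ, slDiag_zpow, sl_mul, slDiag_apply, zpow_add₀ hl, zpow_sub₀ hl]
      field_simp
      ring
    · rw [show k 0 0 * k 1 1 = -χ k by simp [χ], abs_neg, abs_of_pos hχ] at hs
      rw [show k 0 1 * k 1 0 = -(χ k + 1) by simp only [χ]; linear_combination -sl_det k, abs_neg,
        abs_of_pos (by linarith)] at ht
      have e : frob (slDiag l hl ^ (s + t) * k * slDiag l hl ^ (s - t)) =
          ((l ^ s) ^ 2 * k 0 0) ^ 2 + (((l ^ s) ^ 2)⁻¹ * k 1 1) ^ 2 +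
          (((l ^ t) ^ 2 * k 0 1) ^ 2 + (((l ^ t) ^ 2)⁻¹ * k 1 0) ^ 2) := by
        simp only [frob, slDiag_zpow, sl_mul, slDiag_apply, zpow_add₀ hl, zpow_sub₀ hl]
        field_simp
        ring
      have := mul_le_mul_of_nonneg_left hB (show 0 ≤ 1 + l ^ 4 by positivity)
      rw [e]
      linarith
  obtain ⟨k10, k11, k00, k01⟩ := hent hk hki
  have ek := sl_smul_infty k10
  have hkE := ek ▸ smul_mem_pEnds_of_stab h.smul h0 hk hEi
  refine ⟨k 0 0 / k 1 0, div_ne_zero k00 k10, hkE, fun g hg hlk => ?_⟩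
  rw [← ek, ← mul_smul] at hlk
  have hgk := mul_mem hg hk
  have hgi := hlk.ne13.symm
  have hgki := hlk.ne14.symm
  have hgik : (g⁻¹ * k) • infty ≠ infty := by
    rw [mul_smul, Ne, inv_smul_eq_iff]; exact hlk.ne23
  have hgkk : ((g * k)⁻¹ * k) • infty ≠ infty := by
    rw [mul_smul, Ne, inv_smul_eq_iff]; exact hlk.ne24
  obtain ⟨g10, g11, g00, g01⟩ := hent hg hgi
  obtain ⟨f10, f11, f00, f01⟩ := hent hgk hgki
  have same : ∀ {j : SL2R}, j ∈ plaqueStab h.smul h0 → j 1 0 ≠ 0 → j 0 0 ≠ 0 →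
      0 < k 0 0 / k 1 0 * (j 0 0 / j 1 0) := by
    intro j hj j10 j00
    have := mt Link.symm_left (not_link_of_pEnds h0 hkE
      (sl_smul_infty j10 ▸ smul_mem_pEnds_of_stab h.smul h0 hj hEi) hF0)
    rw [zero_eq, link_infty, not_lt, zero_sub, zero_sub, neg_mul_neg] at this
    exact lt_of_le_of_ne this (by positivity)
  have e : ∀ j : SL2R, j 1 0 ≠ 0 → j 1 1 ≠ 0 →
      χ j * (j 0 1 / j 1 1 - j 0 0 / j 1 0) = j 0 0 / j 1 0 := fun j h h' => by
    simp only [χ]; field_simp; linear_combination j 0 0 * sl_det j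
  have x := inv_mul_entries g10 g11 f10 f11
  rw [inv_mul_cancel_left, mul_comm (_ / _ - _ / _)] at x
  rw [ek, sl_smul_infty g10, sl_smul_infty f10, link_infty] at hlk
  exact false_of_uncrossing (pos hk hki) (pos hg hgi) (pos (mul_mem (inv_mem hgk) hk) hgkk)
    (hkmin _ ⟨mul_mem (inv_mem hg) hk, hgik⟩) (hkmin _ ⟨hgk, hgki⟩) (e k k10 k11) (e g g10 g11)
    (e _ f10 f11) (inv_mul_entries g10 g11 k10 k11) x (inv_mul_entries f10 f11 k10 k11)
    (same hg g10 g00) (same hgk f10 f00) hlk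

/-- The complementary regions of a maximal lamination have trivial stabilizers. -/
lemma eq_one_or_of_mem_stab (h0 : o ∉ leaves F) (hg : g ∈ Γ)
    (hg' : g • o ∈ plaque F o) : g = 1 ∨ g = -1 := by
  by_contra! hne
  obtain ⟨m, ⟨hm, hm1, hm2⟩, hmin⟩ := h.surf.exists_min_trace
    (S := {k | k ∈ plaqueStab h.smul h0 ∧ k ≠ 1 ∧ k ≠ -1}) (fun k hk => ⟨hk.1.1, hk.2⟩)
    ⟨g, ⟨hg, hg'⟩, hne.1, hne.2⟩
  obtain ⟨a, b, hab, ha, hb⟩ := h.surf.exists_fixed hm.1 hm1 hm2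
  obtain ⟨M, rfl, rfl⟩ := exists_sl_frame hab; have h' := h.conj M
  have hz : M⁻¹ • o ∉ leaves (fun a b => F (M • a) (M • b)) := by
    rw [leaves_conj, smul_inv_smul]; exact h0
  have hst : ∀ k : SL2R, k ∈ plaqueStab h'.smul hz ↔ M * k * M⁻¹ ∈ plaqueStab h.smul h0 := by
    intro k; rw [mem_plaqueStab, mem_plaqueStab, mem_conjSub, plaque_conj]
    simp only [mul_smul, smul_inv_smul]
  have e : M * (M⁻¹ * m * M) * M⁻¹ = m := by group
  have htr : sltr (M⁻¹ * m * M) = sltr m := by rw [← sltr_conj M, e]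
  obtain ⟨l, hl, hl1, hlΓ, hltr⟩ := exists_slDiag_mem (fun _ => h'.neg_mem_stab hz)
    ((hst _).mpr (e.symm ▸ hm)) (by rw [mul_smul, mul_smul, ha, inv_smul_smul])
    (by rw [mul_smul, mul_smul, hb, inv_smul_smul]) (htr ▸ h.surf.two_lt_trace hm.1 hm1 hm2)
  refine h'.false_of_diag_mem_stab hz hl1 hlΓ fun x hx hx1 hx2 => ?_
  have := hmin _ ⟨(hst x).mp hx, sl_conj_ne_one M hx1, sl_conj_ne_neg_one M hx2⟩
  rwa [sltr_conj, ← htr, hltr] at this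

/-- Any two ends of a complementary region of a maximal lamination are joined by a leaf. -/
lemma leaf_of_mem_pEnds (h0 : o ∉ leaves F) (hp : p ∈ pEnds F o)
    (hq : q ∈ pEnds F o) (hpq : p ≠ q) : F p q := by
  by_contra hn
  refine hn (h.maximal _ _ hpq (fun a b hab => not_link_of_pEnds h0 hp hq hab) fun g hg hlk => ?_)
  have hgs := mem_plaqueStab_of_link h.toIsGeodFamily h.smul h0 hp hq hn hg hlk
  rcases h.eq_one_or_of_mem_stab h0 hg hgs.2 with rfl | rfl
  exacts [hlk.ne13 (one_smul _ p).symm, hlk.ne13 (by rw [neg_sl_smul_proj, one_smul])]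

/-- The complementary regions of a maximal lamination have three ends. -/
lemma exists_vertices (h0 : o ∉ leaves F) :
    ∃ a b c : BdH2, a ≠ b ∧ b ≠ c ∧ c ≠ a ∧ pEnds F o = {a, b, c} := by
  obtain ⟨a, ha, b, hb, c, hc, hab, hac, hbc⟩ := exists_three_pEnds h.toIsGeodFamily h0
  refine ⟨a, b, c, hab, hbc, hac.symm, Set.Subset.antisymm (fun e he => ?_) ?_⟩
  · by_contra hn
    simp only [Set.mem_insert_iff, Set.mem_singleton_iff, not_or] at hn
    have L := fun {p q : BdH2} (hp : p ∈ pEnds F o) (hq : q ∈ pEnds F o) (hpq : p ≠ q) =>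
      h.leaf_of_mem_pEnds h0 hp hq hpq
    rcases link_or_link_or_link hab hac (Ne.symm hn.1) hbc (Ne.symm hn.2.1) (Ne.symm hn.2.2)
      with hl | hl | hl <;> exact h.unlinked (L ‹_› ‹_› hl.ne_left) (L ‹_› ‹_› hl.ne_right) hl
  · rintro x (rfl | rfl | rfl) <;> assumption

end PantsLam

/-! ### Ideal triangles -/

lemma continuous_side (a b c : BdH2) : Continuous fun z => side z a b c :=
  (continuous_hform _ _).mul continuous_const

/-- The closed ideal triangle of `ℍ` with vertices `a, b, c`. -/
def closedTri (a b c : BdH2) : Set ℍ := {z | 0 ≤ side z b c a ∧ 0 ≤ side z c a b ∧ 0 ≤ side z a b c}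

/-- The open ideal triangle of `ℍ` with vertices `a, b, c`. -/
def openTri (a b c : BdH2) : Set ℍ := {z | 0 < side z b c a ∧ 0 < side z c a b ∧ 0 < side z a b c}

lemma openTri_subset (a b c : BdH2) : openTri a b c ⊆ closedTri a b c :=
  fun _ h => ⟨h.1.le, h.2.1.le, h.2.2.le⟩

lemma isClosed_closedTri (a b c : BdH2) : IsClosed (closedTri a b c) :=
  (isClosed_le continuous_const (continuous_side _ _ _)).inter
    ((isClosed_le continuous_const (continuous_side _ _ _)).inter
      (isClosed_le continuous_const (continuous_side _ _ _)))

lemma isOpen_openTri (a b c : BdH2) : IsOpen (openTri a b c) :=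
  (isOpen_lt continuous_const (continuous_side _ _ _)).inter
    ((isOpen_lt continuous_const (continuous_side _ _ _)).inter
      (isOpen_lt continuous_const (continuous_side _ _ _)))

lemma smul_mem_closedTri (g : SL2R) (a b c : BdH2) (z : ℍ) :
    g • z ∈ closedTri (g • a) (g • b) (g • c) ↔ z ∈ closedTri a b c := by
  simp only [closedTri, Set.mem_ofPred_eq, side_smul_nonneg]

lemma smul_mem_openTri (g : SL2R) (a b c : BdH2) (z : ℍ) :
    g • z ∈ openTri (g • a) (g • b) (g • c) ↔ z ∈ openTri a b c := by
  simp only [openTri, Set.mem_ofPred_eq, side_smul_pos]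

lemma closedTri_rotate (a b c : BdH2) : closedTri a b c = closedTri b c a := by
  ext z; simp only [closedTri, Set.mem_ofPred_eq]; tauto

lemma closedTri_swap (a b c : BdH2) : closedTri a b c = closedTri b a c := by
  ext z
  simp only [closedTri, Set.mem_ofPred_eq, side_comm z b c, side_comm z c a, side_comm z a b]; tauto

/-- The barycentric coordinates of a point of `ℍ` with respect to three points at infinity. -/
lemma hform_eq_sides (z : ℍ) (hab : a ≠ b) (hbc : b ≠ c) (hca : c ≠ a) (v w : Fin 2 → ℝ) :
    hform z v w = side z b c a / (vdet a.rep b.rep * vdet c.rep a.rep) ^ 2 *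
        (vdet v a.rep * vdet w a.rep) +
      side z c a b / (vdet b.rep c.rep * vdet a.rep b.rep) ^ 2 * (vdet v b.rep * vdet w b.rep) +
      side z a b c / (vdet c.rep a.rep * vdet b.rep c.rep) ^ 2 * (vdet v c.rep * vdet w c.rep) := by
  have h1 := vdet_ne hab; have h2 := vdet_ne hbc; have h3 := vdet_ne hca
  rw [hform_expand_three z h1 h2 h3]; simp only [side]
  rw [vdet_swap b.rep a.rep, vdet_swap c.rep b.rep, vdet_swap a.rep c.rep]; field_simp

/-! ### Compactness -/

lemma cosh_dist_I (g : SL2R) :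
    cosh (dist (g • I) I) = frob g / 2 := by
  have h := sl_row_sq_pos g; rw [cosh_dist, Complex.dist_eq, ← normSq_eq_norm_sq, normSq_apply]
  simp only [sub_re, sub_im, coe_re, coe_im,
    re_sl_smul_I, im_sl_smul_I, UpperHalfPlane.I_re, UpperHalfPlane.I_im, frob]
  have hd := sl_det g; field_simp; linear_combination (-(g 0 0 * g 1 1 - g 0 1 * g 1 0) - 1) * hd

namespace IsSurfaceGroup

variable {Γ : Subgroup SL2R} (hΓ : IsSurfaceGroup Γ)
include hΓ

lemma finite_of_dist (R R' : ℝ) :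
    {g | g ∈ Γ ∧ ∃ z : ℍ, dist z I ≤ R ∧ dist (g • z) I ≤ R'}.Finite := by
  refine (hΓ.discrete (2 * cosh (R + R'))).subset ?_; rintro g ⟨hg, z, h1, h2⟩; refine ⟨hg, ?_⟩
  have h3 : dist (g • I) I ≤ R + R' := by
    have := dist_triangle (g • I) (g • z) I
    rw [dist_smul, dist_comm I z] at this; linarith
  have h4 := cosh_dist_I g
  have h5 : cosh (dist (g • I) I) ≤ cosh (R + R') :=
    cosh_le_cosh.mpr (by rw [abs_of_nonneg dist_nonneg]; exact h3.trans (le_abs_self _))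
  linarith

lemma finite_of_isCompact {K K' : Set ℍ} (hK : IsCompact K) (hK' : IsCompact K') :
    {g | g ∈ Γ ∧ ∃ z ∈ K, g • z ∈ K'}.Finite := by
  obtain ⟨R, hR⟩ := hK.isBounded.subset_closedBall I
  obtain ⟨R', hR'⟩ := hK'.isBounded.subset_closedBall I
  refine (hΓ.finite_of_dist R R').subset ?_; rintro g ⟨hg, z, hz, hz'⟩
  exact ⟨hg, z, hR hz, hR' hz'⟩

lemma exists_dist_le : ∃ R : ℝ, ∀ z : ℍ, ∃ g ∈ Γ, dist (g • z) I ≤ R := by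
  obtain ⟨R, hR⟩ := hΓ.cocompact; refine ⟨R, fun z => ?_⟩
  obtain ⟨m, hm⟩ := MulAction.exists_smul_eq SL2R I z; obtain ⟨g, hg, h⟩ := hR m
  refine ⟨g, hg, ?_⟩; rw [← hm, smul_smul]; have h1 := cosh_dist_I (g * m)
  set d := dist ((g * m) • I) I; have h2 := add_one_le_exp d
  have h3 := exp_pos (-d); rw [cosh_eq] at h1; linarith

lemma isClosed_orbit {K : Set ℍ} (hK : IsCompact K) : IsClosed {z | ∃ g ∈ Γ, g • z ∈ K} := by
  refine isClosed_of_closure_subset fun z hz => ?_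
  have hfin := hΓ.finite_of_isCompact (isCompact_closedBall z 1) hK
  set S := {g | g ∈ Γ ∧ ∃ w ∈ closedBall z 1, g • w ∈ K}
  have hcl : IsClosed (⋃ g ∈ S, {w : ℍ | g • w ∈ K}) :=
    hfin.isClosed_biUnion fun g _ => hK.isClosed.preimage (continuous_const_smul g)
  have hsub : {z | ∃ g ∈ Γ, g • z ∈ K} ∩ ball z 1 ⊆ ⋃ g ∈ S, {w : ℍ | g • w ∈ K} := by
    rintro w ⟨⟨g, hg, hw⟩, hw'⟩
    exact Set.mem_biUnion (show g ∈ S from ⟨hg, w, ball_subset_closedBall hw', hw⟩) hw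
  have h1 : z ∈ closure ({z | ∃ g ∈ Γ, g • z ∈ K} ∩ ball z 1) := by
    rw [Set.inter_comm]; exact isOpen_ball.inter_closure ⟨mem_ball_self one_pos, hz⟩
  have h2 := hcl.closure_subset_iff.mpr hsub h1; simp only [Set.mem_iUnion] at h2
  obtain ⟨g, hg, hw⟩ := h2; exact ⟨g, hg.1, hw⟩

end IsSurfaceGroup

lemma vdet_mul_ne_zero_of_three (hab : a ≠ b) (hbc : b ≠ c) (hca : c ≠ a) :
    vdet p.rep a.rep * vdet q.rep a.rep ≠ 0 ∨ vdet p.rep b.rep * vdet q.rep b.rep ≠ 0 ∨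
      vdet p.rep c.rep * vdet q.rep c.rep ≠ 0 := by
  by_contra! hcon; simp only [mul_eq_zero, ← eq_iff_vdet] at hcon; grind

namespace PantsLam

variable {Γ : Subgroup SL2R} {F P : Rel} (h : PantsLam Γ F P)
  {o : ℍ}
include h

lemma mem_openTri (h0 : o ∉ leaves F) (hab : a ≠ b) (hbc : b ≠ c) (hca : c ≠ a)
    (hE : pEnds F o = {a, b, c}) : o ∈ openTri a b c := by
  have ha : a ∈ pEnds F o := by simp [hE]
  have hb : b ∈ pEnds F o := by simp [hE]
  have hc : c ∈ pEnds F o := by simp [hE]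
  have key : ∀ {x y w : BdH2}, x ∈ pEnds F o → y ∈ pEnds F o → w ∈ pEnds F o →
      x ≠ y → y ≠ w → w ≠ x → 0 < side o x y w := by
    intro x y w hx hy hw hxy hyw hwx; have hF := h.leaf_of_mem_pEnds h0 hx hy hxy
    refine lt_of_le_of_ne (hw x y hF) fun h' => h0 ⟨x, y, hF, ?_⟩
    exact (side_eq_zero_iff hwx.symm hyw).mp h'.symm
  exact ⟨key hb hc ha hbc hca hab, key hc ha hb hca hab hbc, key ha hb hc hab hbc hca⟩

lemma plaque_eq_openTri (h0 : o ∉ leaves F) (hab : a ≠ b) (hbc : b ≠ c)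
    (hca : c ≠ a) (hE : pEnds F o = {a, b, c}) : plaque F o = openTri a b c := by
  have ha : a ∈ pEnds F o := by simp [hE]
  have hb : b ∈ pEnds F o := by simp [hE]
  have hc : c ∈ pEnds F o := by simp [hE]
  apply Set.Subset.antisymm
  · intro z hz
    exact h.mem_openTri (notMem_of_mem_plaque hz) hab hbc hca ((pEnds_eq_of_mem hz).trans hE)
  · rintro z ⟨s, t, u⟩ p q hpq
    rw [hform_eq_sides z hab hbc hca]
    have h1 := vdet_ne hab
    have h2 := vdet_ne hbc
    have h3 := vdet_ne hca
    have s' : 0 < side z b c a / (vdet a.rep b.rep * vdet c.rep a.rep) ^ 2 := by positivity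
    have t' : 0 < side z c a b / (vdet b.rep c.rep * vdet a.rep b.rep) ^ 2 := by positivity
    have u' : 0 < side z a b c / (vdet c.rep a.rep * vdet b.rep c.rep) ^ 2 := by positivity
    have pa := ha p q hpq
    have pb := hb p q hpq
    have pc := hc p q hpq
    have hx := hform_ne_zero h0 hpq
    have hn := vdet_mul_ne_zero_of_three (p := p) (q := q) hab hbc hca
    unfold side at pa pb pc
    generalize side z b c a / (vdet a.rep b.rep * vdet c.rep a.rep) ^ 2 = S at *
    generalize side z c a b / (vdet b.rep c.rep * vdet a.rep b.rep) ^ 2 = T at *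
    generalize side z a b c / (vdet c.rep a.rep * vdet b.rep c.rep) ^ 2 = U at *
    have m1 := mul_nonneg s'.le pa
    have m2 := mul_nonneg t'.le pb
    have m3 := mul_nonneg u'.le pc
    rcases hn with hn | hn | hn
    · linarith [mul_pos s' (lt_of_le_of_ne pa (mul_ne_zero hx hn).symm)]
    · linarith [mul_pos t' (lt_of_le_of_ne pb (mul_ne_zero hx hn).symm)]
    · linarith [mul_pos u' (lt_of_le_of_ne pc (mul_ne_zero hx hn).symm)]

end PantsLam

/-- Every ideal triangle is the image of the one with vertices `0, ∞, 1` or `0, ∞, -1`. -/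
lemma exists_sl_frame_three (hab : a ≠ b) (hbc : b ≠ c) (hca : c ≠ a) :
    ∃ (M : SL2R) (σ : ℝ), (σ = 1 ∨ σ = -1) ∧ M • zero = a ∧ M • infty = b ∧
      M • ofReal σ = c := by
  obtain ⟨M, rfl, rfl⟩ := exists_sl_frame hab
  have h1 : M⁻¹ • c ≠ infty := fun h' => hbc (by rw [← h', smul_inv_smul])
  obtain ⟨t, ht⟩ := exists_ofReal h1
  have ht0 : t ≠ 0 := fun h' => hca (by rw [zero_eq, ← h', ← ht, smul_inv_smul])
  have hs : 0 < √|t| := sqrt_pos.mpr (abs_pos.mpr ht0)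
  refine ⟨M * slDiag (√|t|) hs.ne', t / |t|, ?_, ?_, ?_, ?_⟩
  · rcases abs_cases t with ⟨e, -⟩ | ⟨e, -⟩ <;> rw [e]
    · left; field_simp
    · right; field_simp
  · rw [mul_smul, slDiag_smul_zero]
  · rw [mul_smul, slDiag_smul_infty]
  · rw [mul_smul, slDiag_smul_ofReal, sq_sqrt (abs_nonneg t), mul_div_cancel₀ _ (abs_ne_zero.mpr ht0),
      ← ht, smul_inv_smul]

lemma exists_rep_expr (z : ℍ) {u v : Fin 2 → ℝ} (hu : u ≠ 0) (hv : v ≠ 0) (w : Fin 2 → ℝ) :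
    ∃ t : ℝ, 0 < t ∧ hform z (mk ℝ u hu).rep (mk ℝ v hv).rep *
      (vdet (mk ℝ u hu).rep w * vdet (mk ℝ v hv).rep w) =
      t * (hform z u v * (vdet u w * vdet v w)) := by
  obtain ⟨s, hs, e1⟩ := exists_rep_mk u hu; obtain ⟨t, ht, e2⟩ := exists_rep_mk v hv
  refine ⟨(s * t) ^ 2, by positivity, ?_⟩
  simp only [e1, e2, hform_smul_left, hform_smul_right, vdet_smul_left]; ring

lemma side_mk_pos (z : ℍ) {u v w : Fin 2 → ℝ} (hu : u ≠ 0) (hv : v ≠ 0) (hw : w ≠ 0) :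
    0 < side z (mk ℝ u hu) (mk ℝ v hv)
      (mk ℝ w hw) ↔ 0 < hform z u v * (vdet u w * vdet v w) := by
  obtain ⟨s, hs, e1⟩ := exists_rep_mk w hw; obtain ⟨t, ht, e2⟩ := exists_rep_expr z hu hv w
  rw [side, e1, vdet_smul_right, vdet_smul_right, mul_mul_mul_comm, mul_left_comm, e2,
    mul_pos_iff_of_pos_left (mul_self_pos.mpr hs), mul_pos_iff_of_pos_left ht]

lemma exists_mem_openTri_model {σ : ℝ} (hσ : σ = 1 ∨ σ = -1) :
    ∃ z, z ∈ openTri zero infty (ofReal σ) := by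
  refine ⟨⟨⟨σ / 2, 1⟩, by simp⟩, ?_⟩
  simp only [openTri, Set.mem_ofPred_eq, zero, infty, ofReal, side_mk_pos, hform, vdet]
  rcases hσ with rfl | rfl <;> norm_num [UpperHalfPlane.re, UpperHalfPlane.im]

/-- Ideal triangles have a uniformly positive inradius. -/
lemma exists_inradius : ∃ ε > 0, ∀ a b c : BdH2, a ≠ b → b ≠ c → c ≠ a →
    ∃ z, ball z ε ⊆ openTri a b c := by
  have key : ∀ σ : ℝ, (σ = 1 ∨ σ = -1) → ∃ ε > 0, ∃ z,
      ball z ε ⊆ openTri zero infty (ofReal σ) := by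
    intro σ hσ; obtain ⟨z, hz⟩ := exists_mem_openTri_model hσ
    obtain ⟨ε, hε, h⟩ := isOpen_iff.mp (isOpen_openTri _ _ _) z hz; exact ⟨ε, hε, z, h⟩
  obtain ⟨ε1, h1, z1, hz1⟩ := key 1 (Or.inl rfl); obtain ⟨ε2, h2, z2, hz2⟩ := key (-1) (Or.inr rfl)
  have key2 : ∀ σ : ℝ, (σ = 1 ∨ σ = -1) → ∃ z,
      ball z (min ε1 ε2) ⊆ openTri zero infty (ofReal σ) := by
    rintro σ (rfl | rfl)
    exacts [⟨z1, (ball_subset_ball (min_le_left _ _)).trans hz1⟩,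
      ⟨z2, (ball_subset_ball (min_le_right _ _)).trans hz2⟩]
  refine ⟨min ε1 ε2, lt_min h1 h2, fun a b c hab hbc hca => ?_⟩
  obtain ⟨M, σ, hσ, rfl, rfl, rfl⟩ := exists_sl_frame_three hab hbc hca; obtain ⟨z, hz⟩ := key2 σ hσ
  refine ⟨M • z, fun w hw => ?_⟩; rw [← smul_inv_smul M w, smul_mem_openTri]; apply hz
  rw [mem_ball] at hw ⊢; rwa [← dist_smul M, smul_inv_smul]

namespace PantsLam

variable {Γ : Subgroup SL2R} {F P : Rel} (h : PantsLam Γ F P)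
  {o : ℍ}
include h

/-- There are finitely many plaques modulo the group, because their incentres are uniformly
separated from each other. -/
lemma exists_finite_plaques : ∃ Z : Set ℍ, Z.Finite ∧ (∀ z ∈ Z, z ∉ leaves F) ∧
    ∀ z ∉ leaves F, ∃ g ∈ Γ, ∃ z' ∈ Z, g • z ∈ plaque F z' := by
  obtain ⟨ε, hε, hin⟩ := exists_inradius
  obtain ⟨R, hR⟩ := h.surf.exists_dist_le
  obtain ⟨t, -, htf, ht⟩ := (isCompact_closedBall I R).finite_cover_balls (half_pos hε)
  let Q : ℍ → ℍ → Prop := fun x z => z ∉ leaves F ∧ ball z ε ⊆ plaque F z ∧ dist z x < ε / 2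
  classical
  let f : ℍ → ℍ := fun x => if hx : ∃ z, Q x z then hx.choose else x
  have hf : ∀ x, (∃ z, Q x z) → Q x (f x) := fun x hx => by
    simp only [f, dif_pos hx]; exact hx.choose_spec
  refine ⟨f '' {x ∈ t | ∃ z, Q x z}, (htf.subset (Set.sep_subset _ _)).image f, ?_, ?_⟩
  · rintro _ ⟨x, ⟨-, hx⟩, rfl⟩
    exact (hf x hx).1
  · intro z hz
    obtain ⟨a, b, c, hab, hbc, hca, hE⟩ := h.exists_vertices hz
    obtain ⟨m, hm⟩ := hin a b c hab hbc hca
    rw [← h.plaque_eq_openTri hz hab hbc hca hE] at hm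
    obtain ⟨g, hg, hgm⟩ := hR m
    have hm0 : m ∈ plaque F z := hm (mem_ball_self hε)
    have hm1 : g • m ∈ plaque F (g • z) := smul_mem_plaque h.smul hg hm0
    have hball : ball (g • m) ε ⊆ plaque F (g • m) := by
      intro w hw
      rw [plaque_eq_of_mem hm1, ← smul_inv_smul g w]
      refine smul_mem_plaque h.smul hg (hm ?_)
      rw [mem_ball] at hw ⊢
      rwa [← dist_smul g, smul_inv_smul]
    obtain ⟨x, hx, hxm⟩ : ∃ x ∈ t, g • m ∈ ball x (ε / 2) := by
      simpa using ht (show g • m ∈ closedBall I R from hgm)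
    have hQ : ∃ w, Q x w := ⟨g • m, notMem_of_mem_plaque hm1, hball, hxm⟩
    obtain ⟨q1, q2, q3⟩ := hf x hQ
    refine ⟨g, hg, f x, ⟨x, ⟨hx, hQ⟩, rfl⟩, ?_⟩
    have h3 : g • m ∈ plaque F (f x) := q2 (by
      rw [mem_ball] at hxm ⊢
      have := dist_triangle_right (g • m) (f x) x
      linarith)
    rw [← plaque_eq_of_mem h3, plaque_eq_of_mem hm1]
    exact mem_plaque_self (notMem_of_mem_plaque (mem_plaque_comm.mp hm1))

lemma P_ne (hab : P a b) : a ≠ b := h.ne (h.P_sub hab)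

/-- An end of a closed leaf determines the leaf. -/
lemma P_unique (hab : P a b) (hac : P a c) : b = c := by
  obtain ⟨g, hg, g1, g2, ga, gb⟩ := h.P_closed hab; obtain ⟨k, hk, k1, k2, ka, kc⟩ := h.P_closed hac
  by_contra hbc
  exact (eq_one_or_of_three (h.P_ne hab) (h.P_ne hac) hbc ka
    (h.surf.fixes_of_fixes hg hk g1 g2 (h.P_ne hab) ga gb ka) kc).elim k1 k2

/-- Near a closed leaf `(0, ∞)`, that is, over `z.re > 0` above the line of slope `l`, there is no
leaf `(a, b)` with `0 < a < b < ∞`: it would cross its image under the holonomy of the closed leaf,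
unless `b ≤ l² a`. So near the closed leaf all plaques, and all leaves, have an end `0` or `∞`. -/
lemma exists_plaque_at_end_of_diag {l : ℝ} {hl : l ≠ 0} (hl1 : 1 < l) (hd : slDiag l hl ∈ Γ)
    (hP : P zero infty) :
    ∃ z ∉ leaves F, zero ∈ pEnds F z ∨ infty ∈ pEnds F z := by
  have hF := h.P_sub hP
  obtain ⟨g, hg, g1, g2, g0, gi⟩ := h.P_closed hP
  obtain ⟨p, q, hp, hpq, hFpq⟩ : ∃ p q : ℝ, 0 < p ∧ p < q ∧ F (ofReal p) (ofReal q) := by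
    obtain ⟨k, hk, p, q, hp, hq, e1, e2⟩ := h.surf.exists_translate_of_side hg g1 g2 g0 gi
      (fun k hk => h.unlinked hF (h.smul k hk _ _ hF)) (σ := 1) (by norm_num)
    have h1 := h.smul k hk _ _ hF
    rw [e1, e2] at h1
    rcases lt_or_gt_of_ne (show p ≠ q by rintro rfl; exact h.ne h1 rfl) with h' | h'
    · exact ⟨p, q, by linarith, h', h1⟩
    · exact ⟨q, p, by linarith, h', h.symm h1⟩
  have hform_eq : ∀ (z : ℍ) (a b : ℝ),
      hform z ![a, 1] ![b, 1] = ((a - z.re) * (b - z.re) + z.im ^ 2) / z.im := by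
    intro z a b; simp [hform]; ring
  have hleaf : ∀ {z : ℍ}, 0 < z.re → l * z.re ≤ z.im → ∀ {a b : ℝ}, 0 < a → 0 < b →
      F (ofReal a) (ofReal b) → 0 < hform z ![a, 1] ![b, 1] := by
    intro z hx hy a b ha hb hab
    wlog hlt : a < b generalizing a b
    · rw [hform_comm]
      refine this hb ha (h.symm hab) (lt_of_le_of_ne (not_lt.mp hlt) ?_)
      rintro rfl; exact h.ne hab rfl
    have hba : b ≤ l ^ 2 * a := by
      have h5 := h.unlinked hab (h.smul _ hd _ _ hab)
      rw [slDiag_smul_ofReal, slDiag_smul_ofReal, link_ofReal] at h5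
      by_contra! h6
      have hl2 : 1 < l ^ 2 := one_lt_pow₀ hl1 two_ne_zero
      nlinarith [mul_pos (mul_pos (show 0 < l ^ 2 * a - a by nlinarith) (sub_pos.mpr h6))
        (mul_pos (show 0 < l ^ 2 * b - b by nlinarith) (show 0 < l ^ 2 * b - a by nlinarith))]
    rw [hform_eq]
    refine div_pos ?_ z.im_pos
    have h7 : (l * z.re) ^ 2 ≤ z.im ^ 2 := pow_le_pow_left₀ (by positivity) hy 2
    have h8 : 0 < (l * z.re) ^ 2 := by positivity
    by_contra! hneg
    have hax : a < z.re := by by_contra!; nlinarith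
    have h9 : b - z.re < l ^ 2 * z.re := by nlinarith
    nlinarith [mul_pos (sub_pos.mpr hax) (sub_pos.mpr h9), mul_pos ha (show 0 < l ^ 2 * z.re by positivity)]
  have hon : ∀ {z : ℍ}, 0 < z.re → l * z.re ≤ z.im → z ∈ leaves F →
      F infty (ofReal z.re) ∨
        F zero (ofReal ((z.re ^ 2 + z.im ^ 2) / z.re)) := by
    rintro z hx hy ⟨a, b, hab, hz⟩
    have hinf : ∀ b, F infty (ofReal b) → z ∈ geod infty (ofReal b) → b = z.re := by
      intro b hb hz
      have := (mem_geod_mk _ _ _).mp hz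
      simp [hform, z.im_ne_zero] at this
      linarith
    rcases eq_infty_or a with rfl | ⟨a, rfl⟩
    · obtain ⟨b, rfl⟩ := exists_ofReal (h.ne hab).symm
      exact Or.inl (hinf b hab hz ▸ hab)
    rcases eq_infty_or b with rfl | ⟨b, rfl⟩
    · exact Or.inl (hinf a (h.symm hab) (by rwa [geod_comm]) ▸ h.symm hab)
    have hn := h.unlinked (h.symm hF) hab
    have hz' := (mem_geod_mk _ _ _).mp hz
    have hz2 := hz'
    rw [hform_eq, div_eq_zero_iff, or_iff_left z.im_ne_zero] at hz2
    rw [zero_eq, link_infty, not_lt] at hn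
    have hend : ∀ b : ℝ, -z.re * (b - z.re) + z.im ^ 2 = 0 → (z.re ^ 2 + z.im ^ 2) / z.re = b :=
      fun b hb => by rw [div_eq_iff hx.ne']; linarith
    by_cases ha : a = 0
    · subst ha; right; rwa [hend b (by linarith)]
    by_cases hb : b = 0
    · subst hb; right; rw [hend a (by linarith)]; exact h.symm hab
    have hpos : 0 < a * b := lt_of_le_of_ne (by linarith) (by positivity)
    rcases pos_and_pos_or_neg_and_neg_of_mul_pos hpos with ⟨ha, hb⟩ | ⟨ha, hb⟩
    · exact absurd hz' (hleaf hx hy ha hb hab).ne'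
    · nlinarith [mul_pos (show 0 < z.re - a by linarith) (show 0 < z.re - b by linarith), z.im_pos]
  by_contra! hcon
  have hcov : ∀ {z : ℍ}, 0 < z.re → l * z.re ≤ z.im → z ∈ leaves F := by
    intro z hx hy
    by_contra hz
    have hend : ∀ c ∈ pEnds F z, ∃ t : ℝ, 0 < t ∧ c = ofReal t := by
      intro c hc
      obtain ⟨t, rfl⟩ := exists_ofReal fun h' : c = _ => (hcon z hz).2 (h' ▸ hc)
      have ht : t ≠ 0 := by rintro rfl; exact (hcon z hz).1 hc
      refine ⟨t, ?_, rfl⟩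
      have h1 := lt_of_le_of_ne (hc _ _ hF) (Ne.symm (mul_ne_zero (hform_ne_zero hz hF)
        (mul_ne_zero (vdet_ne fun h' => ht (BdH2.ofReal_inj.mp h').symm)
          (vdet_ne (ofReal_ne_infty t).symm))))
      rw [zero, infty, ofReal, side_mk_pos, show hform z ![0, 1] ![1, 0] *
        (vdet ![0, 1] ![t, 1] * vdet ![1, 0] ![t, 1]) = z.re / z.im * t by
          simp [hform, vdet]; ring] at h1
      exact pos_of_mul_pos_right h1 (div_pos hx z.im_pos).le
    obtain ⟨a, b, c, hab, hbc, hca, hE⟩ := h.exists_vertices hz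
    have L := fun {p q : BdH2} => h.leaf_of_mem_pEnds (p := p) (q := q) hz
    obtain ⟨s1, s2, s3⟩ := h.mem_openTri hz hab hbc hca hE
    rw [hE] at hend L
    obtain ⟨a, ha, rfl⟩ := hend a (by simp)
    obtain ⟨b, hb, rfl⟩ := hend b (by simp)
    obtain ⟨c, hc, rfl⟩ := hend c (by simp)
    have h1 := hleaf hx hy ha hb (L (by simp) (by simp) hab)
    have h2 := hleaf hx hy hb hc (L (by simp) (by simp) hbc)
    have h3 := hleaf hx hy hc ha (L (by simp) (by simp) hca)
    rw [ofReal, ofReal, ofReal, side_mk_pos, mul_pos_iff_of_pos_left ‹_›] at s1 s2 s3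
    simp [vdet] at s1 s2 s3
    nlinarith [mul_pos (mul_pos s1 s2) s3, sq_nonneg ((a - b) * (b - c) * (c - a))]
  have hm : 0 < (p + q) / 2 := by linarith
  have hm1 : p < (p + q) / 2 := by linarith
  have hm2 : (p + q) / 2 < q := by linarith
  have hl0 : 0 < l := by linarith
  generalize (p + q) / 2 = m at *
  have hr : 0 < m / (1 + l ^ 2) := by positivity
  let z1 : ℍ := ⟨⟨m, l * m⟩, by simp; positivity⟩
  let z2 : ℍ := ⟨⟨m / (1 + l ^ 2), l * (m / (1 + l ^ 2))⟩, by simp; positivity⟩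
  have c₁ := hon (z := z1) hm le_rfl (hcov (z := z1) hm le_rfl)
  have c₂ := hon (z := z2) hr le_rfl (hcov (z := z2) hr le_rfl)
  have x1 : z1.re = m := rfl
  have y1 : z1.im = l * m := rfl
  have x2 : z2.re = m / (1 + l ^ 2) := rfl
  have y2 : z2.im = l * (m / (1 + l ^ 2)) := rfl
  rw [x1, y1, show (m ^ 2 + (l * m) ^ 2) / m = (1 + l ^ 2) * m by field_simp] at c₁
  rw [x2, y2, show ((m / (1 + l ^ 2)) ^ 2 + (l * (m / (1 + l ^ 2))) ^ 2) / (m / (1 + l ^ 2)) = m by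
    field_simp] at c₂
  have d₁ := c₁.resolve_left fun h' => h.unlinked h' hFpq (by rw [link_infty]; nlinarith)
  have d₂ := c₂.resolve_right fun h' => h.unlinked h' hFpq (by
    rw [zero_eq, link_ofReal]
    nlinarith [mul_pos (mul_pos hp (sub_pos.mpr hm1)) (mul_pos (hp.trans hpq) (sub_pos.mpr hm2))])
  refine h.unlinked d₂ d₁ ?_
  rw [zero_eq, link_infty]
  have : m / (1 + l ^ 2) < (1 + l ^ 2) * m := by
    rw [div_lt_iff₀ (by positivity)]
    nlinarith [mul_pos hm (sq_pos_of_pos hl0), mul_pos hm (sq_pos_of_pos (sq_pos_of_pos hl0))]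
  nlinarith

/-- Every closed leaf has an end that is an ideal vertex of a plaque: some plaque spirals
towards it. -/
lemma exists_plaque_at_end (hP : P a b) :
    ∃ z ∉ leaves F, a ∈ pEnds F z ∨ b ∈ pEnds F z := by
  obtain ⟨g, hg, g1, g2, ga, gb⟩ := h.P_closed hP
  obtain ⟨M, l, hl, rfl, rfl, hl1, hd, -⟩ := h.surf.exists_generator hg g1 g2 (h.P_ne hP) ga gb
  obtain ⟨z, hz, hE⟩ := (h.conj M).exists_plaque_at_end_of_diag (hl := hl) hl1
    (mem_conjSub.mpr hd) hP
  refine ⟨M • z, by rwa [leaves_conj] at hz, ?_⟩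
  have key : ∀ c, c ∈ pEnds (fun a b => F (M • a) (M • b)) z → M • c ∈ pEnds F (M • z) := by
    intro c hc a b hab; have := hc (M⁻¹ • a) (M⁻¹ • b) (by simpa using hab)
    have e := side_smul_nonneg M z (M⁻¹ • a) (M⁻¹ • b) c; rw [smul_inv_smul, smul_inv_smul] at e
    exact e.mpr this
  exact hE.imp (key _) (key _)

/-- There are finitely many closed leaves modulo the group. -/
lemma exists_finite_P : ∃ J : Set (BdH2 × BdH2), J.Finite ∧ (∀ j ∈ J, P j.1 j.2) ∧
    ∀ a b, P a b → ∃ g ∈ Γ, (g • a, g • b) ∈ J ∨ (g • b, g • a) ∈ J := by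
  obtain ⟨Z, hZ, hZ', hcov⟩ := h.exists_finite_plaques
  refine ⟨⋃ z ∈ Z, ⋃ x ∈ pEnds F z, {j | j.1 = x ∧ P j.1 j.2}, ?_, ?_, ?_⟩
  · refine hZ.biUnion fun z hz => ?_
    obtain ⟨a, b, c, -, -, -, hE⟩ := h.exists_vertices (hZ' z hz)
    refine Set.Finite.biUnion (by rw [hE]; simp) fun x _ => Set.Subsingleton.finite ?_
    rintro ⟨a, b⟩ ⟨rfl, h1⟩ ⟨a', b'⟩ ⟨h2, h3⟩
    simp only at h2 h3 h1
    subst h2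
    rw [h.P_unique h1 h3]
  · intro j hj
    simp only [Set.mem_iUnion] at hj
    obtain ⟨z, -, x, -, hx⟩ := hj
    exact hx.2
  · intro a b hab
    obtain ⟨z, hz, hE⟩ := h.exists_plaque_at_end hab
    obtain ⟨g, hg, z', hz', hgz⟩ := hcov z hz
    have key : ∀ c e, P c e → c ∈ pEnds F z →
        (g • c, g • e) ∈ ⋃ z ∈ Z, ⋃ x ∈ pEnds F z, {j : BdH2 × BdH2 | j.1 = x ∧ P j.1 j.2} := by
      intro c e hce hc
      have := smul_mem_pEnds h.smul hg hc
      rw [pEnds_eq_of_mem hgz] at this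
      exact Set.mem_biUnion hz' (Set.mem_biUnion this ⟨rfl, h.P_smul g hg _ _ hce⟩)
    rcases hE with hE | hE
    · exact ⟨g, hg, Or.inl (key _ _ hab hE)⟩
    · exact ⟨g, hg, Or.inr (key _ _ (h.P_symm hab) hE)⟩

end PantsLam

/-! ### Local finiteness of ideal triangles spiralling towards closed leaves -/

lemma dist_I_le (z : ℍ) :
    dist z I ≤ hform z ![1, 0] ![1, 0] + hform z ![0, 1] ![0, 1] := by
  have e : 2 * cosh (dist z I) =
      hform z ![1, 0] ![1, 0] + hform z ![0, 1] ![0, 1] := by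
    have := z.im_pos; rw [cosh_dist, Complex.dist_eq, ← normSq_eq_norm_sq, normSq_apply]
    simp only [sub_re, sub_im, coe_re, coe_im, UpperHalfPlane.I_re, UpperHalfPlane.I_im, hform]
    simp; field_simp; ring
  rw [← e, cosh_eq]; have h2 := add_one_le_exp (dist z I)
  have h3 := exp_pos (-dist z I); linarith

lemma slDiag_smul_I_re_im (l : ℝ) (hl : l ≠ 0) (z : ℍ) :
    (slDiag l hl • z).re = l ^ 2 * z.re ∧ (slDiag l hl • z).im = l ^ 2 * z.im := by
  rw [specialLinearGroup_apply]; have e1 : (slDiag l hl : Matrix (Fin 2) (Fin 2) ℝ) 0 0 = l := rfl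
  have e2 : (slDiag l hl : Matrix (Fin 2) (Fin 2) ℝ) 0 1 = 0 := rfl
  have e3 : (slDiag l hl : Matrix (Fin 2) (Fin 2) ℝ) 1 0 = 0 := rfl
  have e4 : (slDiag l hl : Matrix (Fin 2) (Fin 2) ℝ) 1 1 = l⁻¹ := rfl; simp only [e1, e2, e3, e4]
  constructor <;> simp [mk_re, mk_im] <;> ring

lemma exists_dist_mul_le (w : ℍ) (hab : a ≠ b) :
    ∃ z ∈ geod a b, dist w z * |vdet a.rep b.rep| ≤ |hform w a.rep b.rep| := by
  obtain ⟨M, rfl, rfl⟩ := exists_sl_frame hab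
  obtain ⟨s, -, e1⟩ := exists_rep_smul M zero
  obtain ⟨t, -, e2⟩ := exists_rep_smul M infty
  obtain ⟨s', -, e3⟩ := exists_rep_mk (K := ℝ) ![0, 1] (by simp)
  obtain ⟨t', -, e4⟩ := exists_rep_mk (K := ℝ) ![1, 0] (by simp)
  obtain ⟨w, rfl⟩ : ∃ w', w = M • w' := ⟨M⁻¹ • w, (smul_inv_smul M w).symm⟩
  have hw := w.im_pos
  have hz : 0 < (⟨0, w.im⟩ : ℂ).im := hw
  refine ⟨M • ⟨⟨0, w.im⟩, hz⟩, ?_, ?_⟩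
  · rw [smul_mem_geod, mem_geod_zero_infty]
    rfl
  · rw [e1, e2, zero, infty, e3, e4]
    simp only [dist_smul, hform_smul_left, hform_smul_right, vdet_smul_left, vdet_smul_right,
      hform_sl_smul, vdet_sl_smul, smul_comm M]
    have h1 : dist w ⟨⟨0, w.im⟩, hz⟩ ≤ |w.re| / w.im := by
      refine (dist_le_dist_coe_div_sqrt _ _).trans_eq ?_
      have : (⟨⟨0, w.im⟩, hz⟩ : ℍ).im = w.im := rfl
      rw [this, sqrt_mul_self hw.le, Complex.dist_eq]
      congr 1
      have e : ((w : ℂ) - ((⟨⟨0, w.im⟩, hz⟩ : ℍ) : ℂ)) = (w.re : ℂ) := by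
        apply Complex.ext <;> simp
      rw [e, Complex.norm_real, norm_eq_abs]
    have h2 : hform w ![0, 1] ![1, 0] = -w.re / w.im := by simp [hform]
    have h3 : vdet (![0, 1] : Fin 2 → ℝ) ![1, 0] = -1 := by simp [vdet]
    rw [h2, h3]
    have h4 : |w.re| / w.im = |-w.re / w.im| := by rw [abs_div, abs_neg, abs_of_pos hw]
    rw [h4] at h1
    rw [abs_mul t, abs_mul t', abs_mul s, abs_mul s', abs_mul t, abs_mul t', abs_mul s, abs_mul s',
      abs_neg, abs_one, mul_one]
    calc dist w ⟨⟨0, w.im⟩, hz⟩ * (|t| * (|t'| * (|s| * |s'|)))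
        ≤ |-w.re / w.im| * (|t| * (|t'| * (|s| * |s'|))) := by gcongr
      _ = _ := by ring

namespace PantsLam

variable {Γ : Subgroup SL2R} {F P : Rel} (h : PantsLam Γ F P)
  {o : ℍ}
include h

lemma exists_compact_segment (hP : P a b) :
    ∃ K : Set ℍ, IsCompact K ∧ K ⊆ geod a b ∧ ∀ z ∈ geod a b, ∃ k ∈ Γ, k • z ∈ K := by
  obtain ⟨g, hg, g1, g2, ga, gb⟩ := h.P_closed hP
  obtain ⟨M, l, hl, rfl, rfl, hl1, hd, -⟩ := h.surf.exists_generator hg g1 g2 (h.P_ne hP) ga gb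
  have hl2 : 1 < l ^ 2 := one_lt_pow₀ hl1 two_ne_zero
  refine ⟨geod (M • zero) (M • infty) ∩ closedBall (M • I) (log (l ^ 2)),
    (isCompact_closedBall _ _).inter_left ?_, Set.inter_subset_left, fun z hz => ?_⟩
  · exact isClosed_eq (continuous_hform _ _) continuous_const
  · obtain ⟨z, rfl⟩ : ∃ w, z = M • w := ⟨M⁻¹ • z, (smul_inv_smul M z).symm⟩
    rw [smul_mem_geod, mem_geod_zero_infty] at hz
    obtain ⟨n, hn1, hn2⟩ := exists_mem_Ico_zpow z.im_pos hl2
    refine ⟨(M * slDiag l hl * M⁻¹) ^ (-n), Γ.zpow_mem hd _, ?_⟩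
    have e : (M * slDiag l hl * M⁻¹) ^ (-n) • M • z = M • (slDiag l hl ^ (-n)) • z := by
      rw [conj_zpow, mul_smul, mul_smul, inv_smul_smul]
    rw [e, slDiag_zpow]; obtain ⟨h1, h2⟩ := slDiag_smul_I_re_im (l ^ (-n)) (zpow_ne_zero _ hl) z
    refine ⟨?_, ?_⟩
    · rw [smul_mem_geod, mem_geod_zero_infty, h1, hz, mul_zero]
    · rw [mem_closedBall, dist_smul, UpperHalfPlane.dist_of_re_eq (by rw [h1, hz, mul_zero]; rfl),
        UpperHalfPlane.I_im, Real.log_one, Real.dist_eq, sub_zero, h2]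
      have e3 : (l ^ (-n)) ^ 2 = ((l ^ 2) ^ n)⁻¹ := by
        rw [zpow_neg, inv_pow, ← zpow_natCast, zpow_comm, zpow_natCast]
      have hp : 0 < (l ^ 2) ^ n := by positivity
      rw [e3, ← div_eq_inv_mul]; have k1 : 1 ≤ z.im / (l ^ 2) ^ n := (one_le_div hp).mpr hn1
      have k2 : z.im / (l ^ 2) ^ n ≤ l ^ 2 := by
        rw [div_le_iff₀ hp]; rw [zpow_add_one₀ (by positivity)] at hn2; linarith
      rw [abs_of_nonneg (log_nonneg k1)]; exact log_le_log (by linarith) k2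

/-- The union of the lifts of the closed leaves is closed. -/
lemma isClosed_leaves_P : IsClosed (leaves P) := by
  obtain ⟨J, hJ, hJP, hcov⟩ := h.exists_finite_P
  choose K hK1 hK2 hK3 using fun j : J => h.exists_compact_segment (hJP j j.2)
  have := hJ.to_subtype
  have e : leaves P = ⋃ j : J, {z | ∃ g ∈ Γ, g • z ∈ K j} := by
    ext z
    simp only [Set.mem_iUnion, Set.mem_ofPred_eq]
    constructor
    · rintro ⟨a, b, hab, hz⟩
      obtain ⟨g, hg, hj⟩ := hcov a b hab
      have key : ∀ j : J, g • z ∈ geod j.1.1 j.1.2 → ∃ j, ∃ g ∈ Γ, g • z ∈ K j := by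
        intro j hj
        obtain ⟨k, hk, hkz⟩ := hK3 j _ hj
        exact ⟨j, k * g, Γ.mul_mem hk hg, by rwa [mul_smul]⟩
      rcases hj with hj | hj
      · exact key ⟨_, hj⟩ ((smul_mem_geod g a b z).mpr hz)
      · exact key ⟨_, hj⟩ ((smul_mem_geod g b a z).mpr (by rwa [geod_comm]))
    · rintro ⟨j, g, hg, hz⟩
      refine ⟨g⁻¹ • j.1.1, g⁻¹ • j.1.2, h.P_smul _ (Γ.inv_mem hg) _ _ (hJP j j.2), ?_⟩
      rw [← smul_mem_geod g, smul_inv_smul, smul_inv_smul]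
      exact hK2 j hz
  rw [e]
  exact isClosed_iUnion_of_finite fun j => h.surf.isClosed_orbit (hK1 j)

lemma family_P : IsGeodFamily P where
  ne := h.P_ne
  symm := h.P_symm
  unlinked h1 h2 := h.unlinked (h.P_sub h1) (h.P_sub h2)
  isClosed := h.isClosed_leaves_P

lemma smul_mem_leaves_P (hg : g ∈ Γ) (hz : z ∈ leaves P) : g • z ∈ leaves P := by
  obtain ⟨a, b, hab, hz⟩ := hz
  exact ⟨_, _, h.P_smul g hg _ _ hab, (smul_mem_geod g a b z).mpr hz⟩

end PantsLam

/-- Barycentric coordinates in an ideal triangle of `ℍ`. -/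
lemma exists_coords (hab : a ≠ b) (hbc : b ≠ c) (hca : c ≠ a)
    (hz : z ∈ closedTri a b c) : ∃ S T U : ℝ, 0 ≤ S ∧ 0 ≤ T ∧ 0 ≤ U ∧
      (∀ v w, hform z v w = S * (vdet v a.rep * vdet w a.rep) + T * (vdet v b.rep * vdet w b.rep) +
        U * (vdet v c.rep * vdet w c.rep)) ∧
      S * T * vdet a.rep b.rep ^ 2 + T * U * vdet b.rep c.rep ^ 2 +
        S * U * vdet c.rep a.rep ^ 2 = 1 := by
  have E := hform_eq_sides z hab hbc hca; have G := hform_gram z a.rep b.rep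
  have hX := vdet_ne hab
  refine ⟨_, _, _, div_nonneg hz.1 (sq_nonneg _), div_nonneg hz.2.1 (sq_nonneg _),
    div_nonneg hz.2.2 (sq_nonneg _), E, ?_⟩
  generalize side z b c a / (vdet a.rep b.rep * vdet c.rep a.rep) ^ 2 = S at E ⊢
  generalize side z c a b / (vdet b.rep c.rep * vdet a.rep b.rep) ^ 2 = T at E ⊢
  generalize side z a b c / (vdet c.rep a.rep * vdet b.rep c.rep) ^ 2 = U at E ⊢
  rw [E, E, E, vdet_self, vdet_self, vdet_swap b.rep a.rep, vdet_swap a.rep c.rep] at G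
  exact mul_left_cancel₀ (pow_ne_zero 2 hX) (by linear_combination G)

lemma coords_le {S T U η x X Y Z : ℝ} (s : 0 ≤ S) (t : 0 ≤ T) (u : 0 ≤ U) (hη : 0 < η)
    (hx : 0 < x) (hX : x ≤ X) (hY : x ≤ Y) (hZ : x ≤ Z) (hTU : η ≤ T + U) (hSU : η ≤ S + U)
    (hST : η ≤ S + T) (e : S * T * X + T * U * Y + S * U * Z = 1) :
    S ≤ 1 / (η * x) ∧ T ≤ 1 / (η * x) ∧ U ≤ 1 / (η * x) := by
  have k1 := mul_le_mul_of_nonneg_left hX (mul_nonneg s t)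
  have k2 := mul_le_mul_of_nonneg_left hY (mul_nonneg t u)
  have k3 := mul_le_mul_of_nonneg_left hZ (mul_nonneg s u)
  have fin : ∀ {p q r : ℝ}, 0 ≤ p → 0 ≤ q → 0 ≤ r → η ≤ q + r → (p * q + p * r + q * r) * x ≤ 1 →
      p ≤ 1 / (η * x) := by
    intro p q r hp hq hr hqr hle; rw [le_div_iff₀ (by positivity)]
    have k1 : p * (η * x) ≤ p * ((q + r) * x) := by gcongr
    have k2 : 0 ≤ q * r * x := by positivity
    linarith
  exact ⟨fin s t u hTU (by linarith), fin t s u hSU (by linarith), fin u s t hST (by linarith)⟩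

lemma exists_abs_le (s : Finset ℝ) : ∃ C > 0, ∀ y ∈ s, |y| ≤ C := by
  refine ⟨∑ y ∈ s, |y| + 1, by positivity, fun y hy => ?_⟩
  exact (Finset.single_le_sum (f := fun y => |y|) (fun _ _ => abs_nonneg _) hy).trans
    (le_add_of_nonneg_right zero_le_one)

/-- Ideal triangles whose points stay away from a geodesic ending at each vertex are bounded. -/
lemma exists_bound_closedTri {a' b' c' : BdH2} (hab : a ≠ b) (hbc : b ≠ c) (hca : c ≠ a)
    {ε : ℝ} (hε : 0 < ε) : ∃ R : ℝ, ∀ z ∈ closedTri a b c, ε ≤ |hform z a.rep a'.rep| →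
      ε ≤ |hform z b.rep b'.rep| → ε ≤ |hform z c.rep c'.rep| → dist z I ≤ R := by
  have hX := pow_two_pos_of_ne_zero (vdet_ne hab)
  have hY := pow_two_pos_of_ne_zero (vdet_ne hbc)
  have hZ := pow_two_pos_of_ne_zero (vdet_ne hca)
  obtain ⟨x, hx0, hx1, hx2, hx3⟩ : ∃ x > 0, x ≤ vdet a.rep b.rep ^ 2 ∧ x ≤ vdet b.rep c.rep ^ 2 ∧
      x ≤ vdet c.rep a.rep ^ 2 := ⟨min (vdet a.rep b.rep ^ 2) (min (vdet b.rep c.rep ^ 2)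
        (vdet c.rep a.rep ^ 2)), lt_min hX (lt_min hY hZ), min_le_left _ _,
        (min_le_right _ _).trans (min_le_left _ _), (min_le_right _ _).trans (min_le_right _ _)⟩
  obtain ⟨C, hC0, hC⟩ := exists_abs_le {vdet a.rep b.rep * vdet a'.rep b.rep,
    vdet a.rep c.rep * vdet a'.rep c.rep, vdet b.rep a.rep * vdet b'.rep a.rep,
    vdet b.rep c.rep * vdet b'.rep c.rep, vdet c.rep a.rep * vdet c'.rep a.rep,
    vdet c.rep b.rep * vdet c'.rep b.rep}
  simp only [Finset.forall_mem_insert, Finset.mem_singleton, forall_eq] at hC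
  obtain ⟨c1, c2, c3, c4, c5, c6⟩ := hC
  obtain ⟨η, hη0, hη⟩ : ∃ η > 0, η * C = ε := ⟨ε / C, by positivity, by field_simp⟩
  have bound : ∀ {p q α β : ℝ}, 0 ≤ p → 0 ≤ q → |α| ≤ C → |β| ≤ C → ε ≤ |p * α + q * β| →
      η ≤ p + q := by
    intro p q α β hp hq hα hβ hle; have := abs_add_le (p * α) (q * β)
    rw [abs_mul, abs_mul, abs_of_nonneg hp, abs_of_nonneg hq] at this
    have k1 := mul_le_mul_of_nonneg_left hα hp; have k2 := mul_le_mul_of_nonneg_left hβ hq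
    refine le_of_mul_le_mul_right ?_ hC0; linarith
  refine ⟨1 / (η * x) * (a.rep 1 ^ 2 + a.rep 0 ^ 2) + 1 / (η * x) * (b.rep 1 ^ 2 + b.rep 0 ^ 2) +
    1 / (η * x) * (c.rep 1 ^ 2 + c.rep 0 ^ 2), fun z hz ea eb ec => (dist_I_le z).trans ?_⟩
  obtain ⟨S, T, U, s, t, u, E, G⟩ := exists_coords hab hbc hca hz
  rw [E, vdet_self, zero_mul, mul_zero, zero_add] at ea
  rw [E, vdet_self b.rep, zero_mul, mul_zero, add_zero] at eb
  rw [E, vdet_self c.rep, zero_mul, mul_zero, add_zero] at ec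
  obtain ⟨hS, hT, hU⟩ := coords_le s t u hη0 hx0 hx1 hx2 hx3 (bound t u c1 c2 ea)
    (bound s u c3 c4 eb) (bound s t c5 c6 ec) G
  have e : ∀ v : Fin 2 → ℝ, vdet ![1, 0] v * vdet ![1, 0] v + vdet ![0, 1] v * vdet ![0, 1] v =
      v 1 ^ 2 + v 0 ^ 2 := by intro v; simp [vdet]; ring
  have e2 : hform z ![1, 0] ![1, 0] + hform z ![0, 1] ![0, 1] = S * (a.rep 1 ^ 2 + a.rep 0 ^ 2) +
      T * (b.rep 1 ^ 2 + b.rep 0 ^ 2) + U * (c.rep 1 ^ 2 + c.rep 0 ^ 2) := by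
    rw [E, E, ← e, ← e, ← e]; ring
  rw [e2]; gcongr

namespace PantsLam

variable {Γ : Subgroup SL2R} {F P : Rel} (h : PantsLam Γ F P)
  {o : ℍ}
include h

/-- Away from the closed leaves, the translates of an ideal triangle whose vertices are ends of
closed leaves are locally finite. -/
lemma finite_closedTri {a' b' c' : BdH2} (ha : P a a') (hb : P b b') (hc : P c c')
    (hab : a ≠ b) (hbc : b ≠ c) (hca : c ≠ a) {K : Set ℍ} (hK : IsCompact K)
    (hd : Disjoint K (leaves P)) : {g | g ∈ Γ ∧ ∃ z ∈ K, g • z ∈ closedTri a b c}.Finite := by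
  obtain ⟨δ, hδ, hdist⟩ := exists_pos_forall_lt_edist hK h.isClosed_leaves_P hd
  have key : ∀ {g z p q}, g ∈ Γ → z ∈ K → P p q →
      δ * |vdet p.rep q.rep| ≤ |hform (g • z) p.rep q.rep| := by
    intro g z p q hg hz hpq; obtain ⟨w, hw, hle⟩ := exists_dist_mul_le (g • z) (h.P_ne hpq)
    refine le_trans ?_ hle
    have h1 := hdist z hz (g⁻¹ • w) (h.smul_mem_leaves_P (Γ.inv_mem hg) ⟨p, q, hpq, hw⟩)
    rw [edist_nndist, ENNReal.coe_lt_coe, ← NNReal.coe_lt_coe, coe_nndist, ← dist_smul g,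
      smul_inv_smul] at h1
    gcongr
  set ε := min (δ * |vdet a.rep a'.rep|) (min (δ * |vdet b.rep b'.rep|) (δ * |vdet c.rep c'.rep|))
  have hpos : ∀ {p q}, P p q → 0 < (δ : ℝ) * |vdet p.rep q.rep| := fun hpq =>
    mul_pos (NNReal.coe_pos.mpr hδ) (abs_pos.mpr (vdet_ne (h.P_ne hpq)))
  have hε : 0 < ε := lt_min (hpos ha) (lt_min (hpos hb) (hpos hc))
  obtain ⟨R, hR⟩ := exists_bound_closedTri (a' := a') (b' := b') (c' := c') hab hbc hca hε
  refine (h.surf.finite_of_isCompact hK (isCompact_closedBall I R)).subset ?_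
  rintro g ⟨hg, z, hz, hgz⟩
  refine ⟨hg, z, hz, hR _ hgz ((min_le_left _ _).trans (key hg hz ha)) ?_ ?_⟩
  exacts [((min_le_right _ _).trans (min_le_left _ _)).trans (key hg hz hb),
    ((min_le_right _ _).trans (min_le_right _ _)).trans (key hg hz hc)]

end PantsLam

/-! ### Pairs of pants -/

/-- The configuration of two ideal triangles `(a, b, c)` and `(a, b, α c)` that tile the universal
cover of a pair of pants. Its group is generated by the boundary elements `α`, `β` and `β α`, which
fix `a`, `b` and `c`; the images of `(a, b, α c)` under `1`, `β` and `α⁻¹` are adjacent to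
`(a, b, c)`. -/
structure PantsFrame (Γ : Subgroup SL2R) (P : Rel) (α β : SL2R)
    (a b c : BdH2) : Prop where
  memα : α ∈ Γ
  memβ : β ∈ Γ
  fixα : α • a = a
  fixβ : β • b = b
  fixγ : β • α • c = c
  enda : ∃ x, P a x
  endb : ∃ x, P b x
  endc : ∃ x, P c x
  linkγ : Link a b c (α • c)
  linkα : Link b c a (β • a)
  linkβ : Link c a b (α⁻¹ • b)

/-- The ends of a geodesic that is disjoint from its translates and from the closed leaves, and
whose second end is not an end of a closed leaf. -/
structure IsStray (Γ : Subgroup SL2R) (P : Rel) (u w : BdH2) : Prop where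
  simple : ∀ g ∈ Γ, ¬Link u w (g • u) (g • w)
  not_end : ∀ x, ¬P w x
  unlinked : ∀ p q, P p q → ¬Link p q u w

/-- In a coordinate for which the fixed point is `∞`, an element of `SL2R` is affine. -/
lemma exists_affine {M : SL2R} (h : g • M • infty = M • infty) :
    ∃ κ τ : ℝ, 0 < κ ∧ ∀ x, g • M • ofReal x = M • ofReal (κ * x + τ) := by
  obtain ⟨e, he⟩ : ∃ e, e = M⁻¹ * g * M := ⟨_, rfl⟩
  have h0 : e 1 0 = 0 := sl_smul_infty_iff.mp (by rw [he, mul_smul, mul_smul, h, inv_smul_smul])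
  have hd := sl_det e; rw [h0, mul_zero, sub_zero] at hd; have h1 := left_ne_zero_of_mul_eq_one hd
  have h2 := right_ne_zero_of_mul_eq_one hd
  refine ⟨e 0 0 ^ 2, e 0 0 * e 0 1, by positivity, fun x => ?_⟩
  rw [← inv_smul_eq_iff, smul_smul, smul_smul, ← he, sl_smul_ofReal (by rw [h0]; simpa using h2), h0]
  congr 1; rw [zero_mul, zero_add, div_eq_iff h2]; linear_combination (-(e 0 0 * x + e 0 1)) * hd

/-- One zigzag of a simple geodesic forces the next one, in an affine coordinate. -/
lemma zigzag_real {κ τ A C U W B : ℝ} (hκ : 0 < κ) (hB : κ * B + τ = B)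
    (h1 : (A - C) * (A - (κ * C + τ)) < 0) (h2 : (U - C) * (U - A) < 0)
    (h3 : (κ * C + τ - U) * (κ * C + τ - W) < 0) (h4 : 0 ≤ (B - U) * (B - W))
    (hWA : W ≠ κ * A + τ) (hWB : W ≠ B)
    (h5 : ¬(U - (κ * U + τ)) * (W - (κ * U + τ)) * ((U - (κ * W + τ)) * (W - (κ * W + τ))) < 0) :
    (A - U) * (A - (κ * C + τ)) < 0 ∧
      (κ * C + τ - U) * (κ * A + τ - U) * ((κ * C + τ - W) * (κ * A + τ - W)) < 0 := by
  have e : ∀ x, (κ - 1) * (x - B) = κ * x + τ - x := fun x => by linear_combination -hB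
  have m : ∀ x y, κ * x + τ < κ * y + τ ↔ x < y := fun x y => by
    rw [add_lt_add_iff_right, mul_lt_mul_iff_right₀ hκ]
  -- the sides of `B` are invariant, so both points are moved in the same direction
  have d4 : 0 < (κ * U + τ - U) * (κ * W + τ - W) ∨ κ * U + τ = U := by
    rw [← e, ← e, or_iff_not_imp_right]; intro hU; have := sub_ne_zero.mpr hWB
    have h6 : (κ - 1) * (U - B) ≠ 0 := by rw [e]; exact sub_ne_zero.mpr hU
    have h7 := left_ne_zero_of_mul h6; have h8 := right_ne_zero_of_mul h6
    have h4' : 0 < (B - U) * (B - W) := lt_of_le_of_ne h4 (by grind)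
    have : 0 < (κ - 1) ^ 2 := by positivity
    nlinarith [mul_pos this h4']
  have m1 := m C U; have m2 := m U A; have m3 := m A U; have m4 := m U C; have m5 := m C A
  have m6 := m A C
  generalize κ * C + τ = C' at *
  generalize κ * A + τ = A' at *
  generalize κ * U + τ = U' at *
  generalize κ * W + τ = W' at *; clear e m hB h4 
  simp only [mul_neg_iff, sub_pos, sub_neg, mul_pos_iff] at *; grind

lemma fan_step_real {κ τ A C U W : ℝ} (hκ : 0 < κ)
    (h1 : (A - C) * (A - (κ * C + τ)) < 0) (q1 : (A - (κ * U + τ)) * (A - (κ * W + τ)) < 0)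
    (q2 : (κ * C + τ - (κ * U + τ)) * (κ * C + τ - (κ * W + τ)) < 0)
    (q3 : (A - (κ * U + τ)) * (A - (κ * C + τ)) < 0) (hWA : W ≠ A) (hWC : W ≠ κ * C + τ)
    (n1 : ¬(κ * C + τ - (κ * U + τ)) * (κ * A + τ - (κ * U + τ)) *
      ((κ * C + τ - (κ * W + τ)) * (κ * A + τ - (κ * W + τ))) < 0)
    (n2 : (C - U) * (C - A) < 0 → ¬(A - U) * (κ * C + τ - U) * ((A - W) * (κ * C + τ - W)) < 0) :
    (A - U) * (A - W) < 0 ∧ (κ * C + τ - U) * (κ * C + τ - W) < 0 ∧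
      (A - U) * (A - (κ * C + τ)) < 0 := by
  have m : ∀ x y, κ * x + τ < κ * y + τ ↔ x < y := fun x y => by
    rw [add_lt_add_iff_right, mul_lt_mul_iff_right₀ hκ]
  have m1 := m C U; have m2 := m U C; have m3 := m C W; have m4 := m W C; have m5 := m A U
  have m6 := m U A; have m7 := m A W; have m8 := m W A
  generalize κ * A + τ = A' at *
  generalize κ * C + τ = C' at *
  generalize κ * U + τ = U' at *
  generalize κ * W + τ = W' at *; clear m
  simp only [mul_neg_iff, mul_pos_iff, sub_pos, sub_neg] at *; grind

lemma fan_real {κ X Y : ℝ} (hκ : 0 < κ) (hX : 0 < (κ - 1) * X) (hY : 0 < (κ - 1) * Y)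
    (hn : ∀ n : ℕ, Y < κ⁻¹ ^ n * X) : False := by
  rcases lt_trichotomy κ 1 with h | h | h
  · have hX' : X < 0 := by by_contra!; nlinarith
    have ht := tendsto_pow_atTop_atTop_of_one_lt ((one_lt_inv₀ hκ).mpr h)
    obtain ⟨n, hn'⟩ := (ht.eventually_ge_atTop (Y / X)).exists; have := hn n
    rw [div_le_iff_of_neg hX'] at hn'; linarith
  · rw [h] at hX; simp at hX
  · have hY' : 0 < Y := by by_contra!; nlinarith
    have ht := (tendsto_pow_atTop_nhds_zero_of_lt_one (inv_pos.mpr hκ).le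
      (inv_lt_one_of_one_lt₀ h)).mul_const X
    rw [zero_mul] at ht; exact absurd (ge_of_tendsto' ht fun n => (hn n).le) (not_le.mpr hY')

lemma exists_chart (b : BdH2) : ∃ M : SL2R, M • infty = b ∧
    ∀ x, x ≠ b → ∃ t, x = M • ofReal t := by
  obtain ⟨a, ha, -⟩ := exists_ne_ne_bdH2 b b; obtain ⟨M, -, rfl⟩ := exists_sl_frame ha
  refine ⟨M, rfl, fun x hx => ?_⟩
  obtain ⟨t, ht⟩ := exists_ofReal (x := M⁻¹ • x) fun h => hx (by rw [← h, smul_inv_smul])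
  exact ⟨t, by rw [← ht, smul_inv_smul]⟩

namespace IsStray

variable {Γ : Subgroup SL2R} {P : Rel} {u w : BdH2}

lemma smul (hP : ∀ g ∈ Γ, ∀ a b, P a b → P (g • a) (g • b)) (hs : IsStray Γ P u w)
    (hk : k ∈ Γ) : IsStray Γ P (k • u) (k • w) where
  simple g hg hl := by
    apply hs.simple (k⁻¹ * g * k) (Γ.mul_mem (Γ.mul_mem (Γ.inv_mem hk) hg) hk)
    rw [← link_smul k]; simpa [mul_smul] using hl
  not_end x hx := hs.not_end (k⁻¹ • x) (by simpa using hP _ (Γ.inv_mem hk) _ _ hx)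
  unlinked p q hpq hl := by
    apply hs.unlinked _ _ (hP _ (Γ.inv_mem hk) _ _ hpq); rw [← link_smul k]; simpa using hl

end IsStray

namespace PantsFrame

variable {Γ : Subgroup SL2R} {F P : Rel} {α β : SL2R} {a b c u w : BdH2}

lemma inv_smul_c (f : PantsFrame Γ P α β a b c) : β⁻¹ • c = α • c := by rw [inv_smul_eq_iff, f.fixγ]

lemma end_smul (h : PantsLam Γ F P) (hg : g ∈ Γ) (hx : ∃ y, P x y) : ∃ y, P (g • x) y :=
  hx.imp' (g • ·) fun _ hy => h.P_smul g hg _ _ hy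

/-- The frame of the next zigzag in the strip of triangles. -/
lemma next (h : PantsLam Γ F P) (f : PantsFrame Γ P α β a b c) :
    PantsFrame Γ P β⁻¹ (α * β) b (α • c) a where
  memα := Γ.inv_mem f.memβ
  memβ := Γ.mul_mem f.memα f.memβ
  fixα := by rw [inv_smul_eq_iff, f.fixβ]
  fixβ := by rw [mul_smul, f.fixγ]
  fixγ := by rw [mul_smul, smul_inv_smul, f.fixα]
  enda := f.endb
  endb := end_smul h f.memα f.endc
  endc := f.enda
  linkγ := by
    have := (link_smul β⁻¹ _ _ _ _).mpr f.linkα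
    rw [inv_smul_smul, f.inv_smul_c, inv_smul_eq_iff.mpr f.fixβ.symm] at this; exact this.symm_right
  linkα := by
    have := (link_smul α _ _ _ _).mpr f.linkβ; rw [smul_inv_smul, f.fixα] at this
    rw [mul_smul, f.fixβ]; exact this.symm_right
  linkβ := by rw [inv_inv, f.fixγ]; exact f.linkγ.symm_right

lemma rotate (f : PantsFrame Γ P α β a b c) : PantsFrame Γ P β (β * α)⁻¹ b c a where
  memα := f.memβ
  memβ := Γ.inv_mem (Γ.mul_mem f.memβ f.memα)
  fixα := f.fixβ
  fixβ := by rw [inv_smul_eq_iff, mul_smul, f.fixγ]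
  fixγ := by rw [mul_inv_rev, mul_smul, inv_smul_smul, inv_smul_eq_iff, f.fixα]
  enda := f.endb
  endb := f.endc
  endc := f.enda
  linkγ := f.linkα
  linkα := by rw [mul_inv_rev, mul_smul, inv_smul_eq_iff.mpr f.fixβ.symm]; exact f.linkβ
  linkβ := by rw [f.inv_smul_c]; exact f.linkγ

/-- The frame with the two triangles exchanged. -/
lemma flip (h : PantsLam Γ F P) (f : PantsFrame Γ P α β a b c) :
    PantsFrame Γ P β α b a (α • c) where
  memα := f.memβ
  memβ := f.memα
  fixα := f.fixβ
  fixβ := f.fixα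
  fixγ := by rw [f.fixγ]
  enda := f.endb
  endb := f.enda
  endc := end_smul h f.memα f.endc
  linkγ := by rw [f.fixγ]; exact f.linkγ.symm_left.symm_right
  linkα := by
    have := (link_smul α _ _ _ _).mpr f.linkβ; rw [smul_inv_smul, f.fixα] at this
    exact this.symm_left.symm_right
  linkβ := by
    have := (link_smul β⁻¹ _ _ _ _).mpr f.linkα
    rw [inv_smul_smul, f.inv_smul_c, inv_smul_eq_iff.mpr f.fixβ.symm] at this
    exact this.symm_left.symm_right

lemma mirror (f : PantsFrame Γ P α β a b c) : PantsFrame Γ P β⁻¹ α⁻¹ b a c where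
  memα := Γ.inv_mem f.memβ
  memβ := Γ.inv_mem f.memα
  fixα := by rw [inv_smul_eq_iff, f.fixβ]
  fixβ := by rw [inv_smul_eq_iff, f.fixα]
  fixγ := by rw [f.inv_smul_c, inv_smul_smul]
  enda := f.endb
  endb := f.enda
  endc := f.endc
  linkγ := by rw [f.inv_smul_c]; exact f.linkγ.symm_left
  linkα := f.linkβ.symm_left
  linkβ := by rw [inv_inv]; exact f.linkα.symm_left

lemma fix_endb (h : PantsLam Γ F P) (f : PantsFrame Γ P α β a b c)
    (hx : P b x) : β • x = x := by
  obtain ⟨g, hg, g1, g2, gb, gx⟩ := h.P_closed hx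
  exact h.surf.fixes_of_fixes hg f.memβ g1 g2 (h.P_ne hx) gb gx f.fixβ

lemma ne_of_end (hs : IsStray Γ P u w) (hx : ∃ y, P x y) : w ≠ x := by
  rintro rfl; obtain ⟨y, hy⟩ := hx; exact hs.not_end y hy

lemma zigzag_step (h : PantsLam Γ F P) (f : PantsFrame Γ P α β a b c)
    (hs : IsStray Γ P u w) (h1 : Link c a u b) (h2 : Link b (α • c) u w) :
    Link a b u (α • c) ∧ Link (α • c) (β⁻¹ • a) u w := by
  obtain ⟨x, hx⟩ := f.endb; have hxf := f.fix_endb h hx; have hxs := hs.unlinked _ _ hx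
  have hwx : w ≠ x := ne_of_end hs ⟨b, h.P_symm hx⟩
  have hwa : w ≠ β⁻¹ • a := ne_of_end hs (end_smul h (Γ.inv_mem f.memβ) f.enda)
  have hsim := hs.simple β⁻¹ (Γ.inv_mem f.memβ); have hc := f.inv_smul_c; have lγ := f.linkγ
  have hfb := f.fixβ; obtain ⟨M, rfl, hM⟩ := exists_chart b; obtain ⟨A, rfl⟩ := hM a lγ.ne_left
  obtain ⟨C, rfl⟩ := hM c lγ.ne23.symm; obtain ⟨U, rfl⟩ := hM u h1.ne_right
  obtain ⟨W, rfl⟩ := hM w h2.ne14.symm; obtain ⟨B, rfl⟩ := hM x (h.P_ne hx).symm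
  obtain ⟨κ, τ, hκ, act⟩ := exists_affine (inv_smul_eq_iff.mpr hfb.symm); rw [← hc] at lγ h2 ⊢
  rw [act] at lγ h2 hwa hsim ⊢; rw [act] at hsim ⊢
  have hB : κ * B + τ = B := by
    have := act B; rw [inv_smul_eq_iff.mpr hxf.symm, smul_left_cancel_iff, BdH2.ofReal_inj] at this
    exact this.symm
  simp only [link_smul] at *; have l1 := lγ.symm_left; have l2 := h1.swap.symm_left
  rw [link_infty] at l1 h2 hxs; have l2' := h1.swap.symm_left; rw [link_infty] at l2'
  have := zigzag_real hκ hB l1 l2' h2 (not_lt.mp hxs)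
    (fun h' => hwa (by rw [h'])) (fun h' => hwx (by rw [h'])) (by rwa [link_ofReal] at hsim)
  refine ⟨?_, by rw [link_ofReal]; exact this.2⟩; refine Link.symm_left ?_
  rw [link_infty]; exact this.1

/-- A simple geodesic in a pair of pants does not zigzag: it turns around one vertex only. -/
lemma no_zigzag (h : PantsLam Γ F P) (f : PantsFrame Γ P α β a b c)
    (hs : IsStray Γ P u w) (h1 : Link c a u b) (h2 : Link b (α • c) u w) : False := by
  obtain ⟨p1, p2⟩ := f.zigzag_step h hs h1 h2; obtain ⟨q1, q2⟩ := (f.next h).zigzag_step h hs p1 p2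
  obtain ⟨r1, r2⟩ := ((f.next h).next h).zigzag_step h hs q1 q2
  have hsim := hs.simple (α * β) (Γ.mul_mem f.memα f.memβ)
  have e1 : (α * β) • α • c = α • c := by rw [mul_smul, f.fixγ]
  have e2 : (α * β) • β⁻¹ • a = a := by rw [mul_smul, smul_inv_smul, f.fixα]
  rw [← link_smul (α * β), e1, e2, smul_inv_smul] at r1
  have e3 : (α * β) • (β⁻¹ * (α * β))⁻¹ • α • c = c := by
    have : (α * β) * (β⁻¹ * (α * β))⁻¹ = β := by group
    rw [smul_smul, this, f.fixγ]
  rw [← link_smul (α * β), smul_inv_smul, e3] at r2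
  generalize (α * β) • u = u' at *
  generalize (α * β) • w = w' at *; have lγ := f.linkγ
  generalize α • c = c' at *; apply hsim; clear e3 e2 e1 q2 q1 p1 p2 hsim f hs
  obtain ⟨M, rfl, hM⟩ := exists_chart b; obtain ⟨A, rfl⟩ := hM a lγ.ne_left
  obtain ⟨C, rfl⟩ := hM c lγ.ne23.symm; obtain ⟨C', rfl⟩ := hM c' lγ.ne24.symm
  obtain ⟨U, rfl⟩ := hM u h1.ne_right; obtain ⟨W, rfl⟩ := hM w h2.ne14.symm
  obtain ⟨U', rfl⟩ := hM u' r2.ne13.symm; obtain ⟨W', rfl⟩ := hM w' r2.ne14.symm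
  simp only [link_smul] at *; have l1 := lγ.symm_left; have l2 := h1.swap.symm_left
  have l3 := r1.swap.symm_left; rw [link_infty] at l1 l2 l3 h2 r2; rw [link_ofReal]
  simp only [mul_neg_iff, mul_pos_iff, sub_pos, sub_neg] at *; grind

lemma fan_step (h : PantsLam Γ F P) (f : PantsFrame Γ P α β a b c)
    (hs : IsStray Γ P u w) (q1 : Link b a u w) (q2 : Link b (α • c) u w)
    (q3 : Link a b u (α • c)) : Link b a (β • u) (β • w) ∧ Link b (α • c) (β • u) (β • w) ∧
      Link a b (β • u) (α • c) := by
  have hs' := hs.smul h.P_smul f.memβ; have hwa : β • w ≠ a := ne_of_end hs' f.enda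
  have hwc : β • w ≠ α • c := ne_of_end hs' (end_smul h f.memα f.endc)
  have n1 : ¬Link (α • c) (β⁻¹ • a) u w := fun h' => (f.next h).no_zigzag h hs q3 h'
  have n2 : Link c b (β • u) a → ¬Link a (β⁻¹ • c) (β • u) (β • w) :=
    fun h1 h2 => f.mirror.no_zigzag h hs' h1 h2
  have hc := f.inv_smul_c; have lγ := f.linkγ; have hfb := f.fixβ
  have hub : β • u ≠ b := fun h' => q1.ne13 (by rw [← inv_smul_eq_iff.mpr hfb.symm, ← h', inv_smul_smul])
  have hwb : β • w ≠ b := ne_of_end hs' f.endb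
  obtain ⟨u', rfl⟩ : ∃ x, u = β⁻¹ • x := ⟨β • u, by rw [inv_smul_smul]⟩
  obtain ⟨w', rfl⟩ : ∃ x, w = β⁻¹ • x := ⟨β • w, by rw [inv_smul_smul]⟩
  simp only [smul_inv_smul] at *
  rw [← hc] at *; obtain ⟨M, rfl, hM⟩ := exists_chart b; obtain ⟨A, rfl⟩ := hM a lγ.ne_left
  obtain ⟨C, rfl⟩ := hM c lγ.ne23.symm; obtain ⟨U, rfl⟩ := hM u' hub; obtain ⟨W, rfl⟩ := hM w' hwb
  obtain ⟨κ, τ, hκ, act⟩ := exists_affine (inv_smul_eq_iff.mpr hfb.symm)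
  simp only [act, link_smul] at *; have l1 := lγ.symm_left; have l3 := q3.symm_left
  rw [link_infty] at l1 l3 q1 q2; rw [link_ofReal] at n1 n2
  have := fan_step_real hκ l1 q1 q2 l3 (fun h' => hwa (by rw [h'])) (fun h' => hwc (by rw [h'])) n1
    (fun h' => n2 (Link.symm_left (by rwa [link_infty])))
  simp only [link_infty]
  exact ⟨this.1, this.2.1, Link.symm_left (by rw [link_infty]; exact this.2.2)⟩

/-- A stray geodesic cannot turn around the vertex `b`: it would have to turn for ever. -/
lemma no_turn (h : PantsLam Γ F P) (f : PantsFrame Γ P α β a b c)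
    (hs : IsStray Γ P u w) (q1 : Link b a u w) (q2 : Link b (α • c) u w)
    (q3 : Link a b u (α • c)) : False := by
  have hn : ∀ n : ℕ, IsStray Γ P (β ^ n • u) (β ^ n • w) ∧ Link b a (β ^ n • u) (β ^ n • w) ∧
      Link b (α • c) (β ^ n • u) (β ^ n • w) ∧ Link a b (β ^ n • u) (α • c) := by
    intro n
    induction n with
    | zero => simpa using ⟨hs, q1, q2, q3⟩
    | succ n ih =>
      rw [pow_succ', mul_smul, mul_smul]
      exact ⟨ih.1.smul h.P_smul f.memβ, f.fan_step h ih.1 ih.2.1 ih.2.2.1 ih.2.2.2⟩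
  obtain ⟨x, hx⟩ := f.endb; have hxf := f.fix_endb h hx; have hxs := hs.unlinked _ _ hx
  have hwx : w ≠ x := ne_of_end hs ⟨b, h.P_symm hx⟩; have hc := f.inv_smul_c; have lγ := f.linkγ
  have hfb := f.fixβ; rw [← hc] at q2 q3 lγ; simp only [← hc] at hn
  obtain ⟨M, rfl, hM⟩ := exists_chart b; obtain ⟨A, rfl⟩ := hM a lγ.ne_left
  obtain ⟨C, rfl⟩ := hM c lγ.ne23.symm; obtain ⟨U, rfl⟩ := hM u q1.ne13.symm
  obtain ⟨W, rfl⟩ := hM w q1.ne14.symm; obtain ⟨B, rfl⟩ := hM x (h.P_ne hx).symm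
  obtain ⟨κ, τ, hκ, act⟩ := exists_affine (inv_smul_eq_iff.mpr hfb.symm)
  have hB : κ * B + τ = B := by
    have := act B; rw [inv_smul_eq_iff.mpr hxf.symm, smul_left_cancel_iff, BdH2.ofReal_inj] at this
    exact this.symm
  have act' : ∀ t, β • M • ofReal t = M • ofReal (B + κ⁻¹ * (t - B)) := fun t => by
    rw [eq_comm, ← inv_smul_eq_iff, act]; congr 2; field_simp; linear_combination hB
  have actn : ∀ (n : ℕ) t, β ^ n • M • ofReal t = M • ofReal (B + κ⁻¹ ^ n * (t - B)) := by
    intro n t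
    induction n with
    | zero => simp
    | succ n ih => rw [pow_succ', mul_smul, ih, act']; congr 2; ring
  simp only [act, actn, link_smul] at *; have l1 := lγ.symm_left; have l3 := q3.symm_left
  rw [link_infty] at l1 l3 q1 q2 hxs
  have hn' : ∀ n : ℕ, 0 < (B + κ⁻¹ ^ n * (W - B) - (κ * C + τ)) * (κ * C + τ - A) := by
    intro n; obtain ⟨-, p1, p2, p3⟩ := hn n; have p3 := p3.symm_left
    rw [link_infty] at p1 p2 p3
    generalize B + κ⁻¹ ^ n * (W - B) = W' at *
    generalize B + κ⁻¹ ^ n * (U - B) = U' at *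
    generalize κ * C + τ = C' at *; clear hn l1 l3 q1 q2 hxs hB hκ
    simp only [mul_neg_iff, mul_pos_iff, sub_pos, sub_neg] at *; grind
  have hWB : W ≠ B := fun h' => hwx (by rw [h'])
  have hY : 0 < (κ - 1) * ((κ * C + τ - B) * (κ * C + τ - A)) := by
    have e : (κ - 1) * ((κ * C + τ - B) * (κ * C + τ - A)) =
        κ * ((κ * C + τ - C) * (κ * C + τ - A)) := by linear_combination (-(κ * C + τ - A)) * hB
    rw [e]; refine mul_pos hκ ?_; generalize κ * C + τ = C' at l1
    clear hn' hn actn act' act hxs q1 q2 l3 hB e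
    simp only [mul_neg_iff, mul_pos_iff, sub_pos, sub_neg] at *; grind
  refine fan_real (κ := κ) (X := (W - B) * (κ * C + τ - A)) (Y := (κ * C + τ - B) * (κ * C + τ - A))
    hκ ?_ hY (fun n => by have := hn' n; linarith)
  have h0 := hn' 0; rw [pow_zero] at h0; clear hn hn' actn act' act
  generalize κ * C + τ = C' at *; clear hB
  simp only [mul_neg_iff, mul_pos_iff, sub_pos, sub_neg] at *; grind

lemma no_cross_aux (h : PantsLam Γ F P) (f : PantsFrame Γ P α β a b c)
    (hs : IsStray Γ P u w) (hl : Link a b u w) (q3 : Link a b u (α • c)) : False := by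
  have hwc : w ≠ α • c := ne_of_end hs (end_smul h f.memα f.endc)
  by_cases hq : Link b (α • c) u w
  · exact f.no_turn h hs hl.symm_left hq q3
  · refine f.mirror.no_turn h hs hl ?_ ?_ <;> rw [f.inv_smul_c]
    · have hne := f.linkγ
      generalize α • c = c' at *
      obtain ⟨M, rfl, hM⟩ := exists_chart b
      obtain ⟨A, rfl⟩ := hM a hl.ne_left
      obtain ⟨C, rfl⟩ := hM c' q3.ne24.symm
      obtain ⟨U, rfl⟩ := hM u hl.ne23.symm
      obtain ⟨W, rfl⟩ := hM w hl.ne24.symm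
      simp only [link_smul] at *
      have l1 := hl.symm_left
      have l2 := q3.symm_left
      rw [link_infty] at l1 l2 hq
      rw [link_ofReal]
      have n1 : C ≠ W := by rintro rfl; exact hwc rfl
      simp only [mul_neg_iff, mul_pos_iff, sub_pos, sub_neg] at *
      grind
    · exact q3.symm_left

/-- A stray geodesic does not cross the sides of the triangles. -/
lemma no_cross (h : PantsLam Γ F P) (f : PantsFrame Γ P α β a b c)
    (hs : IsStray Γ P u w) (hl : Link a b u w) : False := by
  by_cases q3 : Link a b u (α • c)
  · exact f.no_cross_aux h hs hl q3
  · refine (f.flip h).no_cross_aux h hs hl.symm_left ?_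
    rw [f.fixγ]
    have lγ := f.linkγ
    generalize α • c = c' at *
    obtain ⟨M, rfl, hM⟩ := exists_chart b
    obtain ⟨A, rfl⟩ := hM a hl.ne_left
    obtain ⟨C, rfl⟩ := hM c lγ.ne23.symm
    obtain ⟨C', rfl⟩ := hM c' lγ.ne24.symm
    obtain ⟨U, rfl⟩ := hM u hl.ne23.symm
    obtain ⟨W, rfl⟩ := hM w hl.ne24.symm
    simp only [link_smul] at *
    have l1 := hl.symm_left
    have l2 := lγ.symm_left
    have n3 : ¬(A - U) * (A - C') < 0 := fun h' =>
      q3 (Link.symm_left (by rwa [link_infty]))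
    rw [link_infty] at l1 l2 ⊢
    simp only [mul_neg_iff, sub_pos, sub_neg] at *
    grind

end PantsFrame

/-- The arc from `z` towards `w`: its point at `τ` has the form of `z` plus `τ` times that of `w`,
up to a factor. -/
def arc (z w : ℍ) : ℝ → ℍ :=
  pencil z (hform w ![1, 0] ![1, 0]) (hform w ![1, 0] ![0, 1]) (hform w ![0, 1] ![0, 1])

lemma arc_aux (w : ℍ) : (∀ x y, 0 ≤ hform w ![1, 0] ![1, 0] * x ^ 2 +
    2 * hform w ![1, 0] ![0, 1] * (x * y) + hform w ![0, 1] ![0, 1] * y ^ 2) ∧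
    hform w ![1, 0] ![0, 1] ^ 2 ≤ hform w ![1, 0] ![1, 0] * hform w ![0, 1] ![0, 1] := by
  have hz := w.im_pos; have g := hform_gram w ![1, 0] ![0, 1]
  refine ⟨fun x y => ?_, by nlinarith only [g, sq_nonneg (vdet (![1, 0] : Fin 2 → ℝ) ![0, 1])]⟩
  have e : hform w ![1, 0] ![1, 0] * x ^ 2 + 2 * hform w ![1, 0] ![0, 1] * (x * y) +
      hform w ![0, 1] ![0, 1] * y ^ 2 = ((x - w.re * y) ^ 2 + (w.im * y) ^ 2) / w.im := by
    simp [hform]; field_simp; ring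
  rw [e]; positivity

lemma hform_arc (z w : ℍ) {τ : ℝ} (hτ : 0 ≤ τ) : ∃ s : ℝ, 0 < s ∧ ∀ u v,
    hform (arc z w τ) u v = s * (hform z u v + τ * hform w u v) := by
  obtain ⟨s, hs, h⟩ := hform_pencil z (arc_aux w).1 (arc_aux w).2 hτ
  exact ⟨s, hs, fun u v => by rw [arc, h]; congr 3; simp [hform]; ring⟩

lemma continuousOn_arc (z w : ℍ) : ContinuousOn (arc z w) (Set.Ici 0) :=
  continuousOn_pencil z (arc_aux w).1 (arc_aux w).2

lemma isPreconnected_plaque (F : Rel) (o : ℍ) : IsPreconnected (plaque F o) := by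
  have key : ∀ {z w}, z ∈ plaque F o → w ∈ plaque F o → arc z w '' Set.Icc 0 1 ⊆ plaque F o := by
    rintro z w hz hw _ ⟨t, ht, rfl⟩ a b hab; obtain ⟨s, hs, e⟩ := hform_arc z w ht.1; rw [e]
    nlinarith only [mul_pos hs (add_pos_of_pos_of_nonneg (hz a b hab) (mul_nonneg ht.1 (hw a b hab).le))]
  have hc : ∀ z w, IsPreconnected (arc z w '' Set.Icc 0 1) := fun z w =>
    isPreconnected_Icc.image _ ((continuousOn_arc z w).mono Set.Icc_subset_Ici_self)
  refine isPreconnected_of_forall_pair fun z hz w hw => ⟨_, Set.union_subset (key hz hw) (key hw hz),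
    .inl ⟨0, by simp, pencil_zero z _ _ _⟩, .inr ⟨0, by simp, pencil_zero w _ _ _⟩,
    (hc z w).union (arc z w 1) ⟨1, by simp, rfl⟩ ⟨1, by simp, ?_⟩ (hc w z)⟩
  simp only [arc, pencil, one_mul, add_comm]

lemma side_pos_of_mem_geod (hab : a ≠ b) (hac : a ≠ c) (hz : z ∈ geod a b) : 0 < side z b c a := by
  obtain ⟨s, t, hs, ht, e⟩ := hform_of_mem_geod hab hz; have h1 := vdet_ne hab.symm
  have h2 := vdet_ne hac.symm
  have e' : side z b c a = s * (vdet b.rep a.rep * vdet c.rep a.rep) ^ 2 := by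
    rw [side, e, vdet_self]; ring
  rw [e']; positivity

lemma eq_of_smul_ofReal {x y : ℝ} (h : g • ofReal x = ofReal y) :
    y * (g 1 0 * x + g 1 1) = g 0 0 * x + g 0 1 := by
  by_cases hp : g 1 0 * x + g 1 1 = 0
  · exact absurd (h.symm.trans (sl_smul_ofReal_eq_infty hp)) (ofReal_ne_infty y)
  · rw [sl_smul_ofReal hp, BdH2.ofReal_inj, div_eq_iff hp] at h
    exact h.symm

lemma ofReal_of_fixed (hC : g 1 0 ≠ 0) (hx : g • x = x) :
    ∃ t, x = ofReal t ∧ g 1 0 * t ^ 2 + (g 1 1 - g 0 0) * t - g 0 1 = 0 := by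
  obtain ⟨t, rfl⟩ := exists_ofReal (x := x) (by rintro rfl; exact hC (sl_smul_infty_iff.mp hx))
  exact ⟨t, rfl, by linear_combination eq_of_smul_ofReal hx⟩

/-- A quadratic polynomial whose roots do not separate `0` and `x` has the same sign at `0` and `x`. -/
lemma quadratic_nonneg {C m n p q x : ℝ} (hp : C * p ^ 2 + m * p - n = 0)
    (hq : C * q ^ 2 + m * q - n = 0) (hpq : p ≠ q)
    (hl : 0 ≤ (p - 0) * (q - 0) * ((p - x) * (q - x))) : 0 ≤ -n * (C * x ^ 2 + m * x - n) := by
  have h1 : C * (p + q) = -m := by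
    apply mul_left_cancel₀ (sub_ne_zero.mpr hpq); linear_combination hp - hq
  have h2 : C * (p * q) = -n := by linear_combination p * h1 - hp
  have e : -n * (C * x ^ 2 + m * x - n) = C ^ 2 * ((p - 0) * (q - 0) * ((p - x) * (q - x))) := by
    linear_combination (n - C * ((p - x) * (q - x))) * h2 - n * x * h1
  rw [e]; positivity

lemma frame_real {A D L E a b c y : ℝ} (hE : E = A * D - 1) (hE0 : E < 0) (hA : 0 < A)
    (hAD : A ≤ D) (hDL : D ≤ L * A) (hL : 1 < L) (htr : 2 < A + D)
    (ha : a ^ 2 + (D - A) * a - E = 0) (hb : b ^ 2 + (D - L * A) * b - L * E = 0)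
    (h1 : y * (c + D) = A * c + E) (h2 : c * (y + D) = L * (A * y + E))
    (hf : 0 ≤ c ^ 2 + (D - A) * c - E) (hg : 0 ≤ y ^ 2 + (D - L * A) * y - L * E) :
    A < b ∧ (a - c) * (b - c) * ((a - y) * (b - y)) < 0 ∧
      (b - a) * (c - a) * ((b - L * a) * (c - L * a)) < 0 ∧
      ∀ x, (x + D) * (b - A) = -1 → (c - b) * (a - b) * ((c - x) * (a - x)) < 0 := by
  have hD : 0 < D := by linarith
  have hL0 : 0 < L := by linarith
  have ha0 : a < 0 := by
    by_contra! h; nlinarith only [mul_nonneg (sub_nonneg.mpr hAD) h, sq_nonneg a, ha, hE0]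
  have ha1 : 0 < a + D := by
    by_contra! h
    nlinarith only [mul_nonneg (neg_nonneg.mpr h) (neg_pos.mpr ha0).le, mul_pos hA (neg_pos.mpr ha0), ha, hE0]
  have hb0 : 0 < b := by
    by_contra! h
    nlinarith only [mul_nonneg (sub_nonneg.mpr hDL) (neg_nonneg.mpr h), sq_nonneg b, hb, hE0, hL,
      mul_pos hL0 (neg_pos.mpr hE0)]
  have hf' : 0 ≤ (c - y) * (c + D) := by linear_combination hf + h1
  have hg' : 0 ≤ (y - c) * (y + D) := by linear_combination hg + h2
  have h1' : (A - y) * (c + D) = 1 := by linear_combination -h1 - hE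
  have h2' : (L * A - c) * (y + D) = L := by linear_combination -h2 - L * hE
  have hc1 : c + D ≠ 0 := right_ne_zero_of_mul (h1' ▸ one_ne_zero)
  have hy1 : y + D ≠ 0 := right_ne_zero_of_mul (h2' ▸ hL0.ne')
  have hne : c ≠ y := by
    rintro rfl
    have e1 : A * c + E = 0 :=
      (mul_eq_zero.mp (by linear_combination h1 - h2 : (L - 1) * (A * c + E) = 0)).resolve_left
        (by linarith)
    have h := (mul_eq_zero.mp (h1.trans e1)).resolve_right hc1; rw [h] at e1; linarith
  have hcD : c + D < 0 := by
    by_contra h; have hp : 0 < c + D := lt_of_le_of_ne (not_lt.mp h) (Ne.symm hc1)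
    have hcy : y < c := lt_of_le_of_ne (by nlinarith only [hf', hp]) (Ne.symm hne)
    have hq : y + D < 0 := lt_of_le_of_ne (by nlinarith only [hg', hcy]) hy1
    have hc0 : 0 < c := by
      by_contra! h'
      nlinarith only [mul_pos (mul_pos hL0 hA) (neg_pos.mpr hq), h2', hL,
        mul_nonneg (neg_nonneg.mpr h') (neg_pos.mpr hq).le]
    nlinarith only [mul_pos (neg_pos.mpr hq) hp, h1', mul_pos hA hp, hc0, htr, hAD, hp, mul_pos hc0 hA,
      mul_pos hc0 hD, mul_pos hD hA, mul_pos hD hD]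
  have hcy : c < y := lt_of_le_of_ne (by nlinarith only [hf', hcD]) hne
  have hyA : A < y := by
    by_contra! h; nlinarith only [mul_nonneg (sub_nonneg.mpr h) (neg_pos.mpr hcD).le, h1']
  have hyD : 0 < y + D := by linarith
  have hAy : A * y + E < 0 := by
    have : c * (y + D) < 0 := mul_neg_of_neg_of_pos (by linarith) hyD; rw [h2] at this
    exact (pos_iff_neg_of_mul_neg this).mp hL0
  have hAb : 0 < A * b + E := by
    have e : b * (b + D) = L * (A * b + E) := by linear_combination hb
    exact pos_of_mul_pos_right (by rw [← e]; positivity) hL0.le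
  have hyb : y < b := by nlinarith only [hAy, hAb, hA]
  have hLac : L * a < c := by
    have e1 : (A - a) * (a + D) = 1 := by linear_combination -ha - hE
    have e : (c - L * a) * (y + D) * (a + D) = L * (y - a) := by
      linear_combination -(a + D) * h2' + L * (y + D) * e1
    have : 0 < L * (y - a) := mul_pos hL0 (by linarith); rw [← e] at this
    exact sub_pos.mp (pos_of_mul_pos_left (pos_of_mul_pos_left this ha1.le) hyD.le)
  have hLa : L * a < a := by nlinarith only [ha0, hL]
  have sign : ∀ {p q r s : ℝ}, 0 < p → 0 < q → r < 0 → 0 < s → p * q * (r * s) < 0 :=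
    fun hp hq hr hs => mul_neg_of_pos_of_neg (mul_pos hp hq) (mul_neg_of_neg_of_pos hr hs)
  refine ⟨by linarith, ?_, ?_, fun x hx => ?_⟩
  · refine sign ?_ ?_ ?_ ?_ <;> linarith
  · linarith only [sign (p := b - a) (q := b - L * a) (r := c - a) (s := c - L * a) (by linarith)
      (by linarith) (by linarith) (by linarith)]
  · have hxD : x + D < 0 := by
      by_contra! h; nlinarith only [mul_nonneg h (by linarith : 0 ≤ b - A), hx]
    have hcx : c < x := by
      have e : (x - c) * (b - A) * (y - A) = b - y := by
        linear_combination (y - A) * hx + (b - A) * h1'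
      exact sub_pos.mp (pos_of_mul_pos_left (pos_of_mul_pos_left
        (by rw [e]; linarith : 0 < (x - c) * (b - A) * (y - A)) (by linarith)) (by linarith))
    linarith only [sign (p := b - c) (q := b - a) (r := c - x) (s := a - x) (by linarith)
      (by linarith) (by linarith) (by linarith)]

lemma pEnds_conj (M : SL2R) (F : Rel) (c : BdH2) (w : ℍ) :
    c ∈ pEnds (fun a b => F (M • a) (M • b)) w ↔ M • c ∈ pEnds F (M • w) := by
  refine ⟨fun h a b hab => ?_, fun h a b hab => (side_smul_nonneg M w a b c).mp (h _ _ hab)⟩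
  simpa using (side_smul_nonneg M w (M⁻¹ • a) (M⁻¹ • b) c).mpr (h _ _ (by simpa using hab))

lemma smul_mem_leaves (hinv : ∀ g ∈ Γ, ∀ a b, F a b → F (g • a) (g • b)) (hg : g ∈ Γ)
    (hz : z ∈ leaves F) : g • z ∈ leaves F := by
  obtain ⟨a, b, hab, hz⟩ := hz; exact ⟨_, _, hinv g hg a b hab, (smul_mem_geod g a b z).mpr hz⟩

/-- An element that fixes a boundary leaf of a plaque stabilizes the plaque. -/
lemma mem_stab_of_fix (hF : IsGeodFamily F)
    (hinv : ∀ g ∈ Γ, ∀ a b, F a b → F (g • a) (g • b)) (h0 : o ∉ leaves F)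
    (hab : F a b) (ha : a ∈ pEnds F o) (hb : b ∈ pEnds F o) (hg : g ∈ Γ)
    (ga : g • a = a) (gb : g • b = b) : g ∈ plaqueStab hinv h0 := by
  have h₁ : g • o ∉ leaves F := fun h' => h0 <| by
    simpa using smul_mem_leaves hinv (inv_mem hg) h'
  refine ⟨hg, mem_plaque_of_adjacent hF h0 h₁ hab ha hb
    (by simpa [ga] using smul_mem_pEnds hinv hg ha)
    (by simpa [gb] using smul_mem_pEnds hinv hg hb) ?_⟩
  · obtain ⟨s, hs, es⟩ := exists_rep_smul g a
    obtain ⟨t, ht, et⟩ := exists_rep_smul g b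
    rw [ga] at es
    rw [gb] at et
    have hd : vdet a.rep b.rep = s * (t * vdet a.rep b.rep) := by
      conv_lhs => rw [es, et, vdet_smul_left, vdet_smul_right, vdet_sl_smul]
    have hst : s * t = 1 := by
      have h1 := vdet_ne (hF.ne hab)
      apply mul_right_cancel₀ h1
      linear_combination -hd
    have e : hform (g • o) a.rep b.rep = s * t * hform o a.rep b.rep := by
      conv_lhs => rw [es, et, hform_smul_left, hform_smul_right, hform_sl_smul]
      ring
    rw [e, hst, one_mul]
    exact mul_self_pos.mpr (hform_ne_zero h0 hab)

namespace PantsLam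

variable {Γ : Subgroup SL2R} {F P : Rel} (h : PantsLam Γ F P)
  {o : ℍ}
include h

lemma partner_mem_pEnds (h0 : o ∉ leaves P) (hab : P a b)
    (ha : a ∈ pEnds P o) : b ∈ pEnds P o := by
  by_contra hb; obtain ⟨p, hp, q, hq, hpq, hlt⟩ := exists_separating_leaf h.family_P h0 hb
  refine h.family_P.unlinked hpq hab (link_of_separating hpq hlt ha ?_ ?_).symm_right <;> rintro rfl
  exacts [hb (h.P_unique hpq hab ▸ hq), hb (h.P_unique (h.P_symm hpq) hab ▸ hp)]

/-- If two closed leaves bound a plaque, and the elements along them are `d` and `k`, then `d k` and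
`d⁻¹ k` are not both peripheral. -/
lemma peripheral_ineq (h0 : o ∉ leaves P) (hz : zero ∈ pEnds P o)
    (hC : k 1 0 ≠ 0) {x : ℝ} (hx : k • ofReal x = ofReal x)
    (hxE : ofReal x ∈ pEnds P o) {m : ℝ} (hm : m ≠ 0)
    (hp : ∃ p q, P p q ∧ (slDiag m hm * k) • p = p ∧ (slDiag m hm * k) • q = q) :
    0 ≤ k 0 1 * (m ^ 2 - 1) * (k 0 0 * x + k 0 1) := by
  obtain ⟨p, q, hpq, ep, eq⟩ := hp
  have hne : (slDiag m hm * k) 1 0 ≠ 0 := by simpa [sl_mul, slDiag_apply] using ⟨hm, hC⟩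
  obtain ⟨p, rfl, e1⟩ := ofReal_of_fixed hne ep
  obtain ⟨q, rfl, e2⟩ := ofReal_of_fixed hne eq; have e3 := eq_of_smul_ofReal hx
  have hl := not_link_of_pEnds h0 hz hxE hpq; rw [zero_eq, link_ofReal, not_lt] at hl
  simp only [sl_mul, slDiag_apply] at e1 e2; field_simp at e1 e2
  have := quadratic_nonneg (C := k 1 0) (m := k 1 1 - m ^ 2 * k 0 0) (n := m ^ 2 * k 0 1)
    (by linear_combination e1) (by linear_combination e2) (fun h' => h.P_ne hpq (by rw [h'])) hl
  refine nonneg_of_mul_nonneg_right (a := m ^ 2) ?_ (by positivity)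
  linear_combination this - m ^ 2 * k 0 1 * e3

lemma neg_mem_stab_P (h0 : o ∉ leaves P) (hg : g ∈ plaqueStab h.P_smul h0) :
    -g ∈ plaqueStab h.P_smul h0 :=
  ⟨h.surf.neg_mem hg.1, by rw [neg_sl_smul_uhp]; exact hg.2⟩

lemma P_infty_zero_ne (hP : P zero infty) (hxy : P x y) (h0 : x ≠ zero) : y ≠ infty := by
  rintro rfl; exact h0 (h.P_unique (h.P_symm hxy) (h.P_symm hP))

/-- A plaque that has the closed leaf `(0, ∞)` as a side has another closed leaf as a side. -/
lemma exists_second_side (h0 : o ∉ leaves P) (hP : P zero infty) :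
    ∃ x y, P x y ∧ x ∈ pEnds P o ∧ y ∈ pEnds P o ∧ x ≠ zero ∧ x ≠ infty := by
  obtain ⟨g, hg, hg1, hg2, g0, gi⟩ := h.P_closed hP
  have hre : o.re ≠ 0 := fun h' => h0 ⟨_, _, hP, (mem_geod_zero_infty o).mpr h'⟩
  obtain ⟨σ, hσ, hσre⟩ : ∃ σ : ℝ, σ ^ 2 = 1 ∧ 0 < σ * o.re := by
    rcases lt_or_gt_of_ne hre with h' | h'
    · exact ⟨-1, by norm_num, by linarith⟩
    · exact ⟨1, by norm_num, by linarith⟩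
  obtain ⟨k, hk, p, q, hp, hq, k0, ki⟩ := h.surf.exists_translate_of_side hg hg1 hg2 g0 gi
    (fun k hk => h.family_P.unlinked hP (h.P_smul k hk _ _ hP)) hσ
  have hpq : P (ofReal p) (ofReal q) := by
    have := h.P_smul k hk _ _ hP
    rwa [k0, ki] at this
  have hp0 : p ≠ 0 := fun h' => by rw [h', mul_zero] at hp; exact lt_irrefl _ hp
  by_cases hpE : ofReal p ∈ pEnds P o
  · exact ⟨_, _, hpq, hpE, h.partner_mem_pEnds h0 hpq hpE,
      fun h' => hp0 (BdH2.ofReal_inj.mp h'), ofReal_ne_infty p⟩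
  · obtain ⟨x, hx, y, hy, hxy, hlt⟩ := exists_separating_leaf h.family_P h0 hpE
    have hs : 0 < side o zero infty (ofReal p) := by
      rw [zero, infty, ofReal, side_mk_pos]
      have e : hform o ![0, 1] ![1, 0] * (vdet ![0, 1] ![p, 1] * vdet ![1, 0] ![p, 1]) =
          o.re * p / o.im := by simp [hform, vdet]; ring
      rw [e]
      have h1 : 0 < o.re * p := by
        have : σ * o.re * (σ * p) = o.re * p := by linear_combination o.re * p * hσ
        rw [← this]; exact mul_pos hσre hp
      exact div_pos h1 o.im_pos
    refine ⟨x, y, hxy, hx, hy, ?_, ?_⟩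
    · rintro rfl
      obtain rfl := h.P_unique hxy hP
      exact lt_asymm hlt hs
    · rintro rfl
      obtain rfl := h.P_unique hxy (h.P_symm hP)
      rw [side_comm] at hs
      exact lt_asymm hlt hs

lemma exists_nonperipheral_of_side (h0 : o ∉ leaves P) (hP : P zero infty)
    (hz : zero ∈ pEnds P o) :
    ∃ g ∈ plaqueStab h.P_smul h0, g ≠ 1 ∧ g ≠ -1 ∧ ∀ a b, P a b → g • a = a → g • b ≠ b := by
  obtain ⟨g, hg, hg1, hg2, g0, gi⟩ := h.P_closed hP
  obtain ⟨l, hl, hl1, hd, -⟩ := exists_slDiag_mem (fun _ => h.surf.neg_mem) hg g0 gi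
    (h.surf.two_lt_trace hg hg1 hg2)
  have hds := mem_stab_of_fix h.family_P h.P_smul h0 hP hz (h.partner_mem_pEnds h0 hP hz) hd
    (slDiag_smul_zero l hl) (slDiag_smul_infty l hl)
  obtain ⟨x, y, hxy, hx, hy, hx0, hxi⟩ := h.exists_second_side h0 hP
  obtain ⟨k, hk, hk1, hk2, kx, ky⟩ := h.P_closed hxy
  have hks := mem_stab_of_fix h.family_P h.P_smul h0 hxy hx hy hk kx ky
  have hki : k • infty ≠ infty := fun h' => by
    rcases eq_one_or_of_three (h.P_ne hxy) hxi (h.P_infty_zero_ne hP hxy hx0) kx ky h'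
      with h' | h'
    exacts [hk1 h', hk2 h']
  obtain ⟨n10, -, -, n01⟩ := h.surf.entries_ne_zero hg hg1 hg2 g0 gi hk hki
  obtain ⟨x, rfl, e⟩ := ofReal_of_fixed n10 kx
  have hx0' : x ≠ 0 := fun h' => hx0 (by rw [h']; rfl)
  have hl2 : 1 < l ^ 2 := one_lt_pow₀ hl1 two_ne_zero
  have hAB : k 0 0 * x + k 0 1 ≠ 0 := by
    intro h'; have h2 : x * (k 1 0 * x + k 1 1) = 0 := by linear_combination e + h'
    have h3 := (mul_eq_zero.mp h2).resolve_left hx0'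
    exact hx0' (by linear_combination k 1 1 * h' - k 0 1 * h3 - x * sl_det k)
  by_contra! hcon
  have key : ∀ (m : ℝ) (hm : m ≠ 0), slDiag m hm ∈ plaqueStab h.P_smul h0 →
      0 ≤ k 0 1 * (m ^ 2 - 1) * (k 0 0 * x + k 0 1) := by
    intro m hm hmem
    have hne : (slDiag m hm * k) 1 0 ≠ 0 := by simpa [sl_mul, slDiag_apply] using ⟨hm, n10⟩
    exact h.peripheral_ineq h0 hz n10 kx hx hm (hcon _ (mul_mem hmem hks)
      (fun h' => hne (by simp [h'])) (fun h' => hne (by simp [h', sl_neg_apply])))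
  have k1 := key l hl hds
  have k2 := key l⁻¹ (inv_ne_zero hl) (by rw [← slDiag_inv l hl]; exact inv_mem hds)
  have h4 : 0 < 1 - (l⁻¹) ^ 2 := by rw [inv_pow]; exact sub_pos.mpr (inv_lt_one_of_one_lt₀ hl2)
  rcases lt_or_gt_of_ne (mul_ne_zero n01 hAB) with h3 | h3
  · linarith only [k1, mul_pos (neg_pos.mpr h3) (sub_pos.mpr hl2)]
  · linarith only [k2, mul_pos h3 h4]

omit h in
lemma mem_stab_conj (h : PantsLam Γ F P) (M : SL2R) (h0 : o ∉ leaves P)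
    (h1 : M⁻¹ • o ∉ leaves (fun a b => P (M • a) (M • b))) (k : SL2R) :
    k ∈ plaqueStab (h.conj M).P_smul h1 ↔ M * k * M⁻¹ ∈ plaqueStab h.P_smul h0 := by
  rw [mem_plaqueStab, mem_plaqueStab, mem_conjSub, plaque_conj]; simp only [mul_smul, smul_inv_smul]

omit h in
lemma notMem_conj (M : SL2R) (h0 : o ∉ leaves P) :
    M⁻¹ • o ∉ leaves (fun a b => P (M • a) (M • b)) := by
  rw [leaves_conj, smul_inv_smul]; exact h0

/-- The stabilizer of a plaque contains an element whose axis is not a closed leaf. -/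
lemma exists_nonperipheral (h0 : o ∉ leaves P) :
    ∃ g ∈ plaqueStab h.P_smul h0, g ≠ 1 ∧ g ≠ -1 ∧ ∀ a b, P a b → g • a = a → g • b ≠ b := by
  by_cases hP : ∃ a b, P a b
  · obtain ⟨a, b, hab, ha⟩ : ∃ a b, P a b ∧ a ∈ pEnds P o := by
      obtain ⟨a, b, hab⟩ := hP; by_cases ha : a ∈ pEnds P o
      · exact ⟨a, b, hab, ha⟩
      · obtain ⟨p, hp, q, -, hpq, -⟩ := exists_separating_leaf h.family_P h0 ha
        exact ⟨p, q, hpq, hp⟩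
    obtain ⟨M, rfl, rfl⟩ := exists_sl_frame (h.P_ne hab)
    obtain ⟨g, hg, hg1, hg2, hgP⟩ := (h.conj M).exists_nonperipheral_of_side (notMem_conj M h0) hab
      ((pEnds_conj M P _ _).mpr (by rwa [smul_inv_smul]))
    refine ⟨M * g * M⁻¹, (h.mem_stab_conj M h0 _ g).mp hg, sl_conj_ne_one M hg1,
      sl_conj_ne_neg_one M hg2, fun a b hab ga gb => hgP (M⁻¹ • a) (M⁻¹ • b) (by simpa using hab) ?_ ?_⟩
      <;> rwa [eq_inv_smul_iff, smul_smul, smul_smul]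
  · obtain ⟨g, hg, hgs⟩ := h.surf.exists_side_pos (σ := 1) (by norm_num)
    refine ⟨g, ⟨hg, fun a b hab => absurd ⟨a, b, hab⟩ hP⟩, ?_, ?_, fun a b hab => absurd ⟨a, b, hab⟩ hP⟩
      <;> rintro rfl <;> simp [sl_neg_apply] at hgs

/-- A shortest element of the stabilizer of a plaque whose axis is not a closed leaf yields a
frame. -/
lemma exists_frame_of_diag (h0 : o ∉ leaves P) {l : ℝ} {hl : l ≠ 0} (hl1 : 1 < l)
    (hd : slDiag l hl ∈ plaqueStab h.P_smul h0) (hnP : ¬P zero infty)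
    (hmin : ∀ g ∈ plaqueStab h.P_smul h0, g ≠ 1 → g ≠ -1 → |sltr g| < l + l⁻¹ →
      ∃ a b, P a b ∧ g • a = a ∧ g • b = b) :
    ∃ α β a b c, PantsFrame Γ P α β a b c ∧ a ∈ pEnds P o ∧ b ∈ pEnds P o ∧
      c ∈ pEnds P o ∧ α • c ∈ pEnds P o := by
  have hl0 : 0 < l := by linarith
  have hne1 : ∀ {g : SL2R}, g 1 0 ≠ 0 → g ≠ 1 ∧ g ≠ -1 := fun {g} hg =>
    ⟨fun h' => hg (by rw [h']; exact sl_one_one_zero),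
      fun h' => hg (by rw [h', sl_neg_apply, sl_one_one_zero, neg_zero])⟩
  obtain ⟨ne1, ne2⟩ := slDiag_ne hl hl1
  have mE {g : SL2R} (hg : g ∈ plaqueStab h.P_smul h0) (h1 : g ≠ 1) (h2 : g ≠ -1) {x : BdH2} :=
    mem_pEnds_of_fixed h.family_P h.P_smul h0 hg (h.surf.two_lt_trace hg.1 h1 h2) (a := x)
  have hzE := mE hd ne1 ne2 (slDiag_smul_zero l hl)
  have hiE := mE hd ne1 ne2 (slDiag_smul_infty l hl)
  obtain ⟨k, hk, hlk⟩ : ∃ k ∈ Γ, Link zero infty (k • zero) (k • infty) := by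
    by_contra! hcon
    exact hnP (h.P_maximal _ _ _ hd.1 ne1 ne2 zero_ne_infty (slDiag_smul_zero l hl)
      (slDiag_smul_infty l hl) (fun a b hab => not_link_of_pEnds h0 hzE hiE hab) hcon)
  have hks := mem_plaqueStab_of_link h.family_P h.P_smul h0 hzE hiE hnP hk hlk
  obtain ⟨p, α, hα, hA, hD, hprod, t1, t2, t3, hAD, hDL⟩ :=
    exists_smaller_trace hl hl1 ((link_smul_zero_infty k).mp hlk)
  have hαs : α ∈ plaqueStab h.P_smul h0 := by
    rcases hα with rfl | rfl
    exacts [mul_mem (zpow_mem hd p) hks, h.neg_mem_stab_P h0 (mul_mem (zpow_mem hd p) hks)]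
  have hβs := mul_mem hd hαs
  have hγs : slDiag l hl * α ^ 2 ∈ plaqueStab h.P_smul h0 := mul_mem hd (pow_mem hαs 2)
  have hγ : slDiag l hl * α * α = slDiag l hl * α ^ 2 := by rw [pow_two, mul_assoc]
  obtain ⟨hB, hC⟩ := off_diag_ne_zero_of_lt_one hprod
  have hCβ : (slDiag l hl * α) 1 0 ≠ 0 := by simpa [sl_mul, slDiag_apply] using ⟨hl, hC⟩
  have hCγ : (slDiag l hl * α ^ 2) 1 0 ≠ 0 := by
    rw [← hγ]; simp only [sl_mul, slDiag_apply, zero_mul, zero_add]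
    rw [mul_assoc, mul_assoc, ← mul_add, mul_comm (α 1 1), ← mul_add]
    exact mul_ne_zero (inv_ne_zero hl) (mul_ne_zero hC (add_pos hA hD).ne')
  have hdet := sl_det α
  have htr : 2 < α 0 0 + α 1 1 := by
    have h1 := h.surf.two_lt_trace hαs.1 (hne1 hC).1 (hne1 hC).2
    rwa [sltr, abs_of_pos (add_pos hA hD)] at h1
  obtain ⟨a, a', aP, ea, ea'⟩ := hmin _ hαs (hne1 hC).1 (hne1 hC).2 t1
  obtain ⟨b, b', bP, eb, eb'⟩ := hmin _ hβs (hne1 hCβ).1 (hne1 hCβ).2 t2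
  obtain ⟨c, c', cP, ec, ec'⟩ := hmin _ hγs (hne1 hCγ).1 (hne1 hCγ).2 t3
  have haE := mE hαs (hne1 hC).1 (hne1 hC).2 ea; have hbE := mE hβs (hne1 hCβ).1 (hne1 hCβ).2 eb
  have hcE := mE hγs (hne1 hCγ).1 (hne1 hCγ).2 ec
  have hyE := smul_mem_pEnds_of_stab h.P_smul h0 hαs hcE; have hαe := ea; have hβe := eb
  have hγe : (slDiag l hl * α) • α • c = c := by rw [smul_smul, hγ, ec]
  obtain ⟨a, rfl, fa⟩ := ofReal_of_fixed hC ea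
  obtain ⟨a', rfl, fa'⟩ := ofReal_of_fixed hC ea'
  obtain ⟨b, rfl, fb⟩ := ofReal_of_fixed hCβ eb
  obtain ⟨b', rfl, fb'⟩ := ofReal_of_fixed hCβ eb'
  obtain ⟨c, rfl, -⟩ := ofReal_of_fixed hCγ ec
  refine ⟨α, slDiag l hl * α, _, _, _, ?_, haE, hbE, hcE, hyE⟩
  obtain ⟨y, ey⟩ : ∃ y, α • ofReal c = ofReal y := by
    by_cases hp : α 1 0 * c + α 1 1 = 0
    · rw [sl_smul_ofReal_eq_infty hp, mul_smul, sl_smul_infty hC, slDiag_smul_ofReal,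
        BdH2.ofReal_inj] at hγe
      rw [← hγe] at hp; field_simp at hp; nlinarith only [hp, hD, mul_pos (pow_pos hl0 2) hA]
    · exact ⟨_, sl_smul_ofReal hp⟩
  have fy := eq_of_smul_ofReal ey; have fc := eq_of_smul_ofReal (ey ▸ hγe)
  have eβa : (slDiag l hl * α) • ofReal a = ofReal (l ^ 2 * a) := by
    rw [mul_smul, hαe, slDiag_smul_ofReal]
  have nla := not_link_of_pEnds h0 hzE hcE aP
  have nlb := not_link_of_pEnds h0 hzE (ey ▸ hyE) bP
  rw [zero_eq, link_ofReal, not_lt] at nla nlb; simp only [sl_mul, slDiag_apply] at fb fb' fc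
  field_simp at fb fb' fc; have neb : b ≠ b' := fun h' => h.P_ne bP (by rw [h'])
  have nea : a ≠ a' := fun h' => h.P_ne aP (by rw [h']); have hE : α 0 1 * α 1 0 < 0 := by linarith
  have hf : 0 ≤ (α 1 0 * c) ^ 2 + (α 1 1 - α 0 0) * (α 1 0 * c) - α 0 1 * α 1 0 := by
    refine nonneg_of_mul_nonneg_right (a := -(α 0 1 * α 1 0)) ?_ (by linarith)
    linear_combination α 1 0 ^ 2 * quadratic_nonneg fa fa' nea nla
  have hg : 0 ≤ (α 1 0 * y) ^ 2 + (α 1 1 - l ^ 2 * α 0 0) * (α 1 0 * y) -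
      l ^ 2 * (α 0 1 * α 1 0) := by
    refine nonneg_of_mul_nonneg_right (a := -(l ^ 2 * (α 0 1 * α 1 0))) ?_
      (neg_pos.mpr (mul_neg_of_pos_of_neg (pow_pos hl0 2) hE))
    linear_combination α 1 0 ^ 2 * quadratic_nonneg (C := α 1 0) (m := α 1 1 - l ^ 2 * α 0 0)
      (n := l ^ 2 * α 0 1) (by linear_combination fb) (by linear_combination fb') neb nlb
  obtain ⟨hAb, m1, m2, m3⟩ := frame_real (A := α 0 0) (D := α 1 1) (L := l ^ 2)
    (E := α 0 1 * α 1 0) (a := α 1 0 * a) (b := α 1 0 * b) (c := α 1 0 * c) (y := α 1 0 * y)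
    (by linarith) (by linarith) hA hAD hDL (one_lt_pow₀ hl1 two_ne_zero) htr
    (by linear_combination α 1 0 * fa) (by linear_combination α 1 0 * fb)
    (by linear_combination α 1 0 * fy) (by linear_combination α 1 0 * fc) hf hg
  have hp : -α 1 0 * b + α 0 0 ≠ 0 := by linarith
  have ex : α⁻¹ • ofReal b = _ :=
    sl_smul_ofReal (by rw [sl_inv_10, sl_inv_11]; exact hp)
  rw [sl_inv_00, sl_inv_01, sl_inv_10, sl_inv_11] at ex
  have m4 := m3 (α 1 0 * ((α 1 1 * b + -α 0 1) / (-α 1 0 * b + α 0 0))) (by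
    have hw := div_mul_cancel₀ (α 1 1 * b + -α 0 1) hp
    linear_combination -α 1 0 * hw - hdet)
  have hC4 : 0 < α 1 0 ^ 4 := by positivity
  refine ⟨hαs.1, hβs.1, hαe, hβe, hγe, ⟨_, aP⟩, ⟨_, bP⟩, ⟨_, cP⟩, ?_, ?_, ?_⟩ <;>
    simp only [ey, eβa, ex, link_ofReal] <;> refine neg_of_mul_neg_right ?_ hC4.le
  exacts [by linarith only [m1], by linarith only [m2], by linarith only [m4]]

end PantsLam

/-- The translates of the two triangles of a frame. -/
def tiles (Γ : Subgroup SL2R) (α : SL2R) (a b c : BdH2) : Set ℍ :=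
  {z | ∃ g ∈ Γ, g • z ∈ closedTri a b c ∨ g • z ∈ closedTri a b (α • c)}

namespace PantsFrame

variable {Γ : Subgroup SL2R} {P F : Rel} {α β : SL2R} {a b c : BdH2}

lemma of_conj {M : SL2R}
    (f : PantsFrame (conjSub M Γ) (fun a b => P (M • a) (M • b)) α β a b c) :
    PantsFrame Γ P (M * α * M⁻¹) (M * β * M⁻¹) (M • a) (M • b) (M • c) where
  memα := f.memα
  memβ := f.memβ
  fixα := by rw [mul_smul, mul_smul, inv_smul_smul, f.fixα]
  fixβ := by rw [mul_smul, mul_smul, inv_smul_smul, f.fixβ]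
  fixγ := by simp only [mul_smul, inv_smul_smul, f.fixγ]
  enda := let ⟨_, hx⟩ := f.enda; ⟨_, hx⟩
  endb := let ⟨_, hx⟩ := f.endb; ⟨_, hx⟩
  endc := let ⟨_, hx⟩ := f.endc; ⟨_, hx⟩
  linkγ := by simp only [mul_smul, inv_smul_smul, link_smul, f.linkγ]
  linkα := by simp only [mul_smul, inv_smul_smul, link_smul, f.linkα]
  linkβ := by simp only [mul_inv_rev, inv_inv, mul_smul, inv_smul_smul, link_smul, f.linkβ]

lemma tiles_rotate (f : PantsFrame Γ P α β a b c) : tiles Γ β b c a ⊆ tiles Γ α a b c := by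
  rintro z ⟨g, hg, h | h⟩
  · exact ⟨g, hg, Or.inl (by rwa [closedTri_rotate])⟩
  · refine ⟨β⁻¹ * g, mul_mem (inv_mem f.memβ) hg, Or.inr ?_⟩
    have h1 := (smul_mem_closedTri β⁻¹ _ _ _ _).mpr h
    rwa [inv_smul_eq_iff.mpr f.fixβ.symm, f.inv_smul_c, inv_smul_smul, ← closedTri_rotate,
      smul_smul] at h1

lemma tiles_flip (f : PantsFrame Γ P α β a b c) : tiles Γ β b a (α • c) ⊆ tiles Γ α a b c := by
  rintro z ⟨g, hg, h | h⟩
  exacts [⟨g, hg, Or.inr (by rwa [closedTri_swap])⟩,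
    ⟨g, hg, Or.inl (by rwa [f.fixγ, closedTri_swap] at h)⟩]

lemma mem_nhds_of_side (f : PantsFrame Γ P α β a b c) (hz : z ∈ geod a b) :
    tiles Γ α a b c ∈ nhds z := by
  have hl := f.linkγ
  have h1 := side_pos_of_mem_geod hl.ne_left hl.ne13 hz
  have h2 := side_pos_of_mem_geod hl.ne_left hl.ne14 hz
  have h3 := side_pos_of_mem_geod hl.ne_left.symm hl.ne23 (geod_comm a b ▸ hz)
  have h4 := side_pos_of_mem_geod hl.ne_left.symm hl.ne24 (geod_comm a b ▸ hz)
  filter_upwards [(continuous_side b c a).continuousAt.eventually (lt_mem_nhds h1),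
    (continuous_side b (α • c) a).continuousAt.eventually (lt_mem_nhds h2),
    (continuous_side a c b).continuousAt.eventually (lt_mem_nhds h3),
    (continuous_side a (α • c) b).continuousAt.eventually (lt_mem_nhds h4)] with w w1 w2 w3 w4
  refine ⟨1, one_mem _, ?_⟩
  rw [one_smul]
  rcases le_total 0 (side w a b c) with h | h
  · exact Or.inl ⟨w1.le, by rw [side_comm]; exact w3.le, h⟩
  · refine Or.inr ⟨w2.le, by rw [side_comm]; exact w4.le, ?_⟩
    unfold Link at hl
    unfold side at h ⊢
    generalize hform w a.rep b.rep = s at *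
    generalize vdet a.rep c.rep * vdet b.rep c.rep = p at *
    generalize vdet a.rep (α • c).rep * vdet b.rep (α • c).rep = q at *
    have hp := left_ne_zero_of_mul hl.ne
    refine nonneg_of_mul_nonneg_right (a := p ^ 2) ?_ (by positivity)
    linear_combination mul_nonneg (neg_nonneg.mpr h) (neg_nonneg.mpr hl.le)

lemma mem_nhds_tiles (f : PantsFrame Γ P α β a b c) (hz : z ∈ closedTri a b c) :
    tiles Γ α a b c ∈ nhds z := by
  have hl := f.linkγ; have hl' := f.linkα; rcases hz.1.eq_or_lt with h1 | h1
  · exact Filter.mem_of_superset (f.rotate.mem_nhds_of_side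
      ((side_eq_zero_iff hl.ne_left.symm hl.ne13.symm).mp h1.symm)) f.tiles_rotate
  rcases hz.2.1.eq_or_lt with h2 | h2
  · exact Filter.mem_of_superset (f.rotate.rotate.mem_nhds_of_side
      ((side_eq_zero_iff hl.ne23.symm hl.ne_left).mp h2.symm))
      (f.rotate.tiles_rotate.trans f.tiles_rotate)
  rcases hz.2.2.eq_or_lt with h3 | h3
  · exact f.mem_nhds_of_side ((side_eq_zero_iff hl.ne13 hl.ne23).mp h3.symm)
  · refine Filter.mem_of_superset ((isOpen_openTri a b c).mem_nhds ⟨h1, h2, h3⟩) fun w hw =>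
      ⟨1, one_mem _, Or.inl ?_⟩
    rw [one_smul]; exact openTri_subset _ _ _ hw

lemma tiles_mem_nhds (h : PantsLam Γ F P) (f : PantsFrame Γ P α β a b c)
    (hz : z ∈ tiles Γ α a b c) : tiles Γ α a b c ∈ nhds z := by
  obtain ⟨g, hg, hz⟩ := hz
  have key : tiles Γ α a b c ∈ nhds (g • z) := by
    rcases hz with hz | hz
    exacts [f.mem_nhds_tiles hz,
      Filter.mem_of_superset ((f.flip h).mem_nhds_tiles (by rwa [closedTri_swap])) f.tiles_flip]
  have hc : Continuous fun w : ℍ => g • w := by fun_prop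
  refine Filter.mem_of_superset (hc.continuousAt.preimage_mem_nhds key) ?_; rintro w ⟨k, hk, hw⟩
  exact ⟨k * g, mul_mem hk hg, by simpa only [mul_smul] using hw⟩

/-- The translates of the triangles of a frame are locally finite off the closed leaves. -/
lemma mem_tiles_of_mem_closure (h : PantsLam Γ F P) (f : PantsFrame Γ P α β a b c)
    (hz : z ∈ closure (tiles Γ α a b c)) (hP : z ∉ leaves P) : z ∈ tiles Γ α a b c := by
  obtain ⟨K, hK, hzK, hKP⟩ := exists_compact_subset h.isClosed_leaves_P.isOpen_compl hP
  have hd : Disjoint K (leaves P) := Set.disjoint_left.mpr fun x hx => hKP hx; have hl := f.linkγ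
  obtain ⟨a', ha⟩ := f.enda; obtain ⟨b', hb⟩ := f.endb; obtain ⟨c', hc⟩ := f.endc
  have f1 := h.finite_closedTri ha hb hc hl.ne_left hl.ne23 hl.ne13.symm hK hd
  have f2 := h.finite_closedTri ha hb (h.P_smul α f.memα _ _ hc) hl.ne_left hl.ne24 hl.ne14.symm hK hd
  set S : Set ℍ := (⋃ g ∈ {g | g ∈ Γ ∧ ∃ z ∈ K, g • z ∈ closedTri a b c},
      (fun w : ℍ => g • w) ⁻¹' closedTri a b c) ∪
    ⋃ g ∈ {g | g ∈ Γ ∧ ∃ z ∈ K, g • z ∈ closedTri a b (α • c)},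
      (fun w : ℍ => g • w) ⁻¹' closedTri a b (α • c) with hS
  have hSc : IsClosed S :=
    (f1.isClosed_biUnion fun g _ => (isClosed_closedTri _ _ _).preimage (by fun_prop)).union
      (f2.isClosed_biUnion fun g _ => (isClosed_closedTri _ _ _).preimage (by fun_prop))
  have hSt : S ⊆ tiles Γ α a b c := by
    rintro w (hw | hw) <;> simp only [Set.mem_iUnion] at hw <;> obtain ⟨g, hg, hw⟩ := hw
    exacts [⟨g, hg.1, .inl hw⟩, ⟨g, hg.1, .inr hw⟩]
  have hKS : tiles Γ α a b c ∩ interior K ⊆ S := by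
    rintro w ⟨⟨g, hg, hw | hw⟩, hwK⟩
    exacts [Or.inl (Set.mem_biUnion (show g ∈ {g | _} from ⟨hg, w, interior_subset hwK, hw⟩) hw),
      Or.inr (Set.mem_biUnion (show g ∈ {g | _} from ⟨hg, w, interior_subset hwK, hw⟩) hw)]
  have h1 : z ∈ closure (tiles Γ α a b c ∩ interior K) := by
    have := isOpen_interior.inter_closure (s := interior K) (t := tiles Γ α a b c) ⟨hzK, hz⟩
    rwa [Set.inter_comm] at this
  exact hSt (hSc.closure_subset_iff.mpr hKS h1)

end PantsFrame

/-- A geodesic through a triangle that crosses none of its sides ends at two of its vertices. -/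
lemma false_of_not_link {u w : BdH2} (huw : u ≠ w) (hz : z ∈ geod u w)
    (ht : z ∈ closedTri a b c) (hwa : w ≠ a) (hwb : w ≠ b) (hwc : w ≠ c) (hab : a ≠ b) (hbc : b ≠ c)
    (hca : c ≠ a)
    (h1 : ¬Link a b u w) (h2 : ¬Link b c u w) (h3 : ¬Link c a u w) : False := by
  obtain ⟨s, t, hs, hT, e⟩ := hform_of_mem_geod huw hz
  have key : ∀ {a b c : BdH2}, w ≠ a → w ≠ b → a ≠ c → b ≠ c → ¬Link a b u w → 0 ≤ side z a b c →
      0 < vdet a.rep w.rep * vdet b.rep w.rep * (vdet a.rep c.rep * vdet b.rep c.rep) := by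
    intro a b c ha hb hac hbc hl hsd
    have p1 := mul_ne_zero (vdet_ne ha.symm) (vdet_ne hb.symm)
    have p2 := mul_ne_zero (vdet_ne hac) (vdet_ne hbc); rw [side, e] at hsd
    unfold Link at hl
    generalize vdet a.rep w.rep * vdet b.rep w.rep = x at *
    generalize vdet a.rep u.rep * vdet b.rep u.rep = y at *
    generalize vdet a.rep c.rep * vdet b.rep c.rep = d at *; rw [not_lt] at hl; by_contra hn
    have hn' : x * d < 0 := lt_of_le_of_ne (not_lt.mp hn) (mul_ne_zero p1 p2)
    have h4 : 0 < s * (y * x) + t * x ^ 2 := by positivity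
    nlinarith only [mul_pos h4 (neg_pos.mpr hn'), mul_nonneg (sq_nonneg x) hsd]
  have k1 := key hwa hwb hca.symm hbc h1 ht.2.2; have k2 := key hwb hwc hab.symm hca h2 ht.1
  have k3 := key hwc hwa hbc.symm hab h3 ht.2.1
  rw [vdet_swap c.rep a.rep, vdet_swap c.rep b.rep, vdet_swap b.rep a.rep] at *
  generalize vdet a.rep w.rep = A at *
  generalize vdet b.rep w.rep = B at *
  generalize vdet c.rep w.rep = C at *
  generalize vdet a.rep c.rep = p at *
  generalize vdet b.rep c.rep = q at *
  generalize vdet a.rep b.rep = r at *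
  linarith only [mul_pos (mul_pos k1 k2) k3, sq_nonneg (A * B * C * (p * q * r))]

namespace PantsLam

variable {Γ : Subgroup SL2R} {F P : Rel} (h : PantsLam Γ F P)
  {o : ℍ}
include h

lemma exists_frame (h0 : o ∉ leaves P) :
    ∃ α β a b c, PantsFrame Γ P α β a b c ∧ a ∈ pEnds P o ∧ b ∈ pEnds P o ∧
      c ∈ pEnds P o ∧ α • c ∈ pEnds P o := by
  obtain ⟨m, ⟨hm, hm1, hm2, hmP⟩, hmin⟩ := h.surf.exists_min_trace
    (S := {g | g ∈ plaqueStab h.P_smul h0 ∧ g ≠ 1 ∧ g ≠ -1 ∧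
      ∀ a b, P a b → g • a = a → g • b ≠ b}) (fun k hk => ⟨hk.1.1, hk.2.1, hk.2.2.1⟩) (h.exists_nonperipheral h0)
  obtain ⟨a, b, hab, ha, hb⟩ := h.surf.exists_fixed hm.1 hm1 hm2
  obtain ⟨M, rfl, rfl⟩ := exists_sl_frame hab
  have hz := notMem_conj M h0
  have hst := h.mem_stab_conj M h0 hz
  have hk0 : (M⁻¹ * m * M) • zero = zero := by
    rw [mul_smul, mul_smul, ha, inv_smul_smul]
  have hk1 : (M⁻¹ * m * M) • infty = infty := by
    rw [mul_smul, mul_smul, hb, inv_smul_smul]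
  have hmem : M⁻¹ * m * M ∈ plaqueStab (h.conj M).P_smul hz := by
    rwa [hst, show M * (M⁻¹ * m * M) * M⁻¹ = m by group]
  have htr : sltr (M⁻¹ * m * M) = sltr m := by simpa using sltr_conj M⁻¹ m
  have h2 := h.surf.two_lt_trace hm.1 hm1 hm2
  rw [← htr] at h2 hmin
  obtain ⟨l, hl, hl1, hlΓ, hltr⟩ :=
    exists_slDiag_mem (fun _ => (h.conj M).neg_mem_stab_P hz) hmem hk0 hk1 h2
  obtain ⟨α, β, a, b, c, f, ea, eb, ec, ey⟩ := (h.conj M).exists_frame_of_diag hz hl1 hlΓ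
    (fun hP => hmP _ _ hP ha hb) fun g hg hg1 hg2 hgt => by
      by_contra! hcon
      have := hmin (M * g * M⁻¹) ⟨(hst g).mp hg, sl_conj_ne_one M hg1, sl_conj_ne_neg_one M hg2,
        fun a b hab ga gb => ?_⟩
      · rw [sltr_conj, hltr] at this
        exact not_le.mpr hgt this
      · refine hcon (M⁻¹ • a) (M⁻¹ • b) (by simpa using hab) ?_ ?_ <;>
          rwa [eq_inv_smul_iff, smul_smul, smul_smul]
  simp only [pEnds_conj, smul_inv_smul] at ea eb ec ey
  exact ⟨_, _, _, _, _, f.of_conj, ea, eb, ec, by simpa only [mul_smul, inv_smul_smul] using ey⟩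

/-- The translates of the triangles of a frame cover the plaque. -/
lemma exists_frame_tiles (h0 : o ∉ leaves P) :
    ∃ α β a b c, PantsFrame Γ P α β a b c ∧ o ∈ tiles Γ α a b c := by
  obtain ⟨α, β, a, b, c, f, ha, hb, hc, hy⟩ := h.exists_frame h0
  refine ⟨α, β, a, b, c, f, ?_⟩
  have hl := f.linkγ
  have hU := isPreconnected_plaque P o
  have hab : ¬P a b := fun hP => not_link_of_pEnds h0 hc hy hP hl
  obtain ⟨z, hz⟩ := geod_nonempty hl.ne_left
  have hzU := geod_subset_plaque h.family_P h0 ha hb hl.ne_left hab hz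
  refine hU.subset_left_of_subset_union (u := interior (tiles Γ α a b c))
    (v := (closure (tiles Γ α a b c))ᶜ) isOpen_interior isClosed_closure.isOpen_compl ?_ ?_ ?_
    (mem_plaque_self h0) |> interior_subset
  · exact Set.disjoint_left.mpr fun x hx hx' => hx' (subset_closure (interior_subset hx))
  · intro x hx
    by_cases hc : x ∈ closure (tiles Γ α a b c)
    · exact Or.inl (mem_interior_iff_mem_nhds.mpr (f.tiles_mem_nhds h
        (f.mem_tiles_of_mem_closure h hc (notMem_of_mem_plaque hx))))
    · exact Or.inr hc
  · exact ⟨z, hzU, mem_interior_iff_mem_nhds.mpr (f.mem_nhds_of_side hz)⟩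

lemma notMem_P_of_leaf {u w : BdH2} (hF : F u w) (hP : ¬P u w) (hz : z ∈ geod u w) :
    z ∉ leaves P := by
  rintro ⟨p, q, hpq, hz'⟩
  rcases link_or_eq_of_mem_geod (h.ne hF) hz' hz with hl | ⟨rfl, rfl⟩ | ⟨rfl, rfl⟩
  exacts [h.unlinked (h.P_sub hpq) hF hl, hP hpq, hP (h.P_symm hpq)]

/-- Every end of a leaf is an end of a closed leaf. -/
lemma exists_P_of_leaf {u w : BdH2} (hF : F u w) : ∃ x, P w x := by
  by_contra! hw; obtain ⟨z, hz⟩ := geod_nonempty (h.ne hF)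
  have hzP := h.notMem_P_of_leaf hF (fun hP => hw u (h.P_symm hP)) hz
  have hs : IsStray Γ P u w := ⟨fun g hg => h.unlinked hF (h.smul g hg _ _ hF), hw,
    fun p q hpq => h.unlinked (h.P_sub hpq) hF⟩
  have key : ∀ {α β : SL2R} {a b c : BdH2} {u w : BdH2} {z : ℍ}, PantsFrame Γ P α β a b c →
      IsStray Γ P u w → u ≠ w → z ∈ geod u w → z ∈ closedTri a b c → False :=
    fun f hs huw hz ht => have hl := f.linkγ
    false_of_not_link huw hz ht (PantsFrame.ne_of_end hs f.enda) (PantsFrame.ne_of_end hs f.endb)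
      (PantsFrame.ne_of_end hs f.endc) hl.ne_left hl.ne23 hl.ne13.symm (f.no_cross h hs)
      (f.rotate.no_cross h hs) (f.rotate.rotate.no_cross h hs)
  obtain ⟨α, β, a, b, c, f, g, hg, ht⟩ := h.exists_frame_tiles hzP; have hs' := hs.smul h.P_smul hg
  have hne : g • u ≠ g • w := fun h' => h.ne hF (smul_left_cancel g h')
  have hz' := (smul_mem_geod g u w z).mpr hz; rcases ht with ht | ht
  exacts [key f hs' hne hz' ht, key (f.flip h) hs' hne hz' (by rwa [closedTri_swap])]

end PantsLam

/-- `a, b, c` are the vertices of a complementary triangle of the geodesics of `F`. -/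
def IsTri (F : Rel) (a b c : BdH2) : Prop :=
  a ≠ b ∧ b ≠ c ∧ c ≠ a ∧ ∃ z ∉ leaves F, pEnds F z = {a, b, c}

lemma mem_closedTri_iff : z ∈ closedTri a b c ↔
    ∀ x ∈ ({a, b, c} : Set BdH2), ∀ y ∈ ({a, b, c} : Set BdH2), ∀ w ∈ ({a, b, c} : Set BdH2),
      0 ≤ side z x y w := by
  have h1 : ∀ x y : BdH2, 0 ≤ side z x y x := fun x y => by simp [side, vdet_self]
  have h2 : ∀ x y : BdH2, 0 ≤ side z y x x := fun x y => by simp [side, vdet_self]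
  have h3 : ∀ x y : BdH2, 0 ≤ side z x x y := fun x y =>
    mul_nonneg (hform_self_pos z x.rep_nonzero).le (mul_self_nonneg _)
  constructor
  · rintro ⟨ha, hb, hc⟩
    have ha' := side_comm z b c a ▸ ha
    have hb' := side_comm z c a b ▸ hb
    have hc' := side_comm z a b c ▸ hc
    rintro x (rfl | rfl | rfl) y (rfl | rfl | rfl) w (rfl | rfl | rfl) <;>
      first | assumption | exact h1 _ _ | exact h2 _ _ | exact h3 _ _
  · intro h
    exact ⟨h _ (by simp) _ (by simp) _ (by simp), h _ (by simp) _ (by simp) _ (by simp),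
      h _ (by simp) _ (by simp) _ (by simp)⟩

/-- A point of a geodesic sees the ends of the geodesic in the boundary of its plaque. -/
lemma mem_pEnds_of_unlinked (hxy : x ≠ y)
    (hF : ∀ a b, F a b → ¬Link a b x y) (hz : z ∈ geod x y) : x ∈ pEnds F z := by
  obtain ⟨s, t, hs, ht, e⟩ := hform_of_mem_geod hxy hz; intro a b hab; have hl := hF a b hab
  rw [side, e]; unfold Link at hl; rw [not_lt] at hl
  nlinarith only [mul_nonneg ht.le hl, mul_nonneg hs.le (mul_self_nonneg (vdet a.rep x.rep * vdet b.rep x.rep))]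

lemma dense_compl_geod (a b : BdH2) : Dense (geod a b)ᶜ := by
  intro z; by_cases hz : z ∈ geod a b; swap
  · exact subset_closure hz
  obtain ⟨c, hca, hcb⟩ := exists_ne_ne_bdH2 a b
  have h1 : Filter.Tendsto (rayPt z c.rep) (nhdsWithin 0 (Set.Ioi 0)) (nhds z) := by
    have := ((continuousOn_rayPt z c.rep) 0 Set.self_mem_Ici).tendsto
    rw [show rayPt z c.rep 0 = z from pencil_zero z _ _ _] at this
    exact this.mono_left (nhdsWithin_mono 0 Set.Ioi_subset_Ici_self)
  refine mem_closure_of_tendsto h1 ?_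
  filter_upwards [self_mem_nhdsWithin] with τ hτ hmem
  obtain ⟨s, hs, e⟩ := hform_rayPt z c.rep (le_of_lt hτ)
  have h2 : hform (rayPt z c.rep τ) a.rep b.rep = 0 := hmem; have h3 : hform z a.rep b.rep = 0 := hz
  rw [e, h3, zero_add] at h2
  exact mul_ne_zero hs.ne' (mul_ne_zero (ne_of_gt hτ) (mul_ne_zero (vdet_ne hca.symm)
    (vdet_ne hcb.symm))) h2

namespace PantsLam

variable {Γ : Subgroup SL2R} {F P : Rel} (h : PantsLam Γ F P)
  {o : ℍ}
include h

lemma dense_compl_leaves : Dense (leaves F)ᶜ := by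
  have hΓ : (Γ : Set SL2R).Countable := by
    have : (Γ : Set SL2R) = ⋃ n : ℕ, {g | g ∈ Γ ∧ frob g ≤ n} := by
      ext g; simp only [Set.mem_iUnion]
      exact ⟨fun hg => (exists_nat_ge (frob g)).imp fun n hn => ⟨hg, hn⟩, fun ⟨n, hn⟩ => hn.1⟩
    rw [this]; exact Set.countable_iUnion fun n => (h.surf.discrete n).countable
  obtain ⟨J, hJ, -, hJP⟩ := h.exists_finite_P
  have hE : {x | ∃ y, P x y}.Countable := by
    refine ((hΓ.biUnion fun g _ => (hJ.biUnion fun j _ =>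
      Set.toFinite {g • j.1, g • j.2}).countable)).mono ?_
    rintro x ⟨y, hxy⟩; obtain ⟨g, hg, hj⟩ := hJP x y hxy
    refine Set.mem_biUnion (show g⁻¹ ∈ (Γ : Set SL2R) from inv_mem hg) ?_
    rcases hj with hj | hj <;> refine Set.mem_biUnion hj ?_ <;> simp
  have hL : {p : BdH2 × BdH2 | F p.1 p.2}.Countable := (hE.prod hE).mono fun p hp =>
    Set.mem_prod.mpr ⟨h.exists_P_of_leaf (h.symm hp), h.exists_P_of_leaf hp⟩
  have : (leaves F)ᶜ = ⋂ p ∈ {p : BdH2 × BdH2 | F p.1 p.2}, (geod p.1 p.2)ᶜ := by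
    ext z; simp [leaves]
  rw [this]; refine dense_biInter_of_isOpen (fun p _ => ?_) hL fun p _ => dense_compl_geod _ _
  exact (isClosed_eq (continuous_hform _ _) continuous_const).isOpen_compl

lemma tri_leaf (t : IsTri F a b c) (hx : x ∈ ({a, b, c} : Set BdH2))
    (hy : y ∈ ({a, b, c} : Set BdH2)) (hxy : x ≠ y) : F x y := by
  obtain ⟨-, -, -, z, hz, e⟩ := t; exact h.leaf_of_mem_pEnds hz (e ▸ hx) (e ▸ hy) hxy

lemma tri_not_P (t : IsTri F a b c) (hx : x ∈ ({a, b, c} : Set BdH2))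
    (hy : y ∈ ({a, b, c} : Set BdH2)) : ¬P x y := by
  obtain ⟨-, -, -, z, hz, e⟩ := t; intro hP; obtain ⟨g, hg, h1, h2, gx, gy⟩ := h.P_closed hP
  have := mem_stab_of_fix h.toIsGeodFamily h.smul hz (h.P_sub hP) (e ▸ hx) (e ▸ hy) hg gx gy
  exact (h.eq_one_or_of_mem_stab hz hg this.2).elim h1 h2

/-- A point of a closed complementary triangle is on one of its sides, or is in its interior. -/
lemma mem_side_or_of_mem_tri (t : IsTri F a b c) (hz : z ∈ closedTri a b c) :
    (∃ x ∈ ({a, b, c} : Set BdH2), ∃ y ∈ ({a, b, c} : Set BdH2), F x y ∧ z ∈ geod x y) ∨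
      z ∉ leaves F ∧ pEnds F z = {a, b, c} := by
  obtain ⟨hab, hbc, hca, w, hw, e⟩ := id t; by_contra! hcon
  have key : ∀ {x y}, x ∈ ({a, b, c} : Set BdH2) → y ∈ ({a, b, c} : Set BdH2) → x ≠ y →
      z ∉ geod x y := fun hx hy hxy => hcon.1 _ hx _ hy (h.tri_leaf t hx hy hxy)
  have : z ∈ plaque F w := by
    rw [h.plaque_eq_openTri hw hab hbc hca e]
    refine ⟨hz.1.lt_of_ne' fun h' => ?_, hz.2.1.lt_of_ne' fun h' => ?_, hz.2.2.lt_of_ne' fun h' => ?_⟩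
    exacts [key (by simp) (by simp) hbc ((side_eq_zero_iff hab.symm hca).mp h'),
      key (by simp) (by simp) hca ((side_eq_zero_iff hbc.symm hab).mp h'),
      key (by simp) (by simp) hab ((side_eq_zero_iff hca.symm hbc).mp h')]
  exact hcon.2 (notMem_of_mem_plaque this) ((pEnds_eq_of_mem this).trans e)

/-- Where a leaf meets a closed complementary triangle, it is one of its sides. -/
lemma mem_tri_of_leaf (t : IsTri F a b c) (hz : z ∈ closedTri a b c)
    (hpq : F p q) (hz' : z ∈ geod p q) :
    p ∈ ({a, b, c} : Set BdH2) ∧ q ∈ ({a, b, c} : Set BdH2) := by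
  rcases h.mem_side_or_of_mem_tri t hz with ⟨x, hx, y, hy, hF, hzx⟩ | hzF
  · rcases link_or_eq_of_mem_geod (h.ne hF) hz' hzx with h' | ⟨rfl, rfl⟩ | ⟨rfl, rfl⟩
    exacts [absurd h' (h.unlinked hpq hF), ⟨hx, hy⟩, ⟨hy, hx⟩]
  · exact absurd ⟨p, q, hpq, hz'⟩ hzF.1

lemma pEnds_of_mem_tri (t : IsTri F a b c) (hz : z ∈ closedTri a b c)
    (hzF : z ∉ leaves F) : pEnds F z = {a, b, c} :=
  (h.mem_side_or_of_mem_tri t hz).elim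
    (fun ⟨x, _, y, _, hF, hzx⟩ => absurd ⟨x, y, hF, hzx⟩ hzF) (·.2)

/-- Two closed complementary triangles that meet have the same vertices, or meet along a common
side. -/
lemma tri_inter {a' b' c' : BdH2} (t : IsTri F a b c) (t' : IsTri F a' b' c')
    (hz : z ∈ closedTri a b c) (hz' : z ∈ closedTri a' b' c') :
    ({a, b, c} : Set BdH2) = {a', b', c'} ∨ ∃ p q, F p q ∧ z ∈ geod p q ∧
      (p ∈ ({a, b, c} : Set BdH2) ∧ q ∈ ({a, b, c} : Set BdH2)) ∧
      p ∈ ({a', b', c'} : Set BdH2) ∧ q ∈ ({a', b', c'} : Set BdH2) := by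
  by_cases hF : z ∈ leaves F
  · obtain ⟨p, q, hpq, hzp⟩ := hF
    exact Or.inr ⟨p, q, hpq, hzp, h.mem_tri_of_leaf t hz hpq hzp, h.mem_tri_of_leaf t' hz' hpq hzp⟩
  · exact Or.inl ((h.pEnds_of_mem_tri t hz hF).symm.trans (h.pEnds_of_mem_tri t' hz' hF))

lemma pEnds_smul (e : pEnds F w = {a, b, c})
    (hg : g ∈ Γ) : pEnds F (g • w) = {g • a, g • b, g • c} := by
  refine Set.Subset.antisymm (fun x hx => ?_) ?_
  · have := smul_mem_pEnds h.smul (inv_mem hg) hx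
    rw [inv_smul_smul, e] at this
    simpa only [Set.mem_insert_iff, Set.mem_singleton_iff, inv_smul_eq_iff] using this
  · rintro x (rfl | rfl | rfl) <;> exact smul_mem_pEnds h.smul hg (by rw [e]; simp)

lemma tri_smul (t : IsTri F a b c) (hg : g ∈ Γ) : IsTri F (g • a) (g • b) (g • c) := by
  obtain ⟨hab, hbc, hca, w, hw, e⟩ := t; have hi := MulAction.injective (β := BdH2) g
  exact ⟨hi.ne hab, hi.ne hbc, hi.ne hca, g • w,
    fun h' => hw (by simpa using smul_mem_leaves h.smul (inv_mem hg) h'), h.pEnds_smul e hg⟩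

/-- Finitely many representatives of the complementary triangles. -/
lemma exists_finite_tri : ∃ T : Set (BdH2 × BdH2 × BdH2), T.Finite ∧
    (∀ t ∈ T, IsTri F t.1 t.2.1 t.2.2) ∧ ∀ a b c, IsTri F a b c →
      ∃ g ∈ Γ, (g • a, g • b, g • c) ∈ T := by
  obtain ⟨Z, hZ, -, hZP⟩ := h.exists_finite_plaques
  refine ⟨{t | IsTri F t.1 t.2.1 t.2.2 ∧ ∃ z ∈ Z, pEnds F z = {t.1, t.2.1, t.2.2}}, ?_,
    fun t ht => ht.1, fun a b c t => ?_⟩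
  · refine (hZ.biUnion (t := fun z => {t : BdH2 × BdH2 × BdH2 | IsTri F t.1 t.2.1 t.2.2 ∧
      pEnds F z = {t.1, t.2.1, t.2.2}}) fun z _ => ?_).subset
      fun t ⟨h1, z, hz, e⟩ => Set.mem_biUnion hz ⟨h1, e⟩
    by_cases hE : (pEnds F z).Finite
    · refine (hE.prod (hE.prod hE)).subset ?_
      rintro ⟨a, b, c⟩ ⟨-, e⟩
      rw [e]
      simp
    · convert Set.finite_empty
      refine Set.eq_empty_of_forall_notMem fun t ht => hE ?_
      rw [ht.2]
      exact Set.toFinite _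
  · obtain ⟨-, -, -, w, hw, e⟩ := id t
    obtain ⟨g, hg, z', hz', hgz⟩ := hZP w hw
    exact ⟨g, hg, h.tri_smul t hg, z', hz', pEnds_eq_of_mem hgz ▸ h.pEnds_smul e hg⟩

lemma finite_tri {K : Set ℍ} (hK : IsCompact K) (hd : Disjoint K (leaves P)) :
    {t : BdH2 × BdH2 × BdH2 | IsTri F t.1 t.2.1 t.2.2 ∧
      ∃ z ∈ K, z ∈ closedTri t.1 t.2.1 t.2.2}.Finite := by
  obtain ⟨T, hT, hT3, hTP⟩ := h.exists_finite_tri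
  refine (hT.biUnion (t := fun t => (fun g : SL2R => (g⁻¹ • t.1, g⁻¹ • t.2.1, g⁻¹ • t.2.2)) ''
    {g | g ∈ Γ ∧ ∃ z ∈ K, g • z ∈ closedTri t.1 t.2.1 t.2.2}) fun t ht => ?_).subset ?_
  · have h3 := hT3 t ht
    have hP := fun {x y} (hx : x ∈ ({t.1, t.2.1, t.2.2} : Set BdH2))
      (hy : y ∈ ({t.1, t.2.1, t.2.2} : Set BdH2)) hxy => h.exists_P_of_leaf (h.tri_leaf h3 hy hx hxy)
    obtain ⟨a', ha⟩ := hP (x := t.1) (y := t.2.1) (by simp) (by simp) h3.1.symm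
    obtain ⟨b', hb⟩ := hP (x := t.2.1) (y := t.1) (by simp) (by simp) h3.1
    obtain ⟨c', hc⟩ := hP (x := t.2.2) (y := t.1) (by simp) (by simp) h3.2.2.1.symm
    exact (h.finite_closedTri ha hb hc h3.1 h3.2.1 h3.2.2.1 hK hd).image _
  · rintro ⟨a, b, c⟩ ⟨t, z, hz, hzt⟩
    obtain ⟨g, hg, hgT⟩ := hTP a b c t
    exact Set.mem_biUnion hgT ⟨g, ⟨hg, z, hz, (smul_mem_closedTri g a b c z).mpr hzt⟩, by simp⟩

/-- The complementary triangles cover the complement of the closed leaves. -/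
lemma exists_tri_mem (hP : z ∉ leaves P) :
    ∃ a b c, IsTri F a b c ∧ z ∈ closedTri a b c := by
  obtain ⟨K, hK, hzK, hKP⟩ := exists_compact_subset h.isClosed_leaves_P.isOpen_compl hP
  have hfin := h.finite_tri hK (Set.disjoint_left.mpr fun x hx => hKP hx)
  have hSc := hfin.isClosed_biUnion (f := fun t => closedTri t.1 t.2.1 t.2.2)
    fun t _ => isClosed_closedTri _ _ _
  have h1 : z ∈ closure ((leaves F)ᶜ ∩ interior K) := by
    have := isOpen_interior.inter_closure (s := interior K) (t := (leaves F)ᶜ)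
      ⟨hzK, h.dense_compl_leaves z⟩
    rwa [Set.inter_comm] at this
  have h2 := hSc.closure_subset_iff.mpr (fun w hw => ?_) h1
  · simp only [Set.mem_iUnion] at h2
    obtain ⟨t, ht, hz⟩ := h2
    exact ⟨_, _, _, ht.1, hz⟩
  · obtain ⟨a, b, c, hab, hbc, hca, e⟩ := h.exists_vertices hw.1
    have hwt := openTri_subset _ _ _ (h.mem_openTri hw.1 hab hbc hca e)
    exact Set.mem_biUnion (x := (a, b, c))
      ⟨⟨hab, hbc, hca, w, hw.1, e⟩, w, interior_subset hw.2, hwt⟩ hwt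

/-- Finitely many representatives of the leaves that are not closed. -/
lemma exists_finite_leaves : ∃ Q : Set (BdH2 × BdH2), Q.Finite ∧
    (∀ q ∈ Q, F q.1 q.2 ∧ ¬P q.1 q.2) ∧ ∀ x y, F x y → ¬P x y → ∃ g ∈ Γ, (g • x, g • y) ∈ Q := by
  obtain ⟨T, hT, hT3, hTP⟩ := h.exists_finite_tri
  refine ⟨{q | (F q.1 q.2 ∧ ¬P q.1 q.2) ∧ ∃ t ∈ T, q.1 ∈ ({t.1, t.2.1, t.2.2} : Set BdH2) ∧
    q.2 ∈ ({t.1, t.2.1, t.2.2} : Set BdH2)}, ?_, fun q hq => hq.1, fun x y hF hP => ?_⟩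
  · refine (hT.biUnion (t := fun t => ({t.1, t.2.1, t.2.2} ×ˢ {t.1, t.2.1, t.2.2} :
      Set (BdH2 × BdH2))) fun t _ => Set.toFinite _).subset ?_
    rintro q ⟨-, t, ht, h1, h2⟩; exact Set.mem_biUnion ht ⟨h1, h2⟩
  · obtain ⟨z, hz⟩ := geod_nonempty (h.ne hF)
    obtain ⟨a, b, c, t, hzt⟩ := h.exists_tri_mem (h.notMem_P_of_leaf hF hP hz)
    obtain ⟨g, hg, hgT⟩ := hTP a b c t; obtain ⟨h1, h2⟩ := h.mem_tri_of_leaf t hzt hF hz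
    refine ⟨g, hg, ⟨h.smul g hg _ _ hF, fun h' => hP ?_⟩, _, hgT, ?_, ?_⟩
    · simpa using h.P_smul _ (inv_mem hg) _ _ h'
    all_goals simpa using by assumption

/-- The commutator of elements along two closed leaves that are joined by a leaf is an element whose
axis crosses no closed leaf. -/
lemma exists_axis_commutator {x' y' : BdH2} (hF : F x y) (hxy : ¬P x y) (hx : P x x')
    (hy : P y y') (hg : g ∈ Γ) (hk : k ∈ Γ) (g1 : g ≠ 1) (g2 : g ≠ -1) (k1 : k ≠ 1)
    (k2 : k ≠ -1) (gx : g • x = x) (gx' : g • x' = x') (ky : k • y = y) (ky' : k • y' = y') :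
    g * k * g⁻¹ * k⁻¹ ≠ 1 ∧ g * k * g⁻¹ * k⁻¹ ≠ -1 ∧ ∃ p q, p ≠ q ∧
      (g * k * g⁻¹ * k⁻¹) • p = p ∧ (g * k * g⁻¹ * k⁻¹) • q = q ∧ ∀ a b, P a b → ¬Link a b p q := by
  obtain ⟨z, hz⟩ := geod_nonempty (h.ne hF); have h0 := h.notMem_P_of_leaf hF hxy hz
  have hxE := mem_pEnds_of_unlinked (F := P) (h.ne hF)
    (fun a b hab => h.unlinked (h.P_sub hab) hF) hz
  have hyE := mem_pEnds_of_unlinked (F := P) (h.ne hF).symm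
    (fun a b hab => h.unlinked (h.P_sub hab) (h.symm hF)) (geod_comm x y ▸ hz)
  have hgs := mem_stab_of_fix h.family_P h.P_smul h0 hx hxE (h.partner_mem_pEnds h0 hx hxE) hg gx gx'
  have hks := mem_stab_of_fix h.family_P h.P_smul h0 hy hyE (h.partner_mem_pEnds h0 hy hyE) hk ky ky'
  have hcs : g * k * g⁻¹ * k⁻¹ ∈ plaqueStab h.P_smul h0 :=
    mul_mem (mul_mem (mul_mem hgs hks) (inv_mem hgs)) (inv_mem hks)
  have hne : (g * k * g⁻¹ * k⁻¹) • k • x ≠ k • x := by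
    intro hc
    rw [smul_smul, inv_mul_cancel_right, mul_smul, mul_smul, inv_smul_eq_iff.mpr gx.symm] at hc
    have h1 : k • x = x ∨ k • x = x' := by
      by_contra! hcon
      exact (eq_one_or_of_three (h.P_ne hx) hcon.1.symm hcon.2.symm gx gx' hc).elim g1 g2
    have h2 := (h.surf.fixes_of_common_end hg g1 g2 hk (h.P_ne hx) gx gx'
      (h1.elim Or.inl fun h' => Or.inr (Or.inl h'))).1
    have hxy' : x ≠ y' := fun h' => hxy (h' ▸ h.P_symm hy)
    exact (eq_one_or_of_three (h.ne hF) hxy' (h.P_ne hy) h2 ky ky').elim k1 k2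
  have c1 : g * k * g⁻¹ * k⁻¹ ≠ 1 := fun h' => hne (by rw [h', one_smul])
  have c2 : g * k * g⁻¹ * k⁻¹ ≠ -1 := fun h' => hne (by rw [h', neg_sl_smul_proj, one_smul])
  obtain ⟨p, q, hpq, hp, hq⟩ := h.surf.exists_fixed hcs.1 c1 c2
  have hE {x : BdH2} := mem_pEnds_of_fixed h.family_P h.P_smul h0 hcs
    (h.surf.two_lt_trace hcs.1 c1 c2) (a := x)
  exact ⟨c1, c2, p, q, hpq, hp, hq, fun a b hab => not_link_of_pEnds h0 (hE hp) (hE hq) hab⟩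

end PantsLam

/-! ### Averaging over signs -/

/-- Adjoining to an algebra `B` of `τ`-invariant functions some `τ`-anti-invariant functions with
products in `B` creates no new invariant functions. -/
lemma add_flip_mem_of_mem_adjoin {Ω κ : Type*} {τ : Ω → Ω} {B : Subalgebra ℂ (Ω → ℂ)}
    (hB : ∀ b ∈ B, b ∘ τ = b) {T : κ → Ω → ℂ} (hT : ∀ k, T k ∘ τ = -T k)
    (hTT : ∀ k l, T k * T l ∈ B) {F : Ω → ℂ}
    (hF : F ∈ Algebra.adjoin ℂ ((B : Set (Ω → ℂ)) ∪ Set.range T)) : F + F ∘ τ ∈ B := by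
  let V : Submodule B (Ω → ℂ) := Submodule.span B (Set.range T)
  have hVτ : ∀ v ∈ V, v ∘ τ = -v := by
    intro v hv
    induction hv using Submodule.span_induction with
    | mem v h => obtain ⟨k, rfl⟩ := h; exact hT k
    | zero => ext x; simp
    | add v w _ _ h1 h2 => change v ∘ τ + w ∘ τ = _; rw [h1, h2]; ring
    | smul b v _ h => change (b.1 ∘ τ) * (v ∘ τ) = -(b.1 * v); rw [hB _ b.2, h, mul_neg]
  have hVV : ∀ v ∈ V, ∀ w ∈ V, v * w ∈ B := by
    intro v hv w hw
    induction hv, hw using Submodule.span_induction₂ with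
    | mem_mem v w hv hw =>
      obtain ⟨k, rfl⟩ := hv; obtain ⟨l, rfl⟩ := hw; exact hTT k l
    | zero_left => simp
    | zero_right => simp
    | add_left _ _ _ _ _ _ h1 h2 => rw [add_mul]; exact add_mem h1 h2
    | add_right _ _ _ _ _ _ h1 h2 => rw [mul_add]; exact add_mem h1 h2
    | smul_left b v w _ _ h => change b.1 * v * w ∈ B; rw [mul_assoc]; exact mul_mem b.2 h
    | smul_right b v w _ _ h => change v * (b.1 * w) ∈ B; rw [mul_left_comm]; exact mul_mem b.2 h
  have key : ∃ b ∈ B, ∃ v ∈ V, F = b + v := by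
    induction hF using Algebra.adjoin_induction with
    | mem x hx =>
      rcases hx with hx | ⟨k, rfl⟩
      exacts [⟨x, hx, 0, zero_mem _, by simp⟩,
        ⟨0, zero_mem _, T k, Submodule.subset_span ⟨k, rfl⟩, by simp⟩]
    | algebraMap r => exact ⟨_, B.algebraMap_mem r, 0, zero_mem _, by simp⟩
    | add x y _ _ hx hy =>
      obtain ⟨b, hb, v, hv, rfl⟩ := hx; obtain ⟨c, hc, w, hw, rfl⟩ := hy
      exact ⟨b + c, add_mem hb hc, v + w, add_mem hv hw, by ring⟩
    | mul x y _ _ hx hy =>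
      obtain ⟨b, hb, v, hv, rfl⟩ := hx; obtain ⟨c, hc, w, hw, rfl⟩ := hy
      exact ⟨b * c + v * w, add_mem (mul_mem hb hc) (hVV v hv w hw), b * w + c * v,
        add_mem (V.smul_mem ⟨b, hb⟩ hw) (V.smul_mem ⟨c, hc⟩ hv), by ring⟩
  obtain ⟨b, hb, v, hv, rfl⟩ := key
  have : (b + v) + (b + v) ∘ τ = (2 : ℂ) • b := by
    change b + v + (b ∘ τ + v ∘ τ) = _; rw [hB b hb, hVτ v hv, two_smul]; ring
  rw [this]; exact B.smul_mem hb 2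

section Signs

variable {Ω κ J : Type*} [Fintype J] [DecidableEq J]

/-- The algebra of functions of `(ε, ρ)`, with `ε` a choice of signs, generated by the functions
in `R` and the functions `(ε, ρ) ↦ ε j * T j k ρ` with `j ∈ S`. -/
def signAlg (R : Subalgebra ℂ (Ω → ℂ)) (T : J → κ → Ω → ℂ) (S : Finset J) :
    Subalgebra ℂ ((J → ℤˣ) × Ω → ℂ) :=
  Algebra.adjoin ℂ ({F | ∃ f ∈ R, F = fun x => f x.2} ∪
    {F | ∃ j ∈ S, ∃ k, F = fun x => ((x.1 j : ℤ) : ℂ) * T j k x.2})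

lemma sum_mem_of_mem_signAlg {R : Subalgebra ℂ (Ω → ℂ)} {T : J → κ → Ω → ℂ}
    (hT : ∀ j k l, T j k * T j l ∈ R) (S : Finset J) :
    ∀ F ∈ signAlg R T S, (fun ρ => ∑ ε, F (ε, ρ)) ∈ R := by
  induction S using Finset.induction_on with
  | empty =>
    intro F hF
    have h : ∃ f ∈ R, F = fun x => f x.2 := by
      induction hF using Algebra.adjoin_induction with
      | mem x hx => simpa using hx
      | algebraMap r => exact ⟨_, R.algebraMap_mem r, rfl⟩
      | add x y _ _ hx hy =>
        obtain ⟨f, hf, rfl⟩ := hx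
        obtain ⟨g, hg, rfl⟩ := hy
        exact ⟨f + g, add_mem hf hg, rfl⟩
      | mul x y _ _ hx hy =>
        obtain ⟨f, hf, rfl⟩ := hx
        obtain ⟨g, hg, rfl⟩ := hy
        exact ⟨f * g, mul_mem hf hg, rfl⟩
    obtain ⟨f, hf, rfl⟩ := h
    have : (fun ρ => ∑ _ε : J → ℤˣ, f ρ) = (Fintype.card (J → ℤˣ) : ℂ) • f := by
      ext ρ; simp
    exact this ▸ R.smul_mem hf _
  | insert j S hj ih =>
    intro F hF
    let fl : (J → ℤˣ) → (J → ℤˣ) := fun ε => Function.update ε j (-ε j)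
    have hfl : Function.Involutive fl := fun ε => by
      ext i
      by_cases h : i = j <;> simp [fl, h]
    let τ : (J → ℤˣ) × Ω → (J → ℤˣ) × Ω := fun x => (fl x.1, x.2)
    have hB : ∀ b ∈ signAlg R T S, b ∘ τ = b := by
      intro b hb
      induction hb using Algebra.adjoin_induction with
      | mem x hx =>
        rcases hx with ⟨f, -, rfl⟩ | ⟨i, hi, k, rfl⟩
        · rfl
        · have : i ≠ j := fun h => hj (h ▸ hi)
          ext x; simp [τ, fl, this]
      | algebraMap r => rfl
      | add x y _ _ hx hy => change x ∘ τ + y ∘ τ = _; rw [hx, hy]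
      | mul x y _ _ hx hy => change (x ∘ τ) * (y ∘ τ) = _; rw [hx, hy]
    have hunit : ∀ u : ℤˣ, (((u : ℤ) : ℂ)) * ((u : ℤ) : ℂ) = 1 := fun u => by
      rcases Int.units_eq_one_or u with h | h <;> simp [h]
    have h1 := add_flip_mem_of_mem_adjoin (τ := τ) (B := signAlg R T S) hB
      (T := fun k x => ((x.1 j : ℤ) : ℂ) * T j k x.2) (fun k => by ext x; simp [τ, fl])
      (fun k l => Algebra.subset_adjoin (Or.inl ⟨_, hT j k l, by
        ext x
        simp only [Pi.mul_apply]
        linear_combination (T j k x.2 * T j l x.2) * hunit (x.1 j)⟩)) (F := F) (by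
        refine (Algebra.adjoin_le ?_ : signAlg R T (insert j S) ≤ _) hF
        rintro x (hx | ⟨i, hi, k, rfl⟩)
        · exact Algebra.subset_adjoin (Or.inl (Algebra.subset_adjoin (Or.inl hx)))
        · rcases Finset.mem_insert.mp hi with rfl | hi
          · exact Algebra.subset_adjoin (Or.inr ⟨k, rfl⟩)
          · exact Algebra.subset_adjoin (Or.inl (Algebra.subset_adjoin (Or.inr ⟨i, hi, k, rfl⟩))))
    have h2 := R.smul_mem (ih _ h1) (2⁻¹ : ℂ)
    convert h2 using 1
    ext ρ
    have h3 : ∑ ε, F (fl ε, ρ) = ∑ ε, F (ε, ρ) :=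
      Equiv.sum_comp (hfl.toPerm fl) fun ε => F (ε, ρ)
    simp only [Pi.smul_apply, Pi.add_apply, Function.comp_apply, τ, Finset.sum_add_distrib, h3,
      smul_eq_mul]
    ring

end Signs

/-! ### Regular functions from fixed points -/

lemma PSL2C.exists_lift (σ : PSL2C) : ∃ A : SL(2, ℂ), QuotientGroup.mk A = σ :=
  QuotientGroup.mk_surjective σ

/-- A matrix that represents an element of `PSL₂(ℂ)`. -/
def PSL2C.lift (σ : PSL2C) : SL(2, ℂ) := σ.exists_lift.choose

lemma PSL2C.mk_lift (σ : PSL2C) : (QuotientGroup.mk σ.lift : PSL2C) = σ := σ.exists_lift.choose_spec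

lemma PSL2C.mk_eq_mk {A B : SL(2, ℂ)} :
    (QuotientGroup.mk A : PSL2C) = QuotientGroup.mk B ↔ A = B ∨ A = -B := by
  rw [QuotientGroup.eq]
  constructor
  · intro h
    obtain ⟨r, hr, h⟩ := center_sl_two h
    have hB : B = A * (A⁻¹ * B) := by group
    rcases sq_eq_one_iff.mp hr with rfl | rfl
    · left
      have : A⁻¹ * B = 1 := Subtype.ext (by rw [h]; simp)
      rw [hB, this, mul_one]
    · right
      have : A⁻¹ * B = -1 := Subtype.ext (by rw [h]; ext i j; fin_cases i <;> fin_cases j <;> simp)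
      rw [hB, this, mul_neg, mul_one, neg_neg]
  · rintro (rfl | rfl)
    · simp
    · rw [Matrix.SpecialLinearGroup.mem_center_iff]
      exact ⟨-1, by simp, by ext i j; fin_cases i <;> fin_cases j <;> simp⟩

lemma adPSL_mk (A : SL(2, ℂ)) (X : Matrix (Fin 2) (Fin 2) ℂ) :
    adPSL (QuotientGroup.mk A) X = A.1 * (X * (A⁻¹).1) := rfl

lemma adPSL_apply (σ : PSL2C) (X : Matrix (Fin 2) (Fin 2) ℂ) (i j : Fin 2) : adPSL σ X i j =
    σ.lift i 0 * (X 0 0 * (σ.lift⁻¹) 0 j + X 0 1 * (σ.lift⁻¹) 1 j) +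
      σ.lift i 1 * (X 1 0 * (σ.lift⁻¹) 0 j + X 1 1 * (σ.lift⁻¹) 1 j) := by
  conv_lhs => rw [← σ.mk_lift]
  simp only [adPSL_mk, Matrix.mul_apply, Fin.sum_univ_two]

lemma adPSL_mul_mul (σ : PSL2C) (X Y : Matrix (Fin 2) (Fin 2) ℂ) :
    adPSL σ (X * Y) = adPSL σ X * adPSL σ Y := by
  obtain ⟨A, rfl⟩ := σ.exists_lift
  have h : (A⁻¹).1 * A.1 = 1 := by rw [← Matrix.SpecialLinearGroup.coe_mul]; simp
  simp only [adPSL_mk, Matrix.mul_assoc]; rw [← Matrix.mul_assoc (A⁻¹).1 A.1, h, Matrix.one_mul]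

lemma adPSL_one (σ : PSL2C) : adPSL σ 1 = 1 := by
  obtain ⟨A, rfl⟩ := σ.exists_lift
  rw [adPSL_mk, Matrix.one_mul, ← Matrix.SpecialLinearGroup.coe_mul]; simp

lemma trace_adPSL (σ : PSL2C) (X : Matrix (Fin 2) (Fin 2) ℂ) : (adPSL σ X).trace = X.trace := by
  obtain ⟨A, rfl⟩ := σ.exists_lift
  rw [adPSL_mk, Matrix.trace_mul_comm, Matrix.mul_assoc, ← Matrix.SpecialLinearGroup.coe_mul]; simp

lemma adPSL_apply_eq_sum (σ : PSL2C) (X : Matrix (Fin 2) (Fin 2) ℂ) (i j : Fin 2) :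
    adPSL σ X i j = ∑ k, ∑ l, X k l * adPSL σ (Matrix.single k l 1) i j := by
  conv_lhs => rw [Matrix.matrix_eq_sum_single X]
  simp only [map_sum, Matrix.sum_apply]
  refine Finset.sum_congr rfl fun k _ => Finset.sum_congr rfl fun l _ => ?_
  rw [← mul_one (X k l), ← smul_eq_mul, ← Matrix.smul_single, map_smul, Matrix.smul_apply,
    smul_eq_mul, smul_eq_mul, mul_one]

/-- The discriminant `(tr A)² - 4` of the characteristic polynomial of a lift `A`. -/
def PSL2C.disc (σ : PSL2C) : ℂ := sltr σ.lift ^ 2 - 4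

/-- The traceless matrix `δ (2 A - tr A)`, with `A` a lift and `δ² = (tr A)² - 4`. Its square is
scalar, and its eigenlines are the fixed points of `A`; it is well defined up to its sign, and the
products of two of its entries are regular functions. -/
def PSL2C.axisMat (σ : PSL2C) : Matrix (Fin 2) (Fin 2) ℂ :=
  σ.disc ^ (((2 : ℕ) : ℂ)⁻¹) • ((2 : ℂ) • σ.lift.1 - sltr σ.lift • (1 : Matrix (Fin 2) (Fin 2) ℂ))

lemma PSL2C.disc_sqrt_sq (σ : PSL2C) : (σ.disc ^ (((2 : ℕ) : ℂ)⁻¹)) ^ 2 = σ.disc :=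
  Complex.cpow_nat_inv_pow _ two_ne_zero

lemma PSL2C.lift_conj (κ σ : PSL2C) : (κ * σ * κ⁻¹).lift = κ.lift * σ.lift * κ.lift⁻¹ ∨
    (κ * σ * κ⁻¹).lift = -(κ.lift * σ.lift * κ.lift⁻¹) := by
  rw [← PSL2C.mk_eq_mk, PSL2C.mk_lift, QuotientGroup.mk_mul, QuotientGroup.mk_mul,
    QuotientGroup.mk_inv, PSL2C.mk_lift, PSL2C.mk_lift]

lemma PSL2C.disc_conj (κ σ : PSL2C) : (κ * σ * κ⁻¹).disc = σ.disc := by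
  rcases PSL2C.lift_conj κ σ with h | h <;> simp [PSL2C.disc, h, sltr_neg, sltr_conj]

lemma PSL2C.axisMat_conj (κ σ : PSL2C) :
    ∃ e : ℤˣ, (κ * σ * κ⁻¹).axisMat = ((e : ℤ) : ℂ) • adPSL κ σ.axisMat := by
  have h1 : adPSL κ σ.axisMat = σ.disc ^ (((2 : ℕ) : ℂ)⁻¹) •
      ((2 : ℂ) • (κ.lift * σ.lift * κ.lift⁻¹).1 - sltr σ.lift • 1) := by
    rw [PSL2C.axisMat, map_smul, map_sub, map_smul, map_smul, adPSL_one]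
    conv_lhs => rw [← κ.mk_lift]
    rw [adPSL_mk, Matrix.SpecialLinearGroup.coe_mul, Matrix.SpecialLinearGroup.coe_mul,
      Matrix.mul_assoc]
  rcases PSL2C.lift_conj κ σ with h | h
  · refine ⟨1, ?_⟩
    rw [h1, PSL2C.axisMat, PSL2C.disc_conj, h, sltr_conj]; simp
  · refine ⟨-1, ?_⟩
    rw [h1, PSL2C.axisMat, PSL2C.disc_conj, h, sltr_neg, sltr_conj]
    simp only [Units.val_neg, Units.val_one, Int.cast_neg, Int.cast_one, _root_.neg_smul, one_smul,
      ← smul_neg, Matrix.SpecialLinearGroup.coe_neg]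
    congr 1
    module

section Regular

variable {G : Type*} [Group G]

lemma adPSL_mem (g : G) (i j k l : Fin 2) :
    (fun ρ : RepVar G => adPSL (ρ g) (Matrix.single k l 1) i j) ∈ regularFunctions G :=
  Algebra.subset_adjoin ⟨g, i, j, k, l, rfl⟩

lemma lift_mul_lift_mem (g : G) (i j k l : Fin 2) :
    (fun ρ : RepVar G => (ρ g).lift i j * (ρ g).lift k l) ∈ regularFunctions G := by
  have h : ∀ (σ : PSL2C) (i j k l : Fin 2), adPSL σ (Matrix.single k l 1) i j =
      σ.lift i k * (σ.lift⁻¹) l j := fun σ i j k l => by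
    rw [adPSL_apply]
    fin_cases k <;> fin_cases l <;> simp
  have h' := fun a b c d => adPSL_mem g a b c d
  simp only [h] at h'
  revert k l
  simp only [Fin.forall_fin_two]
  refine ⟨⟨?_, ?_⟩, ⟨?_, ?_⟩⟩
  · simpa only [sl_inv_11] using h' i 1 j 1
  · convert neg_mem (h' i 1 j 0) using 1
    ext; simp [sl_inv_01]
  · convert neg_mem (h' i 0 j 1) using 1
    ext; simp [sl_inv_10]
  · simpa only [sl_inv_00] using h' i 0 j 0

lemma disc_mem (g : G) : (fun ρ : RepVar G => (ρ g).disc) ∈ regularFunctions G := by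
  have h := sub_mem (add_mem (add_mem (lift_mul_lift_mem g 0 0 0 0) (lift_mul_lift_mem g 1 1 1 1))
    (add_mem (lift_mul_lift_mem g 0 0 1 1) (lift_mul_lift_mem g 0 0 1 1)))
    ((regularFunctions G).algebraMap_mem 4)
  convert h using 1
  ext ρ
  simp only [PSL2C.disc, sltr, Pi.sub_apply, Pi.add_apply, Pi.algebraMap_apply, Algebra.algebraMap_self,
    RingHom.id_apply]
  ring

lemma axisMat_mul_mem (g : G) (i j k l : Fin 2) :
    (fun ρ : RepVar G => (ρ g).axisMat i j * (ρ g).axisMat k l) ∈ regularFunctions G := by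
  have hl := fun i j k l => lift_mul_lift_mem (G := G) g i j k l
  have hs : ∀ (c : ℂ) {f : RepVar G → ℂ}, f ∈ regularFunctions G →
      (fun ρ => c * f ρ) ∈ regularFunctions G := fun c f hf => (regularFunctions G).smul_mem hf c
  have key : (fun ρ : RepVar G => (2 * (ρ g).lift i j - sltr (ρ g).lift * (1 : Matrix _ _ ℂ) i j) *
      (2 * (ρ g).lift k l - sltr (ρ g).lift * (1 : Matrix _ _ ℂ) k l)) ∈ regularFunctions G := by
    have h := add_mem (add_mem (hs 4 (hl i j k l)) (hs (-2 * (1 : Matrix _ _ ℂ) k l)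
      (add_mem (hl i j 0 0) (hl i j 1 1)))) (add_mem (hs (-2 * (1 : Matrix _ _ ℂ) i j)
      (add_mem (hl k l 0 0) (hl k l 1 1))) (hs ((1 : Matrix _ _ ℂ) i j * (1 : Matrix _ _ ℂ) k l)
      (add_mem (disc_mem g) ((regularFunctions G).algebraMap_mem 4))))
    convert h using 1
    ext ρ
    simp only [PSL2C.disc, sltr, Pi.add_apply, Pi.algebraMap_apply, Algebra.algebraMap_self,
      RingHom.id_apply]
    ring
  convert mul_mem (disc_mem g) key using 1
  ext ρ; simp only [Pi.mul_apply, PSL2C.axisMat, Matrix.smul_apply, Matrix.sub_apply, smul_eq_mul]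
  linear_combination (2 * (ρ g).lift i j - sltr (ρ g).lift * (1 : Matrix _ _ ℂ) i j) *
      (2 * (ρ g).lift k l - sltr (ρ g).lift * (1 : Matrix _ _ ℂ) k l) * (ρ g).disc_sqrt_sq

end Regular

open PSL2C

lemma PSL2C.mk_smul (A : SL(2, ℂ)) (x : BdH3) : (QuotientGroup.mk A : PSL2C) • x = A • x := rfl

lemma PSL2C.smul_eq (σ : PSL2C) (x : BdH3) : σ • x = σ.lift • x := by
  conv_lhs => rw [← σ.mk_lift]
  rfl

lemma PSL2C.smul_mk (σ : PSL2C) {v : Fin 2 → ℂ} (hv : v ≠ 0) (hv' : σ.lift • v ≠ 0) :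
    σ • mk ℂ v hv = mk ℂ (σ.lift • v) hv' := by
  rw [smul_eq]; rfl

lemma sl_smul_ne_zero {K : Type*} [Field K] (g : SL(2, K)) {v : Fin 2 → K} (hv : v ≠ 0) :
    g • v ≠ 0 := fun h => hv (by rw [← inv_smul_smul g v, h, smul_zero])

/-- The matrix `v ↦ det (w, v) u`. -/
def outer (u w : Fin 2 → ℂ) : Matrix (Fin 2) (Fin 2) ℂ := Matrix.vecMulVec u ![-w 1, w 0]

lemma adPSL_outer (σ : PSL2C) (u w : Fin 2 → ℂ) :
    adPSL σ (outer u w) = outer (σ.lift • u) (σ.lift • w) := by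
  ext i j; rw [adPSL_apply]
  fin_cases i <;> fin_cases j <;>
    simp only [Fin.mk_zero, Fin.mk_one, Fin.isValue, sl_inv_00, sl_inv_01,
      sl_inv_10, sl_inv_11, outer, Matrix.vecMulVec_apply, Matrix.cons_val_zero,
      Matrix.cons_val_one, sl_smul_0, sl_smul_1] <;> ring

lemma outer_mul_outer (u w u' w' : Fin 2 → ℂ) :
    outer u w * outer u' w' = vdet w u' • outer u w' := by
  ext i j; rw [Matrix.mul_apply, Fin.sum_univ_two, Matrix.smul_apply]
  simp only [outer, Matrix.vecMulVec_apply, Matrix.cons_val_zero, Matrix.cons_val_one, vdet,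
    smul_eq_mul]
  ring

lemma trace_outer (u w : Fin 2 → ℂ) : (outer u w).trace = vdet w u := by
  simp only [Matrix.trace_fin_two, outer, Matrix.vecMulVec_apply, Matrix.cons_val_zero,
    Matrix.cons_val_one, vdet]
  ring

/-- Up to a scalar, the projection to one fixed point of `σ` along the other one. -/
def PSL2C.eigMat (σ : PSL2C) (e : ℤˣ) : Matrix (Fin 2) (Fin 2) ℂ :=
  σ.disc • 1 + ((e : ℤ) : ℂ) • σ.axisMat

lemma PSL2C.axisMat_sq (σ : PSL2C) (v : Fin 2 → ℂ) {a : ℂ} (h : σ.lift • v = a • v) :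
    σ.axisMat *ᵥ v = (σ.disc ^ (((2 : ℕ) : ℂ)⁻¹) * (2 * a - sltr σ.lift)) • v := by
  rw [axisMat, Matrix.smul_mulVec, Matrix.sub_mulVec, Matrix.smul_mulVec, Matrix.smul_mulVec,
    Matrix.one_mulVec]
  change _ • ((2 : ℂ) • (σ.lift • v) - _) = _; rw [h]
  module

lemma exists_eigenvalue {σ : PSL2C} {v : Fin 2 → ℂ} (hv : v ≠ 0) :
    σ • mk ℂ v hv = mk ℂ v hv ↔ ∃ a : ℂ, σ.lift • v = a • v := by
  rw [PSL2C.smul_mk σ hv (sl_smul_ne_zero _ hv), mk_eq_mk_iff']; exact exists_congr fun a => eq_comm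

lemma vec_expand {K : Type*} [Field K] (u w v : Fin 2 → K) :
    vdet u w • v = vdet v w • u + vdet u v • w := by
  ext i; fin_cases i <;> simp [vdet] <;> ring

lemma sl_smul_eigen {K : Type*} [Field K] {A : SL(2, K)} {u w : Fin 2 → K} (huw : vdet u w ≠ 0)
    {a b : K} (hu : A • u = a • u) (hw : A • w = b • w) : a * b = 1 ∧ sltr A = a + b := by
  have h1 := vdet_sl_smul A u w; rw [hu, hw, vdet_smul_left, vdet_smul_right] at h1
  refine ⟨mul_right_cancel₀ huw (by linear_combination h1), mul_right_cancel₀ huw ?_⟩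
  have e0 := congrFun hu 0; have e1 := congrFun hu 1
  have f0 := congrFun hw 0; have f1 := congrFun hw 1; rw [sl_smul_0] at e0 f0
  rw [sl_smul_1] at e1 f1; simp only [Pi.smul_apply, smul_eq_mul] at e0 e1 f0 f1
  simp only [sltr, vdet]; linear_combination w 1 * e0 - w 0 * e1 - u 1 * f0 + u 0 * f1

/-- A non-trivial element with two distinct fixed points has non-zero discriminant. -/
lemma disc_ne_zero_of_fixed {σ : PSL2C} (hσ : σ ≠ 1) {x y : BdH3} (hxy : x ≠ y)
    (hx : σ • x = x) (hy : σ • y = y) : σ.disc ≠ 0 := by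
  induction x using ind with | _ u hu =>
  induction y using ind with | _ w hw =>
  obtain ⟨a, ha⟩ := (exists_eigenvalue hu).mp hx
  obtain ⟨b, hb⟩ := (exists_eigenvalue hw).mp hy
  have huw : vdet u w ≠ 0 := fun h => hxy ((mk_eq_iff hu hw).mpr h)
  obtain ⟨h1, h2⟩ := sl_smul_eigen huw ha hb; intro h
  have hab : a = b := by
    have : (a - b) ^ 2 = 0 := by
      rw [disc, h2] at h; linear_combination h - 4 * h1
    exact sub_eq_zero.mp (pow_eq_zero_iff two_ne_zero |>.mp this)
  subst hab
  have hall : ∀ v, σ.lift • v = a • v := fun v => by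
    have := vec_expand u w v
    have h3 : vdet u w • (σ.lift • v) = vdet u w • (a • v) := by
      rw [← smul_comm σ.lift, this, smul_add, smul_comm σ.lift (vdet v w),
        smul_comm σ.lift (vdet u v), ha, hb]
      rw [smul_comm (vdet u w), this]
      module
    exact smul_right_injective _ huw h3
  have e0 := hall ![1, 0]; have e1 := hall ![0, 1]; apply hσ
  rw [← σ.mk_lift, ← QuotientGroup.mk_one, mk_eq_mk]
  simp only [funext_iff, Fin.forall_fin_two, sl_smul_0, sl_smul_1, Matrix.cons_val_zero,
    Matrix.cons_val_one, mul_one, mul_zero, add_zero, zero_add, Pi.smul_apply, smul_eq_mul] at e0 e1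
  rcases mul_self_eq_one_iff.mp h1 with h | h <;> [left; right] <;> apply sl_ext <;>
    simp [e0, e1, h]

/-- Eigenvectors of an element of non-zero discriminant, labelled by the signs. -/
lemma exists_eigenvectors {σ : PSL2C} (hσ : σ.disc ≠ 0) : ∃ u : ℤˣ → Fin 2 → ℂ,
    vdet (u 1) (u (-1)) ≠ 0 ∧ (∀ e, ∃ a : ℂ, σ.lift • u e = a • u e) ∧
    ∀ e, ∃ c : ℂ, c ≠ 0 ∧ σ.eigMat e = c • outer (u e) (u (-e)) := by
  obtain ⟨d, hd⟩ : ∃ d, d = σ.disc ^ (((2 : ℕ) : ℂ)⁻¹) := ⟨_, rfl⟩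
  have hdd := σ.disc_sqrt_sq
  rw [← hd] at hdd
  have hd0 : d ≠ 0 := by rintro rfl; exact hσ (by rw [← hdd]; simp)
  have hex : ∀ e : ℤˣ, ∃ v : Fin 2 → ℂ, v ≠ 0 ∧
      σ.lift • v = ((sltr σ.lift + ((e : ℤ) : ℂ) * d) / 2) • v := by
    intro e
    obtain ⟨a, ha⟩ : ∃ a, a = (sltr σ.lift + ((e : ℤ) : ℂ) * d) / 2 := ⟨_, rfl⟩
    rw [← ha]
    have he : (((e : ℤ) : ℂ)) ^ 2 = 1 := by rcases Int.units_eq_one_or e with h | h <;> simp [h]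
    have hq : a ^ 2 - sltr σ.lift * a + 1 = 0 := by
      rw [disc] at hdd
      rw [ha]
      linear_combination (d ^ 2 / 4) * he + hdd / 4
    have hdet := sl_det σ.lift
    rw [sltr] at hq
    obtain ⟨v, hv, h⟩ := (Matrix.exists_mulVec_eq_zero_iff (M := σ.lift.1 - a • 1)).mpr (by
      rw [Matrix.det_fin_two]; simp; linear_combination hq + hdet)
    rw [Matrix.sub_mulVec, Matrix.smul_mulVec, Matrix.one_mulVec, sub_eq_zero] at h
    exact ⟨v, hv, h⟩
  choose u hu0 hu using hex
  have hne : vdet (u 1) (u (-1)) ≠ 0 := by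
    intro h
    obtain ⟨t, ht⟩ := (mk_eq_mk_iff' ℂ _ _ (hu0 1) (hu0 (-1))).mp
      ((mk_eq_iff (hu0 1) (hu0 (-1))).mpr h)
    have h1 := hu 1
    rw [← ht, smul_comm σ.lift t, hu (-1), smul_comm t, ht, ← sub_eq_zero, ← sub_smul] at h1
    rcases smul_eq_zero.mp h1 with h2 | h2
    · apply hd0
      simp only [Units.val_neg, Units.val_one, Int.cast_neg, Int.cast_one] at h2
      linear_combination -h2
    · exact hu0 1 h2
  refine ⟨u, hne, fun e => ⟨_, hu e⟩, fun e => ?_⟩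
  have hT : ∀ e : ℤˣ, σ.axisMat *ᵥ u e = (((e : ℤ) : ℂ) * σ.disc) • u e := fun e => by
    rw [σ.axisMat_sq _ (hu e), ← hd]
    congr 1
    linear_combination ((e : ℤ) : ℂ) * hdd
  have hne' : vdet (u (-e)) (u e) ≠ 0 := by
    rcases Int.units_eq_one_or e with rfl | rfl
    · rw [vdet_swap]; exact neg_ne_zero.mpr hne
    · simpa using hne
  have he : (((e : ℤ) : ℂ)) ^ 2 = 1 := by rcases Int.units_eq_one_or e with h | h <;> simp [h]
  refine ⟨2 * σ.disc / vdet (u (-e)) (u e),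
    div_ne_zero (mul_ne_zero two_ne_zero hσ) hne', ?_⟩
  have hmv : ∀ v, outer (u e) (u (-e)) *ᵥ v = vdet (u (-e)) v • u e := fun v => by
    ext i; fin_cases i <;> simp [outer, Matrix.mulVec, dotProduct, Matrix.vecMulVec_apply, vdet] <;>
      ring
  refine Matrix.ext_of_mulVec_single fun i => ?_
  generalize (Pi.single i 1 : Fin 2 → ℂ) = v
  refine smul_right_injective _ hne' ?_
  change vdet (u (-e)) (u e) • (σ.eigMat e *ᵥ v) = vdet (u (-e)) (u e) • (_ *ᵥ v)
  have h1 : ∀ e', σ.eigMat e *ᵥ u e' = (σ.disc * (1 + ((e : ℤ) : ℂ) * ((e' : ℤ) : ℂ))) • u e' :=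
    fun e' => by
      rw [eigMat, Matrix.add_mulVec, Matrix.smul_mulVec, Matrix.smul_mulVec,
        Matrix.one_mulVec, hT]
      module
  rw [← Matrix.mulVec_smul, vec_expand, Matrix.mulVec_add, Matrix.mulVec_smul, Matrix.mulVec_smul,
    h1, h1, Matrix.smul_mulVec, hmv, smul_smul, smul_smul, smul_smul, smul_smul]
  have h2 : σ.disc * (1 + ((e : ℤ) : ℂ) * (((-e : ℤˣ) : ℤ) : ℂ)) = 0 := by
    push_cast [Units.val_neg]; linear_combination -σ.disc * he
  rw [h2, mul_zero, zero_smul, zero_add]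
  congr 1
  field_simp
  linear_combination vdet (u (-e)) v * he

/-- A fixed point of an element of non-zero discriminant is spanned by an eigenvector. -/
lemma eq_mk_of_fixed {σ : PSL2C} (hσ : σ.disc ≠ 0) {u w : Fin 2 → ℂ} (hu : u ≠ 0) (hw : w ≠ 0)
    (huw : vdet u w ≠ 0) {a b : ℂ} (ha : σ.lift • u = a • u) (hb : σ.lift • w = b • w) {x : BdH3}
    (hx : σ • x = x) : x = mk ℂ u hu ∨ x = mk ℂ w hw := by
  induction x using ind with | _ v hv =>
  obtain ⟨c, hc⟩ := (exists_eigenvalue hv).mp hx; obtain ⟨h1, h2⟩ := sl_smul_eigen huw ha hb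
  have e := congrArg (fun v => σ.lift • v) (vec_expand u w v)
  simp only [smul_add, smul_comm σ.lift, ha, hb, hc] at e; rw [smul_comm, vec_expand u w v] at e
  have e1 := congrArg (vdet u) e; have e2 := congrArg (fun v => vdet v w) e
  simp only [vdet, Pi.add_apply, Pi.smul_apply, smul_eq_mul] at e1 e2
  have k1 : vdet u v * (c - b) * vdet u w = 0 := by simp only [vdet]; linear_combination e1
  have k2 : vdet v w * (c - a) * vdet u w = 0 := by simp only [vdet]; linear_combination e2
  rw [mk_eq_iff, mk_eq_iff]; by_contra hcon; push Not at hcon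
  have hcb : c = b := by
    refine sub_eq_zero.mp (by_contra fun h => ?_)
    exact mul_ne_zero (mul_ne_zero (by rw [vdet_swap]; exact neg_ne_zero.mpr hcon.1) h) huw k1
  have hca : c = a := sub_eq_zero.mp (by_contra fun h => mul_ne_zero (mul_ne_zero hcon.2 h) huw k2)
  subst hca; subst hcb; apply hσ; rw [disc, h2]; linear_combination 4 * h1

section Axes

variable {G J : Type*} [Group G]

/-- Labels of the translates of the fixed points. -/
abbrev Label (J G : Type*) := J × ℤˣ × G

/-- The translate by `k` of the fixed point `η j s`, for the label `q = (j, s, k)`. -/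
def axisPt (ρ : RepVar G) (η : J → ℤˣ → BdH3) (q : Label J G) : BdH3 := ρ q.2.2 • η q.1 q.2.1

/-- The other end of the same axis. -/
def flipLabel (q : Label J G) : Label J G := (q.1, -q.2.1, q.2.2)

/-- `η` labels the two fixed points of the non-trivial elements `ρ (γ j)`, and for the pairs in
`Q` the translates of these fixed points are distinct. -/
structure IsAxisSystem (γ : J → G) (Q : Set (Label J G × Label J G)) (ρ : RepVar G)
    (η : J → ℤˣ → BdH3) : Prop where
  nontrivial : ∀ j, ρ (γ j) ≠ 1
  fixed : ∀ j s, ρ (γ j) • η j s = η j s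
  ne : ∀ j, η j 1 ≠ η j (-1)
  pair : ∀ q ∈ Q, axisPt ρ η q.1 ≠ axisPt ρ η q.2

/-- The product of two eigenprojections at different axes, vanishing if and only if the fixed
points with labels `q.1` and `q.2` agree. -/
def pairMat (γ : J → G) (q : Label J G × Label J G) (x : (J → ℤˣ) × RepVar G) :
    Matrix (Fin 2) (Fin 2) ℂ :=
  adPSL (x.2 q.2.2.2) ((x.2 (γ q.2.1)).eigMat (-(q.2.2.1 * x.1 q.2.1))) *
    adPSL (x.2 q.1.2.2) ((x.2 (γ q.1.1)).eigMat (q.1.2.1 * x.1 q.1.1))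

lemma sign_cast_mul (a b : ℤˣ) : (((a * b : ℤˣ) : ℤ) : ℂ) = ((a : ℤ) : ℂ) * ((b : ℤ) : ℂ) := by
  push_cast; ring

lemma adPSL_conjRep (κ : PSL2C) (ρ : RepVar G) (k : G) (X : Matrix (Fin 2) (Fin 2) ℂ) :
    adPSL (conjRep κ ρ k) (adPSL κ X) = adPSL κ (adPSL (ρ k) X) := by
  rw [← Module.End.mul_apply, ← Module.End.mul_apply, ← map_mul, ← map_mul]; congr 2
  change κ * ρ k * κ⁻¹ * κ = _
  group

lemma pairMat_conj {γ : J → G} {κ : PSL2C} {ρ : RepVar G} {e : J → ℤˣ}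
    (he : ∀ j, (conjRep κ ρ (γ j)).axisMat = ((e j : ℤ) : ℂ) • adPSL κ (ρ (γ j)).axisMat)
    (q : Label J G × Label J G) (ε : J → ℤˣ) :
    pairMat γ q (ε, conjRep κ ρ) = adPSL κ (pairMat γ q (ε * e, ρ)) := by
  have h1 : ∀ j s, (conjRep κ ρ (γ j)).eigMat s = adPSL κ ((ρ (γ j)).eigMat (s * e j)) :=
    fun j s => by
      rw [eigMat, eigMat, map_add, map_smul, map_smul, adPSL_one, he, sign_cast_mul, smul_smul]
      rw [show (conjRep κ ρ (γ j)).disc = (ρ (γ j)).disc from disc_conj κ _]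
  simp only [pairMat, h1, adPSL_conjRep, adPSL_mul_mul, neg_mul, mul_assoc, Pi.mul_apply]

lemma pairMat_eq {γ : J → G} {ρ : RepVar G} {u : J → ℤˣ → Fin 2 → ℂ}
    (hu : ∀ j e, ∃ c : ℂ, c ≠ 0 ∧ (ρ (γ j)).eigMat e = c • outer (u j e) (u j (-e)))
    (q : Label J G × Label J G) (ε : J → ℤˣ) : ∃ c : ℂ, c ≠ 0 ∧ pairMat γ q (ε, ρ) =
        (c * vdet ((ρ q.2.2.2).lift • u q.2.1 (q.2.2.1 * ε q.2.1))
            ((ρ q.1.2.2).lift • u q.1.1 (q.1.2.1 * ε q.1.1))) •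
          outer ((ρ q.2.2.2).lift • u q.2.1 (-(q.2.2.1 * ε q.2.1)))
            ((ρ q.1.2.2).lift • u q.1.1 (-(q.1.2.1 * ε q.1.1))) := by
  obtain ⟨c1, h1, e1⟩ := hu q.1.1 (q.1.2.1 * ε q.1.1)
  obtain ⟨c2, h2, e2⟩ := hu q.2.1 (-(q.2.2.1 * ε q.2.1)); refine ⟨c2 * c1, mul_ne_zero h2 h1, ?_⟩
  rw [pairMat, e1, e2, map_smul, map_smul, adPSL_outer, adPSL_outer, neg_neg, smul_mul_smul_comm,
    outer_mul_outer, smul_smul]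

set_option maxHeartbeats 1000000 in
/-- The distinctness conditions on fixed points are detected by an invariant function: the axes
are only determined up to their direction, and averaging over the directions of a product of
expressions in the eigenprojections gives a regular function. -/
lemma exists_invariant_of_isAxisSystem [Finite J] {γ : J → G} {Q : Set (Label J G × Label J G)}
    (hQ : Q.Finite) {ρ0 : RepVar G} {η0 : J → ℤˣ → BdH3} (h0 : IsAxisSystem γ Q ρ0 η0)
    (hx : ∀ q ∈ Q, ∃ x : G,
      axisPt ρ0 η0 (flipLabel q.1) ≠ ρ0 x • axisPt ρ0 η0 (flipLabel q.2) ∧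
      ρ0 x • axisPt ρ0 η0 (flipLabel q.1) ≠ axisPt ρ0 η0 (flipLabel q.2)) :
    ∃ f ∈ invariantFunctions G, f ρ0 ≠ 0 ∧ ∀ ρ, f ρ ≠ 0 → ∃ η, IsAxisSystem γ Q ρ η := by
  classical
  have := Fintype.ofFinite J
  have hx' : ∀ q, ∃ x : G, q ∈ Q →
      axisPt ρ0 η0 (flipLabel q.1) ≠ ρ0 x • axisPt ρ0 η0 (flipLabel q.2) ∧
      ρ0 x • axisPt ρ0 η0 (flipLabel q.1) ≠ axisPt ρ0 η0 (flipLabel q.2) := fun q => by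
    by_cases hq : q ∈ Q
    · exact (hx q hq).imp fun _ h _ => h
    · exact ⟨1, fun h => absurd h hq⟩
  choose x hx using hx'
  let R := regularFunctions G
  let T : J → Fin 2 × Fin 2 → RepVar G → ℂ := fun j k ρ => (ρ (γ j)).axisMat k.1 k.2
  let B := signAlg R T Finset.univ
  let W : (Label J G × Label J G) → (J → ℤˣ) × RepVar G → ℂ := fun q z =>
    (pairMat γ q z * adPSL (z.2 (x q)) (pairMat γ q z)).trace
  let y : (J → ℤˣ) × RepVar G → ℂ := (∏ q ∈ hQ.toFinset, W q) * ∏ j, fun z => (z.2 (γ j)).disc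
  have hR : ∀ f ∈ R, (fun z : (J → ℤˣ) × RepVar G => f z.2) ∈ B := fun f hf =>
    Algebra.subset_adjoin (Or.inl ⟨f, hf, rfl⟩)
  have hmul : ∀ {X Y : (J → ℤˣ) × RepVar G → Matrix (Fin 2) (Fin 2) ℂ},
      (∀ i j, (fun z => X z i j) ∈ B) → (∀ i j, (fun z => Y z i j) ∈ B) →
      ∀ i j, (fun z => (X z * Y z) i j) ∈ B := by
    intro X Y hX hY i j
    simp only [Matrix.mul_apply, Fin.sum_univ_two]
    exact add_mem (mul_mem (hX _ _) (hY _ _)) (mul_mem (hX _ _) (hY _ _))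
  have had : ∀ (g : G) {X : (J → ℤˣ) × RepVar G → Matrix (Fin 2) (Fin 2) ℂ},
      (∀ i j, (fun z => X z i j) ∈ B) → ∀ i j, (fun z => adPSL (z.2 g) (X z) i j) ∈ B := by
    intro g X hX i j
    simp only [adPSL_apply_eq_sum _ (X _), Fin.sum_univ_two]
    refine add_mem (add_mem ?_ ?_) (add_mem ?_ ?_) <;>
      exact mul_mem (hX _ _) (hR _ (adPSL_mem _ _ _ _ _))
  have heig : ∀ j s, ∀ a b, (fun z : (J → ℤˣ) × RepVar G =>
      (z.2 (γ j)).eigMat (s * z.1 j) a b) ∈ B := by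
    intro j s a b
    have h1 := add_mem (B.smul_mem (hR _ (disc_mem (γ j))) ((1 : Matrix (Fin 2) (Fin 2) ℂ) a b))
      (B.smul_mem (Algebra.subset_adjoin (Or.inr ⟨j, Finset.mem_univ j, (a, b), rfl⟩) :
        (fun z : (J → ℤˣ) × RepVar G => ((z.1 j : ℤ) : ℂ) * T j (a, b) z.2) ∈ B) ((s : ℤ) : ℂ))
    convert h1 using 1
    ext z
    simp only [eigMat, Matrix.add_apply, Matrix.smul_apply, smul_eq_mul, Pi.add_apply,
      Pi.smul_apply, sign_cast_mul, T]
    ring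
  have hpair : ∀ q i j, (fun z => pairMat γ q z i j) ∈ B := fun q =>
    hmul (had _ (by simpa only [neg_mul] using heig q.2.1 (-q.2.2.1))) (had _ (heig q.1.1 q.1.2.1))
  have hy : y ∈ B := by
    refine mul_mem (prod_mem fun q _ => ?_) (prod_mem fun j _ => hR _ (disc_mem (γ j)))
    have h := hmul (hpair q) (had (x q) (hpair q))
    simp only [W, Matrix.trace_fin_two]
    exact add_mem (h 0 0) (h 1 1)
  -- directions of the axes at `ρ0` for which `y` does not vanish
  have hd0 : ∀ j, (ρ0 (γ j)).disc ≠ 0 := fun j =>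
    disc_ne_zero_of_fixed (h0.nontrivial j) (h0.ne j) (h0.fixed j 1) (h0.fixed j (-1))
  have hvec : ∀ {ρ : RepVar G}, (∀ j, (ρ (γ j)).disc ≠ 0) → ∃ u : J → ℤˣ → Fin 2 → ℂ,
      (∀ j, vdet (u j 1) (u j (-1)) ≠ 0) ∧ (∀ j e, u j e ≠ 0) ∧
      (∀ j e, ∃ a : ℂ, (ρ (γ j)).lift • u j e = a • u j e) ∧
      ∀ j e, ∃ c : ℂ, c ≠ 0 ∧ (ρ (γ j)).eigMat e = c • outer (u j e) (u j (-e)) := by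
    intro ρ hd
    choose u h1 h2 h3 using fun j => exists_eigenvectors (hd j)
    refine ⟨u, h1, fun j e h0 => h1 j ?_, h2, h3⟩
    rcases Int.units_eq_one_or e with rfl | rfl <;> simp [h0, vdet]
  have hW : ∀ {ρ : RepVar G} {u : J → ℤˣ → Fin 2 → ℂ} (hu0 : ∀ j e, u j e ≠ 0)
      (hu : ∀ j e, ∃ c : ℂ, c ≠ 0 ∧ (ρ (γ j)).eigMat e = c • outer (u j e) (u j (-e))) (q)
      (ε : J → ℤˣ) (η : J → ℤˣ → BdH3)
      (hη : ∀ j s, η j s = mk ℂ (u j (s * ε j)) (hu0 _ _)),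
      W q (ε, ρ) ≠ 0 ↔ axisPt ρ η q.1 ≠ axisPt ρ η q.2 ∧
        axisPt ρ η (flipLabel q.1) ≠ ρ (x q) • axisPt ρ η (flipLabel q.2) ∧
        ρ (x q) • axisPt ρ η (flipLabel q.1) ≠ axisPt ρ η (flipLabel q.2) := by
    intro ρ u hu0 hu q ε η hη
    obtain ⟨c, hc, e⟩ := pairMat_eq hu q ε
    have hs := fun (σ : PSL2C) {v : Fin 2 → ℂ} (hv : v ≠ 0) =>
      PSL2C.smul_mk σ hv (sl_smul_ne_zero σ.lift hv)
    simp only [W, e, axisPt, flipLabel, hη, hs, ne_eq, mk_eq_iff, map_smul, adPSL_outer,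
      smul_mul_smul_comm, outer_mul_outer, Matrix.trace_smul, trace_outer, smul_eq_mul,
      mul_eq_zero, hc, false_or, neg_mul, or_self]
    rw [vdet_swap ((ρ q.2.2.2).lift • _), neg_eq_zero]
    tauto
  obtain ⟨u0, hu1, hu2, hu3, hu4⟩ := hvec hd0
  have hε : ∀ j, ∃ e : ℤˣ, ∀ s, η0 j s = mk ℂ (u0 j (s * e)) (hu2 _ _) := by
    intro j
    obtain ⟨a, ha⟩ := hu3 j 1
    obtain ⟨b, hb⟩ := hu3 j (-1)
    have h : ∀ s, _ := fun s =>
      eq_mk_of_fixed (hd0 j) (hu2 j 1) (hu2 j (-1)) (hu1 j) ha hb (h0.fixed j s)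
    rcases h 1 with h1 | h1 <;> rcases h (-1) with h2 | h2
    · exact absurd (h1.trans h2.symm) (h0.ne j)
    · exact ⟨1, fun s => by rcases Int.units_eq_one_or s with rfl | rfl <;> simpa⟩
    · exact ⟨-1, fun s => by rcases Int.units_eq_one_or s with rfl | rfl <;> simpa⟩
    · exact absurd (h1.trans h2.symm) (h0.ne j)
  choose ε0 hε0 using hε
  have hy0 : y (ε0, ρ0) ≠ 0 := by
    simp only [y, Pi.mul_apply, Finset.prod_apply]
    refine mul_ne_zero (Finset.prod_ne_zero_iff.mpr fun q hq => ?_)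
      (Finset.prod_ne_zero_iff.mpr fun j _ => hd0 j)
    have hq := hQ.mem_toFinset.mp hq
    exact (hW hu2 hu4 q ε0 η0 hε0).mpr ⟨h0.pair q hq, hx q hq⟩
  -- a polynomial in `y` that vanishes at the values at `ρ0` other than `y (ε0, ρ0)`
  let V : Finset ℂ := (Finset.univ.image fun ε => y (ε, ρ0)).erase (y (ε0, ρ0))
  let w : (J → ℤˣ) × RepVar G → ℂ := y * ∏ v ∈ V, (y - algebraMap ℂ _ v)
  have hwa : ∀ z, w z = y z * ∏ v ∈ V, (y z - v) := fun z => by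
    simp [w, Finset.prod_apply]
  have hw : w ∈ B := mul_mem hy (prod_mem fun v _ => sub_mem hy (B.algebraMap_mem v))
  refine ⟨fun ρ => ∑ ε, w (ε, ρ), ⟨sum_mem_of_mem_signAlg
    (fun j k l => axisMat_mul_mem (γ j) _ _ _ _) Finset.univ w hw, ?_⟩, ?_, ?_⟩
  · intro κ ρ
    choose e he using fun j => axisMat_conj κ (ρ (γ j))
    have hyc : ∀ ε, y (ε, conjRep κ ρ) = y (ε * e, ρ) := fun ε => by
      simp only [y, W, Pi.mul_apply, Finset.prod_apply]
      congr 1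
      · refine Finset.prod_congr rfl fun q _ => ?_
        rw [pairMat_conj he, adPSL_conjRep, ← adPSL_mul_mul, trace_adPSL]
      · exact Finset.prod_congr rfl fun j _ => disc_conj κ _
    have hwc : ∀ ε, w (ε, conjRep κ ρ) = w (ε * e, ρ) := fun ε => by rw [hwa, hwa, hyc]
    simp only [hwc]
    exact Equiv.sum_comp (Equiv.mulRight e) fun ε => w (ε, ρ)
  · have h1 : ∀ ε, w (ε, ρ0) = if y (ε, ρ0) = y (ε0, ρ0) then w (ε0, ρ0) else 0 := fun ε => by
      split_ifs with h
      · rw [hwa, hwa, h]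
      · rw [hwa, Finset.prod_eq_zero (i := y (ε, ρ0)) _ (sub_self _), mul_zero]
        simp [V, h]
    beta_reduce
    rw [Finset.sum_congr rfl fun ε _ => h1 ε, ← Finset.sum_filter, Finset.sum_const, nsmul_eq_mul]
    refine mul_ne_zero (Nat.cast_ne_zero.mpr (Finset.card_ne_zero_of_mem (a := ε0) (by simp))) ?_
    rw [hwa]
    refine mul_ne_zero hy0 (Finset.prod_ne_zero_iff.mpr fun v hv => sub_ne_zero.mpr ?_)
    exact (Finset.ne_of_mem_erase hv).symm
  · intro ρ hρ
    obtain ⟨ε, -, hε⟩ := Finset.exists_ne_zero_of_sum_ne_zero hρ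
    rw [hwa] at hε
    have hyε := left_ne_zero_of_mul hε
    simp only [y, Pi.mul_apply, Finset.prod_apply] at hyε
    have hd := fun j => Finset.prod_ne_zero_iff.mp (right_ne_zero_of_mul hyε) j (Finset.mem_univ j)
    obtain ⟨u, h1, h2, h3, h4⟩ := hvec hd
    refine ⟨fun j s => mk ℂ (u j (s * ε j)) (h2 _ _), ?_, ?_, ?_, ?_⟩
    · intro j hj
      apply hd j
      have : (ρ (γ j)).lift = 1 ∨ (ρ (γ j)).lift = -1 := by
        rw [← mk_eq_mk, mk_lift, hj]; rfl
      rcases this with h | h <;> rw [disc, h] <;> simp [sltr] <;> norm_num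
    · exact fun j s => (exists_eigenvalue (h2 _ _)).mpr (h3 j _)
    · intro j h
      rw [mk_eq_iff] at h
      rcases Int.units_eq_one_or (ε j) with h' | h'
      · exact h1 j (by simpa [h'] using h)
      · rw [vdet_swap] at h; exact h1 j (by simpa [h'] using h)
    · intro q hq
      exact ((hW h2 h4 q ε _ fun j s => rfl).mp (Finset.prod_ne_zero_iff.mp
        (left_ne_zero_of_mul hyε) q (hQ.mem_toFinset.mpr hq))).1

end Axes

/-! ### Convex co-compact representations have no parabolics -/

lemma H3.mk_smul (A : SL(2, ℂ)) (X : H3) : (QuotientGroup.mk A : PSL2C) • X = A • X := rfl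

/-- The trace of `X⁻¹ Z`; it depends only on the distance of the two points. -/
def H3.disp (X Z : H3) : ℂ := (X.1.adjugate * Z.1).trace

lemma H3.disp_smul (σ : PSL2C) (X Z : H3) : disp (σ • X) (σ • Z) = disp X Z := by
  obtain ⟨A, rfl⟩ := σ.exists_lift
  rw [H3.mk_smul, H3.mk_smul, disp, disp, smul_val, smul_val,
    Matrix.adjugate_mul_distrib, Matrix.adjugate_mul_distrib]
  have h : A.1.adjugate * A.1 = 1 := by rw [Matrix.adjugate_mul, A.2, one_smul]
  have h' : A.1ᴴ * A.1ᴴ.adjugate = 1 := by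
    rw [Matrix.mul_adjugate, Matrix.det_conjTranspose, A.2, star_one, one_smul]
  calc _ = (A.1ᴴ.adjugate * (X.1.adjugate * (A.1.adjugate * A.1) * Z.1 * A.1ᴴ)).trace := by
        simp only [Matrix.mul_assoc]
    _ = _ := by rw [h, Matrix.mul_one, Matrix.trace_mul_comm, Matrix.mul_assoc, h', Matrix.mul_one]

lemma H3.disp_self (X : H3) : disp X X = 2 := by rw [disp, Matrix.adjugate_mul, X.2.2]; simp

lemma H3.disp_eq (X Z : H3) : disp X Z =
    X.1 1 1 * Z.1 0 0 - X.1 0 1 * Z.1 1 0 - X.1 1 0 * Z.1 0 1 + X.1 0 0 * Z.1 1 1 := by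
  rw [disp, Matrix.adjugate_fin_two, Matrix.trace_fin_two, Matrix.mul_apply, Matrix.mul_apply,
    Fin.sum_univ_two, Fin.sum_univ_two]
  simp; ring

lemma H3.entries (X : H3) : ∃ (a d : ℝ) (b : ℂ), 0 < a ∧ 0 < d ∧ X.1 0 0 = a ∧ X.1 1 1 = d ∧
    X.1 0 1 = b ∧ X.1 1 0 = star b ∧ (a * d : ℂ) = 1 + b * star b := by
  have hp : ∀ i, ∃ a : ℝ, 0 < a ∧ X.1 i i = a := fun i => by
    have h := lt_def.mp (X.2.1.diag_pos (i := i)); exact ⟨_, h.1, Complex.ext rfl h.2.symm⟩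
  obtain ⟨a, ha, ha'⟩ := hp 0; obtain ⟨d, hd, hd'⟩ := hp 1
  have hs : X.1 1 0 = star (X.1 0 1) := (X.2.1.isHermitian.apply 1 0).symm; have hdet := X.2.2
  rw [Matrix.det_fin_two, ha', hd', hs] at hdet
  exact ⟨a, d, _, ha, hd, ha', hd', rfl, hs, by linear_combination hdet⟩

lemma H3.ext_entries {X Z : H3} (h : X.1 1 1 = Z.1 1 1) (h' : X.1 0 1 = Z.1 0 1) : X = Z := by
  obtain ⟨a, d, b, ha, hd, e1, e2, e3, e4, e5⟩ := X.entries
  obtain ⟨a', d', b', ha', hd', f1, f2, f3, f4, f5⟩ := Z.entries; rw [e2, f2] at h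
  rw [e3, f3] at h'; subst h'; have hd0 : (d : ℂ) ≠ 0 := by exact_mod_cast hd.ne'
  have : (a : ℂ) = a' := mul_right_cancel₀ hd0 (by rw [e5, h, f5]); apply Subtype.ext; ext i j
  fin_cases i <;> fin_cases j
  exacts [(e1.trans this).trans f1.symm, e3.trans f3.symm, e4.trans f4.symm, (e2.trans h).trans f2.symm]

lemma H3.smul_apply (A : SL(2, ℂ)) (X : H3) (i j : Fin 2) : (A • X).1 i j =
    (A i 0 * X.1 0 0 + A i 1 * X.1 1 0) * star (A j 0) +
      (A i 0 * X.1 0 1 + A i 1 * X.1 1 1) * star (A j 1) := by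
  rw [smul_val, Matrix.mul_apply, Fin.sum_univ_two, Matrix.mul_apply, Matrix.mul_apply,
    Fin.sum_univ_two, Fin.sum_univ_two]
  rfl

lemma H3.smul_axis_apply (A : SL(2, ℂ)) (s : ℝ) (i j : Fin 2) : (A • H3.axis s).1 i j =
    A i 0 * star (A j 0) * exp s + A i 1 * star (A j 1) * exp (-s) := by
  rw [H3.smul_apply]; simp [H3.axis]; ring

/-- The matrix that moves the base point to the point with lower right entry `exp τ` and upper
right entry `b`. -/
def horoFrame (τ : ℝ) (b : ℂ) : SL(2, ℂ) :=
  ⟨!![(exp (-τ / 2) : ℂ), b * (exp (-τ / 2) : ℂ); 0, (exp (τ / 2) : ℂ)], by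
    rw [Matrix.det_fin_two_of, mul_zero, sub_zero, ← ofReal_mul, ← Real.exp_add]
    ring_nf; simp⟩

lemma horoFrame_one_one (τ : ℝ) (b : ℂ) : (horoFrame τ b • H3.axis 0).1 1 1 = exp τ := by
  rw [smul_axis_apply]
  simp only [horoFrame, Matrix.of_apply, Matrix.cons_val_one, Matrix.cons_val_zero, neg_zero,
    Real.exp_zero, zero_mul, zero_add, star_def, conj_ofReal]
  rw [ofReal_one, mul_one, ← ofReal_mul, ← Real.exp_add, add_halves]

lemma horoFrame_zero_one (τ : ℝ) (b : ℂ) : (horoFrame τ b • H3.axis 0).1 0 1 = b := by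
  rw [smul_axis_apply]
  simp only [horoFrame, Matrix.of_apply, Matrix.cons_val_one, Matrix.cons_val_zero, neg_zero,
    Real.exp_zero, star_zero, mul_zero, zero_mul, zero_add, star_def, conj_ofReal]
  rw [ofReal_one, mul_one, mul_assoc, ← ofReal_mul, ← Real.exp_add]; ring_nf; simp

lemma H3.eq_horoFrame {X : H3} {d : ℝ} (hd : 0 < d) (h : X.1 1 1 = d) :
    X = horoFrame (log d) (X.1 0 1) • H3.axis 0 :=
  ext_entries (by rw [horoFrame_one_one, Real.exp_log hd, h]) (by rw [horoFrame_zero_one])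

lemma H3.continuous_sl_smul (A : SL(2, ℂ)) : Continuous fun X : H3 => A • X := by
  refine Continuous.subtype_mk ?_ _
  exact (continuous_const.matrix_mul continuous_subtype_val).matrix_mul continuous_const

lemma H3.continuous_smul (σ : PSL2C) : Continuous fun X : H3 => σ • X := by
  obtain ⟨A, rfl⟩ := σ.exists_lift; exact continuous_sl_smul A

lemma H3.continuous_entry (i j : Fin 2) : Continuous fun X : H3 => X.1 i j :=
  continuous_subtype_val.matrix_elem i j

lemma continuous_horoFrame : Continuous fun q : ℝ × ℂ => horoFrame q.1 q.2 • H3.axis 0 := by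
  have h : Continuous fun q : ℝ × ℂ => (horoFrame q.1 q.2).1 := by
    refine continuous_matrix fun i j => ?_
    fin_cases i <;> fin_cases j <;> simp [horoFrame] <;> fun_prop
  exact Continuous.subtype_mk ((h.matrix_mul continuous_const).matrix_mul h.matrix_conjTranspose) _

/-- A set of points with bounded diagonal entries lies in a compact set. -/
lemma H3.exists_isCompact (R : ℝ) : ∃ K : Set H3, IsCompact K ∧
    ∀ X : H3, (X.1 0 0).re ≤ R → (X.1 1 1).re ≤ R → X ∈ K := by
  refine ⟨_, ((isCompact_Icc (a := log R⁻¹) (b := log R)).prod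
    (isCompact_closedBall (0 : ℂ) R)).image continuous_horoFrame, fun X h0 h1 => ?_⟩
  obtain ⟨a, d, b, ha, hd, e1, e2, e3, e4, e5⟩ := X.entries; rw [e1, ofReal_re] at h0
  rw [e2, ofReal_re] at h1
  have hb : a * d = 1 + ‖b‖ ^ 2 := by
    have h := e5; rw [star_def, mul_conj, normSq_eq_norm_sq] at h; exact_mod_cast h
  refine ⟨(log d, X.1 0 1), ⟨⟨log_le_log (by have := ha.trans_le h0; positivity) ?_,
    log_le_log hd h1⟩, ?_⟩, (eq_horoFrame hd e2).symm⟩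
  · rw [inv_le_iff_one_le_mul₀ (ha.trans_le h0)]
    nlinarith only [mul_le_mul_of_nonneg_right h0 hd.le, hb, sq_nonneg ‖b‖]
  · rw [mem_closedBall_zero_iff, e3]
    refine abs_le_of_sq_le_sq' (?_ : ‖b‖ ^ 2 ≤ R ^ 2) (ha.le.trans h0) |>.2
    nlinarith only [mul_le_mul h0 h1 hd.le (ha.le.trans h0), hb]

lemma H3.entry_le_disp (X Z : H3) (i : Fin 2) : (Z.1 i i).re ≤ (disp X Z).re * (X.1 i i).re := by
  rw [disp_eq]; obtain ⟨a, d, b, ha, hd, e1, e2, e3, e4, e5⟩ := X.entries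
  obtain ⟨a', d', b', ha', hd', f1, f2, f3, f4, f5⟩ := Z.entries
  simp only [e1, e2, e3, e4, f1, f2, f3, f4]; have h := congrArg Complex.re e5
  have h' := congrArg Complex.re f5; simp at h h'
  revert i
  rw [Fin.forall_fin_two, e1, e2, f1, f2]; simp; constructor
  · refine le_of_mul_le_mul_left ?_ ha'
    nlinarith only [sq_nonneg (a * b'.re - a' * b.re), sq_nonneg (a * b'.im - a' * b.im), h, h',
      sq_nonneg a, congrArg (· * a' ^ 2) h, congrArg (· * a ^ 2) h']
  · refine le_of_mul_le_mul_left ?_ hd'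
    nlinarith only [sq_nonneg (d * b'.re - d' * b.re), sq_nonneg (d * b'.im - d' * b.im), h, h',
      sq_nonneg d, congrArg (· * d' ^ 2) h, congrArg (· * d ^ 2) h']

/-- The parabolic matrix that translates by `m`. -/
def parab (m : ℂ) : SL(2, ℂ) := ⟨!![1, m; 0, 1], by simp⟩

lemma H3.disp_parab (X : H3) : disp X (parab 1 • X) = 2 + X.1 1 1 ^ 2 := by
  obtain ⟨a, d, b, ha, hd, e1, e2, e3, e4, e5⟩ := X.entries; rw [disp_eq]; simp only [H3.smul_apply]
  simp [parab, e1, e2, e3, e4]; simp at e5; linear_combination 2 * e5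

lemma parab_mul_horoFrame (m : ℂ) (τ : ℝ) (b : ℂ) :
    parab m * horoFrame τ b = horoFrame τ b * parab (m * exp τ) := by
  have h : (exp τ : ℂ) = exp (τ / 2) * exp (τ / 2) := by
    rw [← ofReal_mul, ← Real.exp_add, add_halves]
  have h' : (exp (-τ / 2) * exp (τ / 2) : ℂ) = 1 := by
    rw [← ofReal_mul, ← Real.exp_add]; ring_nf; simp
  apply sl_ext <;> rw [sl_mul, sl_mul] <;>
    simp only [parab, horoFrame, Matrix.of_apply, Matrix.cons_val_zero, Matrix.cons_val_one]
  · ring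
  · linear_combination -(m * exp (τ / 2)) * h' - (exp (-τ / 2) * m) * h
  · ring
  · ring

/-- The midpoint of `X` and its translate by a large parabolic translation has a small lower right
entry. -/
lemma H3.exists_parab_frame (X : H3) (m : ℝ) : ∃ (A : SL(2, ℂ)) (s : ℝ),
    A • H3.axis (-s) = X ∧ A • H3.axis s = parab m • X ∧
    2 * Real.sinh s = m * (X.1 1 1).re ∧ (A • H3.axis 0).1 1 1 = X.1 1 1 / cosh s := by
  obtain ⟨a, d, b, ha, hd, e1, e2, e3, e4, e5⟩ := X.entries
  obtain ⟨s, hs⟩ : ∃ s, s = arsinh (m * d / 2) := ⟨_, rfl⟩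
  have hsin : 2 * Real.sinh s = m * d := by rw [hs, sinh_arsinh]; ring
  have hcos := cosh_pos s
  obtain ⟨r, hr0, hr⟩ : ∃ r : ℝ, r ≠ 0 ∧ r ^ 2 * (2 * cosh s) = 1 :=
    ⟨(√(2 * cosh s))⁻¹, by positivity, by rw [inv_pow, sq_sqrt (by positivity)]; field_simp⟩
  have hC : (r : ℂ) ^ 2 * (exp s + exp (-s)) = 1 := by
    rw [cosh_eq, mul_div_cancel₀ _ two_ne_zero] at hr; exact_mod_cast hr
  have hee : (exp s * exp (-s) : ℂ) = 1 := by
    rw [← ofReal_mul, ← Real.exp_add]; simp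
  let V : SL(2, ℂ) := ⟨!![(r * exp s : ℂ), -(r * exp (-s)); r, r], by
    rw [Matrix.det_fin_two_of]; linear_combination hC⟩
  have hV1 : V • H3.axis (-s) = H3.axis 0 := by
    apply ext_entries <;> rw [smul_axis_apply] <;> simp [V, H3.axis]
    · simp at hC; linear_combination hC
    · ring
  have hV2 : V • H3.axis s = parab (m * d) • H3.axis 0 := by
    have hm : (m * d : ℂ) = exp s - exp (-s) := by
      rw [sinh_eq] at hsin
      rw [← ofReal_mul, ← hsin]; push_cast; ring
    apply ext_entries <;> rw [smul_axis_apply, smul_axis_apply] <;>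
      simp [V, parab, -ofReal_exp] 
    · linear_combination hC
    · rw [hm]; linear_combination (exp s - exp (-s)) * hC
  have hX := eq_horoFrame hd e2
  refine ⟨horoFrame (log d) (X.1 0 1) * V, s, ?_, ?_, ?_, ?_⟩
  · rw [mul_smul, hV1, ← hX]
  · rw [mul_smul, hV2]
    conv_rhs => rw [hX]
    rw [← mul_smul, ← mul_smul, parab_mul_horoFrame, Real.exp_log hd]
  · rw [e2, hsin, ofReal_re]
  · have h2 : (exp (log d / 2) : ℂ) * exp (log d / 2) = d := by
      rw [← ofReal_mul, ← Real.exp_add, add_halves, Real.exp_log hd]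
    have h3 : (cosh s : ℂ) ≠ 0 := by exact_mod_cast hcos.ne'
    rw [smul_axis_apply, e2, eq_div_iff h3]
    have h4 : (r : ℂ) ^ 2 * (2 * cosh s) = 1 := by exact_mod_cast hr
    rw [sl_mul, sl_mul]
    simp [horoFrame, V, -ofReal_exp, -Complex.ofReal_cosh]
    linear_combination 2 * r ^ 2 * cosh s * h2 + d * h4

lemma exists_parab_conj {A : SL(2, ℂ)} (h1 : A ≠ 1) (h2 : sltr A = 2) :
    ∃ K : SL(2, ℂ), A * K = K * parab 1 := by
  obtain ⟨p, hp⟩ : ∃ p, A 0 0 = 1 + p := ⟨A 0 0 - 1, by ring⟩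
  obtain ⟨q, hq⟩ : ∃ q, A 0 1 = q := ⟨_, rfl⟩; obtain ⟨r, hr⟩ : ∃ r, A 1 0 = r := ⟨_, rfl⟩
  have hs : A 1 1 = 1 - p := by rw [sltr, hp] at h2; linear_combination h2
  have hdet := sl_det A; rw [hp, hq, hr, hs] at hdet; by_cases h0 : r = 0
  · have hp0 : p = 0 := by rw [h0] at hdet; simpa using (by linear_combination -hdet : p ^ 2 = 0)
    have hq0 : q ≠ 0 := by
      rintro rfl; exact h1 (by apply sl_ext <;> simp [hp, hq, hr, hs, hp0, h0])
    obtain ⟨c, hc⟩ := IsAlgClosed.exists_pow_nat_eq q⁻¹ two_pos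
    let K : SL(2, ℂ) := ⟨!![c * q, 0; 0, c], by
      rw [Matrix.det_fin_two_of]; linear_combination q * hc + mul_inv_cancel₀ hq0⟩
    refine ⟨K, ?_⟩
    apply sl_ext <;> rw [sl_mul, sl_mul] <;> simp [K, parab, hp, hq, hr, hs, hp0, h0, mul_comm]
  · obtain ⟨c, hc⟩ := IsAlgClosed.exists_pow_nat_eq (-r⁻¹) two_pos
    let K : SL(2, ℂ) := ⟨!![c * p, c; c * r, 0], by
      rw [Matrix.det_fin_two_of]; linear_combination -r * hc + mul_inv_cancel₀ h0⟩
    refine ⟨K, ?_⟩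
    apply sl_ext <;> rw [sl_mul, sl_mul] <;> simp [K, parab, hp, hq, hr, hs]
    · linear_combination -c * hdet
    all_goals ring

open Filter in
/-- A convex co-compact group contains no parabolics: far out towards the fixed point of a
parabolic the convex set contains points that are moved very little, and translates of these
points accumulate in a compact set, against discreteness. -/
lemma IsConvexCocompact.disc_ne_zero {G : Type*} [Group G] {ρ : G →* PSL2C}
    (h : IsConvexCocompact ρ) {g : G} (hg : g ≠ 1) : (ρ g).disc ≠ 0 := by
  intro hd
  have hg1 : ρ g ≠ 1 := fun h' => hg (h.faithful (h'.trans (map_one ρ).symm))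
  obtain ⟨κ, hκ⟩ : ∃ κ : PSL2C, κ⁻¹ * ρ g * κ = QuotientGroup.mk (parab 1) := by
    have : ∃ A : SL(2, ℂ), (QuotientGroup.mk A : PSL2C) = ρ g ∧ sltr A = 2 := by
      have h2 : (sltr (ρ g).lift - 2) * (sltr (ρ g).lift + 2) = 0 := by
        rw [disc] at hd; linear_combination hd
      rcases mul_eq_zero.mp h2 with h2 | h2
      · exact ⟨_, (ρ g).mk_lift, by linear_combination h2⟩
      · refine ⟨-(ρ g).lift, ?_, by rw [sltr_neg]; linear_combination -h2⟩
        rw [← (ρ g).mk_lift, mk_eq_mk, mk_lift]; simp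
    obtain ⟨A, hA, hA2⟩ := this
    obtain ⟨K, hK⟩ := exists_parab_conj (by rintro rfl; exact hg1 hA.symm) hA2
    refine ⟨QuotientGroup.mk K, ?_⟩
    rw [← hA, mul_assoc, inv_mul_eq_iff_eq_mul]
    exact congrArg _ hK
  have hdisp : ∀ W : H3, disp W (ρ g • W) = 2 + (κ⁻¹ • W).1 1 1 ^ 2 := fun W => by
    rw [← disp_parab, ← H3.mk_smul, ← hκ, ← disp_smul κ⁻¹, smul_smul, smul_smul,
      mul_inv_cancel_right]
  obtain ⟨C, ⟨X₀, hX0⟩, -, hconv, hinv, K, -, hK, hcov⟩ := h.cocompact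
  obtain ⟨R0, hR0⟩ := hK.bddAbove_image
    (Complex.continuous_re.comp (continuous_entry 0 0)).continuousOn
  obtain ⟨R1, hR1⟩ := hK.bddAbove_image
    (Complex.continuous_re.comp (continuous_entry 1 1)).continuousOn
  obtain ⟨K', hK', hmem⟩ := exists_isCompact (max (3 * R0) (3 * R1))
  have hpos : ∀ (X : H3) (i), 0 < (X.1 i i).re := fun X i => (lt_def.mp X.2.1.diag_pos).1
  have hle : ∀ Y ∈ K, ∀ Z, (disp Y Z).re ≤ 3 → Z ∈ K' := by
    intro Y hY Z hZ
    have h0 := hR0 ⟨Y, hY, rfl⟩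
    have h1 := hR1 ⟨Y, hY, rfl⟩
    have k := fun i => (entry_le_disp Y Z i).trans (mul_le_mul_of_nonneg_right hZ (hpos Y i).le)
    exact hmem Z ((k 0).trans ((mul_le_mul_of_nonneg_left h0 (by norm_num)).trans (le_max_left _ _)))
      ((k 1).trans ((mul_le_mul_of_nonneg_left h1 (by norm_num)).trans (le_max_right _ _)))
  have hconj : ∀ (k : G) (Y : H3), disp Y (ρ (k * g * k⁻¹) • Y) =
      2 + (κ⁻¹ • ρ k⁻¹ • Y).1 1 1 ^ 2 := fun k Y => by
    rw [← hdisp, ← disp_smul (ρ k⁻¹), smul_smul, smul_smul, ← map_mul, ← map_mul]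
    congr 3; group
  have hdisc : ∀ t : G, ∃ m > 0, ∀ k, t = k * g * k⁻¹ → ∀ Y ∈ K, 2 + m ≤ (disp Y (ρ t • Y)).re := by
    intro t
    by_cases hk : ∃ k, t = k * g * k⁻¹; swap
    · exact ⟨1, one_pos, fun k e => absurd ⟨k, e⟩ hk⟩
    obtain ⟨k, rfl⟩ := hk
    simp only [hconj k]
    obtain ⟨m, hm, h⟩ := hK.exists_forall_le' (a := 2)
      (f := fun Y : H3 => (2 + (κ⁻¹ • ρ k⁻¹ • Y).1 1 1 ^ 2).re)
      (Complex.continuous_re.comp (continuous_const.add (((continuous_entry 1 1).comp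
        ((continuous_smul _).comp (continuous_smul _))).pow 2))).continuousOn fun Y _ => by
      obtain ⟨a, d, b, -, hd, -, e, -⟩ := (κ⁻¹ • ρ k⁻¹ • Y).entries
      rw [e, ← ofReal_pow, add_re, ofReal_re, show (2 : ℂ).re = 2 from rfl]
      linarith only [pow_pos hd 2]
    exact ⟨m - 2, by linarith, fun _ _ Y hY => by linarith [h Y hY]⟩
  choose m hm0 hm using hdisc
  obtain ⟨μ, hμ0, hμ⟩ := ((h.discrete K' hK').image m).exists_pos_le
  obtain ⟨n, hn⟩ := exists_nat_gt (max 2 (2 / μ + 2))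
  have hn2 := (le_max_left _ _).trans_lt hn
  have hnμ := (le_max_right _ _).trans_lt hn
  obtain ⟨A, s, e1, e2, e3, e4⟩ := (κ⁻¹ • X₀).exists_parab_frame n
  have hd0 := hpos (κ⁻¹ • X₀) 1
  have hs : 0 ≤ s := by
    rw [← sinh_nonneg_iff]
    have : 0 ≤ (n : ℝ) * ((κ⁻¹ • X₀).1 1 1).re := by positivity
    linarith only [this, e3]
  have hpn : ∀ n : ℕ, parab n = parab 1 ^ n := fun n => by
    induction n with
    | zero => rw [pow_zero]; apply sl_ext <;> simp [parab]
    | succ n ih => 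
      rw [pow_succ, ← ih]
      apply sl_ext <;> rw [sl_mul] <;> simp [parab, add_comm]
  have hmid : (κ * QuotientGroup.mk A) • H3.axis 0 ∈ C := by
    refine hconv _ (-s) 0 s (by linarith) hs ?_ ?_
    · rw [mul_smul, H3.mk_smul, e1, smul_inv_smul]; exact hX0
    · rw [mul_smul, H3.mk_smul, e2]
      have : κ • parab (n : ℝ) • κ⁻¹ • X₀ = ρ (g ^ n) • X₀ := by
        rw [Complex.ofReal_natCast, hpn, ← H3.mk_smul, QuotientGroup.mk_pow, ← hκ, smul_smul, smul_smul,
          map_pow]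
        congr 1
        have := conj_pow (i := n) (a := κ⁻¹) (b := ρ g)
        rw [inv_inv] at this
        rw [this]; group
      rw [this]; exact hinv _ _ hX0
  obtain ⟨k, hk⟩ := hcov _ hmid
  have hd1 : disp (ρ k • (κ * QuotientGroup.mk A) • H3.axis 0)
      (ρ (k * g * k⁻¹) • ρ k • (κ * QuotientGroup.mk A) • H3.axis 0) =
      2 + ((κ⁻¹ • X₀).1 1 1 / cosh s) ^ 2 := by
    rw [hconj, map_inv, inv_smul_smul, mul_smul, inv_smul_smul, H3.mk_smul, e4]
  obtain ⟨a, d, b, -, hd, -, e5, -⟩ := (κ⁻¹ • X₀).entries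
  rw [e5, ofReal_re] at e3
  have hd2 := congrArg Complex.re hd1
  rw [e5, ← ofReal_div, ← ofReal_pow, add_re, ofReal_re] at hd2
  have hq : d / cosh s ≤ 2 / n := by
    rw [div_le_div_iff₀ (cosh_pos s) (by positivity)]
    nlinarith only [e3, sinh_lt_cosh s]
  have hq0 : 0 ≤ d / cosh s := by have := cosh_pos s; positivity
  have hq1 : 2 / (n : ℝ) < 1 := by rw [div_lt_one (by positivity)]; exact hn2
  have hqμ : 2 / (n : ℝ) < μ := by
    rw [div_lt_comm₀ (by positivity) hμ0]; linarith only [hnμ]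
  have hsq : (d / cosh s) ^ 2 ≤ 2 / n := by nlinarith only [hq, hq0, hq1]
  have hin : k * g * k⁻¹ ∈ {g : G | (((fun X : H3 => ρ g • X) '' K') ∩ K').Nonempty} := by
    refine ⟨_, ⟨ρ k • (κ * QuotientGroup.mk A) • H3.axis 0, ?_, rfl⟩, hle _ hk _ ?_⟩
    · exact hle _ hk _ (by rw [disp_self]; norm_num)
    · rw [hd2]; norm_num; linarith only [hsq, hq1]
  have h1 := hm (k * g * k⁻¹) k rfl _ hk
  have h2 := hμ _ ⟨_, hin, rfl⟩ (hm0 _)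
  rw [hd2] at h1
  norm_num at h1
  linarith only [h1, h2, hsq, hqμ]

/-! ### The totally geodesic plane and ideal triangles -/

/-- The real matrix `g`, as a complex matrix. -/
def cx (g : SL2R) : SL(2, ℂ) := Matrix.SpecialLinearGroup.map (algebraMap ℝ ℂ) g

lemma cx_mul (g h : SL2R) : cx (g * h) = cx g * cx h := map_mul _ g h

lemma cx_apply (g : SL2R) (i j : Fin 2) : cx g i j = g i j := rfl

/-- The embedding of `ℍ` in `ℍ³` as a totally geodesic plane. -/
def emb (z : ℍ) : H3 := horoFrame (-log z.im) (z.re / z.im) • H3.axis 0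

lemma emb_one_one (z : ℍ) : (emb z).1 1 1 = 1 / z.im := by
  rw [emb, horoFrame_one_one, Real.exp_neg, Real.exp_log z.im_pos]; simp

lemma emb_zero_one (z : ℍ) : (emb z).1 0 1 = z.re / z.im := by rw [emb, horoFrame_zero_one]

lemma continuous_emb : Continuous emb := by
  have h : Continuous fun z : ℍ => ((-log z.im, (z.re : ℂ) / z.im) : ℝ × ℂ) :=
    (UpperHalfPlane.continuous_im.log fun z => z.im_ne_zero).neg.prodMk
      ((continuous_ofReal.comp UpperHalfPlane.continuous_re).div
        (continuous_ofReal.comp UpperHalfPlane.continuous_im)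
        fun z => ofReal_ne_zero.mpr z.im_ne_zero)
  refine (continuous_horoFrame.comp h).congr fun z => ?_; rw [emb, Function.comp_apply]

lemma emb_axis (s : ℝ) : emb (H2.axis s) = H3.axis s := by
  apply ext_entries
  · rw [emb_one_one, H2.axis_im]; simp [H3.axis, Complex.exp_neg]
  · rw [emb_zero_one, H2.axis_re]; simp [H3.axis]

lemma emb_smul (g : SL2R) (z : ℍ) : emb (g • z) = cx g • emb z := by
  have h : ∀ k : SL2R, emb (k • I) = cx k • H3.axis 0 := by
    intro k
    have hk : ((k 1 0 : ℂ) ^ 2 + (k 1 1 : ℂ) ^ 2) ≠ 0 := by exact_mod_cast (sl_row_sq_pos k).ne'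
    apply ext_entries
    · rw [emb_one_one, im_sl_smul_I, smul_axis_apply]
      simp [cx_apply]; ring
    · rw [emb_zero_one, im_sl_smul_I, re_sl_smul_I, smul_axis_apply]
      simp [cx_apply]; field_simp
  obtain ⟨k, rfl⟩ : ∃ k : SL2R, k • I = z := ⟨z.toSL2R, z.toSL2R_smul_I⟩
  rw [← mul_smul, h, h, cx_mul, mul_smul]

/-- The inclusion of the circle at infinity of the totally geodesic plane. -/
def BdH2.toC (x : BdH2) : BdH3 := mk ℂ (fun i => (x.rep i : ℂ)) fun h =>
  x.rep_nonzero (funext fun i => ofReal_eq_zero.mp (congrFun h i))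

lemma BdH2.toC_mk {v : Fin 2 → ℝ} (hv : v ≠ 0) (hv' : (fun i => (v i : ℂ)) ≠ 0) :
    toC (mk ℝ v hv) = mk ℂ (fun i => (v i : ℂ)) hv' := by
  obtain ⟨t, ht, e⟩ := exists_rep_mk v hv; rw [toC, mk_eq_iff]
  simp only [e, vdet, Pi.smul_apply, smul_eq_mul]; push_cast; ring

lemma BdH2.toC_smul (g : SL2R) (x : BdH2) : (g • x).toC = cx g • x.toC := by
  induction x using ind with | _ v hv =>
  have h0 : ∀ {u : Fin 2 → ℝ}, u ≠ 0 → (fun i => (u i : ℂ)) ≠ 0 := fun hu h =>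
    hu (funext fun i => ofReal_eq_zero.mp (congrFun h i))
  rw [Projectivization.smul_mk, toC_mk _ (h0 (sl_smul_ne_zero g hv)), toC_mk _ (h0 hv),
    Projectivization.smul_mk, mk_eq_iff]
  simp only [vdet, sl_smul_0, sl_smul_1, cx_apply]; push_cast; ring

lemma BdH2.toC_zero : zero.toC = BdH3.zero := by
  rw [zero, toC_mk _ (fun h => by simpa using congrFun h 1), BdH3.zero, mk_eq_iff]
  simp [vdet]

lemma BdH2.toC_infty : infty.toC = BdH3.infty := by
  rw [infty, toC_mk _ (fun h => by simpa using congrFun h 0), BdH3.infty, mk_eq_iff]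
  simp [vdet]

lemma mem_idealTriangle_mk {u v w : Fin 2 → ℂ} (hu : u ≠ 0) (hv : v ≠ 0) (hw : w ≠ 0) {X : H3} :
    X ∈ idealTriangle (mk ℂ u hu) (mk ℂ v hv)
      (mk ℂ w hw) ↔ ∃ r s t : ℝ, 0 ≤ r ∧ 0 ≤ s ∧ 0 ≤ t ∧ ∀ i j, X.1 i j =
        r * (u i * star (u j)) + s * (v i * star (v j)) + t * (w i * star (w j)) := by
  have key : ∀ {u : Fin 2 → ℂ} (hu : u ≠ 0), ∃ k : ℝ, 0 < k ∧ ∀ i j,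
      (mk ℂ u hu).rep i * star ((mk ℂ u hu).rep j) =
        k * (u i * star (u j)) := fun hu => by
    obtain ⟨t, ht, e⟩ := exists_rep_mk _ hu
    refine ⟨normSq t, Complex.normSq_pos.mpr ht, fun i j => ?_⟩
    rw [e, Pi.smul_apply, Pi.smul_apply, smul_eq_mul, smul_eq_mul, star_mul', star_def, ← mul_conj]
    ring
  obtain ⟨k, hk, e⟩ := key hu; obtain ⟨l, hl, f⟩ := key hv; obtain ⟨m, hm, o'⟩ := key hw; constructor
  · rintro ⟨r, s, t, hr, hs, ht, h⟩
    refine ⟨r * k, s * l, t * m, by positivity, by positivity, by positivity, fun i j => ?_⟩; rw [h]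
    simp only [Matrix.add_apply, Matrix.smul_apply, Matrix.vecMulVec_apply, Pi.star_apply,
      smul_eq_mul, e, f, o']
    push_cast; ring
  · rintro ⟨r, s, t, hr, hs, ht, h⟩
    refine ⟨r / k, s / l, t / m, by positivity, by positivity, by positivity, ?_⟩; ext i j
    have hk : (k : ℂ) ≠ 0 := by exact_mod_cast hk.ne'
    have hl : (l : ℂ) ≠ 0 := by exact_mod_cast hl.ne'
    have hm : (m : ℂ) ≠ 0 := by exact_mod_cast hm.ne'
    simp only [Matrix.add_apply, Matrix.smul_apply, Matrix.vecMulVec_apply, Pi.star_apply,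
      smul_eq_mul, e, f, o', h]
    push_cast; field_simp

lemma smul_mem_idealTriangle (σ : PSL2C) {p q r : BdH3} {X : H3} (h : X ∈ idealTriangle p q r) :
    σ • X ∈ idealTriangle (σ • p) (σ • q) (σ • r) := by
  induction p using ind with | _ u hu =>
  induction q using ind with | _ v hv =>
  induction r using ind with | _ w hw =>
  obtain ⟨r, s, t, hr, hs, ht, e⟩ := (mem_idealTriangle_mk hu hv hw).mp h
  have hh := fun {v : Fin 2 → ℂ} (hv : v ≠ 0) => sl_smul_ne_zero σ.lift hv
  rw [PSL2C.smul_mk σ hu (hh hu), PSL2C.smul_mk σ hv (hh hv), PSL2C.smul_mk σ hw (hh hw),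
    mem_idealTriangle_mk]
  refine ⟨r, s, t, hr, hs, ht, fun i j => ?_⟩
  conv_lhs => rw [← σ.mk_lift, H3.mk_smul, H3.smul_apply, e, e, e, e]
  have hi : ∀ (v : Fin 2 → ℂ) (i), (σ.lift • v) i = σ.lift i 0 * v 0 + σ.lift i 1 * v 1 := fun v =>
    Fin.forall_fin_two.mpr ⟨sl_smul_0 _ _, sl_smul_1 _ _⟩
  simp only [hi, star_add, star_mul']; ring

lemma PSL2C.mk_smul_mk_eq {A : SL(2, ℂ)} {v w : Fin 2 → ℂ} (hv : v ≠ 0) (hw : w ≠ 0) :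
    (QuotientGroup.mk A : PSL2C) • mk ℂ v hv = mk ℂ w hw ↔
      (A 0 0 * v 0 + A 0 1 * v 1) * w 1 = (A 1 0 * v 0 + A 1 1 * v 1) * w 0 := by
  rw [PSL2C.mk_smul, Projectivization.smul_mk, mk_eq_iff, vdet, sl_smul_0, sl_smul_1,
    sub_eq_zero]

/-- Three distinct points of `∂ℍ³` are the image of `0, ∞, 1`. -/
lemma exists_psl_frame {p q r : BdH3} (hpq : p ≠ q) (hqr : q ≠ r) (hrp : r ≠ p) : ∃ B : PSL2C,
    B • BdH3.zero = p ∧ B • BdH3.infty = q ∧ B • (ofReal 1).toC = r := by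
  induction p using ind with | _ u hu =>
  induction q using ind with | _ v hv =>
  induction r using ind with | _ w hw =>
  rw [Ne, mk_eq_iff] at hpq hqr hrp
  obtain ⟨k, hk⟩ := IsAlgClosed.exists_pow_nat_eq ((vdet v w * vdet w u * vdet v u)⁻¹) two_pos
  have hvu : vdet v u ≠ 0 := by rw [vdet_swap]; exact neg_ne_zero.mpr hpq
  have hk1 : k ^ 2 * (vdet w u * vdet v w) * vdet v u = 1 := by rw [hk]; field_simp
  let A : SL(2, ℂ) := ⟨!![k * vdet w u * v 0, k * vdet v w * u 0;
      k * vdet w u * v 1, k * vdet v w * u 1], by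
    rw [Matrix.det_fin_two_of]; simp only [vdet] at hk1 ⊢; linear_combination hk1⟩
  rw [ofReal, toC_mk _ (fun h => by simpa using congrFun h 1)]
  refine ⟨QuotientGroup.mk A, (mk_smul_mk_eq _ _).mpr ?_, (mk_smul_mk_eq _ _).mpr ?_,
    (mk_smul_mk_eq _ _).mpr ?_⟩ <;> simp [A, vdet] <;> ring

lemma exists_psl_frame_two {p q : BdH3} (hpq : p ≠ q) :
    ∃ B : PSL2C, B • BdH3.zero = p ∧ B • BdH3.infty = q := by
  induction p using ind with | _ u hu =>
  induction q using ind with | _ v hv =>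
  rw [ne_comm, Ne, mk_eq_iff] at hpq
  let A : SL(2, ℂ) := ⟨!![v 0 / vdet v u, u 0; v 1 / vdet v u, u 1], by
    rw [Matrix.det_fin_two_of, div_mul_eq_mul_div, mul_div, ← sub_div, mul_comm (u 0), ← vdet,
      div_self hpq]⟩
  refine ⟨QuotientGroup.mk A, (mk_smul_mk_eq _ _).mpr ?_, (mk_smul_mk_eq _ _).mpr ?_⟩ <;>
    simp [A] <;> ring

lemma mem_model : z ∈ closedTri zero infty (ofReal 1) ↔
    0 ≤ z.re ∧ z.re ≤ 1 ∧ z.re ≤ z.re ^ 2 + z.im ^ 2 := by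
  have hy := z.im_pos
  have key : ∀ {u v : Fin 2 → ℝ} (hu : u ≠ 0) (hv : v ≠ 0) {w} (hw : w ≠ 0),
      0 ≤ side z (mk ℝ u hu) (mk ℝ v hv)
        (mk ℝ w hw) ↔ 0 ≤ z.im * hform z u v * (vdet u w * vdet v w) := by
    intro u v hu hv w hw
    obtain ⟨t, ht, e⟩ := exists_rep_expr z hu hv (mk ℝ w hw).rep
    obtain ⟨s, hs, e'⟩ := exists_rep_mk w hw
    rw [side, e, e', vdet_smul_right, vdet_smul_right, mul_nonneg_iff_of_pos_left ht,
      show hform z u v * (s * vdet u w * (s * vdet v w)) =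
        s * s / z.im * (z.im * hform z u v * (vdet u w * vdet v w)) by field_simp,
      mul_nonneg_iff_of_pos_left (div_pos (mul_self_pos.mpr hs) hy)]
  rw [closedTri, Set.mem_ofPred_eq, zero, infty, ofReal, key, key, key]
  simp only [hform, mul_div_cancel₀ _ hy.ne', vdet]; simp
  constructor <;> rintro ⟨h1, h2, h3⟩ <;> exact ⟨by linarith, by linarith, by linarith⟩

lemma emb_bijOn_model : Set.BijOn emb (closedTri zero infty (ofReal 1))
    (idealTriangle BdH3.zero BdH3.infty (ofReal 1).toC) := by
  have hI : ∀ X : H3, X ∈ idealTriangle BdH3.zero BdH3.infty (ofReal 1).toC ↔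
      ∃ r s t : ℝ, 0 ≤ r ∧ 0 ≤ s ∧ 0 ≤ t ∧ X.1 0 0 = s + t ∧ X.1 0 1 = t ∧ X.1 1 0 = t ∧
        X.1 1 1 = r + t := fun X => by
    rw [BdH3.zero, BdH3.infty, ofReal, toC_mk _ (fun h => by simpa using congrFun h 1),
      mem_idealTriangle_mk]
    simp [Fin.forall_fin_two, and_assoc]
  refine ⟨fun z hz => (hI _).mpr ?_, fun z _ w _ h => ?_, fun X hX => ?_⟩
  · obtain ⟨h0, h1, h2⟩ := mem_model.mp hz
    have hy := z.im_pos
    obtain ⟨a, d, b, ha, hd, e1, e2, e3, e4, e5⟩ := (emb z).entries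
    rw [emb_one_one] at e2
    rw [emb_zero_one] at e3
    have hd' : d = 1 / z.im := by exact_mod_cast e2.symm
    have ha' : a = (z.re ^ 2 + z.im ^ 2) / z.im := by
      have h5 : ((a * d : ℝ) : ℂ) = ((1 + z.re / z.im * (z.re / z.im) : ℝ) : ℂ) := by
        push_cast; rw [e5, ← e3]; simp
      have h6 := Complex.ofReal_injective h5
      rw [hd'] at h6
      field_simp at h6 ⊢
      linarith only [h6]
    refine ⟨(1 - z.re) / z.im, (z.re ^ 2 + z.im ^ 2 - z.re) / z.im, z.re / z.im,
      div_nonneg (by linarith) hy.le, div_nonneg (by linarith) hy.le, by positivity, ?_, ?_, ?_, ?_⟩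
    · rw [e1, ha']; push_cast; ring
    · rw [emb_zero_one]; simp
    · rw [e4, ← e3]; simp
    · rw [emb_one_one]; push_cast; ring
  · have h1 := congrArg (·.1 1 1) h
    have h2 := congrArg (·.1 0 1) h
    simp only [emb_one_one, emb_zero_one] at h1 h2
    have h3 : z.im = w.im := by simpa using h1
    rw [h3, div_left_inj' (ofReal_ne_zero.mpr w.im_ne_zero)] at h2
    exact UpperHalfPlane.ext (Complex.ext (Complex.ofReal_injective h2) h3)
  · obtain ⟨r, s, t, hr, hs, ht, e1, e2, e3, e4⟩ := (hI X).mp hX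
    have hdet := X.2.2
    rw [Matrix.det_fin_two, e1, e2, e3, e4] at hdet
    have hd : (s + t) * (r + t) - t * t = 1 := by exact_mod_cast hdet
    have hp : 0 < r + t := by
      refine lt_of_le_of_ne (by positivity) fun h => ?_
      rw [← h] at hd; nlinarith only [hd, mul_self_nonneg t]
    refine ⟨⟨⟨t / (r + t), 1 / (r + t)⟩, by simpa using hp⟩, mem_model.mpr ?_, ?_⟩
    · change 0 ≤ t / (r + t) ∧ t / (r + t) ≤ 1 ∧ t / (r + t) ≤ (t / (r + t)) ^ 2 + (1 / (r + t)) ^ 2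
      refine ⟨by positivity, (div_le_one hp).mpr (by linarith), ?_⟩
      rw [div_pow, div_pow, ← add_div, div_le_div_iff₀ hp (by positivity)]
      rw [show t ^ 2 + 1 ^ 2 = (s + t) * (r + t) by linarith only [hd]]
      nlinarith only [mul_nonneg hs (sq_nonneg (r + t))]
    · apply ext_entries
      · rw [emb_one_one, e4]; change (1 : ℂ) / ((1 / (r + t) : ℝ) : ℂ) = _; push_cast; simp
      · rw [emb_zero_one, e2]
        change ((t / (r + t) : ℝ) : ℂ) / ((1 / (r + t) : ℝ) : ℂ) = _
        rw [← ofReal_div]; congr 1; field_simp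

/-! ### Adjusting maps of ideal triangles along the sides -/

/-- The ideal triangle with vertices `0, ∞, 1`. -/
def modelTri : Set ℍ := closedTri zero infty (ofReal 1)

/-- The factor of the shear of the model triangle: on the ray with slope `x / y` it interpolates,
by a Möbius transformation of the ray, between the multiplication by `r` on the imaginary axis and
the identity on the other two sides. -/
def shearFactor (r : ℝ) (z : ℍ) : ℝ := (r * (z.re ^ 2 + z.im ^ 2 - z.re) + z.re * (1 - z.re)) /
    ((z.re ^ 2 + z.im ^ 2) * (1 - z.re) + z.re * r * (z.re ^ 2 + z.im ^ 2 - z.re))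

/-- The homeomorphism `z ↦ shearFactor r z * z` of the model triangle. -/
def shear (r : ℝ) (z : ℍ) : ℍ := ofComplex ((shearFactor r z : ℂ) * z)

lemma shearFactor_pos {r : ℝ} (hr : 0 < r) (hz : z ∈ modelTri) :
    0 < r * (z.re ^ 2 + z.im ^ 2 - z.re) + z.re * (1 - z.re) ∧
    0 < (z.re ^ 2 + z.im ^ 2) * (1 - z.re) + z.re * r * (z.re ^ 2 + z.im ^ 2 - z.re) := by
  obtain ⟨h0, h1, h2⟩ := mem_model.mp hz; have hy := z.im_pos
  have p1 : 0 ≤ z.re * (1 - z.re) := mul_nonneg h0 (by linarith)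
  have p2 : 0 ≤ r * (z.re ^ 2 + z.im ^ 2 - z.re) := mul_nonneg hr.le (by linarith); constructor
  · rcases h2.eq_or_lt with h | h
    · nlinarith only [h, p2, sq_pos_of_pos hy]
    · nlinarith only [mul_pos hr (sub_pos.mpr h), p1]
  · rcases h1.eq_or_lt with h | h
    · rw [h]; nlinarith only [mul_pos hr (sq_pos_of_pos hy)]
    · have : 0 < (z.re ^ 2 + z.im ^ 2) * (1 - z.re) := mul_pos (by positivity) (by linarith)
      nlinarith only [this, mul_nonneg h0 p2]

lemma shear_re_im {r : ℝ} (hr : 0 < r) (hz : z ∈ modelTri) :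
    (shear r z).re = shearFactor r z * z.re ∧ (shear r z).im = shearFactor r z * z.im := by
  have hp : 0 < shearFactor r z := div_pos (shearFactor_pos hr hz).1 (shearFactor_pos hr hz).2
  have h : (shear r z : ℂ) = (shearFactor r z : ℂ) * z := by
    rw [shear, ofComplex_apply_of_im_pos]; rw [Complex.im_ofReal_mul]; exact mul_pos hp z.im_pos
  exact ⟨by simpa using congrArg Complex.re h, by simpa using congrArg Complex.im h⟩

lemma shear_mem {r : ℝ} (hr : 0 < r) (hz : z ∈ modelTri) :
    shear r z ∈ modelTri ∧ shear r⁻¹ (shear r z) = z := by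
  obtain ⟨hN, hD⟩ := shearFactor_pos hr hz
  obtain ⟨e1, e2⟩ := shear_re_im hr hz
  obtain ⟨h0, h1, h2⟩ := mem_model.mp hz
  have hy := z.im_pos
  obtain ⟨m, hm⟩ : ∃ m, m = shearFactor r z := ⟨_, rfl⟩
  obtain ⟨k, hk⟩ : ∃ k, k = z.im ^ 2 /
    ((z.re ^ 2 + z.im ^ 2) * (1 - z.re) + z.re * r * (z.re ^ 2 + z.im ^ 2 - z.re)) := ⟨_, rfl⟩
  have hm0 : 0 < m := hm ▸ div_pos hN hD
  have hk0 : 0 < k := hk ▸ div_pos (sq_pos_of_pos hy) hD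
  have hmD := div_mul_cancel₀ (r * (z.re ^ 2 + z.im ^ 2 - z.re) + z.re * (1 - z.re)) hD.ne'
  have hkD := div_mul_cancel₀ (z.im ^ 2) hD.ne'
  rw [← shearFactor, ← hm] at hmD
  rw [← hk] at hkD
  rw [← hm] at e1 e2
  have k1 : 1 - m * z.re = (1 - z.re) * k := by
    refine mul_right_cancel₀ hD.ne' ?_
    linear_combination (z.re - 1) * hkD - z.re * hmD
  have k2 : m * (z.re ^ 2 + z.im ^ 2) - z.re = r * (z.re ^ 2 + z.im ^ 2 - z.re) * k := by
    refine mul_right_cancel₀ hD.ne' ?_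
    linear_combination (z.re ^ 2 + z.im ^ 2) * hmD - r * (z.re ^ 2 + z.im ^ 2 - z.re) * hkD
  have p1 : 0 ≤ 1 - z.re := by linarith
  have p2 : 0 ≤ z.re ^ 2 + z.im ^ 2 - z.re := by linarith
  have hmem : shear r z ∈ modelTri := mem_model.mpr (by
    rw [e1, e2]
    refine ⟨by positivity, ?_, ?_⟩
    · nlinarith only [k1, mul_nonneg p1 hk0.le]
    · nlinarith only [congrArg (m * ·) k2, mul_nonneg hm0.le (mul_nonneg (mul_nonneg hr.le p2) hk0.le)])
  obtain ⟨f1, f2⟩ := shear_re_im (inv_pos.mpr hr) hmem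
  have hD' := (shearFactor_pos (inv_pos.mpr hr) hmem).2
  have hf : shearFactor r⁻¹ (shear r z) * m = 1 := by
    rw [shearFactor, div_mul_eq_mul_div, div_eq_one_iff_eq hD'.ne', e1, e2]
    have : r⁻¹ * r = 1 := inv_mul_cancel₀ hr.ne'
    linear_combination m ^ 2 * (1 - z.re) * r⁻¹ * k2 +
      m ^ 2 * (z.re - (z.re ^ 2 + z.im ^ 2)) * k1 +
      m ^ 2 * (1 - z.re) * (z.re ^ 2 + z.im ^ 2 - z.re) * k * this
  refine ⟨hmem, UpperHalfPlane.ext (Complex.ext ?_ ?_)⟩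
  · change (shear r⁻¹ (shear r z)).re = z.re
    rw [f1, e1, ← mul_assoc, hf, one_mul]
  · change (shear r⁻¹ (shear r z)).im = z.im
    rw [f2, e2, ← mul_assoc, hf, one_mul]

lemma continuousOn_shear {r : ℝ} (hr : 0 < r) : ContinuousOn (shear r) modelTri := by
  rw [isEmbedding_coe.continuousOn_iff]
  have hx := UpperHalfPlane.continuous_re.continuousOn (s := modelTri)
  have hy := UpperHalfPlane.continuous_im.continuousOn (s := modelTri)
  have hN := (hx.pow 2).add (hy.pow 2)
  have hf : ContinuousOn (shearFactor r) modelTri :=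
    ((continuousOn_const.mul (hN.sub hx)).add (hx.mul (continuousOn_const.sub hx))).div
      ((hN.mul (continuousOn_const.sub hx)).add ((hx.mul continuousOn_const).mul (hN.sub hx)))
      fun z hz => (shearFactor_pos hr hz).2.ne'
  refine ((continuous_ofReal.comp_continuousOn hf).mul
    continuous_coe.continuousOn).congr fun z hz => ?_
  have := shear_re_im hr hz
  refine Complex.ext ?_ ?_
  · change (shear r z).re = _
    simp [this.1]
  · change (shear r z).im = _
    simp [this.2]

lemma bijOn_shear {r : ℝ} (hr : 0 < r) : Set.BijOn (shear r) modelTri modelTri := by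
  refine ⟨fun z hz => (shear_mem hr hz).1, Set.LeftInvOn.injOn (f₁' := shear r⁻¹)
    fun z hz => (shear_mem hr hz).2, fun z hz => ?_⟩
  have h := shear_mem (inv_pos.mpr hr) hz; rw [inv_inv] at h; exact ⟨_, h.1, h.2⟩

lemma shear_axis (c s : ℝ) : shear (exp c) (H2.axis s) = H2.axis (s + c) := by
  have hm : H2.axis s ∈ modelTri := mem_model.mpr (by rw [H2.axis_re]; simp; positivity)
  obtain ⟨h1, h2⟩ := shear_re_im (exp_pos c) hm
  refine UpperHalfPlane.ext (Complex.ext (h1.trans ?_) (h2.trans ?_))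
  · rw [H2.axis_re, mul_zero]; exact (H2.axis_re _).symm
  · have : shearFactor (exp c) (H2.axis s) = exp c := by
      rw [shearFactor, H2.axis_re, H2.axis_im]; field_simp; ring
    rw [this, H2.axis_im, mul_comm, ← Real.exp_add]; exact (H2.axis_im _).symm

lemma shear_eq_self {r : ℝ} (hr : 0 < r)
    (h : z ∈ geod infty (ofReal 1) ∨ z ∈ geod (ofReal 1) zero) :
    shear r z = z := by
  have h' : z.re = 1 ∨ z.re ^ 2 + z.im ^ 2 = z.re := by
    have := z.im_pos; rw [infty, ofReal, zero, mem_geod_mk, mem_geod_mk] at h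
    simp [hform, this.ne'] at h; exact h.imp (by intro; linarith) (by intro; linarith)
  have hz : z ∈ modelTri := mem_model.mpr (by
    rcases h' with h | h
    · rw [h]; simp; positivity
    · exact ⟨h ▸ by positivity, by nlinarith only [h, sq_nonneg z.im, sq_nonneg (z.re - 1)], h.ge⟩)
  obtain ⟨e1, e2⟩ := shear_re_im hr hz
  have hm : shearFactor r z = 1 := by
    rw [shearFactor, div_eq_one_iff_eq (shearFactor_pos hr hz).2.ne']
    rcases h' with h' | h' <;> rw [h'] <;> ring
  rw [hm, one_mul] at e1 e2; exact UpperHalfPlane.ext (Complex.ext e1 e2)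

/-- An isometry of `ℍ³` that fixes `0` and `∞` translates the standard geodesic. -/
lemma exists_translation {σ : PSL2C} (h0 : σ • BdH3.zero = BdH3.zero)
    (h1 : σ • BdH3.infty = BdH3.infty) : ∃ c : ℝ, ∀ s, σ • H3.axis s = H3.axis (s + c) := by
  obtain ⟨A, rfl⟩ := σ.exists_lift; rw [BdH3.zero, mk_smul_mk_eq] at h0
  rw [BdH3.infty, mk_smul_mk_eq] at h1; have h01 : A 0 1 = 0 := by simpa using h0
  have h10 : A 1 0 = 0 := by simpa using h1.symm
  have hdet := sl_det A; rw [h01, h10, mul_zero, sub_zero] at hdet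
  have hn : ‖A 0 0‖ * ‖A 1 1‖ = 1 := by rw [← norm_mul, hdet, norm_one]
  have h11 : 0 < ‖A 1 1‖ := norm_pos_iff.mpr (right_ne_zero_of_mul_eq_one hdet)
  refine ⟨-2 * log ‖A 1 1‖, fun s => ?_⟩; rw [H3.mk_smul]
  apply ext_entries <;> rw [smul_axis_apply]
  · have : exp (-(s + -2 * log ‖A 1 1‖)) = ‖A 1 1‖ ^ 2 * exp (-s) := by
      rw [show -(s + -2 * log ‖A 1 1‖) = log ‖A 1 1‖ + log ‖A 1 1‖ + -s by ring,
        Real.exp_add, Real.exp_add, Real.exp_log h11, sq]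
    have e : ∀ t, (H3.axis t).1 1 1 = (exp (-t) : ℂ) := fun t => by simp [H3.axis]
    rw [e, this, h10]; simp [mul_conj, normSq_eq_norm_sq, -ofReal_exp]
  · simp [h01, h10, H3.axis]

lemma smul_axis_mem (A : SL2R) (s : ℝ) : A • H2.axis s ∈ geod (A • zero) (A • infty) := by
  rw [← range_smul_axis]; exact ⟨s, rfl⟩

/-- `f` maps the geodesic `A • H2.axis` by arc length onto the geodesic with the ends prescribed
by `ξ`. -/
def IsGeodParam (ξ : BdH2 → BdH3) (f : ℍ → H3) (A : SL2R) : Prop :=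
  ∃ B : PSL2C, (∀ s, f (A • H2.axis s) = B • H3.axis s) ∧ B • BdH3.zero = ξ (A • zero) ∧
    B • BdH3.infty = ξ (A • infty)

lemma IsGeodParam.congr {ξ : BdH2 → BdH3} {f f' : ℍ → H3} {A : SL2R} (h : IsGeodParam ξ f A)
    (e : ∀ z ∈ geod (A • zero) (A • infty), f' z = f z) : IsGeodParam ξ f' A :=
  h.imp fun _ hB => ⟨fun s => (e _ (smul_axis_mem A s)).trans (hB.1 s), hB.2⟩

lemma isGeodParam_emb {ξ : BdH2 → BdH3} {M A : SL2R} {B : PSL2C}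
    (h0 : B • (A • zero).toC = ξ (M • A • zero))
    (h1 : B • (A • infty).toC = ξ (M • A • infty)) :
    IsGeodParam ξ (fun z => B • emb (M⁻¹ • z)) (M * A) := by
  refine ⟨B * QuotientGroup.mk (cx A), fun s => ?_, ?_, ?_⟩
  · change B • emb (M⁻¹ • (M * A) • _) = _
    rw [mul_smul M, inv_smul_smul, emb_smul, emb_axis, mul_smul, H3.mk_smul]
  · rw [mul_smul M, ← h0, mul_smul, PSL2C.mk_smul, toC_smul, toC_zero]
  · rw [mul_smul M, ← h1, mul_smul, PSL2C.mk_smul, toC_smul, toC_infty]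

lemma bijOn_smul {G α : Type*} [Group G] [MulAction G α] (g : G) {S T : Set α}
    (h : ∀ x, g • x ∈ T ↔ x ∈ S) : Set.BijOn (g • ·) S T :=
  ⟨fun x => (h x).mpr, (MulAction.injective g).injOn,
    fun y hy => ⟨g⁻¹ • y, (h _).mp (by rwa [smul_inv_smul]), smul_inv_smul g y⟩⟩

lemma bijOn_smul_idealTriangle (σ : PSL2C) (p q r : BdH3) :
    Set.BijOn (σ • ·) (idealTriangle p q r) (idealTriangle (σ • p) (σ • q) (σ • r)) :=
  bijOn_smul σ fun _ =>
    ⟨fun h => by simpa using smul_mem_idealTriangle σ⁻¹ h, smul_mem_idealTriangle σ⟩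

lemma closedTri_smul_eq (M : SL2R) :
    closedTri (M • zero) (M • infty) (M • ofReal 1) = {z | M⁻¹ • z ∈ modelTri} := by
  ext z
  conv_lhs => rw [← smul_inv_smul M z, smul_mem_closedTri]
  rfl

/-- A map of an ideal triangle can be reparametrized along one side, without changing it on the
other two sides. -/
lemma adjust_side {M : SL2R} (ha : M • zero = a) (hb : M • infty = b)
    (hc : M • ofReal 1 = c) {fL f : ℍ → H3} {I : Set H3} {ξ : BdH2 → BdH3}
    (hf : ContinuousOn f (closedTri a b c)) (hf' : Set.BijOn f (closedTri a b c) I)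
    (h : IsGeodParam ξ f M) (h' : IsGeodParam ξ fL M) : ∃ f' : ℍ → H3,
      ContinuousOn f' (closedTri a b c) ∧ Set.BijOn f' (closedTri a b c) I ∧
      (∀ z ∈ geod a b, f' z = fL z) ∧ ∀ z, z ∈ geod b c ∨ z ∈ geod c a → f' z = f z := by
  subst ha hb hc
  rw [closedTri_smul_eq] at hf hf' ⊢
  obtain ⟨B, b1, b2, b3⟩ := h
  obtain ⟨B', b1', b2', b3'⟩ := h'
  obtain ⟨c, hc⟩ := exists_translation (σ := B⁻¹ * B')
    (by rw [mul_smul, b2', ← b2, inv_smul_smul]) (by rw [mul_smul, b3', ← b3, inv_smul_smul])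
  have hr := exp_pos c
  have hM : Set.BijOn (fun z => M • shear (exp c) (M⁻¹ • z)) {z | M⁻¹ • z ∈ modelTri}
      {z | M⁻¹ • z ∈ modelTri} :=
    (bijOn_smul M fun z => by simp).comp
      ((bijOn_shear hr).comp (bijOn_smul M⁻¹ fun _ => Iff.rfl))
  refine ⟨fun z => f (M • shear (exp c) (M⁻¹ • z)), ?_, hf'.comp hM, fun z hz => ?_,
    fun z hz => ?_⟩
  · exact hf.comp ((continuous_const_smul M).comp_continuousOn ((continuousOn_shear hr).comp
      (continuous_const_smul M⁻¹).continuousOn fun z hz => hz)) hM.mapsTo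
  · rw [← range_smul_axis] at hz
    obtain ⟨s, rfl⟩ := hz
    change f (M • shear _ (M⁻¹ • M • H2.axis s)) = _
    rw [inv_smul_smul, shear_axis, b1, ← hc, mul_smul, smul_inv_smul]
    exact (b1' s).symm
  · have e : ∀ a b, z ∈ geod (M • a) (M • b) ↔ M⁻¹ • z ∈ geod a b := fun a b => by
      conv_lhs => rw [← smul_inv_smul M z, smul_mem_geod]
    rw [e, e] at hz
    change f (M • _) = _
    rw [shear_eq_self hr hz, smul_inv_smul]

lemma H3.idealTriangle_swap (p q r : BdH3) : idealTriangle p q r = idealTriangle q p r := by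
  ext X
  constructor <;> rintro ⟨s, t, u, hs, ht, hu, h⟩ <;>
    exact ⟨t, s, u, ht, hs, hu, by rw [h, add_comm (((s : ℝ) : ℂ) • _)]⟩

lemma H3.idealTriangle_rotate (p q r : BdH3) :
    idealTriangle p q r = idealTriangle q r p := by
  ext X
  constructor
  · rintro ⟨s, t, u, hs, ht, hu, h⟩
    exact ⟨t, u, s, ht, hu, hs, by rw [h]; abel⟩
  · rintro ⟨s, t, u, hs, ht, hu, h⟩
    exact ⟨u, s, t, hu, hs, ht, by rw [h]; abel⟩

/-- An ideal triangle of `ℍ` can be mapped onto an ideal triangle of `ℍ³` with prescribed geodesic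
parametrizations on its sides. -/
lemma exists_triangle_map (hab : a ≠ b) (hbc : b ≠ c) (hca : c ≠ a)
    {ξ : BdH2 → BdH3} (h1 : ξ a ≠ ξ b) (h2 : ξ b ≠ ξ c) (h3 : ξ c ≠ ξ a) {fL : ℍ → H3}
    (hL : ∀ A : SL2R, A • zero ∈ ({a, b, c} : Set BdH2) →
      A • infty ∈ ({a, b, c} : Set BdH2) → IsGeodParam ξ fL A) :
    ∃ f : ℍ → H3, ContinuousOn f (closedTri a b c) ∧
      Set.BijOn f (closedTri a b c) (idealTriangle (ξ a) (ξ b) (ξ c)) ∧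
      ∀ z, z ∈ geod a b ∨ z ∈ geod b c ∨ z ∈ geod c a → f z = fL z := by
  wlog hM : ∃ M : SL2R, M • zero = a ∧ M • infty = b ∧ M • ofReal 1 = c
    generalizing a b c
  · obtain ⟨M, σ, rfl | rfl, ha, hb, hc⟩ := exists_sl_frame_three hab hbc hca
    · exact absurd ⟨M, ha, hb, hc⟩ hM
    · let w : SL2R := slMk 0 (-1) 1 0 (by norm_num)
      have w0 : w • zero = infty := sl_smul_ofReal_eq_infty (by simp [w, slMk])
      have w1 : w • infty = zero := by
        rw [sl_smul_infty (by simp [w, slMk]), zero_eq]; simp [w, slMk]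
      have w2 : w • ofReal 1 = ofReal (-1) := by
        rw [sl_smul_ofReal (by simp [w, slMk])]; simp [w, slMk]
      have hs : ({b, a, c} : Set BdH2) = {a, b, c} := Set.insert_comm b a _
      obtain ⟨f, f1, f2, f3⟩ := this hab.symm hca.symm hbc.symm h1.symm h3.symm h2.symm
        (by rwa [hs]) ⟨M * w, by rw [mul_smul, w0, hb], by rw [mul_smul, w1, ha],
          by rw [mul_smul, w2, hc]⟩
      rw [closedTri_swap] at f1 f2; rw [idealTriangle_swap] at f2
      refine ⟨f, f1, f2, fun z hz => f3 z ?_⟩; rw [geod_comm b a, geod_comm a c, geod_comm c b]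
      tauto
  obtain ⟨M, ha, hb, hc⟩ := hM; let ω : SL2R := slMk 1 (-1) 1 0 (by norm_num)
  have w0 : ω • zero = infty := sl_smul_ofReal_eq_infty (by simp [ω, slMk])
  have w1 : ω • infty = ofReal 1 := by rw [sl_smul_infty (by simp [ω, slMk])]; simp [ω, slMk]
  have w2 : ω • ofReal 1 = zero := by
    rw [sl_smul_ofReal (by simp [ω, slMk]), zero_eq]; simp [ω, slMk]
  have hb' : (M * ω) • zero = b := by rw [mul_smul, w0, hb]
  have hc' : (M * ω) • infty = c := by rw [mul_smul, w1, hc]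
  have ha' : (M * ω) • ofReal 1 = a := by rw [mul_smul, w2, ha]
  have hc'' : (M * ω * ω) • zero = c := by rw [mul_smul, w0, hc']
  have ha'' : (M * ω * ω) • infty = a := by rw [mul_smul, w1, ha']
  have hb'' : (M * ω * ω) • ofReal 1 = b := by rw [mul_smul, w2, hb']
  obtain ⟨B, Ba, Bb, Bc⟩ := exists_psl_frame h1 h2 h3
  have hB0 : ContinuousOn (fun z => B • emb (M⁻¹ • z)) (closedTri a b c) :=
    ((continuous_smul B).comp (continuous_emb.comp (continuous_const_smul M⁻¹))).continuousOn
  have hB1 : Set.BijOn (fun z => B • emb (M⁻¹ • z)) (closedTri a b c)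
      (idealTriangle (ξ a) (ξ b) (ξ c)) := by
    have k := bijOn_smul_idealTriangle B BdH3.zero BdH3.infty (ofReal 1).toC
    rw [Ba, Bb, Bc] at k; rw [← ha, ← hb, ← hc, closedTri_smul_eq, ha, hb, hc]
    exact k.comp (emb_bijOn_model.comp (bijOn_smul M⁻¹ fun _ => Iff.rfl))
  have p0 : IsGeodParam ξ (fun z => B • emb (M⁻¹ • z)) (M * 1) := isGeodParam_emb
    (by rw [one_smul, toC_zero, Ba, ha]) (by rw [one_smul, toC_infty, Bb, hb])
  have p1 : IsGeodParam ξ (fun z => B • emb (M⁻¹ • z)) (M * ω) := isGeodParam_emb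
    (by rw [w0, toC_infty, Bb, hb]) (by rw [w1, Bc, hc])
  have p2 : IsGeodParam ξ (fun z => B • emb (M⁻¹ • z)) (M * (ω * ω)) := isGeodParam_emb
    (by rw [mul_smul, w0, w1, Bc, hc]) (by rw [mul_smul, w1, w2, toC_zero, Ba, ha])
  rw [mul_one] at p0; rw [← mul_assoc] at p2
  obtain ⟨f₁, c1, i1, e1, o1⟩ := adjust_side ha hb hc hB0 hB1 p0
    (hL M (by simp [ha]) (by simp [hb]))
  rw [closedTri_rotate] at c1 i1
  obtain ⟨f₂, c2, i2, e2, o2⟩ := adjust_side hb' hc' ha' c1 i1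
    (p1.congr fun z hz => o1 z (Or.inl (by rwa [hb', hc'] at hz)))
    (hL (M * ω) (by simp [hb']) (by simp [hc']))
  rw [closedTri_rotate] at c2 i2
  obtain ⟨f₃, c3, i3, e3, o3⟩ := adjust_side hc'' ha'' hb'' c2 i2 (p2.congr fun z hz => by
      rw [hc'', ha''] at hz
      rw [o2 z (Or.inl hz), o1 z (Or.inr hz)]) (hL (M * ω * ω) (by simp [hc'']) (by simp [ha'']))
  rw [closedTri_rotate] at c3 i3; refine ⟨f₃, c3, i3, fun z hz => ?_⟩; rcases hz with hz | hz | hz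
  · rw [o3 z (Or.inl hz), o2 z (Or.inr hz), e1 z hz]
  · rw [o3 z (Or.inr hz), e2 z hz]
  · exact e3 z hz

section Glue

open scoped Pointwise

/-- Maps of the pieces of an invariant family of subsets of the half plane, which agree where the
pieces meet, can be chosen equivariantly, and glued. -/
lemma exists_equivariant_glue (τ : Δ →* PSL2C) {S : Set (Set ℍ)}
    {R : Set ℍ → (ℍ → H3) → Prop} (hcongr : ∀ D f f', Set.EqOn f f' D → R D f → R D f')
    (hR : ∀ D ∈ S, ∀ (g : Δ) f, R D f → R (g • D) fun z => τ g • f (g⁻¹ • z))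
    (hS : ∀ D ∈ S, ∀ g : Δ, g • D ∈ S) (hex : ∀ D ∈ S, ∃ f, R D f)
    (hstab : ∀ D ∈ S, ∀ g : Δ, g • D = D → g.1 = 1 ∨ g.1 = -1)
    (hτ : ∀ g : Δ, g.1 = 1 ∨ g.1 = -1 → τ g = 1)
    (hglue : ∀ D ∈ S, ∀ D' ∈ S, ∀ f f' z, R D f → R D' f' → z ∈ D → z ∈ D' → D ≠ D' → f z = f' z) :
    ∃ f : ℍ → H3, (∀ D ∈ S, R D f) ∧ ∀ D ∈ S, ∀ z ∈ D, ∀ g : Δ, f (g • z) = τ g • f z := by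
  classical
  let r : Set ℍ → Set ℍ := fun D => (Quotient.mk (MulAction.orbitRel Δ (Set ℍ)) D).out
  have hr : ∀ D, ∃ g : Δ, g • r D = D := fun D => by
    have : r D ∈ MulAction.orbit Δ D := Quotient.mk_out (s := MulAction.orbitRel Δ (Set ℍ)) D
    obtain ⟨g, hg⟩ := this; exact ⟨g⁻¹, by rw [← hg, inv_smul_smul]⟩
  have hrg : ∀ D (g : Δ), r (g • D) = r D := fun D g =>
    congrArg Quotient.out (Quotient.sound (s := MulAction.orbitRel Δ (Set ℍ)) ⟨g, rfl⟩)
  choose k hk using hr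
  have hrS : ∀ D ∈ S, r D ∈ S := fun D hD => by
    rw [← inv_smul_eq_iff.mpr (hk D).symm]; exact hS D hD _
  have : Nonempty (ℍ → H3) := ⟨fun _ => H3.axis 0⟩; choose! f0 hf0 using hex
  let F : Set ℍ → ℍ → H3 := fun D z => τ (k D) • f0 (r D) ((k D)⁻¹ • z)
  have hF : ∀ D ∈ S, R D (F D) := fun D hD => by
    have := hR _ (hrS D hD) (k D) _ (hf0 _ (hrS D hD)); rwa [hk] at this
  have hFg : ∀ D ∈ S, ∀ (g : Δ) z, F (g • D) (g • z) = τ g • F D z := fun D hD g z => by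
    have hu : ((k (g • D))⁻¹ * g * k D) • r D = r D := by
      rw [mul_smul, hk, mul_smul, inv_smul_eq_iff, ← hrg D g, hk]
    obtain ⟨u, hu'⟩ : ∃ u, u = (k (g • D))⁻¹ * g * k D := ⟨_, rfl⟩; rw [← hu'] at hu
    have h1 := hstab _ (hrS D hD) u hu
    have h2 : ∀ w : ℍ, u • w = w := fun w => by
      rw [Subgroup.smul_def]; rcases h1 with h | h <;> simp [h, neg_sl_smul_uhp]
    have e1 : g * k D = k (g • D) * u := by rw [hu']; group
    change τ (k (g • D)) • f0 (r (g • D)) ((k (g • D))⁻¹ • g • z) = τ g • τ (k D) • _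
    rw [hrg, ← mul_smul (τ g), ← map_mul, e1, map_mul, hτ u h1, mul_one]; congr 2
    rw [inv_smul_eq_iff, ← h2 ((k D)⁻¹ • z), ← mul_smul, ← e1, mul_smul, smul_inv_smul]
  let f : ℍ → H3 := fun z => if h : ∃ D ∈ S, z ∈ D then F h.choose z else H3.axis 0
  have hf : ∀ D ∈ S, ∀ z ∈ D, f z = F D z := fun D hD z hz => by
    have h : ∃ D ∈ S, z ∈ D := ⟨D, hD, hz⟩; have e : f z = F h.choose z := dif_pos h; rw [e]
    by_cases he : h.choose = D
    · rw [he]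
    · exact hglue _ h.choose_spec.1 _ hD _ _ z (hF _ h.choose_spec.1) (hF _ hD) h.choose_spec.2 hz he
  refine ⟨f, fun D hD => hcongr D _ _ (fun z hz => (hf D hD z hz).symm) (hF D hD),
    fun D hD z hz g => ?_⟩
  rw [hf _ (hS D hD g) _ (Set.smul_mem_smul_set hz), hf D hD z hz, hFg D hD]

end Glue

lemma smul_zero_ne_infty (A : SL2R) : A • zero ≠ A • infty := fun h =>
  zero_ne_infty (MulAction.injective A h)

lemma fix_or_swap (hab : a ≠ b) (h : translateSet g (geod a b) = geod a b) :
    (g • a = a ∧ g • b = b) ∨ (g • a = b ∧ g • b = a) :=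
  geod_inj ((MulAction.injective g).ne hab) hab (translateSet_geod g a b ▸ h)

lemma IsSurfaceGroup.fix_of_translateSet (hΓ : IsSurfaceGroup Γ) (hg : g ∈ Γ) (hab : a ≠ b)
    (h : translateSet g (geod a b) = geod a b) : g • a = a ∧ g • b = b :=
  (fix_or_swap hab h).resolve_right fun h' => hΓ.not_swap hg hab h'.1 h'.2

lemma closedTri_congr {a' b' c' : BdH2} (h : ({a, b, c} : Set BdH2) = {a', b', c'}) :
    closedTri a b c = closedTri a' b' c' := by
  ext z; rw [mem_closedTri_iff, mem_closedTri_iff, h]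

lemma H3.idealTriangle_congr {p q r p' q' r' : BdH3} (hpq : p ≠ q) (hqr : q ≠ r) (hrp : r ≠ p)
    (hp : p ∈ ({p', q', r'} : Set BdH3)) (hq : q ∈ ({p', q', r'} : Set BdH3))
    (hr : r ∈ ({p', q', r'} : Set BdH3)) : idealTriangle p q r = idealTriangle p' q' r' := by
  rcases hp with rfl | rfl | rfl <;> rcases hq with rfl | rfl | rfl <;>
    rcases hr with rfl | rfl | rfl <;> first
      | contradiction
      | rfl
      | exact idealTriangle_swap _ _ _
      | exact idealTriangle_rotate _ _ _
      | exact (idealTriangle_rotate _ _ _).symm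
      | exact (idealTriangle_rotate _ _ _).trans (idealTriangle_swap _ _ _)
      | exact (idealTriangle_swap _ _ _).trans (idealTriangle_rotate _ _ _)

namespace PantsLam

open scoped Pointwise

variable {Γ : Subgroup SL2R} {F P : Rel} (h : PantsLam Γ F P)

include h

/-- A lift of a leaf that is not closed has a trivial stabilizer. -/
lemma eq_one_or_of_smul_leaf (hab : F a b) (hP : ¬P a b) (hg : g ∈ Γ)
    (hgL : translateSet g (geod a b) = geod a b) : g = 1 ∨ g = -1 := by
  have hne := h.ne hab; obtain ⟨z, hz⟩ := geod_nonempty hne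
  obtain ⟨x, y, w, t, hzt⟩ := h.exists_tri_mem (h.notMem_P_of_leaf hab hP hz)
  obtain ⟨ha, hb⟩ := h.mem_tri_of_leaf t hzt hab hz; obtain ⟨-, -, -, o, h0, hE⟩ := t
  rw [← hE] at ha hb; obtain ⟨h1, h2⟩ := h.surf.fix_of_translateSet hg hne hgL
  exact h.eq_one_or_of_mem_stab h0 hg
    (mem_stab_of_fix h.toIsGeodFamily h.smul h0 hab ha hb hg h1 h2).2

/-- A complementary triangle has a trivial stabilizer. -/
lemma eq_one_or_of_smul_tri (t : IsTri F a b c) (hg : g ∈ Γ)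
    (hgT : translateSet g (closedTri a b c) = closedTri a b c) : g = 1 ∨ g = -1 := by
  obtain ⟨hab, hbc, hca, o, h0, hE⟩ := t
  have hz := openTri_subset _ _ _ (h.mem_openTri h0 hab hbc hca hE)
  have hgz : g • o ∈ closedTri a b c := hgT ▸ ⟨o, hz, rfl⟩
  have hgF : g • o ∉ leaves F := fun h' => h0 (by
    simpa using smul_mem_leaves h.smul (inv_mem hg) h')
  have hgE := h.pEnds_of_mem_tri ⟨hab, hbc, hca, o, h0, hE⟩ hgz hgF
  refine h.eq_one_or_of_mem_stab h0 hg ?_; rw [h.plaque_eq_openTri h0 hab hbc hca hE]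
  exact h.mem_openTri hgF hab hbc hca hgE

/-- The leaves that are not closed can be mapped equivariantly to the geodesics prescribed by a map
of their ends. -/
lemma exists_leaf_map (hΔ : Δ ≤ Γ) (τ : Δ →* PSL2C)
    (hτ : ∀ g : Δ, g.1 = 1 ∨ g.1 = -1 → τ g = 1) {ξ : BdH2 → BdH3}
    (hξ : ∀ a b, F a b → ∀ g : Δ, ξ (g.1 • a) = τ g • ξ a)
    (hne : ∀ a b, F a b → ¬P a b → ξ a ≠ ξ b) : ∃ f : ℍ → H3,
      (∀ A : SL2R, F (A • zero) (A • infty) →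
        ¬P (A • zero) (A • infty) → IsGeodParam ξ f A) ∧
      ∀ a b, F a b → ¬P a b → ∀ z ∈ geod a b, ∀ g : Δ, f (g • z) = τ g • f z := by
  refine (exists_equivariant_glue τ
    (S := {L | ∃ a b, F a b ∧ ¬P a b ∧ L = geod a b})
    (R := fun L f => ∀ A : SL2R, geod (A • zero) (A • infty) = L →
      IsGeodParam ξ f A) ?_ ?_ ?_ ?_ ?_ hτ ?_).elim fun f ⟨f1, f2⟩ => ?_
  rotate_right
  · exact ⟨f, fun A hA hA' => f1 _ ⟨_, _, hA, hA', rfl⟩ A rfl,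
      fun a b hab hP z hz g => f2 _ ⟨a, b, hab, hP, rfl⟩ z hz g⟩
  · intro L f f' hff hf A hA
    exact (hf A hA).congr fun z hz => (hff (hA ▸ hz)).symm
  · rintro _ ⟨a, b, hab, hP, rfl⟩ g f hf A hA
    have hA' : geod ((g⁻¹.1 * A) • zero) ((g⁻¹.1 * A) • infty) = geod a b := by
      rw [mul_smul, mul_smul, ← translateSet_geod, hA]
      exact inv_smul_smul g (geod a b)
    have hF : F ((g⁻¹.1 * A) • zero) ((g⁻¹.1 * A) • infty) := by
      rcases geod_inj (smul_zero_ne_infty _) (h.ne hab) hA' with ⟨e1, e2⟩ | ⟨e1, e2⟩ <;>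
        rw [e1, e2]
      exacts [hab, h.symm hab]
    obtain ⟨B, b1, b2, b3⟩ := hf _ hA'
    refine ⟨τ g * B, fun s => ?_, ?_, ?_⟩
    · rw [mul_smul, ← b1, mul_smul]; rfl
    · rw [mul_smul, b2, ← hξ _ _ hF, mul_smul, ← mul_smul g.1, ← Subgroup.coe_mul]; simp
    · rw [mul_smul, b3, ← hξ _ _ (h.symm hF), mul_smul, ← mul_smul g.1, ← Subgroup.coe_mul]; simp
  · rintro _ ⟨a, b, hab, hP, rfl⟩ g
    refine ⟨g.1 • a, g.1 • b, h.smul _ (hΔ g.2) _ _ hab, fun h' => hP ?_,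
      translateSet_geod _ _ _⟩
    simpa using h.P_smul _ (inv_mem (hΔ g.2)) _ _ h'
  · rintro _ ⟨a, b, hab, hP, rfl⟩
    obtain ⟨A0, rfl, rfl⟩ := exists_sl_frame (h.ne hab)
    obtain ⟨B0, b1, b2⟩ := exists_psl_frame_two (hne _ _ hab hP)
    refine ⟨fun z => B0 • emb (A0⁻¹ • z), fun A hA => ?_⟩
    rw [← mul_inv_cancel_left A0 A]
    rcases geod_inj (smul_zero_ne_infty _) (h.ne hab) hA with ⟨e1, e2⟩ | ⟨e1, e2⟩ <;>
      apply isGeodParam_emb <;>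
      simp only [mul_smul, e1, e2, inv_smul_smul, toC_zero, toC_infty, b1,
        b2]
  · rintro _ ⟨a, b, hab, hP, rfl⟩ g hg
    exact h.eq_one_or_of_smul_leaf hab hP (hΔ g.2) hg
  · rintro _ ⟨a, b, hab, hP, rfl⟩ _ ⟨a', b', hab', hP', rfl⟩ f f' z - - hz hz' hD
    rcases link_or_eq_of_mem_geod (h.ne hab') hz hz' with h' | ⟨rfl, rfl⟩ | ⟨rfl, rfl⟩
    · exact (h.unlinked hab hab' h').elim
    · exact absurd rfl hD
    · exact absurd (geod_comm _ _) hD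

/-- A map of the ends of the leaves, equivariant with respect to a homomorphism to `PSL₂(ℂ)`,
extends to a pleated surface. -/
lemma exists_pleat_map (hΔ : Δ ≤ Γ) (τ : Δ →* PSL2C)
    (hτ : ∀ g : Δ, g.1 = 1 ∨ g.1 = -1 → τ g = 1) {ξ : BdH2 → BdH3}
    (hξ : ∀ a b, F a b → ∀ g : Δ, ξ (g.1 • a) = τ g • ξ a)
    (hne : ∀ a b, F a b → ¬P a b → ξ a ≠ ξ b) : ∃ f : ℍ → H3,
      (∀ z ∉ leaves P, ∀ g : Δ, f (g.1 • z) = τ g • f z) ∧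
      ContinuousOn f (leaves P)ᶜ ∧
      (∀ A : SL2R, F (A • zero) (A • infty) →
        ¬P (A • zero) (A • infty) → IsGeodParam ξ f A) ∧
      ∀ a b c, IsTri F a b c →
        Set.BijOn f (closedTri a b c) (idealTriangle (ξ a) (ξ b) (ξ c)) := by
  obtain ⟨fL, l1, l2⟩ := h.exists_leaf_map hΔ τ hτ hξ hne
  have hvert : ∀ {a b c}, IsTri F a b c → ∀ x ∈ ({a, b, c} : Set BdH2), ∀ y ∈ ({a, b, c} : Set BdH2),
      x ≠ y → ξ x ≠ ξ y := fun t x hx y hy hxy => hne _ _ (h.tri_leaf t hx hy hxy)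
        (h.tri_not_P t hx hy)
  refine (exists_equivariant_glue τ
    (S := {T | ∃ a b c, IsTri F a b c ∧ T = closedTri a b c})
    (R := fun T f => ContinuousOn f T ∧ (∀ z ∈ T, z ∈ leaves F → f z = fL z) ∧
      ∀ a b c, IsTri F a b c → T = closedTri a b c →
        Set.BijOn f T (idealTriangle (ξ a) (ξ b) (ξ c))) ?_ ?_ ?_ ?_ ?_ hτ ?_).elim fun f ⟨f1, f2⟩ => ?_
  rotate_right
  · have hcov : ∀ z ∉ leaves P, ∃ a b c, IsTri F a b c ∧ z ∈ closedTri a b c :=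
      fun z hz => h.exists_tri_mem hz
    refine ⟨f, fun z hz g => ?_, fun z hz => ?_, fun A hA hA' => ?_,
      fun a b c t => (f1 _ ⟨a, b, c, t, rfl⟩).2.2 a b c t rfl⟩
    · obtain ⟨a, b, c, t, ht⟩ := hcov z hz
      exact f2 _ ⟨a, b, c, t, rfl⟩ z ht g
    · obtain ⟨K, hK, hKP, hKc⟩ := local_compact_nhds (h.isClosed_leaves_P.isOpen_compl.mem_nhds hz)
      have hfin := h.finite_tri hKc (Set.disjoint_left.mpr fun w hw => hKP hw)
      have := hfin.to_subtype
      have hc : ContinuousOn f (⋃ t : {t : BdH2 × BdH2 × BdH2 | IsTri F t.1 t.2.1 t.2.2 ∧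
          ∃ z ∈ K, z ∈ closedTri t.1 t.2.1 t.2.2}, closedTri t.1.1 t.1.2.1 t.1.2.2) :=
        (locallyFinite_of_finite _).continuousOn_iUnion (fun t => isClosed_closedTri _ _ _)
          fun t => (f1 _ ⟨_, _, _, t.2.1, rfl⟩).1
      refine (hc.mono fun w hw => ?_).continuousAt hK |>.continuousWithinAt
      obtain ⟨a, b, c, t, ht⟩ := hcov w (hKP hw)
      exact Set.mem_iUnion.mpr ⟨⟨(a, b, c), t, w, hw, ht⟩, ht⟩
    · refine (l1 A hA hA').congr fun z hs => ?_
      obtain ⟨a, b, c, t, ht⟩ := hcov _ (h.notMem_P_of_leaf hA hA' hs)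
      rw [(f1 _ ⟨a, b, c, t, rfl⟩).2.1 _ ht ⟨_, _, hA, hs⟩]
  · rintro T f f' hff ⟨k1, k2, k3⟩
    exact ⟨k1.congr hff.symm, fun z hz hz' => (hff hz).symm.trans (k2 z hz hz'),
      fun a b c t hT => (k3 a b c t hT).congr hff⟩
  · rintro _ ⟨a, b, c, t, rfl⟩ g f ⟨k1, k2, k3⟩
    have hmaps : Set.BijOn (fun z : ℍ => g⁻¹ • z) (g • closedTri a b c) (closedTri a b c) :=
      bijOn_smul g⁻¹ fun _ => Set.mem_smul_set_iff_inv_smul_mem.symm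
    refine ⟨?_, fun z hz hz' => ?_, fun a' b' c' t' hT => ?_⟩
    · refine (continuous_smul (τ g)).comp_continuousOn (k1.comp ?_ hmaps.mapsTo)
      exact (continuous_const_smul (g⁻¹ : Δ).1).continuousOn
    · have hw := hmaps.mapsTo hz
      have hwF : (g⁻¹ : Δ).1 • z ∈ leaves F := smul_mem_leaves h.smul (hΔ (g⁻¹ : Δ).2) hz'
      beta_reduce at hw ⊢
      rw [k2 _ hw hwF]
      obtain ⟨p, q, hpq, hwpq⟩ := hwF
      obtain ⟨hp, hq⟩ := h.mem_tri_of_leaf t hw hpq hwpq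
      exact (l2 p q hpq (h.tri_not_P t hp hq) _ hwpq g).symm.trans
        (congrArg fL (smul_inv_smul g z))
    · have t'' := h.tri_smul t' (hΔ (g⁻¹ : Δ).2)
      have hT' : closedTri a b c = closedTri ((g⁻¹ : Δ).1 • a') ((g⁻¹ : Δ).1 • b')
          ((g⁻¹ : Δ).1 • c') := by
        ext z
        rw [← Set.smul_mem_smul_set_iff (a := g), hT, ← smul_mem_closedTri (g⁻¹ : Δ).1]
        exact Iff.of_eq (congrArg (· ∈ _) (inv_smul_smul g z))
      have k := k3 _ _ _ t'' hT'
      have hv : ∀ x ∈ ({a', b', c'} : Set BdH2), τ g • ξ ((g⁻¹ : Δ).1 • x) = ξ x := fun x hx => by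
        obtain ⟨y, hy, hxy⟩ : ∃ y ∈ ({a', b', c'} : Set BdH2), x ≠ y := by
          by_cases hxa : x = a'
          · exact ⟨b', by simp, hxa ▸ t'.1⟩
          · exact ⟨a', by simp, hxa⟩
        rw [← hξ _ _ (h.smul _ (hΔ (g⁻¹ : Δ).2) _ _ (h.tri_leaf t' hx hy hxy))]
        exact congrArg ξ (smul_inv_smul g x)
      have k4 := bijOn_smul_idealTriangle (τ g) (ξ ((g⁻¹ : Δ).1 • a')) (ξ ((g⁻¹ : Δ).1 • b'))
        (ξ ((g⁻¹ : Δ).1 • c'))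
      rw [hv a' (by simp), hv b' (by simp), hv c' (by simp)] at k4
      exact k4.comp (k.comp hmaps)
  · rintro _ ⟨a, b, c, t, rfl⟩ g
    refine ⟨g.1 • a, g.1 • b, g.1 • c, h.tri_smul t (hΔ g.2), Set.ext fun z => ?_⟩
    rw [Set.mem_smul_set_iff_inv_smul_mem, ← smul_mem_closedTri g.1]
    exact Iff.of_eq (congrArg (· ∈ _) (smul_inv_smul g z))
  · rintro _ ⟨a, b, c, t, rfl⟩
    have hs := hvert t
    obtain ⟨f, g1, g2, g3⟩ := exists_triangle_map t.1 t.2.1 t.2.2.1 (hs a (by simp) b (by simp) t.1)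
      (hs b (by simp) c (by simp) t.2.1) (hs c (by simp) a (by simp) t.2.2.1) (fL := fL)
      fun A h0 h1 => l1 A (h.tri_leaf t h0 h1 (smul_zero_ne_infty A)) (h.tri_not_P t h0 h1)
    refine ⟨f, g1, fun z hz ⟨p, q, hpq, hz'⟩ => g3 z ?_, fun a' b' c' t' hT => ?_⟩
    · have hne := h.ne hpq
      obtain ⟨hp, hq⟩ := h.mem_tri_of_leaf t hz hpq hz'
      rcases hp with rfl | rfl | rfl <;> rcases hq with rfl | rfl | rfl <;>
        first | exact absurd rfl hne | tauto | (rw [geod_comm] at hz'; tauto)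
    · obtain ⟨o, h0, hE⟩ := t.2.2.2
      have hz := openTri_subset _ _ _ (h.mem_openTri h0 t.1 t.2.1 t.2.2.1 hE)
      have hE' := h.pEnds_of_mem_tri t' (hT ▸ hz) h0
      rw [hE] at hE'
      have hs' := hvert t'
      have hm : ∀ x ∈ ({a', b', c'} : Set BdH2), ξ x ∈ ({ξ a, ξ b, ξ c} : Set BdH3) := by
        rw [← hE']
        rintro x (rfl | rfl | rfl) <;> simp
      rwa [idealTriangle_congr (hs' a' (by simp) b' (by simp) t'.1)
        (hs' b' (by simp) c' (by simp) t'.2.1) (hs' c' (by simp) a' (by simp) t'.2.2.1)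
        (hm a' (by simp)) (hm b' (by simp)) (hm c' (by simp))]
  · rintro _ ⟨a, b, c, t, rfl⟩ g hg
    exact h.eq_one_or_of_smul_tri t (hΔ g.2) hg
  · rintro _ ⟨a, b, c, t, rfl⟩ _ ⟨a', b', c', t', rfl⟩ f f' z ⟨-, k, -⟩ ⟨-, k', -⟩ hz hz' hD
    rcases h.tri_inter t t' hz hz' with h' | ⟨p, q, hpq, hzpq, -⟩
    · exact absurd (closedTri_congr h') hD
    · rw [k z hz ⟨p, q, hpq, hzpq⟩, k' z hz' ⟨p, q, hpq, hzpq⟩]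

end PantsLam

/-! ### The group of a closed hyperbolic surface -/

lemma exists_smul_eq_of_trace_lt (h : |sltr g| < 2) : ∃ z : ℍ, g • z = z := by
  wlog hc : 0 < g 1 0 generalizing g
  · have hd := sl_det g
    rcases (not_lt.mp hc).eq_or_lt with hc | hc
    · rw [hc] at hd
      rw [sltr, abs_lt] at h
      nlinarith [sq_nonneg (g 0 0 - g 1 1), mul_pos (sub_pos.mpr h.1) (sub_pos.mpr h.2)]
    · obtain ⟨z, hz⟩ := this (g := -g) (by rwa [sltr_neg, abs_neg]) (by
        rw [sl_neg_apply]; linarith)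
      exact ⟨z, by rwa [neg_sl_smul_uhp] at hz⟩
  have hd := sl_det g
  have hq : 0 < g 1 0 * -g 0 1 - ((g 1 1 - g 0 0) / 2) ^ 2 := by
    rw [sltr, abs_lt] at h
    nlinarith [mul_pos (sub_pos.mpr h.1) (sub_pos.mpr h.2)]
  refine ⟨conePt (g 1 0) ((g 1 1 - g 0 0) / 2) (-g 0 1), hform_ext fun v w => ?_⟩
  rw [← smul_inv_smul g v, ← smul_inv_smul g w, hform_sl_smul, smul_inv_smul, smul_inv_smul,
    hform_conePt hc hq, hform_conePt hc hq]
  simp only [sl_smul_0, sl_smul_1, sl_inv_00, sl_inv_01, sl_inv_10,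
    sl_inv_11]
  congr 1
  linear_combination (g 1 0 * (v 0 * w 0) + (g 1 1 - g 0 0) / 2 * (v 0 * w 1 + v 1 * w 0) -
    g 0 1 * (v 1 * w 1)) * hd

lemma eq_one_or_of_smul_eq (h : ∀ z : ℍ, g • z = z) : g = 1 ∨ g = -1 := by
  have h1 : ∀ {a b : BdH2}, a ≠ b → g • a = a ∨ g • a = b := fun {a b} hab => by
    exact (fix_or_swap hab ((Set.image_congr fun z _ => h z).trans (Set.image_id' _))).imp
      And.left And.left
  have h2 : ∀ a : BdH2, g • a = a := fun a => by
    obtain ⟨b, hb, -⟩ := exists_ne_ne_bdH2 a a; obtain ⟨c, hc, hcb⟩ := exists_ne_ne_bdH2 a b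
    rcases h1 hb.symm with h' | h'
    exacts [h', (h1 hc.symm).resolve_right fun h'' => hcb (h''.symm.trans h')]
  exact eq_one_or_of_three zero_ne_infty (b := infty) (c := ofReal 1)
    (fun h => zero_ne_one (BdH2.ofReal_inj.mp h)) (ofReal_ne_infty 1).symm (h2 _) (h2 _) (h2 _)

/-- The group generated by `Δ` and `-1`. -/
def pmGroup (Δ : Subgroup SL2R) : Subgroup SL2R where
  carrier := {g | g ∈ Δ ∨ -g ∈ Δ}
  one_mem' := Or.inl (one_mem Δ)
  mul_mem' := by
    rintro a b (ha | ha) (hb | hb)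
    exacts [Or.inl (mul_mem ha hb), Or.inr (by simpa using mul_mem ha hb),
      Or.inr (by simpa using mul_mem ha hb), Or.inl (by simpa using mul_mem ha hb)]
  inv_mem' := by
    rintro a (ha | ha)
    exacts [Or.inl (inv_mem ha), Or.inr (by simpa using inv_mem ha)]

lemma isSurfaceGroup_of_covering {X : Type*} [TopologicalSpace X] [T1Space X] [CompactSpace X]
    {p : ℍ → X} (hp : IsCoveringMap p) (hsurj : Function.Surjective p)
    (hΔ : ∀ z w, p z = p w ↔ ∃ g ∈ Δ, g • z = w) : IsSurfaceGroup (pmGroup Δ) := by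
  have hinv : ∀ g ∈ pmGroup Δ, ∀ z, p (g • z) = p z := by
    rintro g (hg | hg) z
    · exact ((hΔ z _).mpr ⟨g, hg, rfl⟩).symm
    · exact ((hΔ z _).mpr ⟨-g, hg, neg_sl_smul_uhp g z⟩).symm
  have hfree : ∀ g ∈ pmGroup Δ, ∀ z : ℍ, g • z = z → g = 1 ∨ g = -1 := fun g hg z hz =>
    eq_one_or_of_smul_eq fun w => congrFun (hp.eq_of_comp_eq (continuous_const_smul g) continuous_id
      (funext (hinv g hg)) z hz) w
  refine ⟨Or.inr (by simp), fun g hg => ?_, fun R => ?_, ?_⟩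
  · by_contra! h
    obtain ⟨z, hz⟩ := exists_smul_eq_of_trace_lt h
    rcases hfree g hg z hz with rfl | rfl <;> simp [sltr] at h <;> norm_num at h
  · have hfin : (closedBall I R ∩ p ⁻¹' {p I}).Finite := by
      have := (hp (p I)).discreteTopology_fiber
      refine ((isCompact_closedBall _ _).inter_right
        (isClosed_singleton.preimage hp.continuous)).finite ?_
      exact IsDiscrete.mono ⟨this⟩ Set.inter_subset_right
    refine (hfin.biUnion (t := fun w => {g | g ∈ pmGroup Δ ∧ g • I = w})
      fun w _ => ?_).subset fun g ⟨hg, hgR⟩ => Set.mem_biUnion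
        (x := g • I) ⟨?_, hinv g hg _⟩ ⟨hg, rfl⟩
    · rcases Set.eq_empty_or_nonempty {g | g ∈ pmGroup Δ ∧ g • I = w} with h | ⟨k, hk⟩
      · rw [h]; exact Set.finite_empty
      · refine (Set.toFinite {k, -k}).subset fun g hg => ?_
        rcases hfree (k⁻¹ * g) (mul_mem (inv_mem hk.1) hg.1) I (by
          rw [mul_smul, hg.2, ← hk.2, inv_smul_smul]) with h | h
        · exact Or.inl (inv_mul_eq_one.mp h).symm
        · exact Or.inr (by rw [inv_mul_eq_iff_eq_mul] at h; simpa using h)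
    · rw [mem_closedBall]
      have h1 := cosh_dist_I g
      have h2 := add_one_le_exp (dist (g • I) I)
      have h3 := exp_pos (-dist (g • I) I)
      rw [cosh_eq] at h1
      linarith
  · obtain ⟨n, hn⟩ := isCompact_univ.elim_directed_cover
      (fun n : ℕ => p '' ball I n)
      (fun n => hp.isOpenMap _ isOpen_ball) (fun x _ => by
        obtain ⟨z, rfl⟩ := hsurj x
        obtain ⟨n, hn⟩ := exists_nat_gt (dist z I)
        exact Set.mem_iUnion.mpr ⟨n, z, hn, rfl⟩)
      (directed_of_isDirected_le fun m n hmn =>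
        Set.image_mono (ball_subset_ball (by exact_mod_cast hmn)))
    refine ⟨2 * cosh n, fun m => ?_⟩
    obtain ⟨w, hw, hpw⟩ := hn (Set.mem_univ (p (m • I)))
    obtain ⟨g, hg, hgw⟩ := (hΔ _ _).mp hpw.symm
    refine ⟨g, Or.inl hg, ?_⟩
    have h1 := cosh_dist_I (g * m)
    rw [mul_smul, hgw] at h1
    have h2 : cosh (dist w I) ≤ cosh n := by
      rw [cosh_le_cosh, abs_of_nonneg dist_nonneg, abs_of_nonneg n.cast_nonneg]
      exact (mem_ball.mp hw).le
    linarith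

/-! ### Families of geodesics -/

/-- A symmetric `Γ`-invariant family of pairwise unlinked pairs of points at infinity. -/
structure IsUnlinked (Γ : Subgroup SL2R) (F : Rel) : Prop where
  ne : ∀ {a b}, F a b → a ≠ b
  symm : ∀ {a b}, F a b → F b a
  unlinked : ∀ {a b c e}, F a b → F c e → ¬Link a b c e
  smul : ∀ g ∈ Γ, ∀ a b, F a b → F (g • a) (g • b)

/-- The family `F`, enlarged by the `Γ`-orbit of the pair `p`, `q`. -/
def adjoinRel (Γ : Subgroup SL2R) (F : Rel) (p q a b : BdH2) : Prop :=
  F a b ∨ ∃ g ∈ Γ, (a = g • p ∧ b = g • q) ∨ (a = g • q ∧ b = g • p)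

lemma adjoinRel_self (Γ : Subgroup SL2R) (F : Rel) (p q : BdH2) :
    adjoinRel Γ F p q p q := Or.inr ⟨1, one_mem _, by simp⟩

lemma IsUnlinked.adjoin
    (hF : IsUnlinked Γ F) (hpq : p ≠ q) (h1 : ∀ a b, F a b → ¬Link a b p q)
    (h2 : ∀ g ∈ Γ, ¬Link p q (g • p) (g • q)) : IsUnlinked Γ (adjoinRel Γ F p q) where
  ne := by
    rintro a b (h | ⟨g, -, ⟨rfl, rfl⟩ | ⟨rfl, rfl⟩⟩)
    exacts [hF.ne h, fun h => hpq (MulAction.injective g h),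
      fun h => hpq (MulAction.injective g h).symm]
  symm := by
    rintro a b (h | ⟨g, hg, h⟩)
    exacts [Or.inl (hF.symm h), Or.inr ⟨g, hg, by tauto⟩]
  unlinked := by
    have k1 : ∀ {a b g}, F a b → g ∈ Γ → ¬Link a b (g • p) (g • q) := fun {a b g} h hg h' => by
      rw [← smul_inv_smul g a, ← smul_inv_smul g b, link_smul] at h'
      exact h1 _ _ (hF.smul _ (inv_mem hg) _ _ h) h'
    have k2 : ∀ {g k}, g ∈ Γ → k ∈ Γ → ¬Link (g • p) (g • q) (k • p) (k • q) :=
      fun {g k} hg hk h' => by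
        rw [← smul_inv_smul g (k • p), ← smul_inv_smul g (k • q), link_smul, ← mul_smul,
          ← mul_smul] at h'
        exact h2 _ (mul_mem (inv_mem hg) hk) h'
    rintro a b c e (h | ⟨g, hg, ⟨rfl, rfl⟩ | ⟨rfl, rfl⟩⟩) (h' | ⟨k, hk, ⟨rfl, rfl⟩ | ⟨rfl, rfl⟩⟩) hl
    exacts [hF.unlinked h h' hl, k1 h hk hl, k1 h hk hl.symm_right, k1 h' hg hl.swap, k2 hg hk hl,
      k2 hg hk hl.symm_right, k1 h' hg hl.symm_left.swap, k2 hg hk hl.symm_left,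
      k2 hg hk hl.symm_left.symm_right]
  smul := by
    rintro k hk a b (h | ⟨g, hg, h⟩)
    · exact Or.inl (hF.smul k hk _ _ h)
    · refine Or.inr ⟨k * g, mul_mem hk hg, ?_⟩
      rcases h with ⟨rfl, rfl⟩ | ⟨rfl, rfl⟩ <;> simp [mul_smul]

/-- A limit of points on geodesics of a family lies on a limit geodesic. -/
lemma exists_limit_geod (hz : z ∈ closure (leaves F)) :
    ∃ a b, a ≠ b ∧ z ∈ geod a b ∧ (∀ c e, Link a b c e → ∃ u v, F u v ∧ Link u v c e) ∧
      ∀ g : SL2R, Link a b (g • a) (g • b) → ∃ u v, F u v ∧ Link u v (g • u) (g • v) := by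
  have hunit : ∀ x : BdH2, ∃ u : Fin 2 → ℝ, ‖u‖ = 1 ∧ ∃ hu, x = mk ℝ u hu :=
    fun x => by
      have h := norm_ne_zero_iff.mpr x.rep_nonzero
      refine ⟨‖x.rep‖⁻¹ • x.rep, by rw [norm_smul, norm_inv, norm_norm, inv_mul_cancel₀ h],
        smul_ne_zero (inv_ne_zero h) x.rep_nonzero, ?_⟩
      conv_lhs => rw [← x.mk_rep]
      rw [mk_eq_iff, vdet_smul_right, vdet_self, mul_zero]
  obtain ⟨zs, hzs, hlim⟩ := mem_closure_iff_seq_limit.mp hz; choose a b hF hab using hzs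
  choose u hu hu0 hau using fun n => hunit (a n); choose v hv hv0 hbv using fun n => hunit (b n)
  obtain ⟨⟨U, V⟩, hUV, θ, hθ, hlim'⟩ := ((isCompact_sphere (0 : Fin 2 → ℝ) 1).prod
    (isCompact_sphere (0 : Fin 2 → ℝ) 1)).tendsto_subseq (x := fun n => (u n, v n))
    fun n => ⟨by simp [hu], by simp [hv]⟩
  have hU : U ≠ 0 := by rintro rfl; simpa using hUV.1
  have hV : V ≠ 0 := by rintro rfl; simpa using hUV.2
  have hform0 : hform z U V = 0 := by
    refine tendsto_nhds_unique ((continuous_hform_prod.tendsto (z, U, V)).comp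
      ((hlim.comp hθ.tendsto_atTop).prodMk_nhds hlim')) (tendsto_const_nhds.congr fun n => ?_)
    have := hab (θ n); rw [hau, hbv, mem_geod_mk] at this; exact this.symm
  have hne : mk ℝ U hU ≠ mk ℝ V hV := fun h => by
    rw [mk_eq_iff] at h; have := hform_gram z U V; rw [h, hform0] at this
    nlinarith [mul_pos (hform_self_pos z hU) (hform_self_pos z hV)]
  have hev : ∀ φ : (Fin 2 → ℝ) × (Fin 2 → ℝ) → ℝ, Continuous φ → φ (U, V) < 0 →
      ∃ n, φ (u n, v n) < 0 := fun φ hφ h =>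
    ((((hφ.tendsto _).comp hlim').eventually (gt_mem_nhds h)).exists).imp' θ fun n hn => hn
  refine ⟨_, _, hne, (mem_geod_mk hU hV z).mpr hform0, fun c e hl => ?_, fun g hl => ?_⟩
  · rw [← c.mk_rep, ← e.mk_rep, link_mk_iff] at hl
    obtain ⟨n, hn⟩ := hev (fun x => vdet x.1 c.rep * vdet x.2 c.rep *
      (vdet x.1 e.rep * vdet x.2 e.rep)) (by unfold vdet; fun_prop) hl
    refine ⟨_, _, hF n, ?_⟩; rw [← c.mk_rep, ← e.mk_rep, hau, hbv, link_mk_iff]; exact hn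
  · rw [Projectivization.smul_mk, Projectivization.smul_mk, link_mk_iff] at hl
    obtain ⟨n, hn⟩ := hev (fun x => vdet x.1 (g • x.1) * vdet x.2 (g • x.1) *
      (vdet x.1 (g • x.2) * vdet x.2 (g • x.2))) (by
        simp only [vdet, sl_smul_0, sl_smul_1]; fun_prop) hl
    refine ⟨_, _, hF n, ?_⟩
    rw [hau, hbv, Projectivization.smul_mk, Projectivization.smul_mk, link_mk_iff]; exact hn

/-- By maximality, an unlinked family extends to one with a closed union. -/
lemma IsUnlinked.exists_isClosed {F0 : Rel}
    (h0 : IsUnlinked Γ F0) : ∃ F, (∀ a b, F0 a b → F a b) ∧ IsUnlinked Γ F ∧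
      IsClosed (leaves F) := by
  obtain ⟨m, hm, hmax⟩ := zorn_subset_nonempty
    {S : Set (BdH2 × BdH2) | IsUnlinked Γ fun a b => (a, b) ∈ S} (fun c hc hch hne => by
      refine ⟨⋃₀ c, ⟨fun ⟨s, hs, h⟩ => (hc hs).ne h, fun ⟨s, hs, h⟩ => ⟨s, hs, (hc hs).symm h⟩,
        fun ⟨s, hs, h⟩ ⟨t, ht, h'⟩ => ?_, fun g hg a b ⟨s, hs, h⟩ => ⟨s, hs, (hc hs).smul g hg a b h⟩⟩,
        fun s hs => Set.subset_sUnion_of_mem hs⟩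
      rcases hch.total hs ht with h'' | h''
      · exact (hc ht).unlinked (h'' h) h'
      · exact (hc hs).unlinked h (h'' h')) {x | F0 x.1 x.2} h0
  have hm' : IsUnlinked Γ fun a b => (a, b) ∈ m := hmax.1
  refine ⟨_, fun a b h => hm h, hm', isClosed_of_closure_subset fun z hz => ?_⟩
  obtain ⟨a, b, hab, hzab, h1, h2⟩ := exists_limit_geod hz
  have hnew := hm'.adjoin hab (fun c e hce hl => by
    obtain ⟨u, v, huv, hl'⟩ := h1 c e hl.swap
    exact hm'.unlinked huv hce hl') fun g hg hl => by
    obtain ⟨u, v, huv, hl'⟩ := h2 g hl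
    exact hm'.unlinked huv (hm'.smul g hg _ _ huv) hl'
  exact ⟨a, b, hmax.2 (y := {x | adjoinRel Γ (fun a b => (a, b) ∈ m) a b x.1 x.2}) hnew
    (fun _ => Or.inl) (adjoinRel_self Γ (fun a b => (a, b) ∈ m) a b), hzab⟩

/-! ### Laminations and pleated surfaces in terms of ends -/

/-- The geodesic with ends `a` and `b` belongs to `Λ`. -/
def leafRel (Λ : Set (Set ℍ)) (a b : BdH2) : Prop := a ≠ b ∧ geod a b ∈ Λ

lemma translateSet_neg (g : SL2R) (L : Set ℍ) : translateSet (-g) L = translateSet g L :=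
  Set.image_congr fun z _ => neg_sl_smul_uhp g z

lemma actsNontrivially_iff : ActsNontrivially g ↔ g ≠ 1 ∧ g ≠ -1 := by
  constructor
  · rintro ⟨z, hz⟩
    constructor <;> rintro rfl
    · exact hz (one_smul _ z)
    · exact hz (by rw [neg_sl_smul_uhp, one_smul])
  · rintro ⟨h1, h2⟩
    by_contra h
    exact (eq_one_or_of_smul_eq (by simpa [ActsNontrivially] using h)).elim h1 h2

lemma exists_eq_geod {L : Set ℍ} (h : ∃ a b, HasEndpoints L a b) : ∃ a b, a ≠ b ∧ L = geod a b :=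
  h.imp fun _ h => h.imp fun _ => hasEndpoints_iff.mp

lemma isClosedGeodesic_geod_iff (hΔ : IsSurfaceGroup (pmGroup Δ))
    (hab : a ≠ b) : IsClosedGeodesic Δ (geod a b) ↔
      ∃ g ∈ pmGroup Δ, g ≠ 1 ∧ g ≠ -1 ∧ g • a = a ∧ g • b = b := by
  constructor
  · rintro ⟨-, g, hg, hg', hgL⟩
    obtain ⟨h1, h2⟩ := actsNontrivially_iff.mp hg'
    exact ⟨g, Or.inl hg, h1, h2, hΔ.fix_of_translateSet (Or.inl hg) hab hgL⟩
  · rintro ⟨g, hg, h1, h2, ga, gb⟩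
    have hL : translateSet g (geod a b) = geod a b := by rw [translateSet_geod, ga, gb]
    refine ⟨⟨a, b, hasEndpoints_iff.mpr ⟨hab, rfl⟩⟩, hg.elim
      (fun hg => ⟨g, hg, actsNontrivially_iff.mpr ⟨h1, h2⟩, hL⟩) fun hg => ⟨-g, hg,
      actsNontrivially_iff.mpr ⟨fun h => h2 (by rw [← h, neg_neg]), fun h => h1 (neg_injective h)⟩,
      by rw [translateSet_neg, hL]⟩⟩

/-- The geodesics whose ends form a pair of `F`. -/
def leafSet (F : Rel) : Set (Set ℍ) := {L | ∃ a b, F a b ∧ L = geod a b}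

lemma sUnion_leafSet (F : Rel) : ⋃₀ leafSet F = leaves F := by
  ext z
  exact ⟨fun ⟨_, ⟨a, b, hab, e⟩, hz⟩ => ⟨a, b, hab, e ▸ hz⟩,
    fun ⟨a, b, hab, hz⟩ => ⟨_, ⟨a, b, hab, rfl⟩, hz⟩⟩

lemma subset_leafSet {Λ : Set (Set ℍ)} (h : ∀ L ∈ Λ, ∃ a b, HasEndpoints L a b)
    (hF : ∀ a b, leafRel Λ a b → F a b) : Λ ⊆ leafSet F := fun L hL => by
  obtain ⟨a, b, hab, rfl⟩ := exists_eq_geod (h L hL); exact ⟨a, b, hF _ _ ⟨hab, hL⟩, rfl⟩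

lemma leaves_leafRel {Λ : Set (Set ℍ)} (h : ∀ L ∈ Λ, ∃ a b, HasEndpoints L a b) :
    leaves (leafRel Λ) = ⋃₀ Λ := by
  rw [← sUnion_leafSet]; refine congrArg _ (Set.Subset.antisymm ?_ (subset_leafSet h fun _ _ => id))
  rintro _ ⟨a, b, hab, rfl⟩; exact hab.2

lemma isUnlinkedFamily_leafRel {Λ : Set (Set ℍ)}
    (hd : Λ.PairwiseDisjoint id) (hi : ∀ g ∈ Δ, ∀ L ∈ Λ, translateSet g L ∈ Λ) :
    IsUnlinked (pmGroup Δ) (leafRel Λ) where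
  ne h := h.1
  symm h := ⟨h.1.symm, geod_comm _ _ ▸ h.2⟩
  unlinked {a b c e} h h' hl := by
    obtain ⟨z, h1, h2⟩ := exists_mem_geod_of_link hl
    rcases geod_inj h.1 h'.1 (hd.elim_set h.2 h'.2 z h1 h2) with h'' | h''
    exacts [hl.ne13 h''.1, hl.ne14 h''.1]
  smul g hg a b h := by
    refine ⟨fun h' => h.1 (MulAction.injective g h'), ?_⟩; rw [← translateSet_geod]
    rcases hg with hg | hg
    · exact hi g hg _ h.2
    · rw [← translateSet_neg]; exact hi _ hg _ h.2

lemma IsUnlinked.eq_of_mem (hF : IsUnlinked Γ F) (h : F a b) (h' : F c e)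
    (hz : z ∈ geod a b) (hz' : z ∈ geod c e) : geod a b = geod c e := by
  rcases link_or_eq_of_mem_geod (hF.ne h') hz hz' with h'' | ⟨rfl, rfl⟩ | ⟨rfl, rfl⟩
  · exact (hF.unlinked h h' h'').elim
  · rfl
  · exact geod_comm _ _

lemma IsUnlinked.pairwiseDisjoint
    (hF : IsUnlinked Γ F) : (leafSet F).PairwiseDisjoint id := by
  rintro _ ⟨a, b, hab, rfl⟩ _ ⟨c, e, hce, rfl⟩ hne
  exact Set.disjoint_left.mpr fun z hz hz' => hne (hF.eq_of_mem hab hce hz hz')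

lemma IsUnlinked.translateSet_mem
    (hF : IsUnlinked Γ F) (hg : g ∈ Γ) {L : Set ℍ} (hL : L ∈ leafSet F) :
    translateSet g L ∈ leafSet F := by
  obtain ⟨a, b, hab, rfl⟩ := hL; exact ⟨_, _, hF.smul g hg _ _ hab, translateSet_geod _ _ _⟩

lemma pantsLamination_of_maximal (hΔ : IsSurfaceGroup (pmGroup Δ))
    {Λ P : Set (Set ℍ)} (hΛ : Maximal (IsGeodesicLamination Δ) Λ) (hP : Maximal (IsMulticurve Δ) P)
    (hPΛ : P ⊆ Λ) : PantsLam (pmGroup Δ) (leafRel Λ) (leafRel P) where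
  toIsGeodFamily := by
    have h := isUnlinkedFamily_leafRel hΛ.1.disjoint hΛ.1.invariant
    exact ⟨h.ne, h.symm, h.unlinked, leaves_leafRel hΛ.1.geodesic ▸ hΛ.1.isClosed⟩
  surf := hΔ
  smul := (isUnlinkedFamily_leafRel hΛ.1.disjoint hΛ.1.invariant).smul
  maximal p q hpq h1 h2 := by
    obtain ⟨F, hF, hF', hcl⟩ := ((isUnlinkedFamily_leafRel hΛ.1.disjoint hΛ.1.invariant).adjoin
      hpq h1 h2).exists_isClosed
    refine ⟨hpq, hΛ.2 (y := leafSet F) ⟨?_, hF'.pairwiseDisjoint, fun g hg _ =>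
      hF'.translateSet_mem (Or.inl hg), by rwa [sUnion_leafSet]⟩
      (subset_leafSet hΛ.1.geodesic fun a b h => hF _ _ (Or.inl h))
      ⟨p, q, hF _ _ (adjoinRel_self _ _ _ _), rfl⟩⟩
    rintro L ⟨a, b, hab, rfl⟩; exact ⟨a, b, hasEndpoints_iff.mpr ⟨hF'.ne hab, rfl⟩⟩
  P_sub h := ⟨h.1, hPΛ h.2⟩
  P_symm h := ⟨h.1.symm, geod_comm _ _ ▸ h.2⟩
  P_smul := (isUnlinkedFamily_leafRel hP.1.disjoint hP.1.invariant).smul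
  P_closed h := (isClosedGeodesic_geod_iff hΔ h.1).mp (hP.1.closed _ h.2)
  P_maximal p q g hg h1 h2 hpq gp gq hl hl' := by
    have hF := (isUnlinkedFamily_leafRel hP.1.disjoint hP.1.invariant).adjoin hpq hl hl'
    refine ⟨hpq, hP.2 (y := leafSet _) ⟨?_, hF.pairwiseDisjoint, fun g hg _ =>
      hF.translateSet_mem (Or.inl hg)⟩ (subset_leafSet (fun L hL => (hP.1.closed L hL).1)
      fun a b => Or.inl) ⟨p, q, adjoinRel_self _ _ _ _, rfl⟩⟩
    rintro _ ⟨a, b, hab, rfl⟩; refine (isClosedGeodesic_geod_iff hΔ (hF.ne hab)).mpr ?_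
    rcases hab with hab | ⟨k, hk, hab⟩
    · exact (isClosedGeodesic_geod_iff hΔ hab.1).mp (hP.1.closed _ hab.2)
    · refine ⟨k * g * k⁻¹, mul_mem (mul_mem hk hg) (inv_mem hk), fun h => h1 ?_, fun h => h2 ?_, ?_⟩
      · simpa using h
      · simpa [mul_assoc] using congrArg (fun x => k⁻¹ * x * k) h
      · rcases hab with ⟨rfl, rfl⟩ | ⟨rfl, rfl⟩ <;> simp [mul_smul, gp, gq]

lemma connectedComponentIn_eq_plaque (hz : z ∉ leaves F) :
    connectedComponentIn (leaves F)ᶜ z = plaque F z := by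
  refine Set.Subset.antisymm (fun w hw a b hab => ?_)
    ((isPreconnected_plaque F z).subset_connectedComponentIn (mem_plaque_self hz)
      fun w hw => notMem_of_mem_plaque hw)
  by_contra! hle
  have hc := isPreconnected_connectedComponentIn.image (s := connectedComponentIn (leaves F)ᶜ z)
    _ (continuous_hform a.rep b.rep).continuousOn
  have hne : ∀ x ∈ connectedComponentIn (leaves F)ᶜ z, hform x a.rep b.rep ≠ 0 := fun x hx =>
    hform_ne_zero (connectedComponentIn_subset _ _ hx) hab
  have hz' := mem_connectedComponentIn (F := (leaves F)ᶜ) hz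
  rcases mul_nonpos_iff.mp hle with ⟨h1, h2⟩ | ⟨h1, h2⟩
  · obtain ⟨x, hx, hx0⟩ := hc.Icc_subset ⟨w, hw, rfl⟩ ⟨z, hz', rfl⟩ ⟨h2, h1⟩
    exact hne x hx hx0
  · obtain ⟨x, hx, hx0⟩ := hc.Icc_subset ⟨z, hz', rfl⟩ ⟨w, hw, rfl⟩ ⟨h1, h2⟩
    exact hne x hx hx0

lemma closure_openTri (hw : w ∈ openTri a b c) : closure (openTri a b c) = closedTri a b c := by
  refine Set.Subset.antisymm ((isClosed_closedTri a b c).closure_subset_iff.mpr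
    (openTri_subset a b c)) fun z hz => ?_
  have hc := (continuousOn_arc z w 0 Set.self_mem_Ici).mono_left
    (nhdsWithin_mono 0 Set.Ioi_subset_Ici_self)
  rw [show arc z w 0 = z from pencil_zero z _ _ _] at hc
  refine mem_closure_of_tendsto hc (eventually_mem_nhdsWithin.mono fun t (ht : 0 < t) => ?_)
  obtain ⟨s, hs, e⟩ := hform_arc z w ht.le
  have hside : ∀ {a b c}, 0 ≤ side z a b c → 0 < side w a b c → 0 < side (arc z w t) a b c :=
    fun {a b c} h1 h2 => by
      rw [show side (arc z w t) a b c = s * (side z a b c + t * side w a b c) by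
        simp only [side, e]; ring]
      positivity
  exact ⟨hside hz.1 hw.1, hside hz.2.1 hw.2.1, hside hz.2.2 hw.2.2⟩

lemma PantsLam.isTri_of_isTriangularPlaque {Λ : Set (Set ℍ)}
    (h : PantsLam Γ (leafRel Λ) P)
    (hΛ : ∀ L ∈ Λ, ∃ a b, HasEndpoints L a b) {T : Set ℍ}
    (hT : IsTriangularPlaque Λ T a b c) :
    IsTri (leafRel Λ) a b c ∧ closure T = closedTri a b c := by
  obtain ⟨⟨z, hz, rfl⟩, L1, m1, L2, m2, L3, m3, e1, e2, e3, hfr⟩ := hT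
  obtain ⟨hab, rfl⟩ := hasEndpoints_iff.mp e1; obtain ⟨hbc, rfl⟩ := hasEndpoints_iff.mp e2
  obtain ⟨hca, rfl⟩ := hasEndpoints_iff.mp e3; rw [← leaves_leafRel hΛ] at hz hfr ⊢
  rw [connectedComponentIn_eq_plaque hz] at hfr ⊢
  obtain ⟨a', b', c', hab', hbc', hca', hE⟩ := h.exists_vertices hz
  have t : IsTri (leafRel Λ) a' b' c' := ⟨hab', hbc', hca', z, hz, hE⟩
  have hcl : closure (plaque (leafRel Λ) z) = closedTri a' b' c' := by
    rw [h.plaque_eq_openTri hz hab' hbc' hca' hE, closure_openTri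
      (h.mem_openTri hz hab' hbc' hca' hE)]
  have key : ∀ {x y}, x ≠ y → geod x y ∈ Λ → geod x y ⊆ frontier (plaque (leafRel Λ) z) →
      x ∈ ({a', b', c'} : Set BdH2) := fun {x y} hxy hm hs => by
    obtain ⟨w, hw⟩ := geod_nonempty hxy
    exact (h.mem_tri_of_leaf t (hcl ▸ frontier_subset_closure (hs hw)) ⟨hxy, hm⟩ hw).1
  have ha := key hab m1 (by rw [hfr]; intro w hw; exact Or.inl (Or.inl hw))
  have hb := key hbc m2 (by rw [hfr]; intro w hw; exact Or.inl (Or.inr hw))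
  have hc := key hca m3 (by rw [hfr]; intro w hw; exact Or.inr hw)
  have hs : ({a', b', c'} : Set BdH2) = {a, b, c} := by
    rcases ha with rfl | rfl | rfl <;> rcases hb with rfl | rfl | rfl <;>
      rcases hc with rfl | rfl | rfl <;>
      first | rfl | contradiction | (ext; simp only [Set.mem_insert_iff, Set.mem_singleton_iff]; tauto)
  exact ⟨⟨hab, hbc, hca, z, hz, hE.trans hs⟩, hcl.trans (closedTri_congr hs)⟩

/-- The data at infinity of a pleated surface: an equivariant map of the ends of the leaves that
separates the ends of each leaf, for a homomorphism that is non-trivial on the closed leaves. -/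
def IsPleatable {Δ : Subgroup SL2R} (F P : Rel) (σ : Δ →* PSL2C) : Prop :=
  ∃ ξ : BdH2 → BdH3, (∀ a b, F a b → ∀ g : Δ, ξ (g.1 • a) = σ g • ξ a) ∧
    (∀ a b, F a b → ξ a ≠ ξ b) ∧
    ∀ a b, P a b → ∃ g : Δ, g.1 • a = a ∧ g.1 • b = b ∧ σ g ≠ 1

lemma nonempty_pleatedSurface_iff {Λ P : Set (Set ℍ)}
    (h : PantsLam (pmGroup Δ) (leafRel Λ) (leafRel P)) (hPΛ : P ⊆ Λ)
    (hΛ : ∀ L ∈ Λ, ∃ a b, HasEndpoints L a b) (hP : ∀ L ∈ P, IsClosedGeodesic Δ L)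
    {σ : Δ →* PSL2C} (hσ : ∀ g : Δ, g.1 = 1 ∨ g.1 = -1 → σ g = 1) :
    Nonempty (PleatedSurface Δ Λ σ) ↔ IsPleatable (leafRel Λ) (leafRel P) σ := by
  have hstab : ∀ (g : Δ) {a b}, a ≠ b → translateSet (g : SL2R) (geod a b) = geod a b →
      g.1 • a = a ∧ g.1 • b = b := fun g {a b} hab hg => by
    exact h.surf.fix_of_translateSet (Or.inl g.2) hab hg
  have hclosed : ∀ L ∈ Λ, IsClosedGeodesic Δ L → L ∈ P := fun L hL hc => by
    obtain ⟨a, b, hab, rfl⟩ := exists_eq_geod hc.1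
    obtain ⟨g, hg, h1, h2, ga, gb⟩ := (isClosedGeodesic_geod_iff h.surf hab).mp hc
    exact (h.P_maximal a b g hg h1 h2 hab ga gb
      (fun c e hce => h.unlinked (h.P_sub hce) ⟨hab, hL⟩)
      fun k hk => h.unlinked ⟨hab, hL⟩ (h.smul k hk _ _ ⟨hab, hL⟩)).2
  constructor
  · rintro ⟨S⟩
    refine ⟨S.vertex, fun a b hab => S.vertex_smul _ hab.2 a b (hasEndpoints_iff.mpr ⟨hab.1, rfl⟩),
      fun a b hab => ?_, fun a b hab => ?_⟩
    · by_cases hc : IsClosedGeodesic Δ (geod a b)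
      · exact S.closed_axis _ hab.2 hc a b (hasEndpoints_iff.mpr ⟨hab.1, rfl⟩)
      · obtain ⟨A, rfl, rfl⟩ := exists_sl_frame hab.1
        rw [← range_smul_axis] at hc
        obtain ⟨B, -, -, h0, h1⟩ := S.leaf_geodesic A (by rw [range_smul_axis]; exact hab.2) hc
        rw [← h0, ← h1]
        intro h'
        have := MulAction.injective B h'
        rw [BdH3.zero, BdH3.infty, mk_eq_iff] at this
        simp [vdet] at this
    · obtain ⟨g, hg, hg'⟩ := S.closed_nontrivial _ (hPΛ hab.2) (hP _ hab.2)
      exact ⟨g, (hstab g hab.1 hg).1, (hstab g hab.1 hg).2, hg'⟩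
  · rintro ⟨ξ, h1, h2, h3⟩
    obtain ⟨f, f1, f2, f3, f4⟩ := h.exists_pleat_map (fun g hg => Or.inl hg) σ hσ h1
      fun a b hab _ => h2 a b hab
    have hcl : closedLeaves Δ Λ = leaves (leafRel P) := by
      rw [leaves_leafRel fun L hL => (hP L hL).1, closedLeaves]
      congr 1
      ext L
      exact ⟨fun hL => hclosed L hL.1 hL.2, fun hL => ⟨hPΛ hL, hP L hL⟩⟩
    refine ⟨⟨ξ, f, ?_, ?_, ?_, ?_, ?_, ?_, ?_⟩⟩
    · intro L hL a b hab
      obtain ⟨hab', rfl⟩ := hasEndpoints_iff.mp hab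
      exact h1 a b ⟨hab', hL⟩
    · intro L hL hc
      obtain ⟨a, b, hab, rfl⟩ := exists_eq_geod (hΛ L hL)
      obtain ⟨g, ga, gb, hg⟩ := h3 a b ⟨hab, hclosed _ hL hc⟩
      exact ⟨g, by rw [translateSet_geod, ga, gb], hg⟩
    · intro L hL _ a b hab
      obtain ⟨hab', rfl⟩ := hasEndpoints_iff.mp hab
      exact h2 a b ⟨hab', hL⟩
    · rwa [hcl]
    · rwa [hcl]
    · intro A hA hc
      rw [range_smul_axis] at hA hc
      obtain ⟨B, b1, b2⟩ := f3 A ⟨smul_zero_ne_infty A, hA⟩ fun h' => hc (hP _ h'.2)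
      exact ⟨B, OrderIso.refl ℝ, b1, b2⟩
    · intro T a b c hT
      obtain ⟨t, ht⟩ := h.isTri_of_isTriangularPlaque hΛ hT
      rw [ht]
      exact f4 a b c t

/-! ### Pleated surfaces and axis systems -/

/-- Representatives `(e j 1, e j (-1))` of the orbits of closed leaves, generators `γ j` of their
stabilizers, and representatives of the orbits of the other leaves, whose ends are written as
translates of the points `e j s`. -/
structure LeafLabels (Δ : Subgroup SL2R) (F P : Rel) (J : Type) where
  e : J → ℤˣ → BdH2
  γ : J → Δ
  Q : Set ((J × ℤˣ × Δ) × (J × ℤˣ × Δ))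
  P_e : ∀ j s, P (e j s) (e j (-s))
  γ_smul : ∀ j s, (γ j : SL2R) • e j s = e j s
  stab : ∀ j s, ∀ g : Δ, g.1 • e j s = e j s →
    ∃ n : ℤ, g.1 = (γ j ^ n : Δ) ∨ g.1 = -(γ j ^ n : Δ).1
  inj : ∀ j s j' s', ∀ g : Δ, g.1 • e j s = e j' s' → j = j' ∧ s = s'
  surj : ∀ x y, P x y → ∃ j s, ∃ g : Δ, x = g.1 • e j s
  finite : Q.Finite
  leaf : ∀ q ∈ Q, F ((q.1.2.2 : SL2R) • e q.1.1 q.1.2.1) ((q.2.2.2 : SL2R) • e q.2.1 q.2.2.1) ∧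
    ¬P ((q.1.2.2 : SL2R) • e q.1.1 q.1.2.1) ((q.2.2.2 : SL2R) • e q.2.1 q.2.2.1)
  leaf_surj : ∀ x y, F x y → ¬P x y → ∃ q ∈ Q, ∃ g : Δ,
    x = g.1 • (q.1.2.2 : SL2R) • e q.1.1 q.1.2.1 ∧
    y = g.1 • (q.2.2.2 : SL2R) • e q.2.1 q.2.2.1

lemma neg_zpow_eq_or (A : SL2R) (n : ℤ) : (-A) ^ n = A ^ n ∨ (-A) ^ n = -A ^ n :=
  n.even_or_odd.imp (fun h => h.neg_zpow A) fun h => h.neg_zpow A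

lemma PantsLam.exists_leafLabels
    (h : PantsLam (pmGroup Δ) F P) : ∃ J : Type, Finite J ∧ Nonempty (LeafLabels Δ F P J) := by
  have hpm : ∀ g ∈ pmGroup Δ, ∃ k : Δ, k.1 = g ∨ k.1 = -g := by
    rintro g (hg | hg)
    exacts [⟨⟨g, hg⟩, Or.inl rfl⟩, ⟨⟨-g, hg⟩, Or.inr rfl⟩]
  have hpm' : ∀ g ∈ pmGroup Δ, ∃ k : Δ, ∀ x : BdH2, k.1 • x = g • x := fun g hg => by
    obtain ⟨k, hk | hk⟩ := hpm g hg
    exacts [⟨k, fun x => by rw [hk]⟩, ⟨k, fun x => by rw [hk, neg_sl_smul_proj]⟩]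
  let r : Setoid (BdH2 × BdH2) :=
    { r := fun x y => ∃ g : Δ, (g.1 • x.1 = y.1 ∧ g.1 • x.2 = y.2) ∨ (g.1 • x.1 = y.2 ∧ g.1 • x.2 = y.1)
      iseqv := by
        refine ⟨fun x => ⟨1, Or.inl ⟨one_smul _ _, one_smul _ _⟩⟩, ?_, ?_⟩
        · rintro x y ⟨g, ⟨h1, h2⟩ | ⟨h1, h2⟩⟩
          · exact ⟨g⁻¹, Or.inl ⟨by simp [← h1], by simp [← h2]⟩⟩
          · exact ⟨g⁻¹, Or.inr ⟨by simp [← h2], by simp [← h1]⟩⟩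
        · rintro x y z ⟨g, ⟨h1, h2⟩ | ⟨h1, h2⟩⟩ ⟨k, ⟨h3, h4⟩ | ⟨h3, h4⟩⟩ <;> refine ⟨k * g, ?_⟩ <;>
            simp [mul_smul, h1, h2, h3, h4] }
  obtain ⟨J0, hJ0, hJP, hJ0'⟩ := h.exists_finite_P
  let J : Set (Quotient r) := Quotient.mk r '' J0
  have hJ : ∀ x y, P x y → Quotient.mk r (x, y) ∈ J := fun x y hxy => by
    obtain ⟨g, hg, hg'⟩ := hJ0' x y hxy
    obtain ⟨k, hk⟩ := hpm' g hg
    rcases hg' with hg' | hg' <;> refine ⟨_, hg', (Quotient.sound (s := r) (a := (x, y)) ⟨k, ?_⟩).symm⟩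
    exacts [Or.inl ⟨hk x, hk y⟩, Or.inr ⟨hk x, hk y⟩]
  have hPout : ∀ j : J, P j.1.out.1 j.1.out.2 := by
    rintro ⟨_, x, hx, rfl⟩
    obtain ⟨g, ⟨h1, h2⟩ | ⟨h1, h2⟩⟩ := Quotient.mk_out (s := r) x
    · have := h.P_smul _ (inv_mem (Or.inl g.2)) _ _ (hJP x hx)
      rwa [← h1, ← h2, inv_smul_smul, inv_smul_smul] at this
    · have := h.P_smul _ (inv_mem (Or.inl g.2)) _ _ (h.P_symm (hJP x hx))
      rwa [← h1, ← h2, inv_smul_smul, inv_smul_smul] at this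
  let e : J → ℤˣ → BdH2 := fun j s => if s = 1 then j.1.out.1 else j.1.out.2
  have hPe : ∀ j s, P (e j s) (e j (-s)) := fun j s => by
    rcases Int.units_eq_one_or s with rfl | rfl
    · exact hPout j
    · exact h.P_symm (hPout j)
  have hgen : ∀ j : J, ∃ γ : Δ, (∀ s, γ.1 • e j s = e j s) ∧ ∀ s, ∀ g : Δ, g.1 • e j s = e j s →
      ∃ n : ℤ, g.1 = (γ ^ n : Δ) ∨ g.1 = -(γ ^ n : Δ).1 := fun j => by
    have hP := hPout j
    obtain ⟨g, hg, g1, g2, ga, gb⟩ := h.P_closed hP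
    have hne := h.P_ne hP
    obtain ⟨M, l, hl, hMa, hMb, -, hm, hmgen⟩ := h.surf.exists_generator hg g1 g2 hne ga gb
    obtain ⟨γ, hγ⟩ := hpm _ hm
    have hγn : ∀ n : ℤ, (γ ^ n : Δ).1 = (M * slDiag l hl * M⁻¹) ^ n ∨
        (γ ^ n : Δ).1 = -(M * slDiag l hl * M⁻¹) ^ n := fun n => by
      rw [Subgroup.coe_zpow]
      rcases hγ with hγ | hγ <;> rw [hγ]
      exacts [Or.inl rfl, neg_zpow_eq_or _ n]
    have hfix : ∀ x, (x = zero ∨ x = infty) → γ.1 • M • x = M • x := fun x hx => by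
      have : (M * slDiag l hl * M⁻¹) • M • x = M • x := by
        rw [mul_smul, inv_smul_smul, mul_smul]
        rcases hx with rfl | rfl
        exacts [by rw [slDiag_smul_zero], by rw [slDiag_smul_infty]]
      rcases hγ with hγ | hγ <;> rw [hγ]
      exacts [this, by rw [neg_sl_smul_proj, this]]
    refine ⟨γ, fun s => ?_, fun s k hk => ?_⟩
    · rcases Int.units_eq_one_or s with rfl | rfl
      · exact (congrArg (γ.1 • ·) hMa.symm).trans ((hfix _ (Or.inl rfl)).trans hMa)
      · exact (congrArg (γ.1 • ·) hMb.symm).trans ((hfix _ (Or.inr rfl)).trans hMb)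
    · have hk' : k.1 • j.1.out.2 = j.1.out.2 := by
        refine (h.surf.fixes_of_common_end hg g1 g2 (Or.inl k.2) hne ga gb ?_).2
        rcases Int.units_eq_one_or s with rfl | rfl
        exacts [Or.inl hk, Or.inr (Or.inr (Or.inr hk))]
      obtain ⟨n, hn⟩ := hmgen k (Or.inl k.2) hk'
      refine ⟨n, ?_⟩
      rcases hn with hn | hn <;> rcases hγn n with h' | h' <;> rw [hn, h'] <;> simp
  choose γ hγ hγ' using hgen
  have hpart : ∀ {x y j s} {g : Δ}, P x y → x = g.1 • e j s → y = g.1 • e j (-s) :=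
    fun {x y j s g} hxy hx => h.P_unique hxy (hx ▸ h.P_smul g.1 (Or.inl g.2) _ _ (hPe j s))
  have hsurj : ∀ x y, P x y → ∃ j s, ∃ g : Δ, x = g.1 • e j s := fun x y hxy => by
    obtain ⟨g, ⟨h1, h2⟩ | ⟨h1, h2⟩⟩ := Quotient.mk_out (s := r) (x, y)
    · exact ⟨⟨_, hJ x y hxy⟩, 1, g, h1.symm⟩
    · exact ⟨⟨_, hJ x y hxy⟩, -1, g, by exact h2.symm⟩
  obtain ⟨Q0, hQ0, hQF, hQ⟩ := h.exists_finite_leaves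
  have hlab : ∀ x : Q0, ∃ q : (J × ℤˣ × Δ) × (J × ℤˣ × Δ),
      x.1.1 = q.1.2.2.1 • e q.1.1 q.1.2.1 ∧ x.1.2 = q.2.2.2.1 • e q.2.1 q.2.2.1 := fun x => by
    obtain ⟨y, hy⟩ := h.exists_P_of_leaf (hQF x.1 x.2).1
    obtain ⟨y', hy'⟩ := h.exists_P_of_leaf (h.symm (hQF x.1 x.2).1)
    obtain ⟨j, s, g, hg⟩ := hsurj _ _ hy'
    obtain ⟨j', s', g', hg'⟩ := hsurj _ _ hy
    exact ⟨((j, s, g), (j', s', g')), hg, hg'⟩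
  choose lab hlab using hlab
  have := hQ0.to_subtype
  refine ⟨_, ?_, ⟨⟨e, γ, Set.range lab, hPe, hγ, hγ', fun j s j' s' g hg => ?_, hsurj,
    Set.finite_range _,
    ?_, fun x y hxy hP => ?_⟩⟩⟩
  · exact (hJ0.image _).to_subtype
  · have h2 := hpart (hPe j' s') hg.symm
    have hjj : j = j' := by
      refine Subtype.ext ?_
      rw [← j.1.out_eq, ← j'.1.out_eq]
      refine Quotient.sound ⟨g, ?_⟩
      rcases Int.units_eq_one_or s with rfl | rfl <;> rcases Int.units_eq_one_or s' with rfl | rfl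
      exacts [Or.inl ⟨hg, h2.symm⟩, Or.inr ⟨hg, h2.symm⟩, Or.inr ⟨h2.symm, hg⟩, Or.inl ⟨h2.symm, hg⟩]
    subst hjj
    refine ⟨rfl, by_contra fun hs => ?_⟩
    rw [← ne_eq, Int.units_ne_iff_eq_neg] at hs
    subst hs
    rw [neg_neg] at h2
    exact h.surf.not_swap (Or.inl g.2) (h.P_ne (hPe j s')) h2.symm hg
  · rintro _ ⟨x, rfl⟩
    rw [← (hlab x).1, ← (hlab x).2]
    exact hQF x.1 x.2
  · obtain ⟨g, hg, hq⟩ := hQ x y hxy hP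
    obtain ⟨k, hk⟩ := hpm' _ (inv_mem hg)
    refine ⟨_, ⟨⟨_, hq⟩, rfl⟩, k, ?_, ?_⟩
    · rw [← (hlab ⟨_, hq⟩).1, hk, inv_smul_smul]
    · rw [← (hlab ⟨_, hq⟩).2, hk, inv_smul_smul]

section Labels

variable {G : Type*} [Group G] {Δ : Subgroup SL2R} {F P : Rel}
  (h : PantsLam (pmGroup Δ) F P) {J : Type} (l : LeafLabels Δ F P J) {φ : Δ →* G}
  (hφ : ∀ g : Δ, g.1 = 1 ∨ g.1 = -1 → φ g = 1)

/-- The image of a label under `φ`. -/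
def mapLabel {I J : Type*} {A B : Type*} (i : I → J) (φ : A → B) (q : (I × ℤˣ × A) × (I × ℤˣ × A)) :
    (J × ℤˣ × B) × (J × ℤˣ × B) :=
  ((i q.1.1, q.1.2.1, φ q.1.2.2), (i q.2.1, q.2.2.1, φ q.2.2.2))

include hφ in
lemma map_eq_of_eq_or {g k : Δ} (hgk : g.1 = k ∨ g.1 = -k) : φ g = φ k := by
  rw [← inv_mul_eq_one, ← map_inv, ← map_mul]; apply hφ; rcases hgk with h | h
  · exact Or.inl (by simp [h])
  · exact Or.inr (by rw [Subgroup.coe_mul, Subgroup.coe_inv, h]; simp)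

include h

lemma LeafLabels.partner {j : J} {s : ℤˣ} {g : Δ} (hxy : P x y)
    (hx : x = g.1 • l.e j s) : y = g.1 • l.e j (-s) :=
  h.P_unique hxy (hx ▸ h.P_smul g (Or.inl g.2) _ _ (l.P_e j s))

include hφ

lemma LeafLabels.isPleatable {ρ : RepVar G} {η : J → ℤˣ → BdH3}
    (hη : IsAxisSystem (fun j => φ (l.γ j)) (mapLabel id φ '' l.Q) ρ η) :
    IsPleatable F P (ρ.comp φ) := by
  classical
  let ξ : BdH2 → BdH3 := fun x => if hx : ∃ q : J × ℤˣ × Δ, x = (q.2.2 : SL2R) • l.e q.1 q.2.1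
    then ρ (φ hx.choose.2.2) • η hx.choose.1 hx.choose.2.1 else BdH3.zero
  have hξ : ∀ j s (g : Δ), ξ (g.1 • l.e j s) = ρ (φ g) • η j s := fun j s g => by
    have hx : ∃ q : J × ℤˣ × Δ, g.1 • l.e j s = (q.2.2 : SL2R) • l.e q.1 q.2.1 :=
      ⟨(j, s, g), rfl⟩
    have e1 : ξ (g.1 • l.e j s) = ρ (φ hx.choose.2.2) • η hx.choose.1 hx.choose.2.1 :=
      dif_pos hx
    rw [e1]
    have hs := hx.choose_spec
    generalize hx.choose = q at hs
    obtain ⟨j', s', k⟩ := q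
    have hk : ((k⁻¹ * g : Δ) : SL2R) • l.e j s = l.e j' s' := by
      rw [Subgroup.coe_mul, mul_smul, hs]; simp
    obtain ⟨rfl, rfl⟩ := l.inj _ _ _ _ _ hk
    obtain ⟨n, hn⟩ := l.stab _ _ _ hk
    have e2 := map_eq_of_eq_or hφ hn
    rw [map_mul, map_inv, inv_mul_eq_iff_eq_mul, map_zpow] at e2
    change ρ (φ k) • η j s = _
    rw [e2, map_mul, map_zpow, mul_smul]
    exact congrArg (ρ (φ k) • ·) (zpow_mem (show ρ (φ (l.γ j)) ∈ MulAction.stabilizer PSL2C (η j s)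
      from hη.fixed j s) n).symm
  have hsurj : ∀ a b, F a b → ∃ j s, ∃ g : Δ, a = g.1 • l.e j s := fun a b hab => by
    obtain ⟨x, hx⟩ := h.exists_P_of_leaf (h.symm hab)
    exact l.surj _ _ hx
  refine ⟨ξ, fun a b hab g => ?_, fun a b hab => ?_, fun a b hab => ?_⟩
  · obtain ⟨j, s, k, rfl⟩ := hsurj a b hab
    rw [hξ, ← mul_smul, ← Subgroup.coe_mul, hξ, map_mul, map_mul, mul_smul]
    rfl
  · by_cases hP : P a b
    · obtain ⟨j, s, k, ha⟩ := hsurj a b hab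
      rw [l.partner h hP ha, ha, hξ, hξ]
      refine fun h' => ?_
      have := MulAction.injective _ h'
      rcases Int.units_eq_one_or s with rfl | rfl
      · exact hη.ne j this
      · exact hη.ne j this.symm
    · obtain ⟨q, hq, g, rfl, rfl⟩ := l.leaf_surj a b hab hP
      rw [← mul_smul, ← Subgroup.coe_mul, ← mul_smul, ← Subgroup.coe_mul, hξ, hξ, map_mul, map_mul,
        map_mul, map_mul, mul_smul, mul_smul]
      exact fun h' => hη.pair _ ⟨q, hq, rfl⟩ (MulAction.injective _ h')
  · obtain ⟨j, s, k, ha⟩ := l.surj _ _ hab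
    refine ⟨k * l.γ j * k⁻¹, ?_, ?_, fun h' => hη.nontrivial j ?_⟩
    · simp only [ha, Subgroup.coe_mul, Subgroup.coe_inv, mul_smul, inv_smul_smul, l.γ_smul]
    · simp only [l.partner h hab ha, Subgroup.coe_mul, Subgroup.coe_inv, mul_smul, inv_smul_smul,
        l.γ_smul]
    · simpa using h'

lemma LeafLabels.isAxisSystem {ρ : RepVar G} {ξ : BdH2 → BdH3}
    (h1 : ∀ a b, F a b → ∀ g : Δ, ξ (g.1 • a) = ρ (φ g) • ξ a)
    (h2 : ∀ a b, F a b → ξ a ≠ ξ b) (h3 : ∀ a b, P a b → ∃ g : Δ, g.1 • a = a ∧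
      g.1 • b = b ∧ ρ (φ g) ≠ 1) :
    IsAxisSystem (fun j => φ (l.γ j)) (mapLabel id φ '' l.Q) ρ fun j s => ξ (l.e j s) where
  nontrivial j hj := by
    obtain ⟨g, hg, -, hg'⟩ := h3 _ _ (l.P_e j 1); obtain ⟨n, hn⟩ := l.stab j 1 g hg
    exact hg' (by rw [map_eq_of_eq_or hφ hn, map_zpow, map_zpow, hj, one_zpow])
  fixed j s := by rw [← h1 _ _ (h.P_sub (l.P_e j s)), l.γ_smul]
  ne j := h2 _ _ (h.P_sub (l.P_e j 1))
  pair := by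
    rintro _ ⟨q, hq, rfl⟩; have := h2 _ _ (l.leaf q hq).1
    rwa [h1 _ _ (h.P_sub (l.P_e _ _)), h1 _ _ (h.P_sub (l.P_e _ _))] at this

end Labels

/-! ### Convex co-compact representations are pleatable -/

lemma disc_commutator {σ τ : PSL2C} {x : BdH3} (hσ : σ • x = x) (hτ : τ • x = x) :
    (σ * τ * σ⁻¹ * τ⁻¹).disc = 0 := by
  induction x using ind with | _ v hv =>
  obtain ⟨a, ha⟩ := (exists_eigenvalue hv).mp hσ
  obtain ⟨b, hb⟩ := (exists_eigenvalue hv).mp hτ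
  have hw0 := sl_smul_ne_zero τ.lift (sl_smul_ne_zero σ.lift hv)
  obtain ⟨K, hK⟩ : ∃ K, K = σ.lift * τ.lift * σ.lift⁻¹ * τ.lift⁻¹ := ⟨_, rfl⟩
  have hKw : K • τ.lift • σ.lift • v = τ.lift • σ.lift • v := by
    rw [hK]; simp only [mul_smul, inv_smul_smul]
    rw [ha, hb, smul_comm σ.lift b v, smul_comm τ.lift a v, ha, hb, smul_comm]
  generalize τ.lift • σ.lift • v = w at hw0 hKw
  have htr : sltr K = 2 := by
    have e0 := congrFun hKw 0; have e1 := congrFun hKw 1; rw [sl_smul_0] at e0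
    rw [sl_smul_1] at e1; have hd := sl_det K; by_contra hne
    refine hw0 (funext (Fin.forall_fin_two.mpr ⟨?_, ?_⟩)) <;>
      refine (mul_eq_zero.mp ?_).resolve_left (sub_ne_zero.mpr hne) <;> unfold sltr
    · linear_combination (1 - K 1 1) * e0 + K 0 1 * e1 + w 0 * hd
    · linear_combination (1 - K 0 0) * e1 + K 1 0 * e0 + w 1 * hd
  have hl : (σ * τ * σ⁻¹ * τ⁻¹).lift = K ∨ (σ * τ * σ⁻¹ * τ⁻¹).lift = -K := by
    rw [← mk_eq_mk, mk_lift, hK]; simp only [QuotientGroup.mk_mul, QuotientGroup.mk_inv, mk_lift]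
  rcases hl with h | h <;> simp only [disc, h, sltr_neg, htr] <;> norm_num

/-- The incompressibility condition. -/
def IsIncompressible {G : Type*} [Group G] {Δ : Subgroup SL2R} (P : Rel)
    (φ : Δ →* G) : Prop :=
  ∀ g : Δ, g.1 ≠ 1 → g.1 ≠ -1 → ∀ p q, p ≠ q → g.1 • p = p →
    g.1 • q = q → (∀ a b, P a b → ¬Link a b p q) → φ g ≠ 1

lemma LeafLabels.exists_isAxisSystem_of_isConvexCocompact {G : Type*} [Group G]
    (h : PantsLam (pmGroup Δ) F P)
    {J : Type} (l : LeafLabels Δ F P J) {φ : Δ →* G} (hinc : IsIncompressible P φ)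
    {ρ : RepVar G} (hρ : IsConvexCocompact ρ) :
    ∃ η, IsAxisSystem (fun j => φ (l.γ j)) (mapLabel id φ '' l.Q) ρ η ∧
      ∀ q ∈ mapLabel id φ '' l.Q, axisPt ρ η (flipLabel q.1) ≠ axisPt ρ η (flipLabel q.2) := by
  have hγ1 : ∀ j, (l.γ j).1 ≠ 1 ∧ (l.γ j).1 ≠ -1 := fun j => by
    obtain ⟨g, hg, g1, g2, ga, gb⟩ := h.P_closed (l.P_e j 1)
    have key : ∀ k : Δ, k.1 • l.e j 1 = l.e j 1 →
        ((l.γ j).1 = 1 ∨ (l.γ j).1 = -1) →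
        k.1 = 1 ∨ k.1 = -1 := fun k hk hj => by
      obtain ⟨n, hn⟩ := l.stab j 1 k hk
      rw [Subgroup.coe_zpow] at hn
      rcases hj with hj | hj <;> rw [hj] at hn
      · rwa [one_zpow] at hn
      · rcases neg_zpow_eq_or 1 n with he | he <;> rw [he, one_zpow] at hn
        exacts [hn, by rwa [neg_neg, or_comm] at hn]
    by_contra hj
    rw [not_and_or, not_not, not_not] at hj
    rcases hg with hg | hg
    · exact (key ⟨g, hg⟩ ga hj).elim g1 g2
    · rcases key ⟨-g, hg⟩ (by rwa [neg_sl_smul_proj]) hj with h' | h'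
      · exact g2 (by rw [← neg_neg g]; exact congrArg Neg.neg h')
      · exact g1 (neg_injective h')
  have hdisc : ∀ j, (ρ (φ (l.γ j))).disc ≠ 0 := fun j => hρ.disc_ne_zero
    (hinc _ (hγ1 j).1 (hγ1 j).2 _ _ (h.P_ne (l.P_e j 1)) (l.γ_smul j _) (l.γ_smul j _)
      fun a b hab => h.unlinked (h.P_sub hab) (h.P_sub (l.P_e j 1)))
  choose u hu hu' _ using fun j => exists_eigenvectors (hdisc j)
  have hu0 : ∀ j s, u j s ≠ 0 := fun j s h0 => hu j (by
    rcases Int.units_eq_one_or s with rfl | rfl <;> rw [h0] <;> simp [vdet])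
  let η : J → ℤˣ → BdH3 := fun j s => Projectivization.mk ℂ (u j s) (hu0 j s)
  have hfix : ∀ j s, ρ (φ (l.γ j)) • η j s = η j s := fun j s =>
    (exists_eigenvalue (hu0 j s)).mpr (hu' j s)
  have hpair : ∀ q ∈ l.Q, ∀ s s', ρ (φ q.1.2.2) • η q.1.1 s ≠ ρ (φ q.2.2.2) • η q.2.1 s' := by
    rintro ⟨⟨j, t, g⟩, ⟨j', t', k⟩⟩ hq s s' heq
    obtain ⟨hF, hP⟩ := l.leaf _ hq
    dsimp only at hF hP heq
    have hcn : ∀ (m : SL2R) (k : SL2R), m ≠ 1 ∧ m ≠ -1 →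
        k * m * k⁻¹ ≠ 1 ∧ k * m * k⁻¹ ≠ -1 := fun m k hm =>
      ⟨fun h' => hm.1 (by simpa using h'), fun h' => hm.2 (by
        have := congrArg (fun x => k⁻¹ * x * k) h'
        simpa [mul_assoc] using this)⟩
    have hfx : ∀ (j : J) (k : Δ) s, ((k * l.γ j * k⁻¹ : Δ) : SL2R) • k.1 • l.e j s =
        k.1 • l.e j s := fun j k s => by
      simp only [Subgroup.coe_mul, Subgroup.coe_inv, mul_smul, inv_smul_smul, l.γ_smul]
    have hfη : ∀ (j : J) (k : Δ) s, ρ (φ (k * l.γ j * k⁻¹)) • ρ (φ k) • η j s = ρ (φ k) • η j s :=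
      fun j k s => by
        simp only [map_mul, map_inv, mul_smul, inv_smul_smul, hfix]
    obtain ⟨c1, c2, p, q, hpq, hp, hq', hl⟩ := h.exists_axis_commutator hF hP
      (h.P_smul g (Or.inl g.2) _ _ (l.P_e j t)) (h.P_smul k (Or.inl k.2) _ _ (l.P_e j' t'))
      (Or.inl (g * l.γ j * g⁻¹).2) (Or.inl (k * l.γ j' * k⁻¹).2) (hcn _ _ (hγ1 j)).1
      (hcn _ _ (hγ1 j)).2 (hcn _ _ (hγ1 j')).1 (hcn _ _ (hγ1 j')).2 (hfx j g t) (hfx j g (-t))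
      (hfx j' k t') (hfx j' k (-t'))
    have hne := hinc ((g * l.γ j * g⁻¹) * (k * l.γ j' * k⁻¹) * (g * l.γ j * g⁻¹)⁻¹ *
      (k * l.γ j' * k⁻¹)⁻¹) c1 c2 p q hpq hp hq' hl
    refine hρ.disc_ne_zero hne ?_
    rw [map_mul, map_mul, map_mul, map_inv, map_inv, map_mul, map_mul, map_mul, map_inv, map_inv]
    exact disc_commutator (hfη j g s) (heq ▸ hfη j' k s')
  refine ⟨η, ⟨fun j h1 => ?_, hfix, fun j => ?_, ?_⟩, ?_⟩
  · have := hdisc j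
    rw [h1] at this
    obtain hl | hl := mk_eq_mk.mp ((mk_lift 1).trans (QuotientGroup.mk_one _).symm) <;>
      rw [disc, hl] at this <;> simp [sltr] at this <;> norm_num at this
  · rw [Ne, mk_eq_iff]; exact hu j
  · rintro _ ⟨q, hq, rfl⟩
    exact hpair q hq _ _
  · rintro _ ⟨q, hq, rfl⟩
    exact hpair q hq _ _

/-! ### Reducible representations -/

lemma BdH3.zero_ne_infty : BdH3.zero ≠ BdH3.infty := by
  rw [BdH3.zero, BdH3.infty, Ne, mk_eq_iff]; simp [vdet]

/-- A representation with a fixed point at infinity has the same character as a diagonal one. -/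
lemma exists_diagonal_rep {G : Type*} [Group G] {ρ : RepVar G} {p : BdH3}
    (hp : ∀ g, ρ g • p = p) : ∃ ρ1 : RepVar G, character ρ1 = character ρ ∧
      ∀ g, ρ1 g • BdH3.zero = BdH3.zero ∧ ρ1 g • BdH3.infty = BdH3.infty := by
  obtain ⟨q, hq⟩ : ∃ q, q ≠ p := by
    by_cases h : BdH3.zero = p
    exacts [⟨_, h ▸ BdH3.zero_ne_infty.symm⟩, ⟨_, h⟩]
  obtain ⟨B, -, hB⟩ := exists_psl_frame_two hq
  obtain ⟨ρ', hρ'⟩ : ∃ ρ', ρ' = conjRep B⁻¹ ρ := ⟨_, rfl⟩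
  have h10 : ∀ g, (ρ' g).lift 1 0 = 0 := fun g => by
    have h : ρ' g • BdH3.infty = BdH3.infty := by
      rw [hρ']; change (B⁻¹ * ρ g * B⁻¹⁻¹) • _ = _
      rw [mul_smul, mul_smul, inv_inv, hB, hp, ← hB, inv_smul_smul]
    rw [← (ρ' g).mk_lift, BdH3.infty, mk_smul_mk_eq] at h; simpa using h.symm
  -- `R s` is conjugate to `ρ'` for `s ≠ 0`, and `R 0` is diagonal
  let A : ℂ → G → SL(2, ℂ) := fun s g => ⟨!![(ρ' g).lift 0 0, s ^ 2 * (ρ' g).lift 0 1;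
    0, (ρ' g).lift 1 1], by
      rw [Matrix.det_fin_two_of]; linear_combination sl_det (ρ' g).lift + (ρ' g).lift 0 1 * h10 g⟩
  have a00 : ∀ s g, A s g 0 0 = (ρ' g).lift 0 0 := fun _ _ => rfl
  have a01 : ∀ s g, A s g 0 1 = s ^ 2 * (ρ' g).lift 0 1 := fun _ _ => rfl
  have a10 : ∀ s g, A s g 1 0 = 0 := fun _ _ => rfl
  have a11 : ∀ s g, A s g 1 1 = (ρ' g).lift 1 1 := fun _ _ => rfl
  let R : ℂ → RepVar G := fun s => MonoidHom.mk' (fun g => QuotientGroup.mk (A s g)) fun g k => by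
    rw [← QuotientGroup.mk_mul, mk_eq_mk]
    have hl : (ρ' (g * k)).lift = (ρ' g).lift * (ρ' k).lift ∨
        (ρ' (g * k)).lift = -((ρ' g).lift * (ρ' k).lift) := by
      rw [← mk_eq_mk, mk_lift, QuotientGroup.mk_mul, mk_lift, mk_lift, map_mul]
    rcases hl with hl | hl <;> [left; right] <;> apply sl_ext <;>
      simp only [sl_neg_apply, sl_mul, a00, a01, a10, a11, hl, h10] <;> ring
  have hR : ∀ s ≠ 0, ∃ T : PSL2C, R s = conjRep T ρ' := fun s hs => by
    let T : SL(2, ℂ) := ⟨!![s, 0; 0, s⁻¹], by rw [Matrix.det_fin_two_of]; field_simp; simp⟩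
    refine ⟨QuotientGroup.mk T, MonoidHom.ext fun g => ?_⟩
    change (QuotientGroup.mk (A s g) : PSL2C) = QuotientGroup.mk T * ρ' g * (QuotientGroup.mk T)⁻¹
    rw [eq_mul_inv_iff_mul_eq, ← (ρ' g).mk_lift, ← QuotientGroup.mk_mul, ← QuotientGroup.mk_mul]
    congr 1; apply sl_ext <;> rw [sl_mul, sl_mul] <;> simp [A, T, h10, mul_comm]
    field_simp
  have hreg : ∀ f ∈ regularFunctions G, Continuous fun s => f (R s) := fun f hf => by
    induction hf using Algebra.adjoin_induction with
    | mem f hf =>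
      obtain ⟨g, i, j, k, m, rfl⟩ := hf
      have e : ∀ s, R s g = QuotientGroup.mk (A s g) := fun s => rfl
      simp only [e, adPSL_mk, Matrix.SpecialLinearGroup.coe_inv]
      have hA : Continuous fun s => (A s g).1 := continuous_matrix fun i j => by
        fin_cases i <;> fin_cases j <;> simp [A] <;> fun_prop
      exact ((hA.matrix_mul (continuous_const.matrix_mul hA.matrix_adjugate))).matrix_elem i j
    | algebraMap r => exact continuous_const
    | add f f' _ _ h1 h2 => exact h1.add h2
    | mul f f' _ _ h1 h2 => exact h1.mul h2
  refine ⟨R 0, Quotient.sound fun f hf => ?_, fun g => ⟨?_, ?_⟩⟩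
  · refine (congrFun ((hreg f hf.1).ext_on (dense_compl_singleton 0)
      (continuous_const (y := f ρ)) fun s hs => ?_) 0)
    obtain ⟨T, hT⟩ := hR s hs; change f (R s) = f ρ; rw [hT, hf.2, hρ', hf.2]
  · exact (mk_smul_mk_eq _ _).mpr (by simp [A])
  · exact (mk_smul_mk_eq _ _).mpr (by simp [A])

lemma eq_zero_or_infty {σ : PSL2C} (hσ : σ ≠ 1) (h0 : σ • BdH3.zero = BdH3.zero)
    (h1 : σ • BdH3.infty = BdH3.infty) {x : BdH3} (hx : σ • x = x) :
    x = BdH3.zero ∨ x = BdH3.infty := by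
  have hd := disc_ne_zero_of_fixed hσ BdH3.zero_ne_infty h0 h1
  obtain ⟨a, ha⟩ := (exists_eigenvalue _).mp h0
  obtain ⟨b, hb⟩ := (exists_eigenvalue _).mp h1
  exact eq_mk_of_fixed hd _ _ (by simp [vdet]) ha hb hx

lemma not_isPleatable_of_diagonal {G : Type*} [Group G]
    (h : PantsLam (pmGroup Δ) F P) {φ : Δ →* G} {ρ : RepVar G}
    (hρ : ∀ g, ρ g • BdH3.zero = BdH3.zero ∧ ρ g • BdH3.infty = BdH3.infty) :
    ¬IsPleatable F P (ρ.comp φ) := by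
  rintro ⟨ξ, h1, h2, h3⟩; obtain ⟨z, hz⟩ := h.dense_compl_leaves.nonempty
  obtain ⟨a, b, c, hab, hbc, hca, hE⟩ := h.exists_vertices hz
  have hleaf : ∀ x ∈ ({a, b, c} : Set BdH2), ∀ y ∈ ({a, b, c} : Set BdH2), x ≠ y → F x y :=
    fun x hx y hy => h.leaf_of_mem_pEnds hz (hE ▸ hx) (hE ▸ hy)
  have hval : ∀ x y, F x y → ξ y = BdH3.zero ∨ ξ y = BdH3.infty := fun x y hxy => by
    obtain ⟨w, hw⟩ := h.exists_P_of_leaf hxy; obtain ⟨g, hg, -, hg'⟩ := h3 y w hw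
    exact eq_zero_or_infty hg' (hρ _).1 (hρ _).2 (by rw [← h1 _ _ (h.symm hxy), hg])
  have f1 := hleaf a (by simp) b (by simp) hab; have f2 := hleaf b (by simp) c (by simp) hbc
  have f3 := hleaf c (by simp) a (by simp) hca; have n1 := h2 _ _ f1; have n2 := h2 _ _ f2
  have n3 := h2 _ _ f3
  rcases hval _ _ f3 with ha | ha <;> rcases hval _ _ f1 with hb | hb <;>
    rcases hval _ _ f2 with hc | hc <;> rw [ha, hb] at n1 <;> rw [hb, hc] at n2 <;>
    rw [hc, ha] at n3 <;> simp_all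

/-! ### The set of pleated characters -/

/-- The peripheral structure of the fundamental group of the 3-manifold. -/
structure PeripheralData (G : Type*) [Group G] (ι : Type) where
  Δ : ι → Subgroup SL2R
  F : ι → Rel
  P : ι → Rel
  φ : ∀ i, Δ i →* G
  pants : ∀ i, PantsLam (pmGroup (Δ i)) (F i) (P i)
  map_one : ∀ i (g : Δ i), g.1 = 1 ∨ g.1 = -1 → φ i g = 1

namespace PeripheralData

variable {G : Type*} [Group G] {ι : Type} (D : PeripheralData G ι)

/-- The characters all of whose representations are pleatable along all boundary components. -/
def pleated : Set (CharVar G) :=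
  {c | ∀ ρ : RepVar G, character ρ = c → ∀ i, IsPleatable (D.F i) (D.P i) (ρ.comp (D.φ i))}

lemma exists_nhd [Finite ι] {J : ι → Type} [∀ i, Finite (J i)]
    (l : ∀ i, LeafLabels (D.Δ i) (D.F i) (D.P i) (J i)) {ρ₀ : RepVar G}
    (η : ∀ i, J i → ℤˣ → BdH3) (hη : ∀ i, IsAxisSystem (fun j => D.φ i ((l i).γ j))
      (mapLabel id (D.φ i) '' (l i).Q) ρ₀ (η i))
    (hx : ∀ i, ∀ q ∈ mapLabel id (D.φ i) '' (l i).Q, ∃ x : G,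
      axisPt ρ₀ (η i) (flipLabel q.1) ≠ ρ₀ x • axisPt ρ₀ (η i) (flipLabel q.2) ∧
      ρ₀ x • axisPt ρ₀ (η i) (flipLabel q.1) ≠ axisPt ρ₀ (η i) (flipLabel q.2)) :
    ∃ U, IsOpen U ∧ character ρ₀ ∈ U ∧ U ⊆ D.pleated := by
  let Q : Set (((Σ i, J i) × ℤˣ × G) × ((Σ i, J i) × ℤˣ × G)) :=
    ⋃ i, mapLabel (Sigma.mk i) (D.φ i) '' (l i).Q
  have hQ : Q.Finite := Set.finite_iUnion fun i => (l i).finite.image _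
  obtain ⟨f, hf, hf0, hf'⟩ := exists_invariant_of_isAxisSystem (J := Σ i, J i)
    (γ := fun j => D.φ j.1 ((l j.1).γ j.2)) hQ (ρ0 := ρ₀) (η0 := fun j s => η j.1 j.2 s)
    ⟨fun j => (hη j.1).nontrivial j.2, fun j => (hη j.1).fixed j.2, fun j => (hη j.1).ne j.2,
      fun q hq => by
        obtain ⟨i, q', hq', rfl⟩ := Set.mem_iUnion.mp hq
        exact (hη i).pair _ ⟨q', hq', rfl⟩⟩ fun q hq => by
      obtain ⟨i, q', hq', rfl⟩ := Set.mem_iUnion.mp hq; exact hx i _ ⟨q', hq', rfl⟩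
  refine ⟨_, TopologicalSpace.isOpen_generateFrom_of_mem ⟨f, hf, rfl⟩, ⟨ρ₀, rfl, hf0⟩, ?_⟩
  rintro _ ⟨ρ', rfl, hρ'⟩ ρ hρ i; have hfρ : f ρ = f ρ' := Quotient.exact hρ f hf
  obtain ⟨η', h'⟩ := hf' ρ (hfρ ▸ hρ')
  refine (l i).isPleatable (D.pants i) (D.map_one i) (η := fun j s => η' ⟨i, j⟩ s)
    ⟨fun j => h'.nontrivial ⟨i, j⟩, fun j => h'.fixed ⟨i, j⟩, fun j => h'.ne ⟨i, j⟩, ?_⟩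
  rintro _ ⟨q, hq, rfl⟩; exact h'.pair _ (Set.mem_iUnion.mpr ⟨i, q, hq, rfl⟩)

lemma isOpen_pleated [Finite ι] : IsOpen D.pleated := by
  refine isOpen_iff_forall_mem_open.mpr fun c hc => ?_
  choose J hJ l using fun i => (D.pants i).exists_leafLabels
  obtain ⟨ρ0, rfl⟩ := Quotient.exists_rep c
  choose ξ h1 h2 h3 using hc ρ0 rfl
  refine (D.exists_nhd (fun i => (l i).some) _
    (fun i => (l i).some.isAxisSystem (D.pants i) (D.map_one i) (h1 i) (h2 i) (h3 i))
    fun i q _ => ?_).elim fun U hU => ⟨U, hU.2.2, hU.1, hU.2.1⟩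
  generalize axisPt ρ0 _ (flipLabel q.1) = p
  generalize axisPt ρ0 _ (flipLabel q.2) = r
  by_cases hpr : p = r
  · subst hpr
    by_contra! hall
    obtain ⟨ρ1, hρ1, hfix⟩ := exists_diagonal_rep (ρ := ρ0) (p := p) fun g => by
      by_contra hg
      exact hg (hall g (Ne.symm hg))
    exact not_isPleatable_of_diagonal (D.pants i) hfix (hc ρ1 hρ1 i)
  · exact ⟨1, by simpa using hpr, by simpa using hpr⟩

lemma character_mem_pleated [Finite ι] (hinc : ∀ i, IsIncompressible (D.P i) (D.φ i))
    {ρ : RepVar G} (hρ : IsConvexCocompact ρ) : character ρ ∈ D.pleated := by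
  choose J hJ l using fun i => (D.pants i).exists_leafLabels
  choose η hη hη' using fun i =>
    (l i).some.exists_isAxisSystem_of_isConvexCocompact (D.pants i) (hinc i) hρ
  obtain ⟨U, -, hU, hUD⟩ := D.exists_nhd (fun i => (l i).some) η hη fun i q hq =>
    ⟨1, by simpa using hη' i q hq, by simpa using hη' i q hq⟩
  exact hUD hU

end PeripheralData

lemma incl_eq_one {M : Type*} [TopologicalSpace M] [ChartedSpace (EuclideanHalfSpace 3) M] {k : ℕ}
    (S : HyperbolicBoundary M k) (x0 : M) (i : Fin k) (δ : Path x0 (S.proj i I))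
    (g : S.deck i) (hg : g.1 = 1 ∨ g.1 = -1) : S.incl x0 i δ g = 1 := by
  have hgI : g.1 • I = ((1 : S.deck i) : SL2R) • I := by
    rcases hg with h | h <;> rw [h]
    · rfl
    · rw [neg_sl_smul_uhp]; rfl
  rw [← map_one (S.incl x0 i δ)]
  have h1 : (deckLoop (S.proj i) (S.deck i) (S.proj_smul i) g).Homotopic
      (deckLoop (S.proj i) (S.deck i) (S.proj_smul i) 1) :=
    (SimplyConnectedSpace.paths_homotopic
      ((PathConnectedSpace.somePath (g.1 • I) I).cast
        hgI.symm rfl) (PathConnectedSpace.somePath _ _)).map (S.proj i)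
  have h2 := Path.Homotopic.Quotient.eq.mpr h1
  change peripheralClass _ _ _ _ _ _ = peripheralClass _ _ _ _ _ _
  simp only [peripheralClass, Path.Homotopic.Quotient.mk_trans, Path.Homotopic.Quotient.mk_symm, h2]

end

theorem lemma3p2 {M : Type*} [TopologicalSpace M] [T2Space M] [CompactSpace M] [ConnectedSpace M]
    [ChartedSpace (EuclideanHalfSpace 3) M] (x₀ : M)
    {k : ℕ} (S : HyperbolicBoundary M k) (δ : ∀ i, Path x₀ (S.proj i UpperHalfPlane.I))
    (Λ P : Fin k → Set (Set ℍ))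
    (hΛ : ∀ i, Maximal (IsGeodesicLamination (S.deck i)) (Λ i))
    (hP : ∀ i, Maximal (IsMulticurve (S.deck i)) (P i))
    (hPΛ : ∀ i, P i ⊆ Λ i)
    (hinc : ∀ i, IsIncompressiblePants (S.deck i) (P i) (S.incl x₀ i (δ i)))
    (χ₀ : Set (CharVar (FundamentalGroup M x₀)))
    (hχ₀ : χ₀ ∈ irreducibleComponents (CharVar (FundamentalGroup M x₀)))
    (hcc : ∃ ρ : RepVar (FundamentalGroup M x₀), IsConvexCocompact ρ ∧ character ρ ∈ χ₀) :
    IsOpen {c : χ₀ | (c : CharVar (FundamentalGroup M x₀)) ∈ pleatedCharacters S x₀ δ Λ} ∧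
      Dense {c : χ₀ | (c : CharVar (FundamentalGroup M x₀)) ∈ pleatedCharacters S x₀ δ Λ} := by
  have hsurf : ∀ i, IsSurfaceGroup (pmGroup (S.deck i)) := fun i => by
    have : CompactSpace (Set.range (S.proj i)) := isCompact_iff_compactSpace.mp (S.isCompact i)
    exact isSurfaceGroup_of_covering (S.isCovering i) Set.rangeFactorization_surjective fun z w =>
      Subtype.ext_iff.trans (S.proj_eq_iff i z w)
  let D : PeripheralData (FundamentalGroup M x₀) (Fin k) :=
    ⟨S.deck, fun i => leafRel (Λ i), fun i => leafRel (P i), fun i => S.incl x₀ i (δ i),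
      fun i => pantsLamination_of_maximal (hsurf i) (hΛ i) (hP i) (hPΛ i),
      fun i => incl_eq_one S x₀ i (δ i)⟩
  have hD : pleatedCharacters S x₀ δ Λ = D.pleated := by
    ext c
    refine forall_congr' fun ρ => imp_congr_right fun _ => forall_congr' fun i => ?_
    exact nonempty_pleatedSurface_iff (D.pants i) (hPΛ i) (hΛ i).1.geodesic (hP i).1.closed
      fun g hg => (congrArg ρ (D.map_one i g hg)).trans (map_one ρ)
  have hincD : ∀ i, IsIncompressible (D.P i) (D.φ i) := fun i g h1 h2 p q hpq hp hq hlink => by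
    refine hinc i g (actsNontrivially_iff.mpr ⟨h1, h2⟩) ⟨geod p q, p, q, hasEndpoints_iff.mpr
      ⟨hpq, rfl⟩, by rw [translateSet_geod, hp, hq], fun L' hL' => ?_⟩
    obtain ⟨⟨a, b, hab⟩, -⟩ := (hP i).1.closed L' hL'
    obtain ⟨hne, rfl⟩ := hasEndpoints_iff.mp hab
    refine or_iff_not_imp_right.mpr fun hd => ?_
    obtain ⟨z, hz, hz'⟩ := Set.not_disjoint_iff.mp hd
    rcases link_or_eq_of_mem_geod hpq hz' hz with h | ⟨rfl, rfl⟩ | ⟨rfl, rfl⟩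
    · exact absurd h (hlink a b ⟨hne, hL'⟩)
    · rfl
    · exact geod_comm _ _
  obtain ⟨ρ, hρ, hρχ⟩ := hcc
  rw [hD]
  refine ⟨D.isOpen_pleated.preimage continuous_subtype_val, dense_iff_inter_open.mpr ?_⟩
  rintro _ ⟨U, hU, rfl⟩ ⟨c, hc⟩
  -- two open sets that meet an irreducible set have a common point in it
  obtain ⟨x, hx, hxU, hxD⟩ := hχ₀.1.2 U D.pleated hU D.isOpen_pleated ⟨c, c.2, hc⟩
    ⟨_, hρχ, D.character_mem_pleated hincD hρ⟩
  exact ⟨⟨x, hx⟩, hxU, hxD⟩
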